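/- Let $d\ge 3$, and let $\Gamma^d\subset\mathbb R^d$ be the Avron–Exner–Last graph: the union of all closed segments of length one joining neighbouring points of $\mathbb Z^d$, with the metric of $\mathbb R^d$ and with $\mu$ = Lebesgue measure (length) on the edges. Let $D$ be the space of functions $\varphi$ that are continuous on $\Gamma^d$, smooth on each closed edge, and satisfy Kirchhoff's condition $\sum\varphi_i'=0$ at every vertex, where $\varphi_i'$ are the outgoing derivatives along the $2d$ edges at the vertex. Let $H_0$ be the closure in $L^2(\Gamma^d,\mu)$ of the operator $\varphi\mapsto-\varphi''$ acting on those $\varphi\in D$ for which $\varphi$ and $\varphi''$ are square integrable. Then: 1. $\Gamma^d$ is a complete $\sigma$-compact metric space with Borel $\sigma$-algebra, $\mu$ is $\sigma$-finite, and $H_0$ is a well-defined, self-adjoint, non-negative operator. 2. (Condition (a).) $-H_0$ is the generator of a semigroup $(P_tf)(x)=\int p_0(t,x,y)f(y)\,\mu(dy)$ whose kernel $p_0(t,x,y)$ is jointly continuous for $t>0$, symmetric and non-negative, and satisfies the Chapman–Kolmogorov equation, $\partial p_0/\partial t=-H_0p_0$, $p_0(0,x,y)=\delta_y(x)$ and $\int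 p_0(t,x,y)\,\mu(dy)=1$. The semigroup $P_t$ is strongly continuous on $L^2(\Gamma^d)$ with generator exactly $-H_0$; it maps bounded continuous functions to continuous functions; it is a strongly continuous semigroup on the space $C_0(\Gamma^d)$ of continuous functions vanishing at infinity; and if $f\in C_0(\Gamma^d)\cap\mathrm{Dom}(H_0)$ and $H_0f\in C_0(\Gamma^d)$, then $t^{-1}(P_tf-f)\to-H_0f$ uniformly as $t\to0$. The kernel $p_0$ is the transition density, with respect to $\mu$, of a Markov process on $\Gamma^d$ (started from any point). 3. (Condition (b), with $\alpha=1$ and $\beta=d$.) There is a function $\pi$ such that $p_0(t,x,x)\le\pi(t)$ for all $t>0$ and $x\in\Gamma^d$, $\int_0^\infty\frac{t^m}{1+t^m}\pi(t)\,dt<\infty$ for some $m$, $\pi(t)\le c\,t^{-d/2}$ as $t\to\infty$, and $\pi(t)\le c\,t^{-1/2}$ as $t\to0$. 4. For every $h>0$ there is a constant $C$ with $p_0(t,x,x)\le C\,t^{-1/2}$ for all $0<t\le h$ and all $x\in\Gamma^d$. There is a constant $c>0$ such that $t^{d/2}\,p_0(t,x,x)\to c$ as $t\to\infty$, uniformly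 in $x\in\Gamma^d$. -/

import Mathlib

open MeasureTheory Filter Topology Set
open scoped ContDiff ZeroAtInfty BoundedContinuousFunction NNReal

noncomputable section

/-! ### Schrödinger-type operators on metric measure spaces: the standing assumptions -/

section General

variable {X : Type*} [MetricSpace X] [MeasurableSpace X]

/-- The integral operator `(P_t f)(x) = ∫ p(t,x,y) f(y) μ(dy)`. -/
def kernelOp (μ : Measure X) (p : ℝ → X → X → ℝ) (t : ℝ) (f : X → ℂ) (x : X) : ℂ :=
  ∫ y, (p t x y : ℂ) * f y ∂μ

/-- `p` is the transition density, with respect to `μ`, of a Markov process on `X`: there are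
probability measures `P x` on the path space `ℝ≥0 → X` under which the coordinate process starts
at `x` and has the Markov property with respect to its natural filtration, with transition
probabilities `p(t,x,y) μ(dy)`. -/
def DefinesMarkovProcess (μ : Measure X) (p : ℝ → X → X → ℝ) : Prop :=
  ∃ P : X → Measure (ℝ≥0 → X), ∀ x : X,
    IsProbabilityMeasure (P x) ∧
    (∀ᵐ w ∂(P x), w 0 = x) ∧
    ∀ (s t : ℝ≥0), 0 < t → ∀ A : Set X, MeasurableSet A →
      (P x)[{w : ℝ≥0 → X | w (s + t) ∈ A}.indicator (fun _ => (1 : ℝ)) |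
          MeasurableSpace.comap (fun (w : ℝ≥0 → X) (r : Set.Iic s) => w r) inferInstance]
        =ᵐ[P x] fun w => ∫ y in A, p t (w s) y ∂μ

/-- Condition (a): `-H` is the generator of a semigroup `P_t` given by a kernel `p(t,x,y)` which
is continuous for `t > 0`, symmetric, non-negative, of total mass one, is the fundamental solution
of `∂p/∂t = -H p`, and is the transition density of a Markov process. -/
structure ConditionA (μ : Measure X) (H : Lp ℂ 2 μ →ₗ.[ℂ] Lp ℂ 2 μ)
    (p : ℝ → X → X → ℝ) : Prop where
  /-- joint continuity for `t > 0` -/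
  continuousOn : ContinuousOn (fun q : ℝ × X × X => p q.1 q.2.1 q.2.2) (Ioi 0 ×ˢ univ)
  symm : ∀ t, 0 < t → ∀ x y, p t x y = p t y x
  nonneg : ∀ t, 0 < t → ∀ x y, 0 ≤ p t x y
  integrable : ∀ t, 0 < t → ∀ x, Integrable (p t x) μ
  integral_eq_one : ∀ t, 0 < t → ∀ x, ∫ y, p t x y ∂μ = 1
  /-- the parabolic equation: `p(t,·,y)` is in the domain of `H`, and `∂p/∂t = -H p` -/
  heat_equation : ∀ y : X, ∀ t, 0 < t → ∃ u : H.domain,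
    ((u : Lp ℂ 2 μ) =ᵐ[μ] fun x => (p t x y : ℂ)) ∧
    ∀ᵐ x ∂μ, HasDerivAt (fun τ : ℝ => (p τ x y : ℂ)) (-(H u x)) t
  /-- the initial condition `p(0,x,y) = δ_y(x)` -/
  initial_condition : ∀ (f : X →ᵇ ℂ) (x : X),
    Tendsto (fun t => kernelOp μ p t f x) (𝓝[>] 0) (𝓝 (f x))
  chapman_kolmogorov : ∀ s t, 0 < s → 0 < t → ∀ x y,
    Integrable (fun z => p s x z * p t z y) μ ∧
    p (s + t) x y = ∫ z, p s x z * p t z y ∂μ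
  /-- on `L²`, the kernel defines a strongly continuous semigroup with generator exactly `-H` -/
  l2_semigroup : ∃ P : ℝ → (Lp ℂ 2 μ →L[ℂ] Lp ℂ 2 μ),
    (∀ t, 0 < t → ∀ f : Lp ℂ 2 μ, P t f =ᵐ[μ] kernelOp μ p t f) ∧
    (∀ s t, 0 < s → 0 < t → P (s + t) = (P s).comp (P t)) ∧
    (∀ f, Tendsto (fun t => P t f) (𝓝[>] 0) (𝓝 f)) ∧
    (∀ f g : Lp ℂ 2 μ, (f, g) ∈ H.graph ↔
      Tendsto (fun t : ℝ => ((t⁻¹ : ℝ) : ℂ) • (P t f - f)) (𝓝[>] 0) (𝓝 (-g)))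
  /-- the semigroup acts on bounded continuous functions -/
  acts_bounded : ∀ t, 0 < t → ∀ f : X →ᵇ ℂ, Continuous (kernelOp μ p t f)
  /-- the semigroup acts on continuous functions vanishing at infinity -/
  acts_C0 : ∀ t, 0 < t → ∀ f : C₀(X, ℂ), ∃ g : C₀(X, ℂ), ∀ x, g x = kernelOp μ p t f x
  /-- it is strongly continuous there -/
  strongly_continuous_C0 : ∀ f : C₀(X, ℂ),
    TendstoUniformly (fun t x => kernelOp μ p t f x) f (𝓝[>] 0)
  /-- and its generator there is given by `-H` -/
  generator_C0 : ∀ (f g : C₀(X, ℂ)) (u v : Lp ℂ 2 μ), u =ᵐ[μ] f → v =ᵐ[μ] g →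
    (u, v) ∈ H.graph →
    TendstoUniformly (fun (t : ℝ) x => ((t⁻¹ : ℝ) : ℂ) * (kernelOp μ p t f x - f x))
      (fun x => -g x) (𝓝[>] 0)
  markov : DefinesMarkovProcess μ p

/-- Condition (b): `p(t,x,x) ≤ π(t)`, where `π` has at most a power singularity at zero and is
integrable at infinity: `∫₀^∞ t^m / (1 + t^m) π(t) dt < ∞` for some `m`. -/
def ConditionB (p : ℝ → X → X → ℝ) (π : ℝ → ℝ) : Prop :=
  (∀ t, 0 < t → ∀ x, p t x x ≤ π t) ∧
  ∃ m : ℕ, IntegrableOn (fun t => t ^ m / (1 + t ^ m) * π t) (Ioi 0)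

end General

/-! ### The graph `Γ^d` -/

/-- The union of all closed unit segments joining neighbouring points of `ℤ^d` in `ℝ^d`: the points
of `ℝ^d` all of whose coordinates, with the exception of at most one, are integers. It carries
the metric and the Borel σ-algebra of `ℝ^d`. -/
abbrev LatticeGraph (d : ℕ) : Type :=
  {x : EuclideanSpace ℝ (Fin d) // ∃ i, ∀ j, j ≠ i → ∃ n : ℤ, x j = n}

namespace LatticeGraph

variable {d : ℕ}

/-- The point `z + s e_i`; for `s ∈ [0,1]` it runs through the edge from `z` to `z + e_i`, and `s`
is the distance from `z`. The edges of the graph are indexed by the pairs `(z, i)`. -/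
def edge (z : Fin d → ℤ) (i : Fin d) (s : ℝ) : LatticeGraph d :=
  ⟨WithLp.toLp 2 fun j => (z j : ℝ) + if j = i then s else 0,
    i, fun j hj => ⟨z j, by simp [hj]⟩⟩

theorem continuous_edge (z : Fin d → ℤ) (i : Fin d) : Continuous (edge z i) := by
  refine Continuous.subtype_mk ?_ _
  refine (PiLp.continuous_toLp 2 _).comp (continuous_pi fun j => ?_)
  by_cases h : j = i <;> simp only [h, if_true, if_false] <;> fun_prop

/-- Every point of `Γ^d` lies on one of the closed unit edges. -/
theorem exists_eq_edge (x : LatticeGraph d) :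
    ∃ z i, ∃ s ∈ Icc (0 : ℝ) 1, x = edge z i s := by
  obtain ⟨x, i, hx⟩ := x
  refine ⟨fun j => ⌊x j⌋, i, Int.fract (x i), ⟨Int.fract_nonneg _, (Int.fract_lt_one _).le⟩, ?_⟩
  ext j
  by_cases h : j = i
  · subst h
    simp [edge]
  · obtain ⟨n, hn⟩ := hx j h
    simp [edge, h, hn]

/-- Lebesgue measure (length) on the edges of `Γ^d`. -/
def length (d : ℕ) : Measure (LatticeGraph d) :=
  Measure.sum fun e : (Fin d → ℤ) × Fin d =>
    Measure.map (edge e.1 e.2) (volume.restrict (Icc (0 : ℝ) 1))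

/-- Functions that are continuous on `Γ^d`, smooth on every closed edge, and satisfy Kirchhoff's
condition at every vertex `z`: the derivatives in the direction out of `z`, along the `2d` edges at
`z`, add up to zero. -/
structure IsKirchhoffSmooth (φ : LatticeGraph d → ℂ) : Prop where
  continuous : Continuous φ
  smooth : ∀ z i, ContDiffOn ℝ ∞ (fun s => φ (edge z i s)) (Icc 0 1)
  kirchhoff : ∀ z, ∑ i,
    (derivWithin (fun s => φ (edge z i s)) (Icc 0 1) 0
      - derivWithin (fun s => φ (edge (z - Pi.single i 1) i s)) (Icc 0 1) 1) = 0

theorem ae_edge {P : LatticeGraph d → Prop} (h : ∀ᵐ x ∂(length d), P x)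
    (z : Fin d → ℤ) (i : Fin d) :
    ∀ᵐ s ∂(volume.restrict (Icc (0 : ℝ) 1)), P (edge z i s) :=
  ae_of_ae_map (continuous_edge z i).aemeasurable
    (ae_mono (Measure.le_sum (fun e : (Fin d → ℤ) × Fin d =>
      Measure.map (edge e.1 e.2) (volume.restrict (Icc (0 : ℝ) 1))) (z, i)) h)

theorem two_le_infty : ((2 : ℕ) : WithTop ℕ∞) ≤ ∞ := by
  exact WithTop.coe_le_coe.2 (le_top : ((2 : ℕ) : ℕ∞) ≤ ⊤)

theorem IsKirchhoffSmooth.differentiableWithinAt {φ : LatticeGraph d → ℂ}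
    (hφ : IsKirchhoffSmooth φ) (z : Fin d → ℤ) (i : Fin d) {s : ℝ} (hs : s ∈ Icc (0 : ℝ) 1) :
    DifferentiableWithinAt ℝ (fun s => φ (edge z i s)) (Icc 0 1) s :=
  ((hφ.smooth z i).differentiableOn (by simp)) s hs

theorem IsKirchhoffSmooth.add {φ ψ : LatticeGraph d → ℂ} (hφ : IsKirchhoffSmooth φ)
    (hψ : IsKirchhoffSmooth ψ) : IsKirchhoffSmooth (φ + ψ) where
  continuous := hφ.continuous.add hψ.continuous
  smooth z i := (hφ.smooth z i).add (hψ.smooth z i)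
  kirchhoff z := by
    have h := congrArg₂ (· + ·) (hφ.kirchhoff z) (hψ.kirchhoff z)
    simp only [← Finset.sum_add_distrib, add_zero] at h
    rw [← h]
    refine Finset.sum_congr rfl fun i _ => ?_
    simp only [Pi.add_apply]
    rw [derivWithin_fun_add (hφ.differentiableWithinAt z i (by simp))
        (hψ.differentiableWithinAt z i (by simp)),
      derivWithin_fun_add (hφ.differentiableWithinAt _ i (by simp))
        (hψ.differentiableWithinAt _ i (by simp))]
    ring

theorem IsKirchhoffSmooth.smul {φ : LatticeGraph d → ℂ} (c : ℂ) (hφ : IsKirchhoffSmooth φ) :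
    IsKirchhoffSmooth (c • φ) where
  continuous := hφ.continuous.const_smul c
  smooth z i := (hφ.smooth z i).const_smul c
  kirchhoff z := by
    have h := congrArg (c • ·) (hφ.kirchhoff z)
    simp only [Finset.smul_sum, smul_zero] at h
    rw [← h]
    refine Finset.sum_congr rfl fun i _ => ?_
    simp only [Pi.smul_apply]
    rw [derivWithin_fun_const_smul c (hφ.differentiableWithinAt z i (by simp)),
      derivWithin_fun_const_smul c (hφ.differentiableWithinAt _ i (by simp)), smul_sub]

/-- The graph, in `L²(Γ^d) × L²(Γ^d)`, of the operator `φ ↦ -φ''` on the smooth functions with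
Kirchhoff's conditions: all pairs of classes `(φ, -φ'')`, both square integrable. -/
def smoothGraph (d : ℕ) : Submodule ℂ (Lp ℂ 2 (length d) × Lp ℂ 2 (length d)) where
  carrier := {q | ∃ φ : LatticeGraph d → ℂ, IsKirchhoffSmooth φ ∧ q.1 =ᵐ[length d] φ ∧
    ∀ z i, ∀ᵐ s ∂(volume.restrict (Icc (0 : ℝ) 1)),
      q.2 (edge z i s) = -iteratedDerivWithin 2 (fun s => φ (edge z i s)) (Icc 0 1) s}
  add_mem' := by
    rintro ⟨f, f'⟩ ⟨g, g'⟩ ⟨φ, hφ, hf, hf'⟩ ⟨ψ, hψ, hg, hg'⟩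
    refine ⟨φ + ψ, hφ.add hψ, (Lp.coeFn_add f g).trans (hf.add hg), fun z i => ?_⟩
    filter_upwards [hf' z i, hg' z i, ae_edge (Lp.coeFn_add f' g') z i,
      ae_restrict_mem measurableSet_Icc] with s h1 h2 h3 hs
    have h4 := iteratedDerivWithin_add hs (uniqueDiffOn_Icc zero_lt_one)
      (((hφ.smooth z i).of_le two_le_infty) s hs) (((hψ.smooth z i).of_le two_le_infty) s hs)
    rw [show ((f, f') + (g, g')).2 = f' + g' from rfl, h3, Pi.add_apply, h1, h2]
    have h5 : (fun s => (φ + ψ) (edge z i s)) =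
      (fun s => φ (edge z i s)) + fun s => ψ (edge z i s) := rfl
    rw [h5, h4]
    ring
  zero_mem' := by
    refine ⟨0, ⟨continuous_const, fun z i => contDiffOn_const, fun z => ?_⟩,
      Lp.coeFn_zero _ _ _, fun z i => ?_⟩
    · simp
    · filter_upwards [ae_edge (Lp.coeFn_zero ℂ 2 (length d)) z i] with s hs
      rw [show (0 : Lp ℂ 2 (length d) × Lp ℂ 2 (length d)).2 = 0 from rfl, hs]
      simp
  smul_mem' := by
    rintro c ⟨f, f'⟩ ⟨φ, hφ, hf, hf'⟩
    refine ⟨c • φ, hφ.smul c, (Lp.coeFn_smul c f).trans (hf.const_smul c), fun z i => ?_⟩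
    filter_upwards [hf' z i, ae_edge (Lp.coeFn_smul c f') z i,
      ae_restrict_mem measurableSet_Icc] with s h1 h3 hs
    have h4 := iteratedDerivWithin_const_smul hs (uniqueDiffOn_Icc zero_lt_one) c
      (((hφ.smooth z i).of_le two_le_infty) s hs)
    rw [show (c • (f, f')).2 = c • f' from rfl, h3, Pi.smul_apply, h1]
    have h5 : (fun s => (c • φ) (edge z i s)) = c • (fun s => φ (edge z i s)) := rfl
    rw [h5, h4, smul_neg]

/-- The Kirchhoff Laplacian `H₀` on `Γ^d`: the closure in `L²(Γ^d)` of `φ ↦ -φ''` on the smooth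
functions with Kirchhoff's conditions. -/
def kirchhoffLaplacian (d : ℕ) : Lp ℂ 2 (length d) →ₗ.[ℂ] Lp ℂ 2 (length d) :=
  (smoothGraph d).topologicalClosure.toLinearPMap

end LatticeGraph

end

/-!
The heat kernel of the graph is written down explicitly, by the method of images. A
wave that arrives at a vertex is transmitted with the amplitude `1/d` into each of the `2d`
edges there, with the correction `-1` for the edge that it came from. The integer powers of
this scattering matrix (`amp`) weight the paths from `y` to `x`, and `heatKernel` is the sum
over all paths of the weight times the heat kernel of the line at the length of the path. The
weights grow like `3 ^ |n|` with the number `n` of vertices passed, so the Gaussian decay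
makes all series converge.

A continuous function on the graph extends from every directed edge to the line, a shift by one
being an application of the scattering matrix (`IsUnfolded`). If the extensions are smooth, the
function satisfies Kirchhoff's conditions (`IsUnfolded.isKirchhoffSmooth`). The heat kernel
extends to a smooth solution of the heat equation on the line (`isUnfolded_sourceSum`),
and its action on
unfolded functions is that of the heat kernel of the line (`integral_heatKernel_mul_glue`). Hence
it has mass one and satisfies the Chapman–Kolmogorov equation. As waves have finite
speed, it has exponential moments (`lintegral_abs_heatKernel_mul_exp_le`), which give the
initial condition and the preservation of decay at infinity. Positivity is not visible in
the formula, since the amplitudes have both signs; it follows from the minimum principle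
(`heatFlow_nonneg_of_hasCompactSupport`).

For the operator, consider the pairs `(f, g)` in `L²` with `∂ₜ Pₜ f = -Pₜ g` pointwise
(`IsWeakGenerator`). Since `p(t, x, ·)` belongs to the operator on the smooth functions,
every element of the graph of the adjoint is such a pair. By strong continuity such a pair is
approximated by `(Pₜ f, Pₜ g)`, which belongs to the operator on the smooth functions. This
operator is symmetric by Green's formula (`smoothGraph_symm`), so closure, adjoint and weak
pairs agree. They also agree with the generator (`mem_graph_iff_tendsto`), and the operator is
nonnegative because the semigroup is contractive. The Markov process comes from Kolmogorov's
extension theorem, which is proved here for families of probability measures on Polish spaces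
(`exists_isProjectiveLimit`, `exists_markovProcess`).

For large times, the amplitudes averaged over the edges at a vertex solve the
discrete wave equation on `ℤ^d`, so they are Fourier integrals of `cos (n ω(θ))`
(`meanAmp_eq_integral`), where `cos ω(θ)` is the mean of the `cos θ_j`. Poisson's summation
formula turns the kernel between two vertices into an integral of `exp (-t ω(θ)²)`, up to
exponentially small terms (`heatKernel_vertex`), and Laplace's method gives its asymptotics
(`tendsto_rpow_mul_vertexKernel`). To pass to inner points of the edges, note that
`‖P_{t/2} u‖²` is convex in `t`; therefore `|∂ₜ p| ≤ 4 M / t` if `p ≤ M` at time `t/2`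
(`abs_heatKernelDeriv_le`). As `∂ₜ p` is the second derivative along the edges, the kernel
is nearly linear there (`heatKernel_mem_Icc_of_vertex`). This first gives the bound by
`t ^ (-d/2)`, by induction over dyadic times (`exists_rpow_mul_heatKernel_le`), and then the
uniform limit.
-/

noncomputable section

namespace LatticeGraph

variable {d : ℕ}

/-! ### Directed edges and the scattering matrix -/

/-- The directed edges of `Γ^d`: `(v, i, true)` runs from `v` to `v + e_i`, and `(v, i, false)`
from `v` to `v - e_i`. -/
abbrev DirEdge (d : ℕ) : Type := (Fin d → ℤ) × Fin d × Bool

namespace DirEdge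

/-- The unit vector along the direction `(i, ±)`. -/
def step (a : Fin d × Bool) : Fin d → ℤ := Pi.single a.1 (if a.2 then 1 else -1)

/-- The terminal vertex of a directed edge. -/
def target (e : DirEdge d) : Fin d → ℤ := e.1 + step e.2

/-- The directed edge traversed backwards. -/
def reverse (e : DirEdge d) : DirEdge d := (target e, e.2.1, !e.2.2)

theorem step_not (i : Fin d) (b : Bool) : step (i, !b) = -step (i, b) := by
  cases b <;> simp [step, Pi.single_neg]

@[simp] theorem target_reverse (e : DirEdge d) : target (reverse e) = e.1 := by
  obtain ⟨v, i, b⟩ := e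
  simp [target, reverse, step_not]

@[simp] theorem reverse_fst (e : DirEdge d) : (reverse e).1 = target e := rfl

@[simp] theorem reverse_reverse (e : DirEdge d) : reverse (reverse e) = e := by
  obtain ⟨v, i, b⟩ := e
  have := target_reverse (v, i, b)
  simp only [reverse, target] at this ⊢
  simp [this]

theorem reverse_involutive : Function.Involutive (reverse (d := d)) := reverse_reverse

theorem reverse_injective : Function.Injective (reverse (d := d)) := reverse_involutive.injective

theorem eq_reverse_comm {e f : DirEdge d} : e = reverse f ↔ reverse e = f :=
  ⟨fun h => by simp [h], fun h => by simp [← h]⟩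

end DirEdge

open DirEdge

/-- The scattering operator at the vertices: a wave that leaves `e` at its terminal vertex is
transmitted with the coefficient `1/d` to each of the `2d` edges there, with the correction `-1`
for the edge that it came from. -/
def scatter (φ : DirEdge d → ℝ) (e : DirEdge d) : ℝ :=
  (d : ℝ)⁻¹ * ∑ b, φ (target e, b) - φ (reverse e)

theorem sum_const_dir (x : ℝ) : ∑ _b : Fin d × Bool, x = 2 * d * x := by
  rw [Finset.sum_const, Finset.card_univ, Fintype.card_prod, Fintype.card_fin, Fintype.card_bool]
  simp [mul_comm]

/-- The scattering operator is inverted by its conjugate under the reversal of edges. -/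
theorem scatter_scatter_reverse [NeZero d] (φ : DirEdge d → ℝ) (e : DirEdge d) :
    scatter (fun f => scatter (fun g => φ (reverse g)) (reverse f)) e = φ e := by
  have hd : (d : ℝ) ≠ 0 := NeZero.ne _
  have key : ∀ b, scatter (fun g => φ (reverse g)) (reverse (target e, b)) =
      (d : ℝ)⁻¹ * ∑ c, φ (reverse (target e, c)) - φ (reverse (target e, b)) := by
    intro b
    simp only [scatter, target_reverse, reverse_reverse]
  have key' : scatter (fun g => φ (reverse g)) (reverse (reverse e)) =
      (d : ℝ)⁻¹ * ∑ c, φ (reverse (target e, c)) - φ e := by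
    simp only [scatter, reverse_reverse]
  simp only [scatter] at key key' ⊢
  rw [key']
  simp only [key, Finset.sum_sub_distrib, sum_const_dir]
  field_simp
  ring

/-- The entries of the integer powers of the scattering matrix: `amp n e f` is the amplitude with
which a wave that starts on `f` is seen on `e` after `n` passages through vertices. The negative
powers are defined by reversing the edges; `amp_add_one` shows that they are the inverse powers. -/
def amp : ℤ → DirEdge d → DirEdge d → ℝ
  | Int.ofNat n, e, f => scatter^[n] (Pi.single f 1) e
  | Int.negSucc n, e, f => scatter^[n + 1] (Pi.single (reverse f) 1) (reverse e)

theorem amp_natCast (n : ℕ) (e f : DirEdge d) :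
    amp (n : ℤ) e f = scatter^[n] (Pi.single f 1) e := rfl

theorem amp_zero (e f : DirEdge d) : amp 0 e f = if e = f then 1 else 0 := by
  rw [show (0 : ℤ) = ((0 : ℕ) : ℤ) from rfl, amp_natCast]
  simp [Pi.single_apply]

theorem amp_neg_natCast (n : ℕ) (e f : DirEdge d) :
    amp (-(n : ℤ)) e f = amp (n : ℤ) (reverse e) (reverse f) := by
  cases n with
  | zero => simp [amp_zero, reverse_injective.eq_iff]
  | succ n =>
    rw [show (-((n + 1 : ℕ) : ℤ)) = Int.negSucc n from rfl]
    rfl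

theorem amp_neg (n : ℤ) (e f : DirEdge d) : amp (-n) e f = amp n (reverse e) (reverse f) := by
  obtain ⟨m, rfl | rfl⟩ := n.eq_nat_or_neg
  · exact amp_neg_natCast m e f
  · rw [neg_neg, amp_neg_natCast, reverse_reverse, reverse_reverse]

theorem amp_natCast_add_one (n : ℕ) (e f : DirEdge d) :
    amp ((n : ℤ) + 1) e f = scatter (fun g => amp n g f) e := by
  rw [show ((n : ℤ) + 1) = ((n + 1 : ℕ) : ℤ) by push_cast; rfl, amp_natCast,
    Function.iterate_succ_apply']
  rfl

/-- The recursion holds for all integers because conjugation with the reversal inverts the scattering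
operator. -/
theorem amp_add_one [NeZero d] (n : ℤ) (e f : DirEdge d) :
    amp (n + 1) e f = scatter (fun g => amp n g f) e := by
  obtain ⟨m, rfl | rfl⟩ := n.eq_nat_or_neg
  · exact amp_natCast_add_one m e f
  · cases m with
    | zero => simpa using amp_natCast_add_one 0 e f
    | succ m =>
      have h1 : -((m + 1 : ℕ) : ℤ) + 1 = -(m : ℤ) := by push_cast; ring
      have h2 : ∀ g, amp (-((m + 1 : ℕ) : ℤ)) g f =
          scatter (fun g' => amp (m : ℤ) g' (reverse f)) (reverse g) := by
        intro g
        rw [amp_neg, Nat.cast_succ, amp_natCast_add_one]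
      rw [h1, amp_neg]
      simp only [h2]
      have := scatter_scatter_reverse (fun g => amp (m : ℤ) (reverse g) (reverse f)) e
      simpa using this.symm

/-- The recursion for `amp` in its second argument. -/
theorem amp_natCast_add_one' (n : ℕ) (e f : DirEdge d) :
    amp ((n : ℤ) + 1) e f =
      (d : ℝ)⁻¹ * ∑ b, amp n e (reverse (f.1, b)) - amp n e (reverse f) := by
  induction n generalizing e with
  | zero =>
    -- both sums tell whether `f` starts at the target of `e`
    rw [amp_natCast_add_one]
    simp only [scatter, Nat.cast_zero, amp_zero]
    congr 2
    · have h1 : ∀ b, ((target e, b) = f) ↔ (b = f.2 ∧ target e = f.1) := fun b => by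
        simp [Prod.ext_iff, and_comm]
      have h2 : ∀ b, (e = reverse (f.1, b)) ↔ (b = (reverse e).2 ∧ target e = f.1) := fun b => by
        rw [eq_reverse_comm]
        have h3 : ∀ x y : Bool, x = (!y) ↔ y = !x := by decide
        have h4 := h3 e.2.2 b.2
        simp only [Prod.ext_iff, reverse, eq_comm (a := e.2.1)]
        tauto
      simp only [h1, h2, ite_and, Finset.sum_ite_eq', Finset.mem_univ, if_true]
    · simp only [eq_reverse_comm]
  | succ n ih =>
    -- the recursions in the first and the second argument commute
    rw [amp_natCast_add_one, Nat.cast_succ]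
    simp only [scatter, ih, amp_natCast_add_one]
    simp only [Finset.sum_sub_distrib, mul_sub, Finset.mul_sum]
    rw [Finset.sum_comm]
    ring

theorem amp_natCast_symm (n : ℕ) (e f : DirEdge d) :
    amp n e f = amp n (reverse f) (reverse e) := by
  induction n generalizing e f with
  | zero =>
    simp only [Nat.cast_zero, amp_zero, reverse_injective.eq_iff]
    simp only [eq_comm]
  | succ n ih =>
    rw [Nat.cast_succ, amp_natCast_add_one', amp_natCast_add_one, scatter]
    simp only [target_reverse, reverse_reverse]
    rw [ih e (reverse f), reverse_reverse]
    refine congrArg₂ _ (congrArg _ (Finset.sum_congr rfl fun b _ => ?_)) rfl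
    rw [ih, reverse_reverse]

/-- The scattering matrix is symmetric up to the reversal of edges. -/
theorem amp_symm (n : ℤ) (e f : DirEdge d) : amp n e f = amp n (reverse f) (reverse e) := by
  obtain ⟨m, rfl | rfl⟩ := n.eq_nat_or_neg
  · exact amp_natCast_symm m e f
  · rw [amp_neg, amp_neg, amp_natCast_symm, reverse_reverse, reverse_reverse]

theorem abs_scatter_le {g : DirEdge d → ℝ} (e : DirEdge d) :
    |scatter g e| ≤ (d : ℝ)⁻¹ * ∑ b, |g (target e, b)| + |g (reverse e)| := by
  refine (abs_sub _ _).trans ?_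
  rw [abs_mul, abs_of_nonneg (a := (d : ℝ)⁻¹) (by positivity)]
  gcongr
  exact Finset.abs_sum_le_sum_abs _ _

/-- Every row of the scattering matrix has an absolute sum of at most `2 + 1 = 3`. -/
theorem amp_summable_natCast [NeZero d] (n : ℕ) (e : DirEdge d) :
    Summable (fun f => |amp n e f|) ∧ ∑' f, |amp n e f| ≤ 3 ^ n := by
  have hd : (d : ℝ) ≠ 0 := NeZero.ne _
  induction n generalizing e with
  | zero =>
    have h : ∀ f, |amp ((0 : ℕ) : ℤ) e f| = if f = e then (1 : ℝ) else 0 := by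
      intro f
      rw [Nat.cast_zero, amp_zero]
      by_cases h : e = f <;> simp [h, eq_comm]
    simp only [h]
    exact ⟨(hasSum_ite_eq e (1 : ℝ)).summable, by simp⟩
  | succ n ih =>
    have hb : ∀ f, |amp ((n + 1 : ℕ) : ℤ) e f| ≤
        (d : ℝ)⁻¹ * ∑ b, |amp n (target e, b) f| + |amp n (reverse e) f| := by
      intro f
      rw [Nat.cast_succ, amp_natCast_add_one]
      exact abs_scatter_le e
    have hs1 : HasSum (fun f => ∑ b, |amp n (target e, b) f|)
        (∑ b, ∑' f, |amp n (target e, b) f|) := hasSum_sum fun b _ => (ih _).1.hasSum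
    have hs := (hs1.mul_left (d : ℝ)⁻¹).add (ih (reverse e)).1.hasSum
    refine ⟨Summable.of_nonneg_of_le (fun _ => abs_nonneg _) hb hs.summable, ?_⟩
    refine (Summable.tsum_le_tsum hb
      (Summable.of_nonneg_of_le (fun _ => abs_nonneg _) hb hs.summable) hs.summable).trans ?_
    rw [hs.tsum_eq]
    calc _ ≤ (d : ℝ)⁻¹ * ∑ b : Fin d × Bool, (3 : ℝ) ^ n + 3 ^ n := by
          gcongr with b
          · exact (ih _).2
          · exact (ih _).2
      _ = 3 ^ (n + 1) := by rw [sum_const_dir]; field_simp; ring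

theorem amp_summable [NeZero d] (n : ℤ) (e : DirEdge d) : Summable (fun f => |amp n e f|) := by
  obtain ⟨m, rfl | rfl⟩ := n.eq_nat_or_neg
  · exact (amp_summable_natCast m e).1
  · simp only [amp_neg]
    exact (amp_summable_natCast m (reverse e)).1.comp_injective reverse_injective

theorem tsum_abs_amp_le [NeZero d] (n : ℤ) (e : DirEdge d) :
    ∑' f, |amp n e f| ≤ 3 ^ n.natAbs := by
  obtain ⟨m, rfl | rfl⟩ := n.eq_nat_or_neg
  · simpa using (amp_summable_natCast m e).2
  · simp only [amp_neg, Int.natAbs_neg, Int.natAbs_natCast]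
    exact (reverse_involutive.toPerm.tsum_eq fun f => |amp m (reverse e) f|).trans_le
      (amp_summable_natCast m (reverse e)).2

theorem abs_amp_le [NeZero d] (n : ℤ) (e f : DirEdge d) : |amp n e f| ≤ 3 ^ n.natAbs :=
  ((amp_summable n e).le_tsum f fun _ _ => abs_nonneg _).trans (tsum_abs_amp_le n e)

/-! ### Unfolded families -/

/-- A family of functions on `ℝ`, one for every directed edge, that describes a function on the
graph and its continuation beyond the edges by scattering at the vertices: on reversed edges the
coordinate is reversed, and a shift by one is an application of the scattering operator. -/
structure IsUnfolded {V : Type*} [AddCommGroup V] [Module ℝ V] (h : DirEdge d → ℝ → V) : Prop where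
  reverse : ∀ e s, h (reverse e) s = h e (1 - s)
  shift : ∀ e s, h e (s + 1) = (d : ℝ)⁻¹ • ∑ b, h (target e, b) s - h (DirEdge.reverse e) s

/-- An unfolded family is recovered by the powers of the scattering matrix from its values on
the edges. -/
theorem IsUnfolded.hasSum_amp [NeZero d] {h : DirEdge d → ℝ → ℝ} (hh : IsUnfolded h) {s C : ℝ}
    (hC : ∀ e, |h e s| ≤ C) (hC' : ∀ e, |h e (1 - s)| ≤ C) (n : ℤ) (e : DirEdge d) :
    HasSum (fun f => amp n e f * h f s) (h e (s + n)) := by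
  have key : ∀ (n : ℕ) (s : ℝ), (∀ e, |h e s| ≤ C) → ∀ e,
      HasSum (fun f => amp n e f * h f s) (h e (s + n)) := by
    intro n s hC
    induction n with
    | zero =>
      intro e
      simp only [Nat.cast_zero, amp_zero, add_zero]
      convert! hasSum_ite_eq e (h e s) using 2 with f
      by_cases h : e = f <;> simp [h, eq_comm]
    | succ n ih =>
      intro e
      have h1 := ((hasSum_sum fun b (_ : b ∈ Finset.univ) => ih (target e, b)).mul_left
        (d : ℝ)⁻¹).sub (ih (DirEdge.reverse e))
      convert! h1 using 1
      · funext f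
        rw [Nat.cast_succ, amp_natCast_add_one, scatter]
        simp only [sub_mul, Finset.mul_sum, Finset.sum_mul, mul_assoc]
      · rw [Nat.cast_succ, ← add_assoc, hh.shift, smul_eq_mul]
  obtain ⟨m, rfl | rfl⟩ := n.eq_nat_or_neg
  · simpa using key m s hC e
  -- negative powers are positive powers on the reversed edges
  · have h1 := key m (1 - s) hC' (DirEdge.reverse e)
    rw [← reverse_involutive.toPerm.hasSum_iff] at h1
    rw [hh.reverse] at h1
    convert! h1 using 1
    · funext f
      simp only [amp_neg, Function.comp_apply, Function.Involutive.coe_toPerm, hh.reverse, sub_sub_cancel]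
    · push_cast; ring_nf

/-! ### Gaussian profiles -/

/-- The profile `x ^ k * exp (-x² / 4t)`. The derivatives of the heat kernel of the line in `x` and
`t` are combinations of these. -/
def gaussProfile (k : ℕ) (t x : ℝ) : ℝ := x ^ k * Real.exp (-x ^ 2 / (4 * t))

/-- The normalization `(4πt)^(-1/2)` of the heat kernel of the line. -/
def heatNorm (t : ℝ) : ℝ := (√(4 * Real.pi * t))⁻¹

theorem heatNorm_pos {t : ℝ} (ht : 0 < t) : 0 < heatNorm t := by
  unfold heatNorm; positivity

theorem gaussProfile_zero (t x : ℝ) : gaussProfile 0 t x = Real.exp (-x ^ 2 / (4 * t)) := by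
  simp [gaussProfile]

theorem gaussProfile_zero_neg (t x : ℝ) : gaussProfile 0 t (-x) = gaussProfile 0 t x := by
  simp [gaussProfile]

theorem hasDerivAt_gaussProfile (k : ℕ) (t x : ℝ) :
    HasDerivAt (gaussProfile k t)
      (k * gaussProfile (k - 1) t x - (2 * t)⁻¹ * gaussProfile (k + 1) t x) x := by
  have h1 : HasDerivAt (fun x : ℝ => -x ^ 2 / (4 * t)) (-(2 * x) / (4 * t)) x := by
    have := ((hasDerivAt_pow 2 x).neg).div_const (4 * t)
    simpa using this
  have h2 := (hasDerivAt_pow k x).mul h1.exp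
  convert! h2 using 1
  simp only [gaussProfile, pow_succ]
  rw [show (2 * t)⁻¹ = 2 / (4 * t) by rw [mul_inv, div_eq_mul_inv, mul_inv]; ring]
  ring

theorem hasDerivAt_gaussProfile_time (k : ℕ) {t : ℝ} (ht : 0 < t) (x : ℝ) :
    HasDerivAt (fun t => gaussProfile k t x) ((4 * t ^ 2)⁻¹ * gaussProfile (k + 2) t x) t := by
  have h1 : HasDerivAt (fun t : ℝ => -x ^ 2 / (4 * t)) (x ^ 2 * (4 * t ^ 2)⁻¹) t := by
    have := ((hasDerivAt_id t).const_mul 4).inv (by simpa using ht.ne')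
    have := this.const_mul (-x ^ 2)
    convert! this using 1
    simp only [id]
    field_simp
  have h2 := h1.exp.const_mul (x ^ k)
  convert! h2 using 1
  simp only [gaussProfile, pow_succ]
  ring

theorem continuousOn_gaussProfile (k : ℕ) :
    ContinuousOn (fun q : ℝ × ℝ => gaussProfile k q.1 q.2) (Ioi 0 ×ˢ univ) := by
  unfold gaussProfile
  refine ContinuousOn.mul (by fun_prop) (Real.continuous_exp.comp_continuousOn ?_)
  refine ContinuousOn.div (by fun_prop) (by fun_prop) fun q hq => ?_
  have : (0 : ℝ) < q.1 := hq.1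
  positivity

/-- This makes the Gaussian decay `exp (-2 |n|)` beat the growth `3 ^ |n|` of the amplitudes. -/
theorem exp_neg_two_le : Real.exp (-2) ≤ 1 / 6 := by
  have h1 : (6 : ℝ) ≤ Real.exp 2 := by
    have h := Real.exp_one_gt_d9
    rw [show (2 : ℝ) = 1 + 1 by norm_num, Real.exp_add]
    nlinarith
  rw [Real.exp_neg, one_div]
  exact inv_anti₀ (by norm_num) h1

theorem abs_gaussProfile_le (k : ℕ) {b t : ℝ} (ht : 0 < t) (htb : t ≤ b) (x : ℝ) :
    |gaussProfile k t x| ≤ (k.factorial * Real.exp (9 * b)) * Real.exp (-(2 * |x|)) := by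
  have hb : 0 < b := ht.trans_le htb
  have h1 : |x| ^ k ≤ k.factorial * Real.exp |x| := by
    have := Real.pow_div_factorial_le_exp |x| (abs_nonneg x) k
    rwa [div_le_iff₀ (by positivity), mul_comm] at this
  rw [gaussProfile, abs_mul, Real.abs_exp, abs_pow]
  calc |x| ^ k * Real.exp (-x ^ 2 / (4 * t))
      ≤ (k.factorial * Real.exp |x|) * Real.exp (9 * b - 3 * |x|) := by
        gcongr
        have h2 : -x ^ 2 / (4 * t) ≤ -x ^ 2 / (4 * b) := by
          rw [neg_div, neg_div, neg_le_neg_iff]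
          gcongr
        refine h2.trans ?_
        rw [div_le_iff₀ (by positivity), ← sq_abs]
        nlinarith [sq_nonneg (|x| - 6 * b)]
    _ = _ := by
        rw [mul_assoc, mul_assoc, ← Real.exp_add, ← Real.exp_add]
        ring_nf

/-- On bounded sets of `ρ` and `t`, the shifted profiles decay faster than the entries of the
powers of the scattering matrix can grow. -/
theorem exists_abs_gaussProfile_sub_le (k : ℕ) {b : ℝ} (R : ℝ) :
    ∃ C, 0 < C ∧ ∀ t, 0 < t → t ≤ b → ∀ ρ, |ρ| ≤ R → ∀ n : ℤ,
      |gaussProfile k t (ρ - n)| ≤ C * (1 / 6) ^ n.natAbs := by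
  refine ⟨k.factorial * Real.exp (9 * b) * Real.exp (2 * R), by positivity,
    fun t ht htb ρ hρ n => (abs_gaussProfile_le k ht htb _).trans ?_⟩
  rw [mul_assoc _ (Real.exp (2 * R))]
  gcongr
  have h1 : (n.natAbs : ℝ) ≤ |ρ - n| + R := by
    have h2 : ((n.natAbs : ℕ) : ℝ) = |(n : ℝ)| := by rw [← Int.cast_abs, Int.abs_eq_natAbs]; simp
    rw [h2]
    have := abs_sub_abs_le_abs_sub (n : ℝ) ρ
    rw [abs_sub_comm] at this
    linarith
  calc Real.exp (-(2 * |ρ - n|)) ≤ Real.exp (2 * R + n.natAbs * (-2)) := by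
        gcongr; linarith
    _ = Real.exp (2 * R) * Real.exp (-2) ^ n.natAbs := by
        rw [Real.exp_add, Real.exp_nat_mul]
    _ ≤ _ := by gcongr; exact exp_neg_two_le

theorem summable_half_natAbs : Summable fun n : ℤ => (1 / 2 : ℝ) ^ n.natAbs := by
  refine Summable.of_nat_of_neg ?_ ?_ <;>
    simpa using summable_geometric_of_lt_one (r := (2 : ℝ)⁻¹) (by norm_num) (by norm_num)

/-- A summable majorant of the amplitudes between two edges. -/
def ampWeight (e f : DirEdge d) : ℝ := ∑' n : ℤ, |amp n e f| * (1 / 6) ^ n.natAbs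

theorem abs_amp_mul_le [NeZero d] (e f : DirEdge d) (n : ℤ) :
    |amp n e f| * (1 / 6) ^ n.natAbs ≤ (1 / 2) ^ n.natAbs := by
  calc _ ≤ (3 : ℝ) ^ n.natAbs * (1 / 6) ^ n.natAbs := by gcongr; exact abs_amp_le n e f
    _ = _ := by rw [← mul_pow]; norm_num

theorem summable_ampWeight_terms [NeZero d] (e f : DirEdge d) :
    Summable fun n : ℤ => |amp n e f| * (1 / 6) ^ n.natAbs :=
  Summable.of_nonneg_of_le (fun _ => by positivity) (abs_amp_mul_le e f) summable_half_natAbs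

theorem ampWeight_nonneg (e f : DirEdge d) : 0 ≤ ampWeight e f :=
  tsum_nonneg fun _ => by positivity

theorem ampWeight_le [NeZero d] (e f : DirEdge d) :
    ampWeight e f ≤ ∑' n : ℤ, (1 / 2 : ℝ) ^ n.natAbs :=
  Summable.tsum_le_tsum (abs_amp_mul_le e f) (summable_ampWeight_terms e f) summable_half_natAbs

theorem summable_ampWeight_pairs [NeZero d] (e : DirEdge d) :
    Summable fun q : ℤ × DirEdge d => |amp q.1 e q.2| * (1 / 6) ^ q.1.natAbs := by
  have h0 : 0 ≤ fun q : ℤ × DirEdge d => |amp q.1 e q.2| * (1 / 6 : ℝ) ^ q.1.natAbs :=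
    fun q => by positivity
  rw [summable_prod_of_nonneg h0]
  refine ⟨fun n => (amp_summable n e).mul_right ((1 / 6 : ℝ) ^ n.natAbs), ?_⟩
  simp only [tsum_mul_right]
  refine Summable.of_nonneg_of_le (fun n => ?_) (fun n => ?_) summable_half_natAbs
  · exact mul_nonneg (tsum_nonneg fun _ => abs_nonneg _) (by positivity)
  · calc _ ≤ (3 : ℝ) ^ n.natAbs * (1 / 6) ^ n.natAbs := by gcongr; exact tsum_abs_amp_le n e
      _ = _ := by rw [← mul_pow]; norm_num

theorem summable_ampWeight [NeZero d] (e : DirEdge d) : Summable (ampWeight e) :=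
  (summable_ampWeight_pairs e).prod_symm.prod

/-! ### Gaussian profiles transported along the edges -/

/-- The superposition of the profiles that start on the edge `f` and are seen on the edge `e`. -/
def transport (k : ℕ) (t : ℝ) (e f : DirEdge d) (ρ : ℝ) : ℝ :=
  ∑' n : ℤ, amp n e f * gaussProfile k t (ρ - n)

theorem exists_abs_transport_terms_le (d k : ℕ) (b R : ℝ) :
    ∃ C, 0 < C ∧ ∀ t, 0 < t → t ≤ b → ∀ (e f : DirEdge d) (ρ : ℝ), |ρ| ≤ R → ∀ n : ℤ,
      |amp n e f * gaussProfile k t (ρ - n)| ≤ C * (|amp n e f| * (1 / 6) ^ n.natAbs) := by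
  obtain ⟨C, hC, h⟩ := exists_abs_gaussProfile_sub_le k (b := b) R
  refine ⟨C, hC, fun t ht htb e f ρ hρ n => ?_⟩
  rw [abs_mul, mul_left_comm]
  gcongr
  exact h t ht htb ρ hρ n

theorem summable_transport [NeZero d] (k : ℕ) {t : ℝ} (ht : 0 < t) (e f : DirEdge d) (ρ : ℝ) :
    Summable fun n : ℤ => amp n e f * gaussProfile k t (ρ - n) := by
  obtain ⟨C, hC, h⟩ := exists_abs_transport_terms_le d k t |ρ|
  exact Summable.of_norm_bounded ((summable_ampWeight_terms e f).mul_left C)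
    (fun n => h t ht le_rfl e f ρ le_rfl n)

theorem exists_abs_transport_le (d : ℕ) [NeZero d] (k : ℕ) (b R : ℝ) :
    ∃ C, 0 < C ∧ ∀ t, 0 < t → t ≤ b → ∀ (e f : DirEdge d) (ρ : ℝ), |ρ| ≤ R →
      |transport k t e f ρ| ≤ C * ampWeight e f := by
  obtain ⟨C, hC, h⟩ := exists_abs_transport_terms_le d k b R
  refine ⟨C, hC, fun t ht htb e f ρ hρ => ?_⟩
  rw [ampWeight, ← tsum_mul_left]
  exact tsum_of_norm_bounded (f := fun n : ℤ => amp n e f * gaussProfile k t (ρ - n))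
    ((summable_ampWeight_terms e f).mul_left C).hasSum (fun n => h t ht htb e f ρ hρ n)

theorem hasDerivAt_transport [NeZero d] (k : ℕ) {t : ℝ} (ht : 0 < t) (e f : DirEdge d) (ρ : ℝ) :
    HasDerivAt (transport k t e f)
      (k * transport (k - 1) t e f ρ - (2 * t)⁻¹ * transport (k + 1) t e f ρ) ρ := by
  obtain ⟨C1, hC1, h1⟩ := exists_abs_transport_terms_le d (k - 1) t (|ρ| + 1)
  obtain ⟨C2, hC2, h2⟩ := exists_abs_transport_terms_le d (k + 1) t (|ρ| + 1)
  have hball : ∀ y ∈ Metric.ball ρ 1, |y| ≤ |ρ| + 1 := by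
    intro y hy
    rw [Metric.mem_ball, Real.dist_eq] at hy
    have := abs_sub_abs_le_abs_sub y ρ
    linarith
  have h := hasDerivAt_tsum_of_isPreconnected (𝕜 := ℝ)
    (u := fun n => (k * C1 + (2 * t)⁻¹ * C2) * (|amp n e f| * (1 / 6) ^ n.natAbs))
    (g := fun (n : ℤ) y => amp n e f * gaussProfile k t (y - n))
    (g' := fun (n : ℤ) y => k * (amp n e f * gaussProfile (k - 1) t (y - n)) -
      (2 * t)⁻¹ * (amp n e f * gaussProfile (k + 1) t (y - n)))
    ((summable_ampWeight_terms e f).mul_left _) Metric.isOpen_ball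
    (convex_ball ρ 1).isPreconnected ?_ ?_ (Metric.mem_ball_self one_pos)
    (summable_transport k ht e f ρ) (Metric.mem_ball_self one_pos)
  · convert! h using 1
    rw [Summable.tsum_sub ((summable_transport _ ht e f ρ).mul_left _)
      ((summable_transport _ ht e f ρ).mul_left _), tsum_mul_left, tsum_mul_left]
    rfl
  · intro n y _
    have := ((hasDerivAt_gaussProfile k t (y - n)).comp_sub_const y (n : ℝ)).const_mul (amp n e f)
    convert! this using 1
    ring
  · intro n y hy
    refine (norm_sub_le _ _).trans ?_
    rw [norm_mul, norm_mul (2 * t)⁻¹, Real.norm_natCast,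
      Real.norm_of_nonneg (by positivity : (0 : ℝ) ≤ (2 * t)⁻¹), add_mul, mul_assoc, mul_assoc]
    gcongr
    · exact h1 t ht le_rfl e f y (hball y hy) n
    · exact h2 t ht le_rfl e f y (hball y hy) n

theorem hasDerivAt_transport_time [NeZero d] (k : ℕ) {t : ℝ} (ht : 0 < t) (e f : DirEdge d)
    (ρ : ℝ) :
    HasDerivAt (fun t => transport k t e f ρ) ((4 * t ^ 2)⁻¹ * transport (k + 2) t e f ρ) t := by
  obtain ⟨C, hC, h1⟩ := exists_abs_transport_terms_le d (k + 2) (2 * t) |ρ|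
  have h := hasDerivAt_tsum_of_isPreconnected (𝕜 := ℝ)
    (u := fun n => ((t ^ 2)⁻¹ * C) * (|amp n e f| * (1 / 6) ^ n.natAbs))
    (g := fun (n : ℤ) y => amp n e f * gaussProfile k y (ρ - n))
    (g' := fun (n : ℤ) y => (4 * y ^ 2)⁻¹ * (amp n e f * gaussProfile (k + 2) y (ρ - n)))
    (t := Ioo (t / 2) (2 * t))
    ((summable_ampWeight_terms e f).mul_left _) isOpen_Ioo
    isPreconnected_Ioo ?_ ?_ (y₀ := t) ⟨by linarith, by linarith⟩
    (summable_transport k ht e f ρ) (y := t) ⟨by linarith, by linarith⟩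
  · convert! h using 1
    rw [tsum_mul_left]
    rfl
  · intro n y hy
    have hy0 : 0 < y := by linarith [hy.1]
    have := (hasDerivAt_gaussProfile_time k hy0 (ρ - n)).const_mul (amp n e f)
    convert! this using 1
    ring
  · intro n y hy
    have hy0 : 0 < y := by linarith [hy.1]
    rw [norm_mul, Real.norm_eq_abs, Real.norm_eq_abs,
      abs_of_pos (by positivity : (0 : ℝ) < (4 * y ^ 2)⁻¹), mul_assoc]
    gcongr
    · nlinarith [hy.1]
    · exact h1 y hy0 hy.2.le e f ρ le_rfl n

theorem continuousOn_transport [NeZero d] (k : ℕ) (e f : DirEdge d) :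
    ContinuousOn (fun q : ℝ × ℝ => transport k q.1 e f q.2) (Ioi 0 ×ˢ univ) := by
  intro q hq
  have hq0 : (0 : ℝ) < q.1 := hq.1
  obtain ⟨C, hC, h⟩ := exists_abs_transport_terms_le d k (q.1 + 1) (|q.2| + 1)
  have hc : ContinuousOn (fun q : ℝ × ℝ => transport k q.1 e f q.2)
      (Ioo 0 (q.1 + 1) ×ˢ Metric.ball q.2 1) := by
    refine continuousOn_tsum (u := fun n : ℤ => C * (|amp n e f| * (1 / 6) ^ n.natAbs))
      (fun n => ?_) ((summable_ampWeight_terms e f).mul_left C) ?_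
    · refine continuousOn_const.mul ((continuousOn_gaussProfile k).comp
        (f := fun q : ℝ × ℝ => (q.1, q.2 - n)) (by fun_prop) ?_)
      rintro ⟨a, b⟩ ⟨ha, -⟩
      exact ⟨ha.1, mem_univ _⟩
    · rintro n ⟨a, b⟩ ⟨ha, hb⟩
      refine h a ha.1 ha.2.le e f b ?_ n
      rw [Metric.mem_ball, Real.dist_eq] at hb
      have := abs_sub_abs_le_abs_sub b q.2
      linarith
  refine (hc.continuousAt ?_).continuousWithinAt
  exact (isOpen_Ioo.prod Metric.isOpen_ball).mem_nhds
    ⟨⟨hq0, by simp⟩, Metric.mem_ball_self one_pos⟩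

/-- A shift by one in the coordinate is one more passage through a vertex. -/
theorem transport_add_one [NeZero d] (k : ℕ) {t : ℝ} (ht : 0 < t) (e f : DirEdge d) (ρ : ℝ) :
    transport k t e f (ρ + 1) =
      (d : ℝ)⁻¹ * ∑ b, transport k t (target e, b) f ρ - transport k t (reverse e) f ρ := by
  have h1 : transport k t e f (ρ + 1) = ∑' n : ℤ, amp (n + 1) e f * gaussProfile k t (ρ - n) := by
    rw [transport, ← (Equiv.addRight (1 : ℤ)).tsum_eq]
    refine tsum_congr fun n => ?_
    simp [add_sub_add_right_eq_sub]
  rw [h1]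
  simp only [transport]
  rw [← Summable.tsum_finsetSum (fun b _ => summable_transport k ht (target e, b) f ρ),
    ← tsum_mul_left, ← Summable.tsum_sub _ (summable_transport k ht (reverse e) f ρ)]
  · refine tsum_congr fun n => ?_
    rw [amp_add_one, scatter, sub_mul, mul_assoc, Finset.sum_mul]
  · exact (summable_sum fun b _ => summable_transport k ht (target e, b) f ρ).mul_left _

theorem transport_zero_reverse (t : ℝ) (e f : DirEdge d) (ρ : ℝ) :
    transport 0 t (reverse e) f ρ = transport 0 t e (reverse f) (-ρ) := by
  rw [transport, transport, ← (Equiv.neg ℤ).tsum_eq]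
  refine tsum_congr fun n => ?_
  simp only [Equiv.neg_apply, Int.cast_neg, amp_neg, reverse_reverse]
  rw [← gaussProfile_zero_neg]
  ring_nf

theorem transport_zero_comm (t : ℝ) (e f : DirEdge d) (ρ : ℝ) :
    transport 0 t e f ρ = transport 0 t f e (-ρ) := by
  rw [transport, transport, ← (Equiv.neg ℤ).tsum_eq]
  refine tsum_congr fun n => ?_
  simp only [Equiv.neg_apply, Int.cast_neg]
  rw [amp_neg, ← amp_symm, ← gaussProfile_zero_neg]
  ring_nf

/-- The superposition, at the point of `e` with the coordinate `r`, of the profiles that start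
from the point of `f` with the coordinate `s` in both directions. -/
def sourceSum (k : ℕ) (t : ℝ) (e : DirEdge d) (r : ℝ) (f : DirEdge d) (s : ℝ) : ℝ :=
  transport k t e f (r - s) + transport k t e (reverse f) (r + s - 1)

theorem sourceSum_reverse_right (k : ℕ) (t : ℝ) (e : DirEdge d) (r : ℝ) (f : DirEdge d) (s : ℝ) :
    sourceSum k t e r (reverse f) (1 - s) = sourceSum k t e r f s := by
  rw [sourceSum, sourceSum, reverse_reverse, add_comm]
  ring_nf

theorem sourceSum_zero_comm (t : ℝ) (e : DirEdge d) (r : ℝ) (f : DirEdge d) (s : ℝ) :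
    sourceSum 0 t e r f s = sourceSum 0 t f s e r := by
  rw [sourceSum, sourceSum, transport_zero_comm t e f, transport_zero_comm t e (reverse f),
    transport_zero_reverse]
  ring_nf

/-- The shift relation is the recursion of the scattering amplitudes, and the reversal relation is
`amp_neg` together with the evenness of the Gaussian function. -/
theorem isUnfolded_sourceSum [NeZero d] {t : ℝ} (ht : 0 < t) (f : DirEdge d) (s : ℝ) :
    IsUnfolded (fun e r => sourceSum 0 t e r f s) where
  reverse e r := by
    rw [sourceSum_zero_comm, sourceSum_zero_comm t e, ← sourceSum_reverse_right,
      reverse_reverse]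
  shift e r := by
    simp only [sourceSum]
    rw [show r + 1 - s = r - s + 1 by ring, show r + 1 + s - 1 = r + s - 1 + 1 by ring,
      transport_add_one 0 ht, transport_add_one 0 ht, Finset.sum_add_distrib, smul_eq_mul]
    ring

theorem hasDerivAt_sourceSum [NeZero d] (k : ℕ) {t : ℝ} (ht : 0 < t) (e : DirEdge d) (r : ℝ)
    (f : DirEdge d) (s : ℝ) :
    HasDerivAt (fun r => sourceSum k t e r f s)
      (k * sourceSum (k - 1) t e r f s - (2 * t)⁻¹ * sourceSum (k + 1) t e r f s) r := by
  have h1 := (hasDerivAt_transport k ht e f (r - s)).comp_sub_const r s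
  have h2 := (hasDerivAt_transport k ht e (reverse f) (r + s - 1))
  rw [show r + s - 1 = r - (1 - s) by ring] at h2
  have h3 := h1.add (h2.comp_sub_const r (1 - s))
  convert! h3 using 1
  · funext r
    simp only [sourceSum, Pi.add_apply]
    ring_nf
  · simp only [sourceSum]
    rw [show r + s - 1 = r - (1 - s) by ring]
    ring

theorem hasDerivAt_sourceSum_time [NeZero d] (k : ℕ) {t : ℝ} (ht : 0 < t) (e : DirEdge d) (r : ℝ)
    (f : DirEdge d) (s : ℝ) :
    HasDerivAt (fun t => sourceSum k t e r f s) ((4 * t ^ 2)⁻¹ * sourceSum (k + 2) t e r f s) t := by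
  have h3 := (hasDerivAt_transport_time k ht e f (r - s)).add
    (hasDerivAt_transport_time k ht e (reverse f) (r + s - 1))
  convert! h3 using 1
  simp only [sourceSum]
  ring

/-- A majorant for the sources on `f` seen on `e`, for both directions on `f`. -/
def edgeWeight (e f : DirEdge d) : ℝ := ampWeight e f + ampWeight e (reverse f)

theorem edgeWeight_nonneg (e f : DirEdge d) : 0 ≤ edgeWeight e f :=
  add_nonneg (ampWeight_nonneg _ _) (ampWeight_nonneg _ _)

theorem exists_edgeWeight_le (d : ℕ) [NeZero d] : ∃ C, 0 < C ∧ ∀ e f : DirEdge d, edgeWeight e f ≤ C := by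
  refine ⟨2 * ∑' n : ℤ, (1 / 2 : ℝ) ^ n.natAbs + 1, ?_, fun e f => ?_⟩
  · have : 0 ≤ ∑' n : ℤ, (1 / 2 : ℝ) ^ n.natAbs := tsum_nonneg fun _ => by positivity
    positivity
  · have h1 := ampWeight_le e f
    have h2 := ampWeight_le e (reverse f)
    rw [edgeWeight]
    linarith

theorem summable_edgeWeight [NeZero d] (e : DirEdge d) : Summable (edgeWeight e) :=
  (summable_ampWeight e).add ((summable_ampWeight e).comp_injective reverse_injective)

theorem exists_abs_sourceSum_le (d : ℕ) [NeZero d] (k : ℕ) (b R : ℝ) :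
    ∃ C, 0 < C ∧ ∀ t, 0 < t → t ≤ b → ∀ (e f : DirEdge d) (r : ℝ), |r| ≤ R →
      ∀ s ∈ Icc (0 : ℝ) 1, |sourceSum k t e r f s| ≤ C * edgeWeight e f := by
  obtain ⟨C, hC, h⟩ := exists_abs_transport_le d k b (R + 1)
  refine ⟨C, hC, fun t ht htb e f r hr s hs => ?_⟩
  rw [sourceSum, edgeWeight, mul_add]
  refine (abs_add_le _ _).trans (add_le_add (h t ht htb _ _ _ ?_) (h t ht htb _ _ _ ?_))
  · rw [abs_le] at hr ⊢; constructor <;> linarith [hs.1, hs.2]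
  · rw [abs_le] at hr ⊢; constructor <;> linarith [hs.1, hs.2]

theorem continuousOn_sourceSum [NeZero d] (k : ℕ) (e f : DirEdge d) :
    ContinuousOn (fun q : ℝ × ℝ × ℝ => sourceSum k q.1 e q.2.1 f q.2.2) (Ioi 0 ×ˢ univ) := by
  refine ContinuousOn.add ?_ ?_
  · refine (continuousOn_transport k e f).comp (f := fun q : ℝ × ℝ × ℝ => (q.1, q.2.1 - q.2.2))
      (by fun_prop) fun q hq => ⟨hq.1, mem_univ _⟩
  · refine (continuousOn_transport k e (reverse f)).comp
      (f := fun q : ℝ × ℝ × ℝ => (q.1, q.2.1 + q.2.2 - 1)) (by fun_prop) fun q hq => ⟨hq.1, mem_univ _⟩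

/-- The heat kernel of the line. -/
def heatLine (t x : ℝ) : ℝ := heatNorm t * gaussProfile 0 t x

/-- The Chapman–Kolmogorov equation on the line. -/
theorem integral_heatLine_mul {s t : ℝ} (hs : 0 < s) (ht : 0 < t) (x y : ℝ) :
    Integrable (fun z => heatLine s (x - z) * heatLine t (z - y)) ∧
      ∫ z, heatLine s (x - z) * heatLine t (z - y) = heatLine (s + t) (x - y) := by
  have hst : 0 < s + t := by positivity
  have hb : 0 < (s + t) / (4 * s * t) := by positivity
  have key : ∀ z, heatLine s (x - z) * heatLine t (z - y) =
      (heatNorm s * heatNorm t * Real.exp (-(x - y) ^ 2 / (4 * (s + t)))) *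
        Real.exp (-((s + t) / (4 * s * t)) * (z - (t * x + s * y) / (s + t)) ^ 2) := by
    intro z
    simp only [heatLine, gaussProfile_zero]
    rw [mul_mul_mul_comm, ← Real.exp_add, mul_assoc (heatNorm s * heatNorm t), ← Real.exp_add]
    congr 2
    field_simp
    ring
  simp only [key]
  have hi : Integrable fun z : ℝ => Real.exp (-((s + t) / (4 * s * t)) * z ^ 2) :=
    integrable_exp_neg_mul_sq hb
  refine ⟨(hi.comp_sub_right _).const_mul _, ?_⟩
  rw [integral_const_mul, integral_sub_right_eq_self
    (fun z : ℝ => Real.exp (-((s + t) / (4 * s * t)) * z ^ 2)), integral_gaussian, heatLine,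
    gaussProfile_zero]
  rw [mul_right_comm]
  congr 1
  unfold heatNorm
  rw [← mul_inv, ← Real.sqrt_mul (by positivity), inv_mul_eq_div, ← Real.sqrt_div (by positivity),
    ← Real.sqrt_inv]
  congr 1
  field_simp

theorem integrable_heatLine {t : ℝ} (ht : 0 < t) : Integrable (heatLine t) := by
  have h : heatLine t = fun x => heatNorm t * Real.exp (-(4 * t)⁻¹ * x ^ 2) := by
    funext x
    rw [heatLine, gaussProfile_zero]
    congr 2
    field_simp
  rw [h]
  exact (integrable_exp_neg_mul_sq (by positivity)).const_mul _

theorem integral_heatLine {t : ℝ} (ht : 0 < t) : ∫ x, heatLine t x = 1 := by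
  have h : heatLine t = fun x => heatNorm t * Real.exp (-(4 * t)⁻¹ * x ^ 2) := by
    funext x
    rw [heatLine, gaussProfile_zero]
    congr 2
    field_simp
  rw [h, integral_const_mul, integral_gaussian, heatNorm, inv_mul_eq_one₀ (by positivity)]
  congr 1
  field_simp

/-! ### Coordinates on the graph -/

/-- The edge `(z, i)`, directed from `z` to `z + e_i`. -/
def forward (ε : (Fin d → ℤ) × Fin d) : DirEdge d := (ε.1, ε.2, true)

/-- The point of the directed edge `e` at the distance `r` from its origin. -/
def point (e : DirEdge d) (r : ℝ) : LatticeGraph d :=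
  if e.2.2 then edge e.1 e.2.1 r else edge (e.1 - Pi.single e.2.1 1) e.2.1 (1 - r)

theorem point_forward (ε : (Fin d → ℤ) × Fin d) (r : ℝ) :
    point (forward ε) r = edge ε.1 ε.2 r := by simp [point, forward]

theorem edge_apply (z : Fin d → ℤ) (i : Fin d) (s : ℝ) (j : Fin d) :
    (edge z i s).1 j = z j + if j = i then s else 0 := rfl

theorem target_forward (ε : (Fin d → ℤ) × Fin d) :
    target (forward ε) = ε.1 + Pi.single ε.2 1 := by simp [forward, target, step]

theorem point_reverse (e : DirEdge d) (r : ℝ) : point (reverse e) r = point e (1 - r) := by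
  obtain ⟨v, i, b⟩ := e
  cases b
  · simp [point, reverse, target, step, Pi.single_neg, sub_eq_add_neg]
  · simp [point, reverse, target, step]

theorem eq_forward_or (e : DirEdge d) : ∃ ε, e = forward ε ∨ e = reverse (forward ε) := by
  obtain ⟨v, i, b⟩ := e
  cases b
  · refine ⟨(v - Pi.single i 1, i), Or.inr ?_⟩
    simp [forward, reverse, target, step]
  · exact ⟨(v, i), Or.inl rfl⟩

theorem point_zero_apply (e : DirEdge d) (j : Fin d) : (point e 0).1 j = e.1 j := by
  obtain ⟨v, i, b⟩ := e
  cases b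
  · by_cases h : j = i <;> simp [point, edge_apply, h]
  · simp [point, edge_apply]

theorem point_zero_eq (v : Fin d → ℤ) (a b : Fin d × Bool) :
    point (v, a) 0 = point (v, b) 0 := by
  ext j
  simp [point_zero_apply]

theorem dist_edge (z : Fin d → ℤ) (i : Fin d) (r s : ℝ) :
    dist (edge z i r) (edge z i s) = |r - s| := by
  rw [Subtype.dist_eq, EuclideanSpace.dist_eq, Finset.sum_eq_single i]
  · rw [Real.sqrt_sq dist_nonneg]
    simp [edge_apply, Real.dist_eq]
  · intro j _ hj
    simp [edge_apply, hj]
  · simp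

theorem dist_point (e : DirEdge d) (r s : ℝ) : dist (point e r) (point e s) = |r - s| := by
  obtain ⟨v, i, b⟩ := e
  cases b
  · simp only [point, Bool.false_eq_true, if_false, dist_edge]
    rw [abs_sub_comm]
    ring_nf
  · simp only [point, if_true, dist_edge]

/-- A family of functions of the coordinates on the directed edges is compatible if it comes from
a function on the graph: both orientations of an edge give the same values, and the values at a
common vertex agree. -/
structure IsCompatible {V : Type*} (h : DirEdge d → ℝ → V) : Prop where
  reverse : ∀ e s, h (reverse e) s = h e (1 - s)
  vertex : ∀ v a b, h (v, a) 0 = h (v, b) 0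

/-- The shift relation contains the continuity at the vertices. -/
theorem IsUnfolded.isCompatible [NeZero d] {V : Type*} [AddCommGroup V] [Module ℝ V]
    {h : DirEdge d → ℝ → V} (hh : IsUnfolded h) : IsCompatible h where
  reverse := hh.reverse
  vertex v := by
    -- at the target of an edge, the shift relation expresses the value by the vertex alone
    have key : ∀ a, (2 : ℝ) • h (v, a) 0 = (d : ℝ)⁻¹ • ∑ b, h (v, b) 0 := by
      intro a
      have h1 := hh.shift (DirEdge.reverse (v, a)) 0
      rw [hh.reverse, reverse_reverse, target_reverse] at h1
      rw [two_smul]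
      nth_rewrite 1 [show (0 : ℝ) = 1 - (0 + 1) by ring]
      rw [h1]
      abel
    intro a b
    have h2 : (2 : ℝ) • h (v, a) 0 = (2 : ℝ) • h (v, b) 0 := (key a).trans (key b).symm
    simpa using congrArg (fun x => (2⁻¹ : ℝ) • x) h2

/-- The edge on which a point lies, by choice at the vertices. -/
def coordEdge (x : LatticeGraph d) : (Fin d → ℤ) × Fin d :=
  ((exists_eq_edge x).choose, (exists_eq_edge x).choose_spec.choose)

/-- The coordinate of a point on its edge. -/
def coord (x : LatticeGraph d) : ℝ := (exists_eq_edge x).choose_spec.choose_spec.choose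

theorem coord_mem (x : LatticeGraph d) : coord x ∈ Icc (0 : ℝ) 1 :=
  (exists_eq_edge x).choose_spec.choose_spec.choose_spec.1

theorem edge_coord (x : LatticeGraph d) : edge (coordEdge x).1 (coordEdge x).2 (coord x) = x :=
  (exists_eq_edge x).choose_spec.choose_spec.choose_spec.2.symm

theorem point_coord (x : LatticeGraph d) : point (forward (coordEdge x)) (coord x) = x := by
  rw [point_forward, edge_coord]

/-- The value at an end of an edge depends on the vertex alone, which is recovered from the point by
rounding down its integer coordinates. -/
theorem IsCompatible.vertex_value {V : Type*} {h : DirEdge d → ℝ → V} (hh : IsCompatible h)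
    (z : Fin d → ℤ) (i : Fin d) {s : ℝ} (hs : s = 0 ∨ s = 1) (a : Fin d × Bool) :
    h (z, i, true) s = h (fun j => ⌊(edge z i s).1 j⌋, a) 0 := by
  rcases hs with rfl | rfl
  · have : (fun j => ⌊(edge z i 0).1 j⌋) = z := by
      funext j
      simp [edge_apply]
    rw [this]
    exact hh.vertex _ _ _
  · have : (fun j => ⌊(edge z i 1).1 j⌋) = target (forward (z, i)) := by
      funext j
      by_cases hj : j = i <;> simp [edge_apply, target_forward, hj]
    rw [this]
    have h1 := hh.reverse (forward (z, i)) 0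
    rw [sub_zero] at h1
    exact h1.symm.trans (hh.vertex _ _ _)

/-- Two representations of a point either coincide, if the point is inside an edge, or both give a
vertex. -/
theorem IsCompatible.eq_of_edge_eq {V : Type*} {h : DirEdge d → ℝ → V} (hh : IsCompatible h)
    {z z' : Fin d → ℤ} {i i' : Fin d} {s s' : ℝ} (hs : s ∈ Icc (0 : ℝ) 1) (hs' : s' ∈ Icc (0 : ℝ) 1)
    (heq : edge z i s = edge z' i' s') : h (z, i, true) s = h (z', i', true) s' := by
  have key : ∀ {z z' : Fin d → ℤ} {i i' : Fin d} {s s' : ℝ}, s ∈ Ioo (0 : ℝ) 1 →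
      s' ∈ Icc (0 : ℝ) 1 → edge z i s = edge z' i' s' → z = z' ∧ i = i' ∧ s = s' := by
    intro z z' i i' s s' hs hs' heq
    have hc : ∀ j, (z j : ℝ) + (if j = i then s else 0) = z' j + if j = i' then s' else 0 :=
      fun j => by rw [← edge_apply, ← edge_apply, heq]
    have hii : i = i' := by
      by_contra hne
      have h1 := hc i
      simp only [if_true, hne, if_false, add_zero] at h1
      have h2 : (0 : ℝ) < ((z' i - z i : ℤ) : ℝ) := by push_cast; linarith [hs.1]
      have h3 : ((z' i - z i : ℤ) : ℝ) < 1 := by push_cast; linarith [hs.2]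
      have h4 : (0 : ℤ) < z' i - z i := by exact_mod_cast h2
      have h5 : z' i - z i < (1 : ℤ) := by exact_mod_cast h3
      omega
    subst hii
    have hz : z = z' := by
      funext j
      have h1 := hc j
      by_cases hj : j = i
      · simp only [hj, if_true] at h1 ⊢
        have h2 : (-1 : ℝ) < ((z' i - z i : ℤ) : ℝ) := by push_cast; linarith [hs.1, hs'.2]
        have h3 : ((z' i - z i : ℤ) : ℝ) < 1 := by push_cast; linarith [hs.2, hs'.1]
        have h4 : (-1 : ℤ) < z' i - z i := by exact_mod_cast h2
        have h5 : z' i - z i < (1 : ℤ) := by exact_mod_cast h3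
        omega
      · simpa [hj] using h1
    subst hz
    exact ⟨rfl, rfl, by simpa using hc i⟩
  have hend : ∀ {s : ℝ}, s ∈ Icc (0 : ℝ) 1 → s ∉ Ioo (0 : ℝ) 1 → s = 0 ∨ s = 1 := by
    intro s h1 h2
    by_contra! h3
    exact h2 ⟨lt_of_le_of_ne h1.1 h3.1.symm, lt_of_le_of_ne h1.2 h3.2⟩
  by_cases h1 : s ∈ Ioo (0 : ℝ) 1
  · obtain ⟨rfl, rfl, rfl⟩ := key h1 hs' heq
    rfl
  by_cases h2 : s' ∈ Ioo (0 : ℝ) 1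
  · obtain ⟨rfl, rfl, rfl⟩ := key h2 hs heq.symm
    rfl
  rw [hh.vertex_value z i (hend hs h1) (i, true), heq,
    ← hh.vertex_value z' i' (hend hs' h2) (i, true)]

/-- The function on the graph that is described by a compatible family. By `glue_edge` the choice
in `coordEdge` and `coord` does not matter. -/
def glue {V : Type*} (h : DirEdge d → ℝ → V) (x : LatticeGraph d) : V :=
  h (forward (coordEdge x)) (coord x)

theorem IsCompatible.glue_edge {V : Type*} {h : DirEdge d → ℝ → V} (hh : IsCompatible h)
    (z : Fin d → ℤ) (i : Fin d) {s : ℝ} (hs : s ∈ Icc (0 : ℝ) 1) :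
    glue h (edge z i s) = h (z, i, true) s :=
  hh.eq_of_edge_eq (coord_mem _) hs (edge_coord _)

theorem IsCompatible.glue_point {V : Type*} {h : DirEdge d → ℝ → V} (hh : IsCompatible h)
    (e : DirEdge d) {s : ℝ} (hs : s ∈ Icc (0 : ℝ) 1) : glue h (point e s) = h e s := by
  obtain ⟨ε, rfl | rfl⟩ := eq_forward_or e
  · rw [point_forward]
    exact hh.glue_edge _ _ hs
  · rw [point_reverse, point_forward, hh.glue_edge _ _ ⟨by linarith [hs.2], by linarith [hs.1]⟩,
      hh.reverse]
    rfl

theorem exists_eq_point (x : LatticeGraph d) : ∃ e, ∃ s ∈ Icc (0 : ℝ) 1, x = point e s :=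
  ⟨_, _, coord_mem x, (point_coord x).symm⟩

/-! ### Topology and measure -/

theorem isClosed_range : IsClosed
    {x : EuclideanSpace ℝ (Fin d) | ∃ i, ∀ j, j ≠ i → ∃ n : ℤ, x j = n} := by
  have : {x : EuclideanSpace ℝ (Fin d) | ∃ i, ∀ j, j ≠ i → ∃ n : ℤ, x j = n} =
      ⋃ i, ⋂ j, ⋂ (_ : j ≠ i), (fun x : EuclideanSpace ℝ (Fin d) => x j) ⁻¹' range Int.cast := by
    ext x
    simp [eq_comm]
  rw [this]
  refine isClosed_iUnion_of_finite fun i => isClosed_iInter fun j => isClosed_iInter fun _ => ?_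
  exact Int.isClosedEmbedding_coe_real.isClosed_range.preimage (by fun_prop)

theorem isClosedEmbedding_val : IsClosedEmbedding (Subtype.val : LatticeGraph d → _) :=
  isClosed_range.isClosedEmbedding_subtypeVal

instance : CompleteSpace (LatticeGraph d) := isClosed_range.completeSpace_coe

instance : ProperSpace (LatticeGraph d) :=
  ⟨fun x r => by
    have := isClosedEmbedding_val.isCompact_preimage (isCompact_closedBall (x : EuclideanSpace ℝ (Fin d)) r)
    exact this⟩

/-- The parametrization of the graph by its edges. -/
def edgeMap (d : ℕ) (w : ((Fin d → ℤ) × Fin d) × ℝ) : LatticeGraph d := edge w.1.1 w.1.2 w.2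

theorem continuous_edgeMap : Continuous (edgeMap d) :=
  continuous_prod_of_discrete_left.2 fun ε => continuous_edge ε.1 ε.2

theorem measurable_edgeMap : Measurable (edgeMap d) :=
  measurable_from_prod_countable_right fun ε => (continuous_edge ε.1 ε.2).measurable

/-- Length on the disjoint union of the edges. -/
def edgeMeasure (d : ℕ) : Measure (((Fin d → ℤ) × Fin d) × ℝ) :=
  (Measure.count : Measure ((Fin d → ℤ) × Fin d)).prod (volume.restrict (Icc (0 : ℝ) 1))

theorem length_eq_map : length d = (edgeMeasure d).map (edgeMap d) := by
  rw [edgeMeasure, Measure.count, Measure.prod_sum_left,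
    Measure.map_sum measurable_edgeMap.aemeasurable, length]
  congr 1
  funext ε
  rw [Measure.dirac_prod, Measure.map_map measurable_edgeMap (by fun_prop)]
  rfl

/-- A bounded set meets only finitely many edges. -/
theorem isProperMap_edge : IsProperMap
    (fun w : ((Fin d → ℤ) × Fin d) × Icc (0 : ℝ) 1 => edgeMap d (w.1, w.2)) := by
  have hc : Continuous (fun w : ((Fin d → ℤ) × Fin d) × Icc (0 : ℝ) 1 => edgeMap d (w.1, w.2)) :=
    continuous_edgeMap.comp (by fun_prop)
  rw [isProperMap_iff_isCompact_preimage]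
  refine ⟨hc, fun K hK => ?_⟩
  obtain ⟨R, hR⟩ := (hK.image isClosedEmbedding_val.continuous).isBounded.exists_norm_le
  have hfin : {z : Fin d → ℤ | ∀ j, |z j| ≤ ⌈R⌉ + 1}.Finite := by
    simp only [abs_le]
    exact Set.Finite.pi' fun _ => Set.finite_Icc _ _
  refine IsCompact.of_isClosed_subset
    (((hfin.prod (finite_univ (α := Fin d))).isCompact).prod isCompact_univ)
    (hK.isClosed.preimage hc) ?_
  rintro ⟨⟨z, i⟩, s⟩ hw
  refine ⟨⟨fun j => ?_, mem_univ _⟩, mem_univ _⟩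
  have h1 := hR _ (mem_image_of_mem _ hw)
  have h2 := (PiLp.norm_apply_le (p := 2) (edge z i s).1 j).trans h1
  rw [edge_apply, Real.norm_eq_abs] at h2
  have h3 : |(if j = i then (s : ℝ) else 0)| ≤ 1 := by
    split_ifs
    · rw [abs_of_nonneg s.2.1]; exact s.2.2
    · simp
  have h4 : |(z j : ℝ)| ≤ R + 1 := by
    have := abs_sub_abs_le_abs_sub (z j : ℝ) (-(if j = i then (s : ℝ) else 0))
    rw [abs_neg, sub_neg_eq_add] at this
    linarith
  have h5 : ((|z j| : ℤ) : ℝ) ≤ ((⌈R⌉ + 1 : ℤ) : ℝ) := by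
    push_cast; linarith [Int.le_ceil R]
  exact_mod_cast h5

theorem surjective_edge : Function.Surjective
    (fun w : ((Fin d → ℤ) × Fin d) × Icc (0 : ℝ) 1 => edgeMap d (w.1, w.2)) :=
  fun x => ⟨(coordEdge x, ⟨coord x, coord_mem x⟩), edge_coord x⟩

/-- The topology of the graph is that of the edges glued at the vertices. -/
theorem isQuotientMap_edge : IsQuotientMap
    (fun w : ((Fin d → ℤ) × Fin d) × Icc (0 : ℝ) 1 => edgeMap d (w.1, w.2)) :=
  isProperMap_edge.isClosedMap.isQuotientMap isProperMap_edge.continuous surjective_edge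

/-- A function on the graph is continuous if it is continuous on every closed edge. -/
theorem continuous_of_edge {V : Type*} [TopologicalSpace V] {φ : LatticeGraph d → V}
    (h : ∀ z i, ContinuousOn (fun s => φ (edge z i s)) (Icc 0 1)) : Continuous φ := by
  rw [isQuotientMap_edge.continuous_iff]
  refine continuous_prod_of_discrete_left.2 fun ε => ?_
  exact (h ε.1 ε.2).domRestrict

instance : IsFiniteMeasureOnCompacts (length d) where
  lt_top_of_isCompact K hK := by
    have h1 := ((isProperMap_iff_isCompact_preimage.1 isProperMap_edge).2 hK).image continuous_fst
    rw [length_eq_map, Measure.map_apply measurable_edgeMap hK.measurableSet]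
    have h2 : edgeMap d ⁻¹' K ∩ univ ×ˢ Icc 0 1 ⊆
        (Prod.fst '' ((fun w : ((Fin d → ℤ) × Fin d) × Icc (0 : ℝ) 1 =>
          edgeMap d (w.1, w.2)) ⁻¹' K)) ×ˢ univ := by
      rintro ⟨ε, s⟩ ⟨h1, -, h2⟩
      exact ⟨⟨(ε, ⟨s, h2⟩), h1, rfl⟩, mem_univ _⟩
    have h3 : edgeMeasure d (edgeMap d ⁻¹' K) =
        edgeMeasure d (edgeMap d ⁻¹' K ∩ univ ×ˢ Icc 0 1) := by
      rw [edgeMeasure, ← Measure.restrict_univ (μ := (Measure.count : Measure ((Fin d → ℤ) × Fin d))),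
        Measure.prod_restrict, Measure.restrict_apply (measurable_edgeMap hK.measurableSet),
        Measure.restrict_apply (measurable_edgeMap hK.measurableSet |>.inter
          (MeasurableSet.univ.prod measurableSet_Icc)), inter_assoc, inter_self]
    rw [h3]
    refine (measure_mono h2).trans_lt ?_
    rw [edgeMeasure, Measure.prod_prod]
    refine ENNReal.mul_lt_top ?_ (by simp)
    exact Measure.count_apply_lt_top.2 (isCompact_iff_finite.1 h1)

instance : SigmaFinite (length d) := inferInstance

instance : (length d).IsOpenPosMeasure where
  open_pos U hU hne := by
    obtain ⟨x, hx⟩ := hne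
    obtain ⟨z, i, s, hs, rfl⟩ := exists_eq_edge x
    have h1 : IsOpen (edge z i ⁻¹' U) := hU.preimage (continuous_edge z i)
    have h2 : (edge z i ⁻¹' U ∩ Ioo 0 1).Nonempty := by
      have : s ∈ closure (Ioo (0 : ℝ) 1) := by rwa [closure_Ioo (by norm_num)]
      exact mem_closure_iff.1 this _ h1 hx
    have h3 := (h1.inter isOpen_Ioo).measure_pos volume h2
    have h4 : Measure.map (edge z i) (volume.restrict (Icc (0 : ℝ) 1)) ≤ length d :=
      Measure.le_sum (fun e : (Fin d → ℤ) × Fin d =>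
        Measure.map (edge e.1 e.2) (volume.restrict (Icc (0 : ℝ) 1))) (z, i)
    refine ne_of_gt (lt_of_lt_of_le h3 (le_trans ?_ (h4 U)))
    rw [Measure.map_apply (continuous_edge z i).measurable hU.measurableSet,
      Measure.restrict_apply h1.measurableSet]
    exact measure_mono (inter_subset_inter_right _ Ioo_subset_Icc_self)

/-- Integrals over the graph in coordinates. -/
theorem integrable_iff_edge {V : Type*} [NormedAddCommGroup V] {φ : LatticeGraph d → V}
    (hφ : AEStronglyMeasurable φ (length d)) :
    Integrable φ (length d) ↔ Integrable (fun w => φ (edgeMap d w)) (edgeMeasure d) := by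
  rw [length_eq_map] at hφ ⊢
  exact integrable_map_measure hφ measurable_edgeMap.aemeasurable

theorem integral_eq_edge {V : Type*} [NormedAddCommGroup V] [NormedSpace ℝ V]
    {φ : LatticeGraph d → V} (hφ : AEStronglyMeasurable φ (length d)) :
    ∫ x, φ x ∂(length d) = ∫ w, φ (edgeMap d w) ∂(edgeMeasure d) := by
  rw [length_eq_map] at hφ ⊢
  exact integral_map measurable_edgeMap.aemeasurable hφ

theorem ae_edgeMeasure_mem : ∀ᵐ w ∂(edgeMeasure d), w.2 ∈ Icc (0 : ℝ) 1 := by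
  have : (edgeMeasure d) = (edgeMeasure d).restrict (univ ×ˢ Icc 0 1) := by
    conv_lhs => rw [edgeMeasure, ← Measure.restrict_univ (μ := (Measure.count : Measure ((Fin d → ℤ) × Fin d)))]
    conv_rhs => rw [edgeMeasure, ← Measure.prod_restrict, Measure.restrict_restrict measurableSet_Icc, inter_self]
  rw [this]
  filter_upwards [ae_restrict_mem (MeasurableSet.univ.prod measurableSet_Icc)] with w hw
  exact hw.2

/-! ### The heat kernel of the graph -/

/-- Every directed edge is an edge with an orientation. -/
def orient : (((Fin d → ℤ) × Fin d) × Bool) ≃ DirEdge d where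
  toFun q := if q.2 then forward q.1 else reverse (forward q.1)
  invFun e := ((if e.2.2 then e.1 else e.1 - Pi.single e.2.1 1, e.2.1), e.2.2)
  left_inv := by
    rintro ⟨⟨z, i⟩, b⟩
    cases b <;> simp [forward, reverse, target, step]
  right_inv := by
    rintro ⟨v, i, b⟩
    cases b <;> simp [forward, reverse, target, step]

theorem hasSum_orient {V : Type*} [AddCommMonoid V] [TopologicalSpace V] [ContinuousAdd V]
    [RegularSpace V] {I : DirEdge d → V} {S : V} (h : HasSum I S) :
    HasSum (fun ε => I (forward ε) + I (DirEdge.reverse (forward ε))) S := by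
  have h1 := (LatticeGraph.orient (d := d)).hasSum_iff.2 h
  refine h1.prod_fiberwise fun ε => ?_
  have h2 := hasSum_fintype fun b : Bool => (I ∘ LatticeGraph.orient) (ε, b)
  simpa [LatticeGraph.orient] using h2

theorem continuous_transport [NeZero d] (k : ℕ) {t : ℝ} (ht : 0 < t) (e f : DirEdge d) :
    Continuous (transport k t e f) :=
  continuous_iff_continuousAt.2 fun ρ => (hasDerivAt_transport k ht e f ρ).continuousAt

/-- The heat kernel of `Γ^d`: the sum over all paths from `y` to `x` of the heat kernel of the line
at the length of the path, multiplied by the scattering amplitude of the path. It is written in the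
chosen coordinates of `x` and `y`; by `heatKernel_point` any other coordinates give the same. -/
def heatKernel (t : ℝ) (x y : LatticeGraph d) : ℝ :=
  heatNorm t *
    sourceSum 0 t (forward (coordEdge x)) (coord x) (forward (coordEdge y)) (coord y)

theorem isCompatible_sourceSum [NeZero d] {t : ℝ} (ht : 0 < t) (f : DirEdge d) (s : ℝ) :
    IsCompatible (fun e r => sourceSum 0 t e r f s) := (isUnfolded_sourceSum ht f s).isCompatible

theorem heatKernel_symm (t : ℝ) (x y : LatticeGraph d) :
    heatKernel t x y = heatKernel t y x := by
  rw [heatKernel, heatKernel, sourceSum_zero_comm]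

theorem heatKernel_point_left [NeZero d] {t : ℝ} (ht : 0 < t) (e : DirEdge d) {r : ℝ}
    (hr : r ∈ Icc (0 : ℝ) 1) (y : LatticeGraph d) :
    heatKernel t (point e r) y =
      heatNorm t * sourceSum 0 t e r (forward (coordEdge y)) (coord y) := by
  rw [heatKernel]
  exact congrArg _ ((isCompatible_sourceSum ht _ _).glue_point e hr)

theorem heatKernel_point [NeZero d] {t : ℝ} (ht : 0 < t) (e f : DirEdge d) {r s : ℝ}
    (hr : r ∈ Icc (0 : ℝ) 1) (hs : s ∈ Icc (0 : ℝ) 1) :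
    heatKernel t (point e r) (point f s) = heatNorm t * sourceSum 0 t e r f s := by
  rw [heatKernel_point_left ht e hr, sourceSum_zero_comm, sourceSum_zero_comm t e]
  exact congrArg _ ((isCompatible_sourceSum ht _ _).glue_point f hs)

theorem heatKernel_edgeMap [NeZero d] {t : ℝ} (ht : 0 < t) (e : DirEdge d) {r : ℝ}
    (hr : r ∈ Icc (0 : ℝ) 1) {w : ((Fin d → ℤ) × Fin d) × ℝ} (hw : w.2 ∈ Icc (0 : ℝ) 1) :
    heatKernel t (point e r) (edgeMap d w) =
      heatNorm t * sourceSum 0 t e r (forward w.1) w.2 := by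
  rw [← heatKernel_point ht e (forward w.1) hr hw, point_forward, edgeMap]

theorem continuousOn_heatNorm : ContinuousOn heatNorm (Ioi 0) := by
  unfold heatNorm
  refine ContinuousOn.inv₀ (by fun_prop) fun t ht => ?_
  have : (0 : ℝ) < t := ht
  positivity

theorem continuousOn_heatKernel [NeZero d] :
    ContinuousOn (fun q : ℝ × LatticeGraph d × LatticeGraph d => heatKernel q.1 q.2.1 q.2.2)
      (Ioi 0 ×ˢ univ) := by
  -- on products of closed edges the kernel is a series; these products cover properly
  let Q : ((((Fin d → ℤ) × Fin d) × Icc (0 : ℝ) 1)) → LatticeGraph d := fun w => edgeMap d (w.1, w.2)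
  have hQ : IsProperMap (Prod.map (id : Ioi (0 : ℝ) → Ioi (0 : ℝ)) (Prod.map Q Q)) :=
    isProperMap_id.prodMap (isProperMap_edge.prodMap isProperMap_edge)
  have hQ' := hQ.isClosedMap.isQuotientMap hQ.continuous
    (Function.surjective_id.prodMap (surjective_edge.prodMap surjective_edge))
  have hc : Continuous fun q : Ioi (0 : ℝ) × LatticeGraph d × LatticeGraph d =>
      heatKernel (q.1 : ℝ) q.2.1 q.2.2 := by
    rw [hQ'.continuous_iff]
    have heq : ∀ q : Ioi (0 : ℝ) × (((Fin d → ℤ) × Fin d) × Icc (0 : ℝ) 1) ×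
        (((Fin d → ℤ) × Fin d) × Icc (0 : ℝ) 1),
        heatKernel (q.1 : ℝ) (Q q.2.1) (Q q.2.2) = heatNorm q.1 *
          sourceSum 0 q.1 (forward q.2.1.1) q.2.1.2 (forward q.2.2.1) q.2.2.2 := by
      rintro ⟨t, ⟨ε, r⟩, ⟨ε', r'⟩⟩
      rw [← heatKernel_point t.2 _ _ r.2 r'.2, point_forward, point_forward]
      rfl
    refine (continuous_congr heq).2 (Continuous.mul ?_ ?_)
    · exact (continuousOn_heatNorm.domRestrict).comp continuous_fst
    · -- the edges form discrete factors
      let g : (((Fin d → ℤ) × Fin d) × ((Fin d → ℤ) × Fin d)) × (Ioi (0 : ℝ) × Icc (0 : ℝ) 1 ×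
        Icc (0 : ℝ) 1) → ℝ := fun q =>
          sourceSum 0 (q.2.1 : ℝ) (forward q.1.1) q.2.2.1 (forward q.1.2) q.2.2.2
      have hg : Continuous g := by
        refine continuous_prod_of_discrete_left.2 fun ε => ?_
        exact (continuousOn_sourceSum 0 (forward ε.1) (forward ε.2)).comp_continuous
          (f := fun q : Ioi (0 : ℝ) × Icc (0 : ℝ) 1 × Icc (0 : ℝ) 1 => ((q.1 : ℝ), (q.2.1 : ℝ), (q.2.2 : ℝ)))
          (by fun_prop) fun q => ⟨q.1.2, mem_univ _⟩
      exact hg.comp (f := fun q : Ioi (0 : ℝ) × (((Fin d → ℤ) × Fin d) × Icc (0 : ℝ) 1) ×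
        (((Fin d → ℤ) × Fin d) × Icc (0 : ℝ) 1) => ((q.2.1.1, q.2.2.1), (q.1, q.2.1.2, q.2.2.2)))
        (by fun_prop)
  rw [continuousOn_iff_continuous_domRestrict]
  exact hc.comp (f := fun q : ((Ioi 0 ×ˢ univ : Set (ℝ × LatticeGraph d × LatticeGraph d))) =>
    ((⟨q.1.1, q.2.1⟩ : Ioi (0 : ℝ)), q.1.2.1, q.1.2.2)) (by fun_prop)

theorem continuous_heatKernel [NeZero d] {t : ℝ} (ht : 0 < t) :
    Continuous (fun q : LatticeGraph d × LatticeGraph d => heatKernel t q.1 q.2) :=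
  continuousOn_heatKernel.comp_continuous (f := fun q : LatticeGraph d × LatticeGraph d =>
    (t, q.1, q.2)) (by fun_prop) fun _ => ⟨ht, mem_univ _⟩

theorem continuous_heatKernel_right [NeZero d] {t : ℝ} (ht : 0 < t) (x : LatticeGraph d) :
    Continuous (heatKernel t x) :=
  (continuous_heatKernel ht).comp (f := fun y => (x, y)) (by fun_prop)

theorem integrable_edgeWeight [NeZero d] (e : DirEdge d) :
    Integrable (fun w => edgeWeight e (forward w.1)) (edgeMeasure d) := by
  refine Integrable.comp_fst (f := fun ε => edgeWeight e (forward ε)) ?_ _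
  rw [integrable_count_iff]
  refine ((summable_edgeWeight e).comp_injective (i := forward) ?_).norm
  rintro ⟨z, i⟩ ⟨z', i'⟩ h
  simpa [forward] using h

theorem integral_eq_sum_edge {V : Type*} [NormedAddCommGroup V] [NormedSpace ℝ V]
    {φ : LatticeGraph d → V} (hφ : Integrable φ (length d)) :
    HasSum (fun ε : (Fin d → ℤ) × Fin d => ∫ s in Icc (0 : ℝ) 1, φ (edge ε.1 ε.2 s))
      (∫ x, φ x ∂(length d)) := by
  have h := hasSum_integral_measure hφ
  convert! h using 2 with ε
  rw [integral_map (continuous_edge _ _).aemeasurable]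
  exact hφ.aestronglyMeasurable.mono_measure (Measure.le_sum (fun e : (Fin d → ℤ) × Fin d =>
      Measure.map (edge e.1 e.2) (volume.restrict (Icc (0 : ℝ) 1))) ε)

theorem integrable_heatKernel_mul [NeZero d] {t : ℝ} (ht : 0 < t) (x : LatticeGraph d)
    {φ : LatticeGraph d → ℝ} (hφ : AEStronglyMeasurable φ (length d)) {C : ℝ}
    (hC : ∀ x, |φ x| ≤ C) : Integrable (fun y => heatKernel t x y * φ y) (length d) := by
  obtain ⟨e, r, hr, rfl⟩ := exists_eq_point x
  obtain ⟨K, hK, h⟩ := exists_abs_sourceSum_le d 0 t 1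
  have hm := (continuous_heatKernel_right ht (point e r)).aestronglyMeasurable.mul hφ
  have hm' := hm
  rw [length_eq_map] at hm'
  refine (integrable_iff_edge hm).2 ?_
  refine Integrable.mono' (((integrable_edgeWeight e).const_mul (heatNorm t * K)).mul_const C)
    (hm'.comp_measurable measurable_edgeMap) ?_
  filter_upwards [ae_edgeMeasure_mem] with w hw
  simp only [Pi.mul_apply]
  rw [norm_mul, heatKernel_edgeMap ht e hr hw, norm_mul, Real.norm_eq_abs (heatNorm t),
    abs_of_pos (heatNorm_pos ht)]
  have h1 := h t ht le_rfl e (forward w.1) r (by rw [abs_of_nonneg hr.1]; exact hr.2) w.2 hw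
  refine mul_le_mul ?_ (hC _) (abs_nonneg _) ?_
  · rw [mul_assoc]
    exact mul_le_mul_of_nonneg_left h1 (heatNorm_pos ht).le
  · exact mul_nonneg (mul_nonneg (heatNorm_pos ht).le hK.le) (edgeWeight_nonneg _ _)

theorem integrable_heatKernel [NeZero d] {t : ℝ} (ht : 0 < t) (x : LatticeGraph d) :
    Integrable (heatKernel t x) (length d) := by
  simpa using integrable_heatKernel_mul ht x (φ := fun _ => 1) aestronglyMeasurable_const (C := 1)
    (by simp)

theorem setIntegral_Icc_reflect {V : Type*} [NormedAddCommGroup V] [NormedSpace ℝ V] (g : ℝ → V) :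
    ∫ s in Icc (0 : ℝ) 1, g (1 - s) = ∫ s in Icc (0 : ℝ) 1, g s := by
  rw [integral_Icc_eq_integral_Ioc, integral_Icc_eq_integral_Ioc,
    ← intervalIntegral.integral_of_le zero_le_one, ← intervalIntegral.integral_of_le zero_le_one,
    intervalIntegral.integral_comp_sub_left]
  simp

/-- The action of the heat kernel on a function on the graph is the action of the heat kernel of
the line on its unfolded family. This unfolding gives the total mass and the Chapman–Kolmogorov
equation of the kernel. -/
theorem integral_heatKernel_mul_glue [NeZero d] {t : ℝ} (ht : 0 < t) {h : DirEdge d → ℝ → ℝ}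
    (hh : IsUnfolded h) (hc : ∀ e, Continuous (h e)) {C : ℝ}
    (hC : ∀ e, ∀ s ∈ Icc (0 : ℝ) 1, |h e s| ≤ C) (e : DirEdge d) {r : ℝ}
    (hr : r ∈ Icc (0 : ℝ) 1) :
    ∫ y, heatKernel t (point e r) y * glue h y ∂(length d) = ∫ τ, heatLine t (r - τ) * h e τ := by
  have hcomp := hh.isCompatible
  have hC' : ∀ s ∈ Icc (0 : ℝ) 1, (∀ e, |h e s| ≤ C) ∧ (∀ e, |h e (1 - s)| ≤ C) := fun s hs =>
    ⟨fun e => hC e s hs, fun e => hC e _ ⟨by linarith [hs.2], by linarith [hs.1]⟩⟩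
  have hC0 : 0 ≤ C := (abs_nonneg _).trans (hC e 0 ⟨le_rfl, zero_le_one⟩)
  obtain ⟨K, hK, hgauss⟩ := exists_abs_gaussProfile_sub_le 0 (b := t) 1
  have hrs : ∀ s ∈ Icc (0 : ℝ) 1, |r - s| ≤ 1 := fun s hs => by
    rw [abs_le]; constructor <;> linarith [hr.1, hr.2, hs.1, hs.2]
  -- the contribution of the edge `f` after `n` passages through vertices
  let F : ℤ → DirEdge d → ℝ → ℝ := fun n f s => amp n e f * gaussProfile 0 t (r - s - n) * h f s
  have hFc : ∀ n f, Continuous (F n f) := fun n f => by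
    have : Continuous (gaussProfile 0 t) := by unfold gaussProfile; fun_prop
    have h2 := hc f
    fun_prop
  have hFb : ∀ n f, ∀ s ∈ Icc (0 : ℝ) 1, ‖F n f s‖ ≤ K * C * (|amp n e f| * (1 / 6) ^ n.natAbs) := by
    intro n f s hs
    have h1 := hgauss t ht le_rfl (r - s) (hrs s hs) n
    have h2 := hC f s hs
    simp only [F, norm_mul, Real.norm_eq_abs]
    calc _ ≤ |amp n e f| * (K * (1 / 6) ^ n.natAbs) * C := by gcongr
      _ = _ := by ring
  have hFi : ∀ n f, IntegrableOn (F n f) (Icc 0 1) := fun n f =>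
    (hFc n f).continuousOn.integrableOn_Icc
  have hFn : ∀ n f, ∫ s in Icc (0 : ℝ) 1, ‖F n f s‖ ≤ K * C * (|amp n e f| * (1 / 6) ^ n.natAbs) := by
    intro n f
    have := setIntegral_mono_on (hFi n f).norm (integrableOn_const (C := K * C *
      (|amp n e f| * (1 / 6) ^ n.natAbs)) (by simp)) measurableSet_Icc (hFb n f)
    simpa using this
  let T : ℤ → DirEdge d → ℝ := fun n f => ∫ s in Icc (0 : ℝ) 1, F n f s
  have hT : Summable (Function.uncurry T) := by
    refine Summable.of_norm_bounded ((summable_ampWeight_pairs e).mul_left (K * C)) fun q => ?_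
    exact (norm_integral_le_integral_norm _).trans (hFn q.1 q.2)
  have htr : ∀ f, ∫ s in Icc (0 : ℝ) 1, transport 0 t e f (r - s) * h f s = ∑' n, T n f := by
    intro f
    refine Eq.trans ?_ (hasSum_integral_of_summable_integral_norm (F := fun n => F n f)
      (μ := volume.restrict (Icc 0 1)) (fun n => hFi n f)
      (Summable.of_nonneg_of_le (fun n => integral_nonneg fun _ => norm_nonneg _)
        (fun n => hFn n f) ((summable_ampWeight_terms e f).mul_left _))).tsum_eq.symm
    simp only [F, tsum_mul_right]
    rfl
  have hrefl : ∀ f, ∫ s in Icc (0 : ℝ) 1, transport 0 t e (reverse f) (r + s - 1) * h f s =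
      ∑' n, T n (reverse f) := by
    intro f
    rw [← htr, ← setIntegral_Icc_reflect]
    refine setIntegral_congr_fun measurableSet_Icc fun s _ => ?_
    simp only [hh.reverse]
    ring_nf
  have hti : ∀ k f g, Continuous g → IntegrableOn (fun s => transport 0 t e f (g s) * h k s)
      (Icc 0 1) := fun k f g hg => by
    have h1 := continuous_transport 0 ht e f
    have h2 := hc k
    exact (by fun_prop : Continuous fun s => transport 0 t e f (g s) * h k s).continuousOn.integrableOn_Icc
  -- on the graph
  have hglue : Continuous (glue h) := continuous_of_edge fun z i => by
    refine (hc (z, i, true)).continuousOn.congr fun s hs => ?_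
    exact hcomp.glue_edge z i hs
  have hglueb : ∀ x, |glue h x| ≤ C := fun x => hC _ _ (coord_mem x)
  have h1 := integral_eq_sum_edge (integrable_heatKernel_mul ht (point e r)
    hglue.aestronglyMeasurable hglueb)
  have h2 : ∀ ε : (Fin d → ℤ) × Fin d, ∫ s in Icc (0 : ℝ) 1,
      heatKernel t (point e r) (edge ε.1 ε.2 s) * glue h (edge ε.1 ε.2 s) =
      heatNorm t * (∑' n, T n (forward ε) + ∑' n, T n (reverse (forward ε))) := by
    intro ε
    rw [← htr, ← hrefl, ← integral_add (hti _ _ _ (by fun_prop)) (hti _ _ _ (by fun_prop)),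
      ← integral_const_mul]
    refine setIntegral_congr_fun measurableSet_Icc fun s hs => ?_
    have h3 := heatKernel_edgeMap ht e hr (w := (ε, s)) hs
    simp only [edgeMap] at h3
    simp only [h3, hcomp.glue_edge ε.1 ε.2 hs, sourceSum]
    rw [mul_assoc, add_mul]
    rfl
  simp only [h2] at h1
  have h3 : HasSum (fun f => ∑' n, T n f) (∑' f, ∑' n, T n f) := hT.prod_symm.prod.hasSum
  rw [h1.unique ((hasSum_orient h3).mul_left (heatNorm t))]
  -- on the line
  have hline : ∀ n : ℤ, ∀ s ∈ Icc (0 : ℝ) 1, ∑' f, F n f s = gaussProfile 0 t (r - s - n) * h e (s + n) := by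
    intro n s hs
    rw [← ((hh.hasSum_amp (hC' s hs).1 (hC' s hs).2 n e).mul_left _).tsum_eq]
    refine tsum_congr fun f => ?_
    simp only [F]; ring
  have hTn : ∀ n : ℤ, ∑' f, T n f =
      ∫ s in (0 : ℝ)..1, gaussProfile 0 t (r - (s + n)) * h e (s + n) := by
    intro n
    rw [(hasSum_integral_of_summable_integral_norm (F := fun f => F n f)
      (μ := volume.restrict (Icc 0 1)) (fun f => hFi n f)
      (Summable.of_nonneg_of_le (fun n => integral_nonneg fun _ => norm_nonneg _)
        (fun f => hFn n f) (((amp_summable n e).mul_right _).mul_left _))).tsum_eq,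
      intervalIntegral.integral_of_le zero_le_one, ← integral_Icc_eq_integral_Ioc]
    refine setIntegral_congr_fun measurableSet_Icc fun s hs => ?_
    simp only [hline n s hs]
    ring_nf
  have hint : Integrable fun τ => gaussProfile 0 t (r - τ) * h e τ := by
    have hcont : Continuous fun τ => gaussProfile 0 t (r - τ) * h e τ := by
      have : Continuous (gaussProfile 0 t) := by unfold gaussProfile; fun_prop
      have h2 := hc e
      fun_prop
    refine Real.integrable_of_summable_norm_Icc (f := ⟨_, hcont⟩) ?_
    refine Summable.of_nonneg_of_le (fun _ => norm_nonneg _) (fun n => ?_)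
      (summable_half_natAbs.mul_left (K * C))
    refine (ContinuousMap.norm_le _ (by positivity)).2 fun s => ?_
    have h4 : gaussProfile 0 t (r - (s + n)) * h e (s + n) = ∑' f, F n f s := by
      rw [hline n s s.2]; ring_nf
    change ‖gaussProfile 0 t (r - (s + n)) * h e (s + n)‖ ≤ _
    have h5 := ((amp_summable n e).mul_right ((1 / 6 : ℝ) ^ n.natAbs)).mul_left (K * C)
    rw [h4]
    refine (tsum_of_norm_bounded h5.hasSum fun f => hFb n f s s.2).trans ?_
    rw [tsum_mul_left, tsum_mul_right]
    gcongr
    calc _ ≤ (3 : ℝ) ^ n.natAbs * (1 / 6) ^ n.natAbs := by gcongr; exact tsum_abs_amp_le n e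
      _ = _ := by rw [← mul_pow]; norm_num
  have h6 := hint.hasSum_intervalIntegral_comp_add_int
  simp only [← hTn] at h6
  rw [show (∑' f, ∑' n, T n f) = ∑' n, ∑' f, T n f from hT.tsum_comm, h6.tsum_eq,
    ← integral_const_mul]
  simp only [heatLine, mul_assoc]

theorem isUnfolded_one [NeZero d] : IsUnfolded (fun (_ : DirEdge d) (_ : ℝ) => (1 : ℝ)) where
  reverse _ _ := rfl
  shift e s := by
    have : (d : ℝ) ≠ 0 := NeZero.ne _
    rw [sum_const_dir, smul_eq_mul]
    field_simp
    norm_num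

/-- Constants unfold to constants. -/
theorem integral_heatKernel [NeZero d] {t : ℝ} (ht : 0 < t) (x : LatticeGraph d) :
    ∫ y, heatKernel t x y ∂(length d) = 1 := by
  obtain ⟨e, r, hr, rfl⟩ := exists_eq_point x
  have h := integral_heatKernel_mul_glue ht (isUnfolded_one (d := d)) (fun _ => continuous_const)
    (C := 1) (by simp) e hr
  simp only [glue, mul_one] at h
  rw [h, integral_sub_left_eq_self (heatLine t), integral_heatLine ht]

theorem exists_abs_heatKernel_le [NeZero d] {t : ℝ} (ht : 0 < t) :
    ∃ C, ∀ x y : LatticeGraph d, |heatKernel t x y| ≤ C := by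
  obtain ⟨K, hK, h⟩ := exists_abs_sourceSum_le d 0 t 1
  obtain ⟨C, hC, hW⟩ := exists_edgeWeight_le d
  refine ⟨heatNorm t * (K * C), fun x y => ?_⟩
  rw [heatKernel, abs_mul, abs_of_pos (heatNorm_pos ht)]
  have hx := coord_mem x
  gcongr
  · exact (heatNorm_pos ht).le
  · refine (h t ht le_rfl _ _ _ (by rw [abs_of_nonneg hx.1]; exact hx.2) _ (coord_mem y)).trans ?_
    gcongr
    exact hW _ _

theorem integrable_tsum {F : ℤ → ℝ → ℝ} (hF : ∀ n, Integrable (F n))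
    (hF' : Summable fun n => ∫ τ, ‖F n τ‖) (hm : AEStronglyMeasurable (fun τ => ∑' n, F n τ)) :
    Integrable fun τ => ∑' n, F n τ := by
  refine ⟨hm, ?_⟩
  calc ∫⁻ τ, ‖∑' n, F n τ‖ₑ ≤ ∫⁻ τ, ∑' n, ‖F n τ‖ₑ := lintegral_mono fun τ => enorm_tsum_le_tsum_enorm
    _ = ∑' n, ENNReal.ofReal (∫ τ, ‖F n τ‖) := by
        rw [lintegral_tsum fun n => (hF n).aestronglyMeasurable.enorm]
        exact tsum_congr fun n => (ofReal_integral_norm_eq_lintegral_enorm (hF n)).symm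
    _ < ⊤ := by
        rw [← ENNReal.ofReal_tsum_of_nonneg (fun n => integral_nonneg fun _ => norm_nonneg _) hF']
        exact ENNReal.ofReal_lt_top

theorem integral_heatLine_mul_transport [NeZero d] {s t : ℝ} (hs : 0 < s) (ht : 0 < t)
    (e f : DirEdge d) (r a : ℝ) :
    Integrable (fun τ => heatLine s (r - τ) * (heatNorm t * transport 0 t e f (τ - a))) ∧
    ∫ τ, heatLine s (r - τ) * (heatNorm t * transport 0 t e f (τ - a)) =
      heatNorm (s + t) * transport 0 (s + t) e f (r - a) := by
  let F : ℤ → ℝ → ℝ := fun n τ => amp n e f * (heatLine s (r - τ) * heatLine t (τ - (a + n)))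
  have hF : ∀ n, Integrable (F n) := fun n =>
    (integral_heatLine_mul hs ht r (a + n)).1.const_mul _
  have hpos : ∀ {t : ℝ}, 0 < t → ∀ x, 0 ≤ heatLine t x := fun ht x =>
    mul_nonneg (heatNorm_pos ht).le (by rw [gaussProfile_zero]; positivity)
  have hFn : ∀ n, ∫ τ, ‖F n τ‖ =
      heatNorm (s + t) * |amp n e f * gaussProfile 0 (s + t) (r - a - n)| := by
    intro n
    have h1 : ∀ τ, ‖F n τ‖ = |amp n e f| * (heatLine s (r - τ) * heatLine t (τ - (a + n))) := by
      intro τ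
      rw [Real.norm_eq_abs, abs_mul, abs_of_nonneg (mul_nonneg (hpos hs _) (hpos ht _))]
    simp only [h1]
    rw [integral_const_mul, (integral_heatLine_mul hs ht r (a + n)).2, heatLine, abs_mul,
      abs_of_nonneg (a := gaussProfile _ _ _) (by rw [gaussProfile_zero]; positivity)]
    ring_nf
  have hsum : Summable fun n => ∫ τ, ‖F n τ‖ := by
    simp only [hFn]
    exact (summable_transport 0 (add_pos hs ht) e f (r - a)).abs.mul_left _
  have heq : ∀ τ, heatLine s (r - τ) * (heatNorm t * transport 0 t e f (τ - a)) = ∑' n, F n τ := by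
    intro τ
    rw [transport, ← tsum_mul_left, ← tsum_mul_left]
    refine tsum_congr fun n => ?_
    simp only [F, heatLine]
    ring_nf
  have h := hasSum_integral_of_summable_integral_norm hF hsum
  simp only [heq]
  refine ⟨?_, ?_⟩
  · refine integrable_tsum hF hsum ?_
    simp only [← heq]
    have h1 := continuous_transport 0 ht e f
    have h2 : Continuous (heatLine s) := by unfold heatLine gaussProfile; fun_prop
    exact (by fun_prop : Continuous fun τ =>
      heatLine s (r - τ) * (heatNorm t * transport 0 t e f (τ - a))).aestronglyMeasurable
  · rw [← h.tsum_eq, transport, ← tsum_mul_left]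
    refine tsum_congr fun n => ?_
    simp only [F]
    rw [integral_const_mul, (integral_heatLine_mul hs ht r (a + n)).2, heatLine]
    ring_nf

/-- The function `p(t, ·, y)` unfolds to the sum of the sources, on which the heat kernel of the line
acts term by term. -/
theorem chapmanKolmogorov [NeZero d] {s t : ℝ} (hs : 0 < s) (ht : 0 < t) (x y : LatticeGraph d) :
    Integrable (fun z => heatKernel s x z * heatKernel t z y) (length d) ∧
      heatKernel (s + t) x y = ∫ z, heatKernel s x z * heatKernel t z y ∂(length d) := by
  obtain ⟨e, r, hr, rfl⟩ := exists_eq_point x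
  obtain ⟨C, hC⟩ := exists_abs_heatKernel_le (d := d) ht
  have hsymm : ∀ z, heatKernel t z y = heatKernel t y z := fun z => heatKernel_symm t z y
  refine ⟨integrable_heatKernel_mul hs _ ?_ (C := C) fun z => hC z y, ?_⟩
  · simp only [hsymm]
    exact (continuous_heatKernel_right ht y).aestronglyMeasurable
  obtain ⟨f, u, hu, rfl⟩ := exists_eq_point y
  have hunf := isUnfolded_sourceSum ht f u
  have hunf' : IsUnfolded (fun e r => heatNorm t * sourceSum 0 t e r f u) := by
    refine ⟨fun e s => congrArg _ (hunf.reverse e s), fun e s => ?_⟩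
    simp only [hunf.shift, smul_eq_mul, ← Finset.mul_sum]
    ring
  have h1 := integral_heatKernel_mul_glue hs hunf' (C := C) (fun e => ?_) (fun e v hv => ?_) e hr
  · have h2 : ∀ z, glue (fun e r => heatNorm t * sourceSum 0 t e r f u) z =
        heatKernel t z (point f u) := fun z => by
      rw [heatKernel_symm, heatKernel_point_left ht f hu, sourceSum_zero_comm, glue]
    simp only [h2] at h1
    rw [h1, heatKernel_point (add_pos hs ht) e f hr hu, sourceSum]
    have h3 := integral_heatLine_mul_transport hs ht e f r u
    have h4 := integral_heatLine_mul_transport hs ht e (reverse f) r (1 - u)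
    have h5 : ∀ τ, heatLine s (r - τ) * (heatNorm t * sourceSum 0 t e τ f u) =
        heatLine s (r - τ) * (heatNorm t * transport 0 t e f (τ - u)) +
        heatLine s (r - τ) * (heatNorm t * transport 0 t e (reverse f) (τ - (1 - u))) := by
      intro τ
      rw [sourceSum]
      ring_nf
    simp only [h5]
    rw [integral_add h3.1 h4.1, h3.2, h4.2]
    ring_nf
  · exact continuous_const.mul (continuous_iff_continuousAt.2 fun v =>
      (hasDerivAt_sourceSum 0 ht e v f u).continuousAt)
  · rw [← heatKernel_point ht e f hv hu]
    exact hC _ _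

/-! ### Exponential moments of the heat kernel -/

/-- The case of `dist_point_le` for waves that come from the origin of `e`. -/
theorem dist_origin_le {n : ℕ} {e f : DirEdge d} (h : amp n e f ≠ 0) {s : ℝ}
    (hs : s ∈ Icc (0 : ℝ) 1) : dist (point e 0) (point f s) ≤ n + s := by
  induction n generalizing e with
  | zero =>
    have : e = f := by
      by_contra hne
      exact h (by rw [Nat.cast_zero, amp_zero, if_neg hne])
    rw [this, dist_point, zero_sub, abs_neg, abs_of_nonneg hs.1]
    simp
  | succ n ih =>
    have h1 : ∃ g : DirEdge d, g.1 = target e ∧ amp n g f ≠ 0 := by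
      by_contra! hne
      refine h ?_
      rw [Nat.cast_succ, amp_natCast_add_one, scatter, hne _ (reverse_fst e),
        Finset.sum_eq_zero fun b _ => hne _ rfl]
      simp
    obtain ⟨⟨v, a⟩, hg, hg'⟩ := h1
    have h2 : point (v, a) 0 = point e 1 := by
      rw [show v = (reverse e).1 from hg, point_zero_eq _ a (reverse e).2, point_reverse, sub_zero]
    have h3 := dist_triangle (point e 0) (point e 1) (point f s)
    rw [dist_point, ← h2] at h3
    have h4 := ih hg'
    norm_num at h3
    push_cast
    linarith

/-- Waves have the propagation speed one. -/
theorem dist_point_le {n : ℤ} {e f : DirEdge d} (h : amp n e f ≠ 0) {r s : ℝ}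
    (hr : r ∈ Icc (0 : ℝ) 1) (hs : s ∈ Icc (0 : ℝ) 1) :
    dist (point e r) (point f s) ≤ |r - s - n| := by
  have key : ∀ {n : ℕ} {e f : DirEdge d}, amp n e f ≠ 0 → ∀ {r s : ℝ}, r ∈ Icc (0 : ℝ) 1 →
      s ∈ Icc (0 : ℝ) 1 → dist (point e r) (point f s) ≤ |r - s - n| := by
    intro n e f h r s hr hs
    cases n with
    | zero =>
      have : e = f := by
        by_contra hne
        exact h (by rw [Nat.cast_zero, amp_zero, if_neg hne])
      rw [this, dist_point]
      simp
    | succ n =>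
      have h1 : ∃ g : DirEdge d, g.1 = target e ∧ amp n g f ≠ 0 := by
        by_contra! hne
        refine h ?_
        rw [Nat.cast_succ, amp_natCast_add_one, scatter, hne _ (reverse_fst e),
          Finset.sum_eq_zero fun b _ => hne _ rfl]
        simp
      obtain ⟨⟨v, a⟩, hg, hg'⟩ := h1
      have h2 : point (v, a) 0 = point e 1 := by
        rw [show v = (reverse e).1 from hg, point_zero_eq _ a (reverse e).2, point_reverse, sub_zero]
      have h3 := dist_triangle (point e r) (point e 1) (point f s)
      rw [dist_point, ← h2, abs_sub_comm, abs_of_nonneg (by linarith [hr.2])] at h3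
      have h4 := dist_origin_le hg' hs
      rw [abs_sub_comm]
      refine le_trans ?_ (le_abs_self _)
      push_cast
      linarith
  obtain ⟨m, rfl | rfl⟩ := n.eq_nat_or_neg
  · simpa using key h hr hs
  · rw [amp_neg] at h
    have h1 := key h (r := 1 - r) (s := 1 - s) ⟨by linarith [hr.2], by linarith [hr.1]⟩
      ⟨by linarith [hs.2], by linarith [hs.1]⟩
    rw [point_reverse, point_reverse, sub_sub_cancel, sub_sub_cancel] at h1
    refine h1.trans_eq ?_
    rw [← abs_neg]
    push_cast
    ring_nf

/-- Exponential moments of the heat kernel of the line, by completing the square. -/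
theorem integral_heatLine_mul_exp {t : ℝ} (ht : 0 < t) (a : ℝ) :
    ∫⁻ x, ENNReal.ofReal (heatLine t x * Real.exp (a * |x|)) ≤
      ENNReal.ofReal (2 * Real.exp (a ^ 2 * t)) := by
  have h1 : ∀ a x : ℝ, heatLine t x * Real.exp (a * x) =
      Real.exp (a ^ 2 * t) * heatLine t (x - 2 * a * t) := by
    intro a x
    rw [heatLine, heatLine, gaussProfile_zero, gaussProfile_zero, mul_assoc, ← Real.exp_add,
      mul_left_comm, ← Real.exp_add]
    congr 2
    field_simp
    ring
  have h2 : ∀ a : ℝ, Integrable fun x => heatLine t x * Real.exp (a * x) := fun a => by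
    simp only [h1]
    exact ((integrable_heatLine ht).comp_sub_right _).const_mul _
  have h3 : ∀ a : ℝ, ∫ x, heatLine t x * Real.exp (a * x) = Real.exp (a ^ 2 * t) := fun a => by
    simp only [h1]
    rw [integral_const_mul, integral_sub_right_eq_self (heatLine t), integral_heatLine ht, mul_one]
  have hpos : ∀ x, 0 ≤ heatLine t x := fun x =>
    mul_nonneg (heatNorm_pos ht).le (by rw [gaussProfile_zero]; positivity)
  calc _ ≤ ∫⁻ x, ENNReal.ofReal (heatLine t x * Real.exp (a * x) +
        heatLine t x * Real.exp (-a * x)) := by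
        refine lintegral_mono fun x => ENNReal.ofReal_le_ofReal ?_
        rw [← mul_add]
        refine mul_le_mul_of_nonneg_left ?_ (hpos x)
        rcases abs_cases x with ⟨h, -⟩ | ⟨h, -⟩ <;> rw [h]
        · linarith [Real.exp_pos (-a * x)]
        · rw [show a * -x = -a * x by ring]
          linarith [Real.exp_pos (a * x)]
    _ = _ := by
        have h4 : Integrable fun x => heatLine t x * Real.exp (a * x) +
          heatLine t x * Real.exp (-a * x) := (h2 a).add (h2 (-a))
        rw [← ofReal_integral_eq_lintegral_ofReal h4,
          integral_add (h2 a) (h2 (-a)), h3, h3]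
        · ring_nf
        · exact ae_of_all _ fun x => add_nonneg (mul_nonneg (hpos x) (Real.exp_pos _).le)
            (mul_nonneg (hpos x) (Real.exp_pos _).le)

/-- The translates of the unit interval by the integers fill the line. -/
theorem tsum_lintegral_Icc_sub {g : ℝ → ENNReal} (hg : Measurable g) (r : ℝ) :
    ∑' n : ℤ, ∫⁻ s in Icc (0 : ℝ) 1, g (r - s - n) = ∫⁻ x, g x := by
  have h1 : ∫⁻ x, g x = ∫⁻ x, g (r - x) := (lintegral_sub_left_eq_self g r).symm
  rw [h1, ← setLIntegral_univ, ← iUnion_Ioc_add_intCast (0 : ℝ),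
    lintegral_iUnion (fun _ => measurableSet_Ioc) (pairwise_disjoint_Ioc_add_intCast (0 : ℝ))]
  refine tsum_congr fun n => ?_
  rw [setLIntegral_congr (Ioc_ae_eq_Icc (α := ℝ) (μ := volume) (a := 0) (b := 1)).symm]
  have h2 := (measurePreserving_add_right (volume : Measure ℝ) (n : ℝ)).setLIntegral_comp_preimage
    (s := Ioc (0 + (n : ℝ)) (0 + n + 1)) measurableSet_Ioc (f := fun x => g (r - x))
    (by fun_prop)
  rw [← h2]
  congr 1
  · congr 1
    ext x
    simp [add_comm]
  · funext a
    congr 1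
    ring

theorem lintegral_eq_tsum_edge {φ : LatticeGraph d → ENNReal} (hφ : Measurable φ) :
    ∫⁻ x, φ x ∂(length d) = ∑' ε : (Fin d → ℤ) × Fin d, ∫⁻ s in Icc (0 : ℝ) 1, φ (edge ε.1 ε.2 s) := by
  rw [length, lintegral_sum_measure]
  refine tsum_congr fun ε => ?_
  rw [lintegral_map hφ (continuous_edge _ _).measurable]

theorem setLIntegral_Icc_reflect (g : ℝ → ENNReal) :
    ∫⁻ s in Icc (0 : ℝ) 1, g (1 - s) = ∫⁻ s in Icc (0 : ℝ) 1, g s := by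
  have h := (Measure.measurePreserving_sub_left (volume : Measure ℝ) 1).setLIntegral_comp_preimage_emb
    (Homeomorph.subLeft (1 : ℝ)).measurableEmbedding g (Icc 0 1)
  rw [← h]
  simp

/-- Exponential moments of the heat kernel. A path with `n` passages through vertices has a weight of
at most `3 ^ |n|` in total, which is an exponential function of its length and is absorbed into the
moments of the heat kernel of the line. -/
theorem lintegral_abs_heatKernel_mul_exp_le [NeZero d] {t : ℝ} (ht : 0 < t) {L : ℝ} (hL : 0 ≤ L)
    (x : LatticeGraph d) :
    ∫⁻ y, ENNReal.ofReal (|heatKernel t x y| * Real.exp (L * dist x y)) ∂(length d) ≤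
      ENNReal.ofReal (2 * Real.exp 2 * Real.exp ((L + 2) ^ 2 * t)) := by
  obtain ⟨e, r, hr, rfl⟩ := exists_eq_point x
  have hpos : ∀ x, 0 ≤ heatLine t x := fun x =>
    mul_nonneg (heatNorm_pos ht).le (by rw [gaussProfile_zero]; positivity)
  let q : ℝ → ℝ := fun x => heatLine t x * Real.exp (L * |x|)
  have hq0 : ∀ x, 0 ≤ q x := fun x => mul_nonneg (hpos x) (Real.exp_pos _).le
  have hqc : Continuous q := by
    have : Continuous (heatLine t) := by unfold heatLine gaussProfile; fun_prop
    fun_prop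
  -- the contribution of the paths with `n` passages through vertices
  let I : DirEdge d → ENNReal := fun f =>
    ∑' n : ℤ, ∫⁻ s in Icc (0 : ℝ) 1, ENNReal.ofReal (|amp n e f| * q (r - s - n))
  have hterm : ∀ f, ∀ s ∈ Icc (0 : ℝ) 1,
      ENNReal.ofReal (heatNorm t * |transport 0 t e f (r - s)| *
        Real.exp (L * dist (point e r) (point f s))) ≤
      ∑' n : ℤ, ENNReal.ofReal (|amp n e f| * q (r - s - n)) := by
    intro f s hs
    have hsum := (summable_transport 0 ht e f (r - s)).abs.mul_left
      (heatNorm t * Real.exp (L * dist (point e r) (point f s)))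
    have h1 : heatNorm t * |transport 0 t e f (r - s)| *
        Real.exp (L * dist (point e r) (point f s)) ≤
        ∑' n : ℤ, heatNorm t * Real.exp (L * dist (point e r) (point f s)) *
          |amp n e f * gaussProfile 0 t (r - s - n)| := by
      rw [tsum_mul_left, mul_right_comm]
      refine mul_le_mul_of_nonneg_left ?_ (mul_nonneg (heatNorm_pos ht).le (Real.exp_pos _).le)
      exact norm_tsum_le_tsum_norm (f := fun n : ℤ => amp n e f * gaussProfile 0 t (r - s - n))
        (summable_transport 0 ht e f (r - s)).abs
    refine (ENNReal.ofReal_le_ofReal h1).trans ?_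
    rw [ENNReal.ofReal_tsum_of_nonneg (fun n => mul_nonneg
      (mul_nonneg (heatNorm_pos ht).le (Real.exp_pos _).le) (abs_nonneg _)) hsum]
    refine ENNReal.tsum_le_tsum fun n => ENNReal.ofReal_le_ofReal ?_
    by_cases hn : amp n e f = 0
    · simp [hn]
    · have h2 := dist_point_le hn hr hs
      rw [abs_mul, abs_of_nonneg (a := gaussProfile _ _ _) (by rw [gaussProfile_zero]; positivity)]
      calc _ = |amp n e f| * (heatLine t (r - s - n) *
            Real.exp (L * dist (point e r) (point f s))) := by rw [heatLine]; ring
        _ ≤ _ := by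
          refine mul_le_mul_of_nonneg_left (mul_le_mul_of_nonneg_left ?_ (hpos _)) (abs_nonneg _)
          gcongr
  have hI : ∀ f, ∫⁻ s in Icc (0 : ℝ) 1, ENNReal.ofReal (heatNorm t *
      |transport 0 t e f (r - s)| * Real.exp (L * dist (point e r) (point f s))) ≤ I f := by
    intro f
    refine (setLIntegral_mono' measurableSet_Icc (hterm f)).trans_eq ?_
    exact lintegral_tsum fun n => by fun_prop
  have hcont : Continuous fun y => |heatKernel t (point e r) y| * Real.exp (L * dist (point e r) y) := by
    have := continuous_heatKernel_right ht (point e r)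
    fun_prop
  rw [lintegral_eq_tsum_edge hcont.measurable.ennreal_ofReal]
  calc _ ≤ ∑' ε : (Fin d → ℤ) × Fin d, (I (forward ε) + I (reverse (forward ε))) := by
        refine ENNReal.tsum_le_tsum fun ε => ?_
        refine le_trans ?_ (add_le_add (hI _) (hI _))
        rw [← setLIntegral_Icc_reflect (fun s => ENNReal.ofReal (heatNorm t *
          |transport 0 t e (reverse (forward ε)) (r - s)| *
          Real.exp (L * dist (point e r) (point (reverse (forward ε)) s)))),
          ← lintegral_add_right' _ ?_]
        · refine setLIntegral_mono' measurableSet_Icc fun s hs => ?_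
          rw [← ENNReal.ofReal_add]
          · refine ENNReal.ofReal_le_ofReal ?_
            rw [point_reverse, sub_sub_cancel, ← add_mul, ← mul_add, ← point_forward,
              heatKernel_point ht e _ hr hs, abs_mul, abs_of_pos (heatNorm_pos ht), sourceSum,
              show r + s - 1 = r - (1 - s) by ring]
            have := heatNorm_pos ht
            gcongr
            exact abs_add_le _ _
          · have := heatNorm_pos ht; positivity
          · have := heatNorm_pos ht; positivity
        · have h1 := continuous_transport 0 ht e (reverse (forward ε))
          have h2 : Continuous fun s => point (reverse (forward ε)) (1 - s) := by
            simp only [point_reverse, sub_sub_cancel, point_forward]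
            exact continuous_edge _ _
          exact (by fun_prop : Measurable fun s : ℝ => ENNReal.ofReal (heatNorm t *
          |transport 0 t e (reverse (forward ε)) (r - (1 - s))| *
          Real.exp (L * dist (point e r) (point (reverse (forward ε)) (1 - s))))).aemeasurable
    _ = ∑' f, I f := (hasSum_orient (ENNReal.summable.hasSum)).tsum_eq
    _ = ∑' n : ℤ, (∑' f, ENNReal.ofReal |amp n e f|) *
          ∫⁻ s in Icc (0 : ℝ) 1, ENNReal.ofReal (q (r - s - n)) := by
        rw [ENNReal.tsum_comm]
        refine tsum_congr fun n => ?_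
        rw [← ENNReal.tsum_mul_right]
        refine tsum_congr fun f => ?_
        simp only [ENNReal.ofReal_mul (abs_nonneg _)]
        rw [lintegral_const_mul _ (by fun_prop)]
    _ ≤ ∑' n : ℤ, ∫⁻ s in Icc (0 : ℝ) 1,
          ENNReal.ofReal (Real.exp 2 * (heatLine t (r - s - n) * Real.exp ((L + 2) * |r - s - n|))) := by
        refine ENNReal.tsum_le_tsum fun n => ?_
        rw [← ENNReal.ofReal_tsum_of_nonneg (fun f => abs_nonneg _) (amp_summable n e),
          ← lintegral_const_mul _ (by fun_prop)]
        refine setLIntegral_mono' measurableSet_Icc fun s hs => ?_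
        rw [← ENNReal.ofReal_mul (tsum_nonneg fun _ => abs_nonneg _)]
        refine ENNReal.ofReal_le_ofReal ?_
        have h1 : (3 : ℝ) ^ n.natAbs ≤ Real.exp (2 * (|r - s - n| + 1)) := by
          have h3 : (3 : ℝ) ≤ Real.exp 2 := by linarith [Real.add_one_le_exp (2 : ℝ)]
          have h4 : (n.natAbs : ℝ) ≤ |r - s - n| + 1 := by
            rw [Nat.cast_natAbs, Int.cast_abs]
            have h5 := abs_sub_abs_le_abs_sub (n : ℝ) (r - s)
            rw [abs_sub_comm (n : ℝ)] at h5
            have h6 : |r - s| ≤ 1 := by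
              rw [abs_le]; constructor <;> linarith [hr.1, hr.2, hs.1, hs.2]
            linarith
          calc (3 : ℝ) ^ n.natAbs ≤ Real.exp 2 ^ n.natAbs := by gcongr
            _ = Real.exp (n.natAbs * 2) := (Real.exp_nat_mul _ _).symm
            _ ≤ _ := Real.exp_le_exp.2 (by linarith)
        calc _ ≤ Real.exp (2 * (|r - s - n| + 1)) * q (r - s - n) :=
              mul_le_mul_of_nonneg_right ((tsum_abs_amp_le n e).trans h1) (hq0 _)
          _ = _ := by
              simp only [q]
              rw [mul_left_comm, ← Real.exp_add, mul_left_comm (Real.exp 2), ← Real.exp_add]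
              ring_nf
    _ = ∫⁻ x, ENNReal.ofReal (Real.exp 2 * (heatLine t x * Real.exp ((L + 2) * |x|))) := by
        refine tsum_lintegral_Icc_sub (g := fun x => ENNReal.ofReal (Real.exp 2 *
          (heatLine t x * Real.exp ((L + 2) * |x|)))) ?_ r
        have : Continuous (heatLine t) := by unfold heatLine gaussProfile; fun_prop
        fun_prop
    _ ≤ _ := by
        simp only [ENNReal.ofReal_mul (Real.exp_pos 2).le]
        rw [lintegral_const_mul' _ _ ENNReal.ofReal_ne_top, mul_comm 2 (Real.exp 2), mul_assoc,
          ENNReal.ofReal_mul (Real.exp_pos 2).le]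
        gcongr
        exact integral_heatLine_mul_exp ht (L + 2)

theorem setIntegral_abs_heatKernel_le [NeZero d] {t : ℝ} (ht : 0 < t) {L : ℝ} (hL : 0 ≤ L)
    (δ : ℝ) (x : LatticeGraph d) :
    ∫ y in {y | δ ≤ dist x y}, |heatKernel t x y| ∂(length d) ≤
      2 * Real.exp 2 * Real.exp ((L + 2) ^ 2 * t - L * δ) := by
  have hms : MeasurableSet {y | δ ≤ dist x y} :=
    (isClosed_le continuous_const (by fun_prop)).measurableSet
  rw [integral_eq_lintegral_of_nonneg_ae (ae_of_all _ fun y => abs_nonneg _)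
    (continuous_heatKernel_right ht x).abs.aestronglyMeasurable]
  refine ENNReal.toReal_le_of_le_ofReal (by positivity) ?_
  calc ∫⁻ y in {y | δ ≤ dist x y}, ENNReal.ofReal |heatKernel t x y| ∂(length d)
      ≤ ∫⁻ y in {y | δ ≤ dist x y}, ENNReal.ofReal (Real.exp (-(L * δ))) *
        ENNReal.ofReal (|heatKernel t x y| * Real.exp (L * dist x y)) ∂(length d) := by
        refine setLIntegral_mono' hms fun y hy => ?_
        rw [← ENNReal.ofReal_mul (Real.exp_pos _).le, mul_left_comm, ← Real.exp_add]
        refine ENNReal.ofReal_le_ofReal (le_mul_of_one_le_right (abs_nonneg _) ?_)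
        refine Real.one_le_exp ?_
        have := mul_le_mul_of_nonneg_left hy hL
        linarith
    _ ≤ ∫⁻ y, ENNReal.ofReal (Real.exp (-(L * δ))) *
        ENNReal.ofReal (|heatKernel t x y| * Real.exp (L * dist x y)) ∂(length d) :=
        setLIntegral_le_lintegral _ _
    _ ≤ _ := by
        rw [lintegral_const_mul' _ _ ENNReal.ofReal_ne_top, sub_eq_add_neg, Real.exp_add,
          ← mul_assoc, mul_comm _ (Real.exp (-(L * δ))), ENNReal.ofReal_mul (Real.exp_pos _).le]
        gcongr
        exact lintegral_abs_heatKernel_mul_exp_le ht hL x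

theorem integral_abs_heatKernel_le [NeZero d] {t : ℝ} (ht : 0 < t) (x : LatticeGraph d) :
    ∫ y, |heatKernel t x y| ∂(length d) ≤ 2 * Real.exp 2 * Real.exp (4 * t) := by
  have h := setIntegral_abs_heatKernel_le ht le_rfl 0 x
  have h1 : {y | 0 ≤ dist x y} = univ := by simp
  rw [h1, setIntegral_univ] at h
  norm_num at h
  exact h

/-! ### The heat flow -/

section HeatFlow

variable {V : Type*} [NormedAddCommGroup V] [NormedSpace ℝ V]

/-- The action of the heat kernel on functions. -/
def heatFlow (t : ℝ) (f : LatticeGraph d → V) (x : LatticeGraph d) : V :=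
  ∫ y, heatKernel t x y • f y ∂(length d)

theorem integrable_heatKernel_smul [NeZero d] {t : ℝ} (ht : 0 < t) (x : LatticeGraph d)
    {f : LatticeGraph d → V} (hf : AEStronglyMeasurable f (length d)) {C : ℝ}
    (hC : ∀ x, ‖f x‖ ≤ C) : Integrable (fun y => heatKernel t x y • f y) (length d) := by
  refine (integrable_heatKernel_mul ht x hf.norm (C := C) (by simpa using hC)).mono
    ((continuous_heatKernel_right ht x).aestronglyMeasurable.smul hf) (ae_of_all _ fun y => ?_)
  simp [norm_smul]

/-- The heat flow nearly sees only the values at nearby points. -/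
theorem norm_heatFlow_le [NeZero d] {t : ℝ} (ht : 0 < t) (x : LatticeGraph d)
    {f : LatticeGraph d → V} {C η δ L : ℝ}
    (hC : ∀ x, ‖f x‖ ≤ C) (hη : ∀ y, dist x y < δ → ‖f y‖ ≤ η) (hη0 : 0 ≤ η) (hL : 0 ≤ L) :
    ‖heatFlow t f x‖ ≤ 2 * Real.exp 2 * Real.exp (4 * t) * η +
      2 * Real.exp 2 * Real.exp ((L + 2) ^ 2 * t - L * δ) * C := by
  have hC0 : 0 ≤ C := (norm_nonneg _).trans (hC x)
  have hms : MeasurableSet {y | δ ≤ dist x y} :=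
    (isClosed_le continuous_const (by fun_prop)).measurableSet
  have hi := (integrable_heatKernel ht x).abs
  calc ‖heatFlow t f x‖ ≤ ∫ y, (|heatKernel t x y| * η +
        {y | δ ≤ dist x y}.indicator (fun y => |heatKernel t x y|) y * C) ∂(length d) := by
        refine norm_integral_le_of_norm_le ((hi.mul_const η).add ((hi.indicator hms).mul_const C))
          (ae_of_all _ fun y => ?_)
        rw [norm_smul, Real.norm_eq_abs]
        by_cases hy : δ ≤ dist x y
        · rw [indicator_of_mem (by exact hy)]
          have := mul_le_mul_of_nonneg_left (hC y) (abs_nonneg (heatKernel t x y))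
          have h2 := mul_nonneg (abs_nonneg (heatKernel t x y)) hη0
          linarith
        · rw [indicator_of_notMem (by exact hy), zero_mul, add_zero]
          exact mul_le_mul_of_nonneg_left (hη y (not_le.1 hy)) (abs_nonneg _)
    _ = (∫ y, |heatKernel t x y| ∂(length d)) * η +
        (∫ y in {y | δ ≤ dist x y}, |heatKernel t x y| ∂(length d)) * C := by
        rw [integral_add (hi.mul_const η) ((hi.indicator hms).mul_const C), integral_mul_const,
          integral_mul_const, integral_indicator hms]
    _ ≤ _ := by
        gcongr
        · exact integral_abs_heatKernel_le ht x
        · exact setIntegral_abs_heatKernel_le ht hL δ x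

theorem heatFlow_sub_const [NeZero d] [CompleteSpace V] {t : ℝ} (ht : 0 < t) (x : LatticeGraph d)
    {f : LatticeGraph d → V} (hf : AEStronglyMeasurable f (length d)) {C : ℝ}
    (hC : ∀ x, ‖f x‖ ≤ C) (v : V) : heatFlow t (fun y => f y - v) x = heatFlow t f x - v := by
  simp only [heatFlow, smul_sub]
  rw [integral_sub (integrable_heatKernel_smul ht x hf hC)
    ((integrable_heatKernel ht x).smul_const v), integral_smul_const, integral_heatKernel ht,
    one_smul]

/-- For small times, the heat flow is close to the identity at all points near which the function
is nearly constant. -/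
theorem eventually_norm_heatFlow_sub_lt [NeZero d] [CompleteSpace V] (C : ℝ) {ε : ℝ} (hε : 0 < ε) :
    ∃ η > 0, ∀ δ > 0, ∀ᶠ t in 𝓝[>] (0 : ℝ), ∀ f : LatticeGraph d → V,
      AEStronglyMeasurable f (length d) → (∀ x, ‖f x‖ ≤ C) → ∀ x,
      (∀ y, dist x y < δ → ‖f y - f x‖ ≤ η) → ‖heatFlow t f x - f x‖ < ε := by
  by_cases hC : 0 ≤ C
  swap
  · refine ⟨1, one_pos, fun δ _ => Eventually.of_forall fun t f _ h x _ => ?_⟩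
    exact absurd ((norm_nonneg _).trans (h x)) hC
  refine ⟨ε / (4 * Real.exp 2 * Real.exp 4), by positivity, fun δ hδ => ?_⟩
  -- the exponential weight makes the contribution of distant points small
  obtain ⟨L, hL0, hL⟩ : ∃ L, 0 ≤ L ∧ 2 * Real.exp 2 * Real.exp (1 - L * δ) * (C + C) < ε / 2 := by
    have h1 : Tendsto (fun L => 2 * Real.exp 2 * Real.exp (1 - L * δ) * (C + C)) atTop
        (𝓝 (2 * Real.exp 2 * 0 * (C + C))) := by
      refine ((Real.tendsto_exp_atBot.comp ?_).const_mul _).mul_const _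
      have h2 : Tendsto (fun L : ℝ => L * δ) atTop atTop := tendsto_id.atTop_mul_const hδ
      exact tendsto_atBot_add_const_left _ _ (tendsto_neg_atTop_atBot.comp h2)
    have h2 := h1.eventually_lt_const (u := ε / 2) (by simpa using hε)
    exact ((eventually_ge_atTop 0).and h2).exists
  have hτ : (0 : ℝ) < min 1 (((L + 2) ^ 2)⁻¹) := by positivity
  filter_upwards [Ioo_mem_nhdsGT hτ] with t ht f hf hCf x hx
  rw [← heatFlow_sub_const ht.1 x hf hCf]
  refine (norm_heatFlow_le ht.1 x (C := C + C) (δ := δ)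
    (fun y => (norm_sub_le _ _).trans (add_le_add (hCf y) (hCf x))) hx (by positivity) hL0).trans_lt ?_
  have h1 : t ≤ 1 := (ht.2.trans_le (min_le_left _ _)).le
  have h2 : (L + 2) ^ 2 * t ≤ 1 := by
    have h3 := mul_le_mul_of_nonneg_left (ht.2.trans_le (min_le_right _ _)).le
      (sq_nonneg (L + 2))
    rwa [mul_inv_cancel₀ (by positivity)] at h3
  have h3 : 2 * Real.exp 2 * Real.exp (4 * t) * (ε / (4 * Real.exp 2 * Real.exp 4)) ≤ ε / 2 := by
    calc _ ≤ 2 * Real.exp 2 * Real.exp 4 * (ε / (4 * Real.exp 2 * Real.exp 4)) := by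
          gcongr; linarith
      _ = ε / 2 := by field_simp; norm_num
  have h4 : 2 * Real.exp 2 * Real.exp ((L + 2) ^ 2 * t - L * δ) * (C + C) ≤
      2 * Real.exp 2 * Real.exp (1 - L * δ) * (C + C) := by gcongr
  linarith

/-- The initial condition, uniformly for uniformly continuous functions. -/
theorem tendstoUniformly_heatFlow [NeZero d] [CompleteSpace V] {f : LatticeGraph d → V}
    (hf : UniformContinuous f) {C : ℝ} (hC : ∀ x, ‖f x‖ ≤ C) :
    TendstoUniformly (fun t => heatFlow t f) f (𝓝[>] 0) := by
  rw [Metric.tendstoUniformly_iff]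
  intro ε hε
  obtain ⟨η, hη, h⟩ := eventually_norm_heatFlow_sub_lt (d := d) (V := V) C hε
  obtain ⟨δ, hδ, hδ'⟩ := Metric.uniformContinuous_iff.1 hf η hη
  filter_upwards [h δ hδ] with t ht x
  rw [dist_comm, dist_eq_norm]
  refine ht f hf.continuous.aestronglyMeasurable hC x fun y hy => ?_
  rw [dist_comm] at hy
  rw [← dist_eq_norm]
  exact (hδ' hy).le

/-- The initial condition at a single point, where continuity suffices. -/
theorem tendsto_heatFlow [NeZero d] [CompleteSpace V] {f : LatticeGraph d → V}
    (hf : Continuous f) {C : ℝ} (hC : ∀ x, ‖f x‖ ≤ C) (x : LatticeGraph d) :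
    Tendsto (fun t => heatFlow t f x) (𝓝[>] 0) (𝓝 (f x)) := by
  have := hf.aestronglyMeasurable (μ := length d)
  rw [Metric.tendsto_nhds]
  intro ε hε
  obtain ⟨η, hη, h⟩ := eventually_norm_heatFlow_sub_lt (d := d) (V := V) C hε
  obtain ⟨δ, hδ, hδ'⟩ := Metric.continuousAt_iff.1 (hf.continuousAt (x := x)) η hη
  filter_upwards [h δ hδ] with t ht
  rw [dist_eq_norm]
  refine ht f this hC x fun y hy => ?_
  rw [dist_comm] at hy
  rw [← dist_eq_norm]
  exact (hδ' hy).le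

/-- The heat flow preserves decay at infinity, uniformly for bounded times. -/
theorem eventually_norm_heatFlow_lt [NeZero d] {f : LatticeGraph d → V} {C : ℝ}
    (hC : ∀ x, ‖f x‖ ≤ C) (hf : Tendsto f (cocompact _) (𝓝 0)) (T : ℝ) {ε : ℝ} (hε : 0 < ε) :
    ∀ᶠ x in cocompact (LatticeGraph d), ∀ t, 0 < t → t ≤ T → ‖heatFlow t f x‖ < ε := by
  rcases isEmpty_or_nonempty (LatticeGraph d) with hX | ⟨⟨x₀⟩⟩
  · exact Eventually.of_forall fun x => hX.elim x
  have hC0 : 0 ≤ C := (norm_nonneg _).trans (hC x₀)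
  let η := ε / (4 * Real.exp 2 * Real.exp (4 * T))
  have hη : 0 < η := by positivity
  obtain ⟨R, hR⟩ : ∃ R, ∀ y, R < dist y x₀ → ‖f y‖ ≤ η := by
    have h1 : ∀ᶠ y in cocompact (LatticeGraph d), ‖f y‖ ≤ η := by
      filter_upwards [hf.eventually (Metric.ball_mem_nhds 0 hη)] with y hy
      simpa using (mem_ball_zero_iff.1 hy).le
    rw [← Metric.cobounded_eq_cocompact, ← Metric.comap_dist_right_atTop x₀] at h1
    obtain ⟨R, hR⟩ := eventually_atTop.1 (eventually_comap.1 h1)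
    exact ⟨R, fun y hy => hR _ hy.le y rfl⟩
  obtain ⟨δ, hδ⟩ : ∃ δ, 2 * Real.exp 2 * Real.exp ((1 + 2) ^ 2 * T - 1 * δ) * C < ε / 2 := by
    have h1 : Tendsto (fun δ => 2 * Real.exp 2 * Real.exp ((1 + 2) ^ 2 * T - 1 * δ) * C) atTop
        (𝓝 (2 * Real.exp 2 * 0 * C)) := by
      refine ((Real.tendsto_exp_atBot.comp ?_).const_mul _).mul_const _
      simp only [one_mul]
      exact tendsto_atBot_add_const_left _ _ tendsto_neg_atTop_atBot
    exact (h1.eventually_lt_const (u := ε / 2) (by simpa using hε)).exists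
  have h1 : ∀ᶠ x in cocompact (LatticeGraph d), R + δ < dist x x₀ := by
    rw [← Metric.cobounded_eq_cocompact, ← Metric.comap_dist_right_atTop x₀]
    exact (eventually_gt_atTop _).comap _
  filter_upwards [h1] with x hx t ht htT
  refine (norm_heatFlow_le ht x hC (δ := δ) (η := η) (L := 1) (fun y hy => hR y ?_) hη.le
    zero_le_one).trans_lt ?_
  · linarith [dist_triangle x y x₀]
  · have h3 : 2 * Real.exp 2 * Real.exp (4 * t) * η ≤ ε / 2 := by
      calc _ ≤ 2 * Real.exp 2 * Real.exp (4 * T) * η := by gcongr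
        _ = ε / 2 := by simp only [η]; field_simp; norm_num
    have h4 : 2 * Real.exp 2 * Real.exp ((1 + 2) ^ 2 * t - 1 * δ) * C ≤
      2 * Real.exp 2 * Real.exp ((1 + 2) ^ 2 * T - 1 * δ) * C := by gcongr
    exact (add_lt_add_of_le_of_lt h3 (h4.trans_lt hδ)).trans_eq (add_halves ε)

end HeatFlow

/-! ### Smooth solutions of the heat equation on the graph -/

/-- The mean over the edges at the end of `e` is the even part, about this end, of the continuation
of the function on `e`. -/
theorem IsUnfolded.add_reflect {V : Type*} [AddCommGroup V] [Module ℝ V] {h : DirEdge d → ℝ → V}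
    (hh : IsUnfolded h) (e : DirEdge d) (s : ℝ) :
    h e (1 + s) + h e (1 - s) = (d : ℝ)⁻¹ • ∑ b, h (target e, b) s := by
  rw [add_comm 1 s, hh.shift, ← hh.reverse, sub_add_cancel]

/-- A smooth unfolded family satisfies Kirchhoff's condition: by `IsUnfolded.add_reflect` the mean over
the edges at a vertex is even, so its derivative at the vertex vanishes. -/
theorem IsUnfolded.isKirchhoffSmooth [NeZero d] {h : DirEdge d → ℝ → ℂ} (hh : IsUnfolded h)
    (hc : ∀ e, ContDiff ℝ ∞ (h e)) : IsKirchhoffSmooth (glue h) where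
  continuous := continuous_of_edge fun z i =>
    (hc (z, i, true)).continuous.continuousOn.congr fun s hs => hh.isCompatible.glue_edge z i hs
  smooth z i := (hc (z, i, true)).contDiffOn.congr fun s hs => hh.isCompatible.glue_edge z i hs
  kirchhoff z := by
    have hdiff : ∀ e s, HasDerivAt (h e) (deriv (h e) s) s := fun e s =>
      ((hc e).differentiable (by simp) s).hasDerivAt
    have hd0 : (d : ℝ) ≠ 0 := NeZero.ne _
    have hin : ∀ i, derivWithin (fun s => glue h (edge z i s)) (Icc 0 1) 0 =
        deriv (h (z, i, true)) 0 := fun i =>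
      (((hdiff (z, i, true) 0).hasDerivWithinAt).congr_of_mem
        (fun s hs => hh.isCompatible.glue_edge z i hs) (by simp)).derivWithin
        (uniqueDiffOn_Icc zero_lt_one 0 (by simp))
    have hout : ∀ i, derivWithin (fun s => glue h (edge (z - Pi.single i 1) i s)) (Icc 0 1) 1 =
        -deriv (h (z, i, false)) 0 := by
      intro i
      have h1 : ∀ s, h (z - Pi.single i 1, i, true) s = h (z, i, false) (1 - s) := fun s => by
        rw [← hh.reverse]
        simp [DirEdge.reverse, target, step, Pi.single_neg, sub_eq_add_neg]
      have h2 : HasDerivAt (fun s => h (z, i, false) (1 - s)) (-deriv (h (z, i, false)) 0) 1 := by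
        have h3 := hdiff (z, i, false) 0
        rw [show (0 : ℝ) = 1 - 1 by ring] at h3
        have h4 := h3.comp_const_sub 1 1
        simpa using h4
      refine (h2.hasDerivWithinAt.congr_of_mem (fun s hs => ?_) (by simp)).derivWithin
        (uniqueDiffOn_Icc zero_lt_one 1 (by simp))
      rw [hh.isCompatible.glue_edge _ i hs, h1]
    obtain ⟨a⟩ : Nonempty (Fin d × Bool) := ⟨(0, true)⟩
    -- the mean over the edges at a vertex is an even function of the coordinate
    have hmean : ∀ s, ∑ b, h (z, b) s =
        (d : ℝ) • (h (DirEdge.reverse (z, a)) (1 + s) + h (DirEdge.reverse (z, a)) (1 - s)) := by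
      intro s
      rw [hh.add_reflect, smul_smul, mul_inv_cancel₀ hd0, one_smul, target_reverse]
    have h1 : HasDerivAt (fun s => ∑ b, h (z, b) s) (∑ b, deriv (h (z, b)) 0) 0 :=
      HasDerivAt.fun_sum fun b _ => hdiff _ _
    have h2 : HasDerivAt (fun s => ∑ b, h (z, b) s) 0 0 := by
      simp only [hmean]
      have h3 := (hdiff (DirEdge.reverse (z, a)) (1 + 0)).comp_const_add 1 0
      have h4 := (hdiff (DirEdge.reverse (z, a)) (1 - 0)).comp_const_sub 1 0
      have h5 := (h3.add h4).const_smul (d : ℝ)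
      rw [add_zero, sub_zero, add_neg_cancel, smul_zero] at h5
      exact h5
    have h6 := h1.unique h2
    rw [Fintype.sum_prod_type] at h6
    rw [← h6]
    refine Finset.sum_congr rfl fun i _ => ?_
    rw [hin, hout, Fintype.sum_bool, sub_neg_eq_add]

theorem IsUnfolded.iteratedDerivWithin_glue [NeZero d] {h : DirEdge d → ℝ → ℂ} (hh : IsUnfolded h)
    {h' h'' : ℝ → ℂ} {z : Fin d → ℤ} {i : Fin d}
    (h1 : ∀ s, HasDerivAt (h (z, i, true)) (h' s) s) (h2 : ∀ s, HasDerivAt h' (h'' s) s)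
    {s : ℝ} (hs : s ∈ Icc (0 : ℝ) 1) :
    iteratedDerivWithin 2 (fun s => glue h (edge z i s)) (Icc 0 1) s = h'' s := by
  have h3 : ∀ s ∈ Icc (0 : ℝ) 1, derivWithin (fun s => glue h (edge z i s)) (Icc 0 1) s = h' s :=
    fun s hs => ((h1 s).hasDerivWithinAt.congr_of_mem
      (fun s hs => hh.isCompatible.glue_edge z i hs) hs).derivWithin
      (uniqueDiffOn_Icc zero_lt_one s hs)
  rw [iteratedDerivWithin_succ, iteratedDerivWithin_one]
  have h4 := ((h2 s).hasDerivWithinAt.congr_of_mem h3 hs).derivWithin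
    (uniqueDiffOn_Icc zero_lt_one s hs)
  rw [← h4]

/-- A smooth solution of the heat equation on the graph for `t > 0`, given on every directed edge
together with its continuation; `u'` and `u''` are the derivatives along the edges. -/
structure IsHeatSolution {V : Type*} [NormedAddCommGroup V] [NormedSpace ℝ V]
    (u u' u'' : ℝ → DirEdge d → ℝ → V) : Prop where
  isUnfolded : ∀ {t}, 0 < t → IsUnfolded (u t)
  contDiff : ∀ {t}, 0 < t → ∀ e, ContDiff ℝ ∞ (u t e)
  hasDerivAt : ∀ {t}, 0 < t → ∀ e r, HasDerivAt (u t e) (u' t e r) r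
  hasDerivAt_deriv : ∀ {t}, 0 < t → ∀ e r, HasDerivAt (u' t e) (u'' t e r) r
  hasDerivAt_time : ∀ {t}, 0 < t → ∀ e r, HasDerivAt (fun τ => u τ e r) (u'' t e r) t

theorem IsHeatSolution.ofReal {u u' u'' : ℝ → DirEdge d → ℝ → ℝ} (hu : IsHeatSolution u u' u'') :
    IsHeatSolution (fun t e r => (u t e r : ℂ)) (fun t e r => (u' t e r : ℂ))
      (fun t e r => (u'' t e r : ℂ)) where
  isUnfolded ht :=
    ⟨fun e s => congrArg _ ((hu.isUnfolded ht).reverse e s), fun e s => by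
      rw [(hu.isUnfolded ht).shift e s]; simp⟩
  contDiff ht e := Complex.ofRealCLM.contDiff.comp (hu.contDiff ht e)
  hasDerivAt ht e r := (hu.hasDerivAt ht e r).ofReal_comp
  hasDerivAt_deriv ht e r := (hu.hasDerivAt_deriv ht e r).ofReal_comp
  hasDerivAt_time ht e r := (hu.hasDerivAt_time ht e r).ofReal_comp

theorem hasDerivAt_heatNorm {t : ℝ} (ht : 0 < t) :
    HasDerivAt heatNorm (-(2 * t)⁻¹ * heatNorm t) t := by
  have h0 : (0 : ℝ) < 4 * Real.pi * t := by positivity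
  have h1 := (((hasDerivAt_id t).const_mul (4 * Real.pi)).sqrt h0.ne').inv
    (Real.sqrt_ne_zero'.2 h0)
  convert! h1 using 1
  simp only [id, heatNorm, Real.sq_sqrt h0.le]
  field_simp

section Profile

variable {V : Type*} [NormedAddCommGroup V] [NormedSpace ℝ V]

theorem contDiff_of_profile {c : ℝ} {H : ℕ → ℝ → V}
    (h : ∀ k r, HasDerivAt (H k) ((k : ℝ) • H (k - 1) r - c • H (k + 1) r) r) (k : ℕ) :
    ContDiff ℝ ∞ (H k) := by
  have hd : ∀ k, deriv (H k) = fun r => (k : ℝ) • H (k - 1) r - c • H (k + 1) r := fun k =>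
    funext fun r => (h k r).deriv
  have key : ∀ (n : ℕ) k, ContDiff ℝ n (H k) := by
    intro n
    induction n with
    | zero =>
      intro k
      exact contDiff_zero.2 (continuous_iff_continuousAt.2 fun r => (h k r).continuousAt)
    | succ n ih =>
      intro k
      rw [Nat.cast_succ, contDiff_succ_iff_deriv]
      refine ⟨fun r => (h k r).differentiableAt, by simp, ?_⟩
      rw [hd]
      exact ((ih _).const_smul _).sub ((ih _).const_smul _)
  exact contDiff_infty.2 fun n => key n k

/-- A family that differentiates like the Gaussian profiles `x ^ k * exp (-x² / 4t)` gives a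
solution of the heat equation. -/
theorem isHeatSolution_of_profile {H : ℕ → ℝ → DirEdge d → ℝ → V}
    (h0 : ∀ {t}, 0 < t → IsUnfolded (H 0 t))
    (h1 : ∀ {t}, 0 < t → ∀ k e r, HasDerivAt (H k t e)
      ((k : ℝ) • H (k - 1) t e r - (2 * t)⁻¹ • H (k + 1) t e r) r)
    (h2 : ∀ {t}, 0 < t → ∀ k e r, HasDerivAt (fun τ => H k τ e r)
      ((4 * t ^ 2)⁻¹ • H (k + 2) t e r) t) :
    IsHeatSolution (fun t e r => heatNorm t • H 0 t e r)
      (fun t e r => heatNorm t • (-(2 * t)⁻¹ • H 1 t e r))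
      (fun t e r => heatNorm t • ((4 * t ^ 2)⁻¹ • H 2 t e r - (2 * t)⁻¹ • H 0 t e r)) where
  isUnfolded {t} ht :=
    ⟨fun e s => congrArg _ ((h0 ht).reverse e s), fun e s => by
      rw [(h0 ht).shift e s, smul_sub, smul_comm, Finset.smul_sum]⟩
  contDiff {t} ht e := (contDiff_of_profile (H := fun k => H k t e) (fun k r => h1 ht k e r)
    0).const_smul _
  hasDerivAt {t} ht e r := by
    have h := (h1 ht 0 e r).const_smul (heatNorm t)
    convert! h using 2
    simp
  hasDerivAt_deriv {t} ht e r := by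
    have h := ((h1 ht 1 e r).const_smul (-(2 * t)⁻¹)).const_smul (heatNorm t)
    convert! h using 2
    have h3 : (4 * t ^ 2)⁻¹ = (2 * t)⁻¹ * (2 * t)⁻¹ := by
      rw [← mul_inv]; ring_nf
    rw [h3, smul_sub, smul_smul, smul_smul]
    simp only [Nat.cast_one, one_smul, Nat.sub_self, Nat.reduceAdd, mul_smul, neg_smul]
    abel
  hasDerivAt_time {t} ht e r := by
    have h := (hasDerivAt_heatNorm ht).smul (h2 ht 0 e r)
    convert! h using 1
    simp only [smul_sub, smul_smul, neg_mul, neg_smul, Nat.reduceAdd]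
    rw [sub_eq_add_neg, mul_comm (heatNorm t) (2 * t)⁻¹]

end Profile

theorem isHeatSolution_sourceSum [NeZero d] (f : DirEdge d) (s : ℝ) :
    IsHeatSolution (fun t e r => heatNorm t * sourceSum 0 t e r f s)
      (fun t e r => heatNorm t * (-(2 * t)⁻¹ * sourceSum 1 t e r f s))
      (fun t e r => heatNorm t *
        ((4 * t ^ 2)⁻¹ * sourceSum 2 t e r f s - (2 * t)⁻¹ * sourceSum 0 t e r f s)) :=
  isHeatSolution_of_profile (H := fun k t e r => sourceSum k t e r f s)
    (fun ht => isUnfolded_sourceSum ht f s) (fun ht k e r => hasDerivAt_sourceSum k ht e r f s)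
    (fun ht k e r => hasDerivAt_sourceSum_time k ht e r f s)

/-- The time derivative of the heat kernel. -/
def heatKernelDeriv (t : ℝ) (x y : LatticeGraph d) : ℝ :=
  deriv (fun τ => heatKernel τ x y) t

theorem hasDerivAt_heatKernel_point [NeZero d] {t : ℝ} (ht : 0 < t) (e f : DirEdge d) {r s : ℝ}
    (hr : r ∈ Icc (0 : ℝ) 1) (hs : s ∈ Icc (0 : ℝ) 1) :
    HasDerivAt (fun τ => heatKernel τ (point e r) (point f s)) (heatNorm t *
        ((4 * t ^ 2)⁻¹ * sourceSum 2 t e r f s - (2 * t)⁻¹ * sourceSum 0 t e r f s)) t := by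
  refine ((isHeatSolution_sourceSum f s).hasDerivAt_time ht e r).congr_of_eventuallyEq ?_
  filter_upwards [lt_mem_nhds ht] with τ hτ
  exact heatKernel_point hτ e f hr hs

theorem heatKernelDeriv_point [NeZero d] {t : ℝ} (ht : 0 < t) (e f : DirEdge d) {r s : ℝ}
    (hr : r ∈ Icc (0 : ℝ) 1) (hs : s ∈ Icc (0 : ℝ) 1) :
    heatKernelDeriv t (point e r) (point f s) = heatNorm t *
        ((4 * t ^ 2)⁻¹ * sourceSum 2 t e r f s - (2 * t)⁻¹ * sourceSum 0 t e r f s) :=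
  (hasDerivAt_heatKernel_point ht e f hr hs).deriv

theorem hasDerivAt_heatKernel [NeZero d] {t : ℝ} (ht : 0 < t) (x y : LatticeGraph d) :
    HasDerivAt (fun τ => heatKernel τ x y) (heatKernelDeriv t x y) t := by
  obtain ⟨e, r, hr, rfl⟩ := exists_eq_point x
  obtain ⟨f, s, hs, rfl⟩ := exists_eq_point y
  rw [heatKernelDeriv_point ht e f hr hs]
  exact hasDerivAt_heatKernel_point ht e f hr hs

theorem heatKernelDeriv_symm (t : ℝ) (x y : LatticeGraph d) :
    heatKernelDeriv t x y = heatKernelDeriv t y x := by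
  rw [heatKernelDeriv, heatKernelDeriv]
  simp only [heatKernel_symm _ x y]

theorem measurable_sourceSum [NeZero d] (k : ℕ) {t : ℝ} (ht : 0 < t) (e : DirEdge d) (r : ℝ) :
    Measurable fun w : ((Fin d → ℤ) × Fin d) × ℝ => sourceSum k t e r (forward w.1) w.2 := by
  refine measurable_from_prod_countable_right fun ε => ?_
  unfold sourceSum
  have h1 := continuous_transport k ht e (forward ε)
  have h2 := continuous_transport k ht e (reverse (forward ε))
  exact (by fun_prop : Continuous fun s => transport k t e (forward ε) (r - s) +
    transport k t e (reverse (forward ε)) (r + s - 1)).measurable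

/-- The majorant of the kernel is bounded and integrable, hence square integrable. -/
theorem memLp_edgeWeight [NeZero d] (e : DirEdge d) :
    MemLp (fun w => edgeWeight e (forward w.1)) 2 (edgeMeasure d) := by
  obtain ⟨C, hC, h⟩ := exists_edgeWeight_le d
  have hi := integrable_edgeWeight e
  refine (memLp_two_iff_integrable_sq hi.aestronglyMeasurable).2
    ((hi.const_mul C).mono' (hi.aestronglyMeasurable.pow 2) (ae_of_all _ fun w => ?_))
  rw [Real.norm_eq_abs, abs_of_nonneg (sq_nonneg _), sq]
  exact mul_le_mul_of_nonneg_right (h _ _) (edgeWeight_nonneg _ _)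

theorem aestronglyMeasurable_comp_edgeMap {V : Type*} [TopologicalSpace V] {f : LatticeGraph d → V}
    (hf : AEStronglyMeasurable f (length d)) :
    AEStronglyMeasurable (fun w => f (edgeMap d w)) (edgeMeasure d) := by
  rw [length_eq_map] at hf
  exact hf.comp_measurable measurable_edgeMap

theorem memLp_of_edgeWeight [NeZero d] {φ : LatticeGraph d → ℝ}
    (hφ : AEStronglyMeasurable φ (length d)) {e : DirEdge d} {C : ℝ}
    (h : ∀ ε, ∀ s ∈ Icc (0 : ℝ) 1, |φ (edge ε.1 ε.2 s)| ≤ C * edgeWeight e (forward ε)) :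
    MemLp φ 2 (length d) := by
  have h1 := aestronglyMeasurable_comp_edgeMap hφ
  rw [length_eq_map] at hφ ⊢
  refine (memLp_map_measure_iff hφ measurable_edgeMap.aemeasurable).2 ?_
  refine ((memLp_edgeWeight e).const_mul C).mono' h1 ?_
  filter_upwards [ae_edgeMeasure_mem] with w hw
  exact h w.1 w.2 hw

theorem exists_abs_heatKernel_edge_le [NeZero d] {t : ℝ} (ht : 0 < t) (x : LatticeGraph d) :
    ∃ e C, ∀ ε, ∀ s ∈ Icc (0 : ℝ) 1,
      |heatKernel t x (edge ε.1 ε.2 s)| ≤ C * edgeWeight e (forward ε) ∧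
      |heatKernelDeriv t x (edge ε.1 ε.2 s)| ≤ C * edgeWeight e (forward ε) := by
  obtain ⟨e, r, hr, rfl⟩ := exists_eq_point x
  obtain ⟨C0, hC0, h0⟩ := exists_abs_sourceSum_le d 0 t 1
  obtain ⟨C2, hC2, h2⟩ := exists_abs_sourceSum_le d 2 t 1
  have hN := heatNorm_pos ht
  have hr1 : |r| ≤ 1 := by rw [abs_of_nonneg hr.1]; exact hr.2
  refine ⟨e, heatNorm t * C0 + heatNorm t * ((4 * t ^ 2)⁻¹ * C2 + (2 * t)⁻¹ * C0),
    fun ε s hs => ?_⟩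
  have h0' := h0 t ht le_rfl e (forward ε) r hr1 s hs
  have h2' := h2 t ht le_rfl e (forward ε) r hr1 s hs
  have hw := edgeWeight_nonneg e (forward ε)
  rw [← point_forward, heatKernel_point ht _ _ hr hs, heatKernelDeriv_point ht _ _ hr hs]
  rw [abs_mul, abs_mul, abs_of_pos hN]
  have hA : heatNorm t * |sourceSum 0 t e r (forward ε) s| ≤
      heatNorm t * C0 * edgeWeight e (forward ε) := by
    rw [mul_assoc]; gcongr
  have hB : heatNorm t * |(4 * t ^ 2)⁻¹ * sourceSum 2 t e r (forward ε) s -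
      (2 * t)⁻¹ * sourceSum 0 t e r (forward ε) s| ≤
      heatNorm t * ((4 * t ^ 2)⁻¹ * C2 + (2 * t)⁻¹ * C0) * edgeWeight e (forward ε) := by
    rw [mul_assoc]
    refine mul_le_mul_of_nonneg_left ((abs_sub _ _).trans ?_) hN.le
    rw [abs_mul, abs_mul, abs_of_pos (by positivity : 0 < (4 * t ^ 2)⁻¹),
      abs_of_pos (by positivity : 0 < (2 * t)⁻¹), add_mul, mul_assoc, mul_assoc]
    gcongr
  have hA0 : 0 ≤ heatNorm t * C0 * edgeWeight e (forward ε) := by positivity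
  have hB0 : 0 ≤ heatNorm t * ((4 * t ^ 2)⁻¹ * C2 + (2 * t)⁻¹ * C0) * edgeWeight e (forward ε) := by
    positivity
  constructor <;> rw [add_mul] <;> linarith

theorem continuous_heatKernelDeriv [NeZero d] {t : ℝ} (ht : 0 < t) (x : LatticeGraph d) :
    Continuous (heatKernelDeriv t x) := by
  obtain ⟨e, r, hr, rfl⟩ := exists_eq_point x
  refine continuous_of_edge fun z i => ?_
  have h : ∀ k, Continuous fun s => sourceSum k t e r (z, i, true) s := fun k => by
    unfold sourceSum
    have h1 := continuous_transport k ht e (z, i, true)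
    have h2 := continuous_transport k ht e (reverse (z, i, true))
    fun_prop
  have h2 : ContinuousOn (fun s => heatNorm t * ((4 * t ^ 2)⁻¹ * sourceSum 2 t e r (z, i, true) s -
      (2 * t)⁻¹ * sourceSum 0 t e r (z, i, true) s)) (Icc 0 1) :=
    (continuous_const.mul ((continuous_const.mul (h 2)).sub
      (continuous_const.mul (h 0)))).continuousOn
  refine h2.congr fun s hs => ?_
  have h3 := heatKernelDeriv_point ht e (forward (z, i)) hr hs
  rw [point_forward] at h3
  exact h3

theorem memLp_heatKernel [NeZero d] {t : ℝ} (ht : 0 < t) (x : LatticeGraph d) :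
    MemLp (heatKernel t x) 2 (length d) := by
  obtain ⟨e, C, h⟩ := exists_abs_heatKernel_edge_le ht x
  exact memLp_of_edgeWeight (continuous_heatKernel_right ht x).aestronglyMeasurable
    fun ε s hs => (h ε s hs).1

theorem memLp_heatKernelDeriv [NeZero d] {t : ℝ} (ht : 0 < t) (x : LatticeGraph d) :
    MemLp (heatKernelDeriv t x) 2 (length d) := by
  obtain ⟨e, C, h⟩ := exists_abs_heatKernel_edge_le ht x
  exact memLp_of_edgeWeight (continuous_heatKernelDeriv ht x).aestronglyMeasurable
    fun ε s hs => (h ε s hs).2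

/-- The heat kernel as a function of one of its arguments belongs to the domain of the operator
on smooth functions, and it solves the heat equation. -/
theorem heatKernel_isKirchhoffSmooth [NeZero d] {t : ℝ} (ht : 0 < t) (x : LatticeGraph d) :
    IsKirchhoffSmooth (fun y => (heatKernel t x y : ℂ)) ∧
    ∀ z i, ∀ s ∈ Icc (0 : ℝ) 1, iteratedDerivWithin 2
      (fun s => (heatKernel t x (edge z i s) : ℂ)) (Icc 0 1) s = heatKernelDeriv t x (edge z i s) := by
  obtain ⟨e, r, hr, rfl⟩ := exists_eq_point x
  have hu := (isHeatSolution_sourceSum e r).ofReal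
  have h1 : (fun y => (heatKernel t (point e r) y : ℂ)) =
      glue fun e' r' => ((heatNorm t * sourceSum 0 t e' r' e r : ℝ) : ℂ) := by
    funext y
    rw [glue, ← heatKernel_point ht _ _ (coord_mem y) hr, point_coord, heatKernel_symm]
  refine ⟨?_, fun z i s hs => ?_⟩
  · rw [h1]
    exact (hu.isUnfolded ht).isKirchhoffSmooth (hu.contDiff ht)
  · have h2 := (hu.isUnfolded ht).iteratedDerivWithin_glue (fun s => hu.hasDerivAt ht (z, i, true) s)
      (fun s => hu.hasDerivAt_deriv ht (z, i, true) s) hs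
    rw [← h1] at h2
    rw [h2, heatKernelDeriv_symm]
    have h3 := heatKernelDeriv_point ht (forward (z, i)) e hs hr
    rw [point_forward] at h3
    rw [h3]
    rfl

/-! ### Smoothness of the heat flow -/

section Flow

variable {V : Type*} [NormedAddCommGroup V]

/-- The functions on the graph that are integrable against all the majorants `edgeWeight` of the
heat kernel. This class contains the bounded and the square integrable functions, so that both are
treated at once. -/
structure IsModerate (f : LatticeGraph d → V) : Prop where
  aestronglyMeasurable : AEStronglyMeasurable f (length d)
  integrable : ∀ e, Integrable (fun w => edgeWeight e (forward w.1) * ‖f (edgeMap d w)‖)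
    (edgeMeasure d)

theorem isModerate_of_bounded [NeZero d] {f : LatticeGraph d → V}
    (hf : AEStronglyMeasurable f (length d)) {C : ℝ} (hC : ∀ x, ‖f x‖ ≤ C) : IsModerate f where
  aestronglyMeasurable := hf
  integrable e := by
    refine ((integrable_edgeWeight e).mul_const C).mono' ((integrable_edgeWeight
      e).aestronglyMeasurable.mul (aestronglyMeasurable_comp_edgeMap hf).norm)
      (ae_of_all _ fun w => ?_)
    rw [norm_mul, norm_norm, Real.norm_eq_abs, abs_of_nonneg (edgeWeight_nonneg _ _)]
    exact mul_le_mul_of_nonneg_left (hC _) (edgeWeight_nonneg _ _)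

theorem isModerate_of_memLp [NeZero d] {f : LatticeGraph d → V} (hf : MemLp f 2 (length d)) :
    IsModerate f where
  aestronglyMeasurable := hf.1
  integrable e := by
    have h1 : MemLp (fun w => f (edgeMap d w)) 2 (edgeMeasure d) := by
      rw [length_eq_map] at hf
      exact (memLp_map_measure_iff hf.1 measurable_edgeMap.aemeasurable).1 hf
    exact (memLp_edgeWeight e).integrable_mul h1.norm

variable [NormedSpace ℝ V]

/-- The heat flow on a directed edge and its continuation, up to the normalization, together with
the analogous integrals for the other profiles. -/
def edgeFlow (f : LatticeGraph d → V) (k : ℕ) (t : ℝ) (e : DirEdge d) (r : ℝ) : V :=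
  ∫ w, sourceSum k t e r (forward w.1) w.2 • f (edgeMap d w) ∂(edgeMeasure d)

variable {f : LatticeGraph d → V}

theorem IsModerate.exists_bound [NeZero d] (hf : IsModerate f) (k : ℕ) (b R : ℝ) (e : DirEdge d) :
    ∃ g : ((Fin d → ℤ) × Fin d) × ℝ → ℝ, Integrable g (edgeMeasure d) ∧
      ∀ᵐ w ∂(edgeMeasure d), ∀ t, 0 < t → t ≤ b → ∀ r, |r| ≤ R →
        ‖sourceSum k t e r (forward w.1) w.2 • f (edgeMap d w)‖ ≤ g w := by
  obtain ⟨C, hC, h⟩ := exists_abs_sourceSum_le d k b R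
  refine ⟨_, (hf.integrable e).const_mul C, ?_⟩
  filter_upwards [ae_edgeMeasure_mem] with w hw t ht htb r hr
  rw [norm_smul, ← mul_assoc]
  exact mul_le_mul_of_nonneg_right (h t ht htb e _ r hr _ hw) (norm_nonneg _)

theorem IsModerate.aestronglyMeasurable_smul [NeZero d] (hf : IsModerate f) (k : ℕ) {t : ℝ}
    (ht : 0 < t) (e : DirEdge d) (r : ℝ) :
    AEStronglyMeasurable (fun w => sourceSum k t e r (forward w.1) w.2 • f (edgeMap d w))
      (edgeMeasure d) :=
  (measurable_sourceSum k ht e r).aestronglyMeasurable.smul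
    (aestronglyMeasurable_comp_edgeMap hf.aestronglyMeasurable)

theorem IsModerate.integrable_smul [NeZero d] (hf : IsModerate f) (k : ℕ) {t : ℝ}
    (ht : 0 < t) (e : DirEdge d) (r : ℝ) :
    Integrable (fun w => sourceSum k t e r (forward w.1) w.2 • f (edgeMap d w))
      (edgeMeasure d) := by
  obtain ⟨g, hg, h⟩ := hf.exists_bound k t |r| e
  refine hg.mono' (hf.aestronglyMeasurable_smul k ht e r) ?_
  filter_upwards [h] with w hw
  exact hw t ht le_rfl r le_rfl

/-- Differentiation under the integral, along the edge. -/
theorem IsModerate.hasDerivAt_edgeFlow [NeZero d] (hf : IsModerate f) (k : ℕ) {t : ℝ}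
    (ht : 0 < t) (e : DirEdge d) (r : ℝ) :
    HasDerivAt (edgeFlow f k t e)
      ((k : ℝ) • edgeFlow f (k - 1) t e r - (2 * t)⁻¹ • edgeFlow f (k + 1) t e r) r := by
  obtain ⟨g1, hg1, h1⟩ := hf.exists_bound (k - 1) t (|r| + 1) e
  obtain ⟨g2, hg2, h2⟩ := hf.exists_bound (k + 1) t (|r| + 1) e
  have h := (hasDerivAt_integral_of_dominated_loc_of_deriv_le (μ := edgeMeasure d)
    (F := fun r w => sourceSum k t e r (forward w.1) w.2 • f (edgeMap d w))
    (F' := fun r w => (k : ℝ) • (sourceSum (k - 1) t e r (forward w.1) w.2 • f (edgeMap d w)) -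
      (2 * t)⁻¹ • (sourceSum (k + 1) t e r (forward w.1) w.2 • f (edgeMap d w)))
    (bound := fun w => k * g1 w + (2 * t)⁻¹ * g2 w) (x₀ := r)
    (Metric.ball_mem_nhds r one_pos)
    (Eventually.of_forall fun r => hf.aestronglyMeasurable_smul k ht e r)
    (hf.integrable_smul k ht e r) ?_ ?_ ?_ ?_).2
  · have hi : ∀ (c : ℝ) (k : ℕ), Integrable (fun w => c • (sourceSum k t e r (forward w.1) w.2 •
        f (edgeMap d w))) (edgeMeasure d) := fun c k => (hf.integrable_smul k ht e r).smul c
    rw [integral_sub (hi _ _) (hi _ _), integral_smul, integral_smul] at h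
    exact h
  · exact ((hf.aestronglyMeasurable_smul _ ht e r).const_smul _).sub
      ((hf.aestronglyMeasurable_smul _ ht e r).const_smul _)
  · filter_upwards [h1, h2] with w hw1 hw2 x hx
    have hx' : |x| ≤ |r| + 1 := by
      rw [Metric.mem_ball, Real.dist_eq] at hx
      have := abs_sub_abs_le_abs_sub x r
      linarith
    refine (norm_sub_le _ _).trans (add_le_add ?_ ?_)
    · rw [norm_smul, Real.norm_natCast]
      exact mul_le_mul_of_nonneg_left (hw1 t ht le_rfl x hx') (by positivity)
    · rw [norm_smul, Real.norm_of_nonneg (by positivity)]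
      exact mul_le_mul_of_nonneg_left (hw2 t ht le_rfl x hx') (by positivity)
  · exact (hg1.const_mul _).add (hg2.const_mul _)
  · refine ae_of_all _ fun w x _ => ?_
    have := (hasDerivAt_sourceSum k ht e x (forward w.1) w.2).smul_const (f (edgeMap d w))
    convert! this using 1
    rw [sub_smul, mul_smul, mul_smul]

/-- Differentiation under the integral, in time. -/
theorem IsModerate.hasDerivAt_edgeFlow_time [NeZero d] (hf : IsModerate f) (k : ℕ) {t : ℝ}
    (ht : 0 < t) (e : DirEdge d) (r : ℝ) :
    HasDerivAt (fun τ => edgeFlow f k τ e r) ((4 * t ^ 2)⁻¹ • edgeFlow f (k + 2) t e r) t := by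
  obtain ⟨g, hg, h1⟩ := hf.exists_bound (k + 2) (2 * t) |r| e
  have h := (hasDerivAt_integral_of_dominated_loc_of_deriv_le (μ := edgeMeasure d)
    (F := fun τ w => sourceSum k τ e r (forward w.1) w.2 • f (edgeMap d w))
    (F' := fun τ w => (4 * τ ^ 2)⁻¹ • (sourceSum (k + 2) τ e r (forward w.1) w.2 •
      f (edgeMap d w)))
    (bound := fun w => (t ^ 2)⁻¹ * g w) (x₀ := t) (s := Ioo (t / 2) (2 * t))
    (Ioo_mem_nhds (by linarith) (by linarith)) ?_
    (hf.integrable_smul k ht e r) ?_ ?_ ?_ ?_).2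
  · rw [integral_smul] at h
    exact h
  · filter_upwards [lt_mem_nhds ht] with τ hτ
    exact hf.aestronglyMeasurable_smul k hτ e r
  · exact (hf.aestronglyMeasurable_smul _ ht e r).const_smul _
  · filter_upwards [h1] with w hw1 τ hτ
    have hτ0 : 0 < τ := by linarith [hτ.1]
    rw [norm_smul, Real.norm_of_nonneg (by positivity)]
    refine mul_le_mul ?_ (hw1 τ hτ0 hτ.2.le r le_rfl) (norm_nonneg _) (by positivity)
    refine inv_anti₀ (by positivity) ?_
    nlinarith [hτ.1]
  · exact hg.const_mul _
  · refine ae_of_all _ fun w τ hτ => ?_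
    have hτ0 : 0 < τ := by linarith [hτ.1]
    have := (hasDerivAt_sourceSum_time k hτ0 e r (forward w.1) w.2).smul_const (f (edgeMap d w))
    convert! this using 1
    rw [mul_smul]

theorem IsModerate.isUnfolded_edgeFlow [NeZero d] (hf : IsModerate f) {t : ℝ} (ht : 0 < t) :
    IsUnfolded (edgeFlow f 0 t) where
  reverse e s := integral_congr_ae (ae_of_all _ fun w => by
    simp only [(isUnfolded_sourceSum ht (forward w.1) w.2).reverse e s])
  shift e s := by
    have hi : Integrable (fun w => (d : ℝ)⁻¹ • ∑ b, sourceSum 0 t (target e, b) s (forward w.1) w.2 •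
        f (edgeMap d w)) (edgeMeasure d) :=
      (integrable_finsetSum _ fun b _ => hf.integrable_smul 0 ht (target e, b) s).smul _
    have h1 : edgeFlow f 0 t e (s + 1) = ∫ w, ((d : ℝ)⁻¹ • ∑ b, sourceSum 0 t (target e, b) s
        (forward w.1) w.2 • f (edgeMap d w) - sourceSum 0 t (DirEdge.reverse e) s (forward w.1) w.2 •
        f (edgeMap d w)) ∂(edgeMeasure d) := integral_congr_ae (ae_of_all _ fun w => by
      simp only [(isUnfolded_sourceSum ht (forward w.1) w.2).shift e s, sub_smul, smul_assoc,
        Finset.sum_smul])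
    rw [h1, integral_sub hi (hf.integrable_smul 0 ht _ s), integral_smul,
      integral_finsetSum _ fun b _ => hf.integrable_smul 0 ht (target e, b) s]
    rfl

theorem IsModerate.heatFlow_point [NeZero d] (hf : IsModerate f) {t : ℝ} (ht : 0 < t)
    (e : DirEdge d) {r : ℝ} (hr : r ∈ Icc (0 : ℝ) 1) :
    heatFlow t f (point e r) = heatNorm t • edgeFlow f 0 t e r := by
  have hm : AEStronglyMeasurable (fun y => heatKernel t (point e r) y • f y) (length d) :=
    (continuous_heatKernel_right ht _).aestronglyMeasurable.smul hf.aestronglyMeasurable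
  rw [heatFlow, integral_eq_edge hm, edgeFlow, ← integral_smul]
  refine integral_congr_ae ?_
  filter_upwards [ae_edgeMeasure_mem] with w hw
  rw [heatKernel_edgeMap ht e hr hw, mul_smul]

theorem IsModerate.integrable_heatKernel_smul [NeZero d] (hf : IsModerate f) {t : ℝ} (ht : 0 < t)
    (x : LatticeGraph d) : Integrable (fun y => heatKernel t x y • f y) (length d) := by
  obtain ⟨e, r, hr, rfl⟩ := exists_eq_point x
  refine (integrable_iff_edge ((continuous_heatKernel_right ht _).aestronglyMeasurable.smul
    hf.aestronglyMeasurable)).2 (((hf.integrable_smul 0 ht e r).smul (heatNorm t)).congr ?_)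
  filter_upwards [ae_edgeMeasure_mem] with w hw
  simp only [Pi.smul_apply, Pi.smul_apply']
  rw [heatKernel_edgeMap ht e hr hw, mul_smul]

/-- The heat flow of a function, on the directed edges. -/
theorem IsModerate.isHeatSolution [NeZero d] (hf : IsModerate f) :
    IsHeatSolution (fun t e r => heatNorm t • edgeFlow f 0 t e r)
      (fun t e r => heatNorm t • (-(2 * t)⁻¹ • edgeFlow f 1 t e r))
      (fun t e r => heatNorm t • ((4 * t ^ 2)⁻¹ • edgeFlow f 2 t e r -
        (2 * t)⁻¹ • edgeFlow f 0 t e r)) :=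
  isHeatSolution_of_profile (fun ht => hf.isUnfolded_edgeFlow ht)
    (fun ht k e r => hf.hasDerivAt_edgeFlow k ht e r)
    (fun ht k e r => hf.hasDerivAt_edgeFlow_time k ht e r)

/-- The time derivative of the heat flow. -/
def heatFlowDeriv (t : ℝ) (f : LatticeGraph d → V) (x : LatticeGraph d) : V :=
  deriv (fun τ => heatFlow τ f x) t

theorem IsModerate.hasDerivAt_heatFlow_point [NeZero d] (hf : IsModerate f) {t : ℝ} (ht : 0 < t)
    (e : DirEdge d) {r : ℝ} (hr : r ∈ Icc (0 : ℝ) 1) :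
    HasDerivAt (fun τ => heatFlow τ f (point e r)) (heatNorm t • ((4 * t ^ 2)⁻¹ • edgeFlow f 2 t e r -
        (2 * t)⁻¹ • edgeFlow f 0 t e r)) t := by
  refine (hf.isHeatSolution.hasDerivAt_time ht e r).congr_of_eventuallyEq ?_
  filter_upwards [lt_mem_nhds ht] with τ hτ
  exact hf.heatFlow_point hτ e hr

theorem IsModerate.hasDerivAt_heatFlow [NeZero d] (hf : IsModerate f) {t : ℝ} (ht : 0 < t)
    (x : LatticeGraph d) : HasDerivAt (fun τ => heatFlow τ f x) (heatFlowDeriv t f x) t := by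
  obtain ⟨e, r, hr, rfl⟩ := exists_eq_point x
  rw [heatFlowDeriv, (hf.hasDerivAt_heatFlow_point ht e hr).deriv]
  exact hf.hasDerivAt_heatFlow_point ht e hr

theorem IsModerate.continuous_heatFlow [NeZero d] (hf : IsModerate f) {t : ℝ} (ht : 0 < t) :
    Continuous (heatFlow t f) := by
  refine continuous_of_edge fun z i => ?_
  refine ContinuousOn.congr (f := fun s => heatNorm t • edgeFlow f 0 t (forward (z, i)) s) ?_
    fun s hs => ?_
  · exact (hf.isHeatSolution.contDiff ht _).continuous.continuousOn
  · have := hf.heatFlow_point ht (forward (z, i)) hs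
    rwa [point_forward] at this

end Flow

/-- The heat flow maps into the smooth functions with Kirchhoff's conditions. -/
theorem IsModerate.isKirchhoffSmooth_heatFlow [NeZero d] {f : LatticeGraph d → ℂ}
    (hf : IsModerate f) {t : ℝ} (ht : 0 < t) :
    IsKirchhoffSmooth (heatFlow t f) ∧
    ∀ z i, ∀ s ∈ Icc (0 : ℝ) 1, iteratedDerivWithin 2
      (fun s => heatFlow t f (edge z i s)) (Icc 0 1) s = heatFlowDeriv t f (edge z i s) := by
  have hu := hf.isHeatSolution
  have h1 : heatFlow t f = glue fun e r => heatNorm t • edgeFlow f 0 t e r := by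
    funext y
    rw [glue, ← hf.heatFlow_point ht _ (coord_mem y), point_coord]
  refine ⟨?_, fun z i s hs => ?_⟩
  · rw [h1]
    exact (hu.isUnfolded ht).isKirchhoffSmooth (hu.contDiff ht)
  · have h2 := (hu.isUnfolded ht).iteratedDerivWithin_glue (fun s => hu.hasDerivAt ht (z, i, true) s)
      (fun s => hu.hasDerivAt_deriv ht (z, i, true) s) hs
    rw [← h1] at h2
    have h3 := (hf.hasDerivAt_heatFlow_point ht (forward (z, i)) hs).deriv
    rw [point_forward] at h3
    rw [h2, heatFlowDeriv, h3]
    rfl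

/-! ### Positivity: the minimum principle -/

/-- The necessary second order condition at a minimum. -/
theorem nonneg_of_isLocalMin {w w' : ℝ → ℝ} {c a : ℝ} (h : ∀ s, HasDerivAt w (w' s) s)
    (h2 : HasDerivAt w' c a) (hmin : IsLocalMin w a) : 0 ≤ c := by
  by_contra! hc
  have hd : deriv w = w' := funext fun s => (h s).deriv
  have hmax : IsLocalMax w a := by
    refine isLocalMax_of_deriv_deriv_neg ?_ hmin.deriv_eq_zero (h a).continuousAt
    rwa [hd, h2.deriv]
  have hconst : w =ᶠ[𝓝 a] fun _ => w a := by
    filter_upwards [hmin, hmax] with s h3 h4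
    exact le_antisymm h4 h3
  have h5 : w' =ᶠ[𝓝 a] fun _ => 0 := by
    filter_upwards [hconst.eventuallyEq_nhds] with s hs
    rw [← hd, hs.deriv_eq, deriv_const]
  have h6 := h2.deriv
  rw [h5.deriv_eq, deriv_const] at h6
  linarith

/-- Kirchhoff's condition makes the vertices as good as inner points for the second derivative
test: the mean over the edges at a vertex is an even smooth function. -/
theorem IsHeatSolution.nonneg_of_min [NeZero d] {u u' u'' : ℝ → DirEdge d → ℝ → ℝ}
    (hu : IsHeatSolution u u' u'') {t : ℝ} (ht : 0 < t) {c : ℝ} {e : DirEdge d} {r : ℝ}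
    (hr : r ∈ Ioc (0 : ℝ) 1) (hc : u t e r = c) (hmin : ∀ f, ∀ s ∈ Icc (0 : ℝ) 1, c ≤ u t f s) :
    0 ≤ u'' t e r := by
  have hd : (0 : ℝ) < d := Nat.cast_pos.2 (NeZero.pos d)
  rcases hr.2.lt_or_eq with hr1 | rfl
  · refine nonneg_of_isLocalMin (hu.hasDerivAt ht e) (hu.hasDerivAt_deriv ht e r) ?_
    filter_upwards [Ioo_mem_nhds hr.1 hr1] with s hs
    rw [hc]
    exact hmin e s (Ioo_subset_Icc_self hs)
  -- at a vertex, the mean over the edges is considered instead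
  · have hw : ∀ s, HasDerivAt (fun s => u t e (1 + s) + u t e (1 - s))
        (u' t e (1 + s) - u' t e (1 - s)) s := fun s => by
      have h3 := (hu.hasDerivAt ht e (1 + s)).comp_const_add 1 s
      have h4 := (hu.hasDerivAt ht e (1 - s)).comp_const_sub 1 s
      exact h3.add h4
    have hw' : HasDerivAt (fun s => u' t e (1 + s) - u' t e (1 - s)) (2 * u'' t e 1) 0 := by
      have h3 := (hu.hasDerivAt_deriv ht e (1 + 0)).comp_const_add 1 0
      have h4 := (hu.hasDerivAt_deriv ht e (1 - 0)).comp_const_sub 1 0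
      have h5 := h3.sub h4
      rw [add_zero, sub_zero, sub_neg_eq_add, ← two_mul] at h5
      exact h5
    have hge : ∀ s ∈ Icc (0 : ℝ) 1, 2 * c ≤ u t e (1 + s) + u t e (1 - s) := by
      intro s hs
      rw [(hu.isUnfolded ht).add_reflect, smul_eq_mul, inv_mul_eq_div, le_div_iff₀ hd]
      calc 2 * c * d = ∑ _b : Fin d × Bool, c := by rw [sum_const_dir]; ring
        _ ≤ _ := Finset.sum_le_sum fun b _ => hmin _ s hs
    have hlm : IsLocalMin (fun s => u t e (1 + s) + u t e (1 - s)) 0 := by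
      filter_upwards [Ioo_mem_nhds (show (-1 : ℝ) < 0 by norm_num) one_pos] with s hs
      simp only [add_zero, sub_zero, hc, ← two_mul]
      rcases le_total 0 s with h0 | h0
      · exact hge s ⟨h0, hs.2.le⟩
      · have := hge (-s) ⟨by linarith, by linarith [hs.1]⟩
        rw [sub_neg_eq_add, ← sub_eq_add_neg] at this
        linarith
    have := nonneg_of_isLocalMin hw hw' hlm
    linarith

theorem exists_eq_point_pos (x : LatticeGraph d) : ∃ e, ∃ s ∈ Ioc (0 : ℝ) 1, x = point e s := by
  obtain ⟨e, s, hs, rfl⟩ := exists_eq_point x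
  rcases hs.1.eq_or_lt with rfl | h
  · exact ⟨reverse e, 1, by simp, by rw [point_reverse, sub_self]⟩
  · exact ⟨e, s, ⟨h, hs.2⟩, rfl⟩

theorem nonpos_of_min_left {w : ℝ → ℝ} {c a : ℝ} (h : HasDerivAt w c a) {b : ℝ} (hb : b < a)
    (hmin : ∀ s, b < s → s < a → w a ≤ w s) : c ≤ 0 := by
  have h1 := (hasDerivWithinAt_iff_tendsto_slope' (s := Iio a) (by simp)).1 h.hasDerivWithinAt
  refine le_of_tendsto h1 ?_
  filter_upwards [Ioo_mem_nhdsLT hb] with s hs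
  rw [slope_def_field]
  exact div_nonpos_of_nonneg_of_nonpos (sub_nonneg.2 (hmin s hs.1 hs.2)) (by linarith [hs.2])

theorem continuousOn_heatFlow [NeZero d] {f : LatticeGraph d → ℝ} (hf : Continuous f)
    (hfs : HasCompactSupport f) :
    ContinuousOn (fun q : ℝ × LatticeGraph d => heatFlow q.1 f q.2) (Ioi 0 ×ˢ univ) := by
  refine continuousOn_integral_of_compact_support (f := fun (q : ℝ × LatticeGraph d) y =>
    heatKernel q.1 q.2 y • f y) hfs ?_ fun q y _ hy => ?_
  · have h1 : ContinuousOn (fun q : (ℝ × LatticeGraph d) × LatticeGraph d =>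
        heatKernel q.1.1 q.1.2 q.2) ((Ioi 0 ×ˢ univ) ×ˢ univ) :=
      continuousOn_heatKernel.comp (f := fun q : (ℝ × LatticeGraph d) × LatticeGraph d =>
        (q.1.1, q.1.2, q.2)) (by fun_prop) fun q hq => ⟨hq.1.1, mem_univ _⟩
    exact h1.smul (by fun_prop : Continuous fun q : (ℝ × LatticeGraph d) × LatticeGraph d =>
      f q.2).continuousOn
  · simp only [image_eq_zero_of_notMem_tsupport hy, smul_zero]

/-- The minimum principle. The flow starts from `f ≥ 0` and decays at infinity, so a negative value
would lead to a negative minimum over a compact set of positive times and points. There the time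
derivative is not positive and the second derivative is not negative, a contradiction after an
increasing linear function of time has been added. -/
theorem heatFlow_nonneg_of_hasCompactSupport [NeZero d] {f : LatticeGraph d → ℝ}
    (hf : Continuous f) (hfs : HasCompactSupport f) (hpos : ∀ x, 0 ≤ f x) {T : ℝ} (hT : 0 < T)
    (x₁ : LatticeGraph d) : 0 ≤ heatFlow T f x₁ := by
  by_contra! hneg
  obtain ⟨C, hC⟩ := hfs.exists_bound_of_continuous hf
  have hmod : IsModerate f := isModerate_of_bounded hf.aestronglyMeasurable hC
  -- the perturbed flow `v` satisfies `v' > v''`, and it attains a negative minimum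
  set ε := -heatFlow T f x₁ / (2 * T) with hε
  have hε0 : 0 < ε := div_pos (by linarith) (by linarith)
  set m := heatFlow T f x₁ / 2 with hm
  have hm0 : m < 0 := by linarith
  let v : ℝ × LatticeGraph d → ℝ := fun q => heatFlow q.1 f q.2 + ε * q.1
  have hv1 : v (T, x₁) = m := by
    simp only [v, hε, hm]
    field_simp
    ring
  have hinit := Metric.tendstoUniformly_iff.1
    (tendstoUniformly_heatFlow (hf.uniformContinuous_of_tendsto_cocompact
      hfs.is_zero_at_infty) hC) (-m) (by linarith)
  obtain ⟨τ, hτ, hinit⟩ := mem_nhdsGT_iff_exists_Ioo_subset.1 hinit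
  have hτ0 : (0 : ℝ) < τ := hτ
  have hfar := eventually_norm_heatFlow_lt hC hfs.is_zero_at_infty T (ε := -m) (by linarith)
  obtain ⟨K, hK, hfar⟩ := mem_cocompact'.1 hfar
  -- a value of at most `m` is possible only on the compact set `[τ, T] × K`
  have hout : ∀ t x, 0 < t → t ≤ T → (t < τ ∨ x ∉ K) → m < v (t, x) := by
    intro t x ht htT h
    have h1 : 0 < ε * t := mul_pos hε0 ht
    rcases h with h | h
    · have h2 := hinit ⟨ht, h⟩ x
      rw [Real.dist_eq] at h2
      have := (abs_lt.1 h2).2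
      have := hpos x
      simp only [v]
      linarith
    · have h2 : ∀ t, 0 < t → t ≤ T → ‖heatFlow t f x‖ < -m := by
        by_contra h3
        exact h (hfar h3)
      have := (abs_lt.1 (h2 t ht htT)).1
      simp only [v]
      linarith
  have hT1 : τ ≤ T ∧ x₁ ∈ K := by
    by_contra! h
    refine (hout T x₁ hT le_rfl ?_).ne' hv1
    by_cases h3 : T < τ
    · exact Or.inl h3
    · exact Or.inr (h (not_lt.1 h3))
  have hS : IsCompact (Icc τ T ×ˢ K) := isCompact_Icc.prod hK
  have hvc : ContinuousOn v (Icc τ T ×ˢ K) := by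
    refine ContinuousOn.add ((continuousOn_heatFlow hf hfs).mono ?_) (by fun_prop)
    exact prod_mono (fun t ht => hτ0.trans_le ht.1) (subset_univ _)
  obtain ⟨⟨t, x⟩, hq, hqmin⟩ := hS.exists_isMinOn ⟨(T, x₁), ⟨hT1.1, le_rfl⟩, hT1.2⟩ hvc
  have hvm : v (t, x) ≤ m := by
    rw [← hv1]
    exact hqmin ⟨⟨hT1.1, le_rfl⟩, hT1.2⟩
  have ht0 : 0 < t := hτ0.trans_le hq.1.1
  have hmin : ∀ t' x', 0 < t' → t' ≤ T → v (t, x) ≤ v (t', x') := by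
    intro t' x' ht' hT'
    by_cases h : t' < τ ∨ x' ∉ K
    · exact hvm.trans (hout t' x' ht' hT' h).le
    · push Not at h
      exact hqmin (⟨⟨h.1, hT'⟩, h.2⟩ : (t', x') ∈ Icc τ T ×ˢ K)
  have hu := hmod.isHeatSolution
  obtain ⟨e, r, hr, rfl⟩ := exists_eq_point_pos x
  have hr' := Ioc_subset_Icc_self hr
  have htime := hmod.hasDerivAt_heatFlow_point ht0 e hr'
  have h1 : HasDerivAt (fun t => v (t, point e r)) _ t :=
    htime.add ((hasDerivAt_id t).const_mul ε)
  have h2 := nonpos_of_min_left h1 ht0 fun s hs hst => hmin s _ hs (hst.le.trans hq.1.2)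
  have h3 := hu.nonneg_of_min ht0 hr (c := heatFlow t f (point e r))
    (hmod.heatFlow_point ht0 e hr').symm fun g s hs => by
      rw [← hmod.heatFlow_point ht0 g hs]
      have := hmin t (point g s) ht0 hq.1.2
      simp only [v] at this
      linarith
  linarith

/-- If the kernel were negative at `y`, the flow of a nonnegative bump at `y` would be negative at `x`. -/
theorem heatKernel_nonneg [NeZero d] {t : ℝ} (ht : 0 < t) (x y : LatticeGraph d) :
    0 ≤ heatKernel t x y := by
  by_contra! hneg
  have hc := continuous_heatKernel_right ht x
  obtain ⟨δ, hδ, hball⟩ := Metric.eventually_nhds_iff.1 (hc.continuousAt.eventually_lt_const hneg)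
  let f : LatticeGraph d → ℝ := fun z => max 0 (δ - dist z y)
  have hf : Continuous f := by fun_prop
  have hfs : HasCompactSupport f := HasCompactSupport.intro (isCompact_closedBall y δ) fun z hz => by
    rw [Metric.mem_closedBall, not_le] at hz
    exact max_eq_left (by linarith)
  have h1 := heatFlow_nonneg_of_hasCompactSupport hf hfs (fun z => le_max_left _ _) ht x
  have h2 : ∀ z, heatKernel t x z * f z ≤ 0 := by
    intro z
    by_cases hz : dist z y < δ
    · exact mul_nonpos_of_nonpos_of_nonneg (hball hz).le (le_max_left _ _)
    · rw [show f z = 0 from max_eq_left (by linarith), mul_zero]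
  have hi : Integrable (fun z => heatKernel t x z * f z) (length d) :=
    (hc.mul hf).integrable_of_hasCompactSupport hfs.mul_left
  have h3 : ∫ z, -(heatKernel t x z * f z) ∂(length d) = 0 := by
    refine le_antisymm ?_ (integral_nonneg fun z => neg_nonneg.2 (h2 z))
    rw [integral_neg]
    exact neg_nonpos.2 h1
  rw [integral_eq_zero_iff_of_nonneg (fun z => neg_nonneg.2 (h2 z)) hi.neg] at h3
  have h4 : (fun z => -(heatKernel t x z * f z)) = fun _ => 0 :=
    (Continuous.ae_eq_iff_eq (length d) (hc.mul hf).neg continuous_const).1 h3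
  have h5 := congrFun h4 y
  simp only [f, dist_self, sub_zero, max_eq_right hδ.le] at h5
  have h6 := mul_neg_of_neg_of_pos hneg hδ
  linarith

/-! ### The heat semigroup on the square integrable functions -/

theorem lintegral_heatKernel [NeZero d] {t : ℝ} (ht : 0 < t) (x : LatticeGraph d) :
    ∫⁻ y, ENNReal.ofReal (heatKernel t x y) ∂(length d) = 1 := by
  rw [← ofReal_integral_eq_lintegral_ofReal (integrable_heatKernel ht x)
    (ae_of_all _ (heatKernel_nonneg ht x)), integral_heatKernel ht, ENNReal.ofReal_one]

theorem kernelOp_heatKernel (t : ℝ) (f : LatticeGraph d → ℂ) :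
    kernelOp (length d) heatKernel t f = heatFlow t f := by
  funext x
  simp only [kernelOp, heatFlow, Complex.real_smul]

section Normed

variable {V : Type*} [NormedAddCommGroup V] [NormedSpace ℝ V]

theorem heatFlow_congr {f g : LatticeGraph d → V} (h : f =ᵐ[length d] g) (t : ℝ) :
    heatFlow t f = heatFlow t g := by
  funext x
  refine integral_congr_ae ?_
  filter_upwards [h] with y hy
  rw [hy]

/-- Jensen's inequality for the heat kernel. -/
theorem sq_integral_heatKernel_le [NeZero d] {t : ℝ} (ht : 0 < t) {φ : LatticeGraph d → ℝ}
    (hφ : MemLp φ 2 (length d)) (x : LatticeGraph d) :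
    Integrable (fun y => heatKernel t x y * φ y ^ 2) (length d) ∧
    (∫ y, heatKernel t x y * φ y ∂(length d)) ^ 2 ≤
      ∫ y, heatKernel t x y * φ y ^ 2 ∂(length d) := by
  obtain ⟨C, hC⟩ := exists_abs_heatKernel_le (d := d) ht
  have hm := (continuous_heatKernel_right ht x).aestronglyMeasurable (μ := length d)
  have h1 : Integrable (fun y => heatKernel t x y * φ y ^ 2) (length d) :=
    hφ.integrable_sq.bdd_mul hm (c := C) (ae_of_all _ fun y => hC x y)
  have h2 : Integrable (fun y => heatKernel t x y * φ y) (length d) :=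
    (isModerate_of_memLp hφ).integrable_heatKernel_smul ht x
  refine ⟨h1, ?_⟩
  set m := ∫ y, heatKernel t x y * φ y ∂(length d)
  have h3 : 0 ≤ ∫ y, heatKernel t x y * (φ y - m) ^ 2 ∂(length d) :=
    integral_nonneg fun y => mul_nonneg (heatKernel_nonneg ht x y) (sq_nonneg _)
  have h4 : ∀ y, heatKernel t x y * (φ y - m) ^ 2 = heatKernel t x y * φ y ^ 2 -
      2 * m * (heatKernel t x y * φ y) + m ^ 2 * heatKernel t x y := fun y => by ring
  simp only [h4] at h3
  have h5 : Integrable (fun y => heatKernel t x y * φ y ^ 2 - 2 * m * (heatKernel t x y * φ y))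
    (length d) := h1.sub (h2.const_mul _)
  rw [integral_add h5 ((integrable_heatKernel ht x).const_mul _),
    integral_sub h1 (h2.const_mul _), integral_const_mul, integral_const_mul,
    integral_heatKernel ht] at h3
  change 0 ≤ _ - 2 * m * m + m ^ 2 * 1 at h3
  linarith

theorem norm_heatFlow_le_integral [NeZero d] {t : ℝ} (ht : 0 < t) (f : LatticeGraph d → V)
    (x : LatticeGraph d) : ‖heatFlow t f x‖ ≤ ∫ y, heatKernel t x y * ‖f y‖ ∂(length d) := by
  refine (norm_integral_le_integral_norm _).trans_eq (integral_congr_ae (ae_of_all _ fun y => ?_))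
  simp only [norm_smul, Real.norm_of_nonneg (heatKernel_nonneg ht x y)]

/-- The heat flow is a contraction for the `L²` norm. -/
theorem memLp_heatFlow [NeZero d] {t : ℝ} (ht : 0 < t) {f : LatticeGraph d → V}
    (hf : MemLp f 2 (length d)) :
    MemLp (heatFlow t f) 2 (length d) ∧
      eLpNorm (heatFlow t f) 2 (length d) ≤ eLpNorm f 2 (length d) := by
  have hm : AEStronglyMeasurable (heatFlow t f) (length d) :=
    ((isModerate_of_memLp hf).continuous_heatFlow ht).aestronglyMeasurable
  have hmain : ∫⁻ x, ‖heatFlow t f x‖ₑ ^ 2 ∂(length d) ≤ ∫⁻ y, ‖f y‖ₑ ^ 2 ∂(length d) := by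
    calc ∫⁻ x, ‖heatFlow t f x‖ₑ ^ 2 ∂(length d)
        ≤ ∫⁻ x, ∫⁻ y, ENNReal.ofReal (heatKernel t x y) * ‖f y‖ₑ ^ 2 ∂(length d) ∂(length d) := by
          refine lintegral_mono fun x => ?_
          obtain ⟨h1, h2⟩ := sq_integral_heatKernel_le ht hf.norm x
          have h3 := pow_le_pow_left₀ (norm_nonneg _) (norm_heatFlow_le_integral ht f x) 2
          rw [← ofReal_norm, ← ENNReal.ofReal_pow (norm_nonneg _)]
          refine (ENNReal.ofReal_le_ofReal (h3.trans h2)).trans_eq ?_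
          rw [ofReal_integral_eq_lintegral_ofReal h1 (ae_of_all _ fun y =>
            mul_nonneg (heatKernel_nonneg ht x y) (sq_nonneg _))]
          refine lintegral_congr fun y => ?_
          rw [ENNReal.ofReal_mul (heatKernel_nonneg ht x y), ENNReal.ofReal_pow (norm_nonneg _),
            ofReal_norm]
      _ = ∫⁻ y, ∫⁻ x, ENNReal.ofReal (heatKernel t x y) * ‖f y‖ₑ ^ 2 ∂(length d) ∂(length d) := by
          refine lintegral_lintegral_swap ?_
          exact ((continuous_heatKernel ht).measurable.ennreal_ofReal.aemeasurable).mul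
            ((hf.1.enorm.pow_const 2).comp_snd)
      _ = _ := by
          refine lintegral_congr fun y => ?_
          rw [lintegral_mul_const _ ((by
            have := continuous_heatKernel_right ht y
            simp only [heatKernel_symm t _ y]
            fun_prop : Measurable fun x => ENNReal.ofReal (heatKernel t x y)))]
          simp only [heatKernel_symm t _ y]
          rw [lintegral_heatKernel ht, one_mul]
  have hle : eLpNorm (heatFlow t f) 2 (length d) ≤ eLpNorm f 2 (length d) := by
    rw [eLpNorm_eq_lintegral_rpow_enorm_toReal two_ne_zero ENNReal.ofNat_ne_top,
      eLpNorm_eq_lintegral_rpow_enorm_toReal two_ne_zero ENNReal.ofNat_ne_top]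
    simp only [ENNReal.toReal_ofNat, ENNReal.rpow_ofNat]
    gcongr
  exact ⟨⟨hm, hle.trans_lt hf.2⟩, hle⟩

theorem heatFlow_add [NeZero d] {t : ℝ} (ht : 0 < t) {f g : LatticeGraph d → V}
    (hf : IsModerate f) (hg : IsModerate g) :
    heatFlow t (f + g) = heatFlow t f + heatFlow t g := by
  funext x
  simp only [heatFlow, Pi.add_apply, smul_add]
  exact integral_add (hf.integrable_heatKernel_smul ht x) (hg.integrable_heatKernel_smul ht x)

/-- The semigroup property of the heat flow. -/
theorem heatFlow_heatFlow [NeZero d] [CompleteSpace V] {s t : ℝ} (hs : 0 < s) (ht : 0 < t) {f : LatticeGraph d → V}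
    (hf : IsModerate f) (hPf : IsModerate (heatFlow t fun y => ‖f y‖)) (x : LatticeGraph d) :
    heatFlow s (heatFlow t f) x = heatFlow (s + t) f x := by
  have hmeas : AEStronglyMeasurable (fun q : LatticeGraph d × LatticeGraph d =>
      heatKernel s x q.1 • heatKernel t q.1 q.2 • f q.2) ((length d).prod (length d)) := by
    have h1 := continuous_heatKernel_right hs x
    have h2 := continuous_heatKernel (d := d) ht
    have h3 : Continuous fun q : LatticeGraph d × LatticeGraph d => heatKernel s x q.1 := by
      fun_prop
    have h4 : AEStronglyMeasurable (fun q : LatticeGraph d × LatticeGraph d => f q.2)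
      ((length d).prod (length d)) := hf.aestronglyMeasurable.comp_snd
    have h5 : AEStronglyMeasurable (fun q : LatticeGraph d × LatticeGraph d =>
      heatKernel t q.1 q.2 • f q.2) ((length d).prod (length d)) := h2.aestronglyMeasurable.smul h4
    exact AEStronglyMeasurable.smul (f := fun q : LatticeGraph d × LatticeGraph d =>
      heatKernel s x q.1) h3.aestronglyMeasurable h5
  have hint : Integrable (fun q : LatticeGraph d × LatticeGraph d =>
      heatKernel s x q.1 • heatKernel t q.1 q.2 • f q.2) ((length d).prod (length d)) := by
    have h1 : ∀ z, Integrable (fun y => heatKernel s x z • heatKernel t z y • f y) (length d) :=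
      fun z => (hf.integrable_heatKernel_smul ht z).smul (heatKernel s x z)
    have h2 : ∀ z, ∫ y, ‖heatKernel s x z • heatKernel t z y • f y‖ ∂(length d) =
        heatKernel s x z • heatFlow t (fun y => ‖f y‖) z := fun z => by
      simp only [heatFlow, smul_eq_mul, norm_smul, Real.norm_of_nonneg (heatKernel_nonneg hs _ _),
        Real.norm_of_nonneg (heatKernel_nonneg ht _ _)]
      rw [integral_const_mul]
    refine (integrable_prod_iff hmeas).2 ⟨ae_of_all _ h1, ?_⟩
    simp only [h2]
    exact hPf.integrable_heatKernel_smul hs x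
  calc heatFlow s (heatFlow t f) x
      = ∫ z, ∫ y, heatKernel s x z • heatKernel t z y • f y ∂(length d) ∂(length d) := by
        refine integral_congr_ae (ae_of_all _ fun z => ?_)
        simp only [heatFlow, integral_smul]
    _ = ∫ y, ∫ z, heatKernel s x z • heatKernel t z y • f y ∂(length d) ∂(length d) :=
        integral_integral_swap hint
    _ = _ := by
        refine integral_congr_ae (ae_of_all _ fun y => ?_)
        simp only [smul_smul]
        rw [integral_smul_const, (chapmanKolmogorov hs ht x y).2]

end Normed

theorem isModerate_coe [NeZero d] (f : Lp ℂ 2 (length d)) : IsModerate f :=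
  isModerate_of_memLp (Lp.memLp f)

theorem heatFlow_heatFlow_Lp [NeZero d] {s t : ℝ} (hs : 0 < s) (ht : 0 < t)
    (f : Lp ℂ 2 (length d)) (x : LatticeGraph d) :
    heatFlow s (heatFlow t f) x = heatFlow (s + t) f x :=
  heatFlow_heatFlow hs ht (isModerate_coe f)
    (isModerate_of_memLp (memLp_heatFlow ht (Lp.memLp f).norm).1) x

/-- The heat semigroup on `L²`, with the identity for `t ≤ 0`. -/
def heatOp [NeZero d] (t : ℝ) : Lp ℂ 2 (length d) →L[ℂ] Lp ℂ 2 (length d) :=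
  if ht : 0 < t then
    LinearMap.mkContinuous
      { toFun := fun f => (memLp_heatFlow ht (Lp.memLp f)).1.toLp _
        map_add' := fun f g => by
          refine (MemLp.toLp_congr _ ((memLp_heatFlow ht (Lp.memLp f)).1.add
            (memLp_heatFlow ht (Lp.memLp g)).1) ?_).trans (MemLp.toLp_add _ _)
          rw [heatFlow_congr (Lp.coeFn_add f g), heatFlow_add ht (isModerate_coe f)
            (isModerate_coe g)]
        map_smul' := fun c f => by
          refine (MemLp.toLp_congr _ ((memLp_heatFlow ht (Lp.memLp f)).1.const_smul c) ?_).trans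
            (MemLp.toLp_const_smul _ _)
          rw [heatFlow_congr (Lp.coeFn_smul c f)]
          refine ae_of_all _ fun x => ?_
          simp only [heatFlow, Pi.smul_apply]
          rw [← integral_smul]
          simp only [smul_comm c] } 1 fun f => by
        rw [one_mul, LinearMap.coe_mk, AddHom.coe_mk, Lp.norm_toLp, Lp.norm_def]
        exact ENNReal.toReal_mono (Lp.memLp f).2.ne (memLp_heatFlow ht (Lp.memLp f)).2
  else 1

theorem heatOp_ae_eq [NeZero d] {t : ℝ} (ht : 0 < t) (f : Lp ℂ 2 (length d)) :
    heatOp t f =ᵐ[length d] heatFlow t f := by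
  rw [heatOp, dif_pos ht]
  exact (memLp_heatFlow ht (Lp.memLp f)).1.coeFn_toLp

theorem norm_heatOp_le [NeZero d] (t : ℝ) (f : Lp ℂ 2 (length d)) : ‖heatOp t f‖ ≤ ‖f‖ := by
  by_cases ht : 0 < t
  · rw [Lp.norm_def, Lp.norm_def]
    refine ENNReal.toReal_mono (Lp.memLp f).2.ne ?_
    rw [eLpNorm_congr_ae (heatOp_ae_eq ht f)]
    exact (memLp_heatFlow ht (Lp.memLp f)).2
  · simp [heatOp, dif_neg ht]

theorem heatOp_add [NeZero d] {s t : ℝ} (hs : 0 < s) (ht : 0 < t) :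
    heatOp (d := d) (s + t) = (heatOp s).comp (heatOp t) := by
  ext1 f
  refine Lp.ext ?_
  rw [ContinuousLinearMap.comp_apply]
  refine (heatOp_ae_eq (add_pos hs ht) f).trans ?_
  refine EventuallyEq.trans ?_ (heatOp_ae_eq hs _).symm
  rw [heatFlow_congr (heatOp_ae_eq ht f)]
  exact ae_of_all _ fun x => (heatFlow_heatFlow_Lp hs ht f x).symm

theorem tendsto_heatOp_of_hasCompactSupport [NeZero d] {g : LatticeGraph d → ℂ}
    (hg : Continuous g) (hgs : HasCompactSupport g) {f : Lp ℂ 2 (length d)}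
    (hfg : f =ᵐ[length d] g) : Tendsto (fun t => heatOp t f) (𝓝[>] 0) (𝓝 f) := by
  obtain ⟨C, hC⟩ := hgs.exists_bound_of_continuous hg
  have hgi : Integrable g (length d) := hg.integrable_of_hasCompactSupport hgs
  have huni := Metric.tendstoUniformly_iff.1 (tendstoUniformly_heatFlow
    (hg.uniformContinuous_of_tendsto_cocompact hgs.is_zero_at_infty) hC)
  -- convergence of the inner products, from uniform convergence
  have hinner : Tendsto (fun t => inner ℂ (heatOp t f) f) (𝓝[>] 0) (𝓝 (inner ℂ f f)) := by
    rw [Metric.tendsto_nhds]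
    intro ε hε
    set M := ∫ x, ‖g x‖ ∂(length d) with hM
    have hM0 : 0 ≤ M := integral_nonneg fun _ => norm_nonneg _
    filter_upwards [huni (ε / (M + 1)) (by positivity), self_mem_nhdsWithin] with t ht ht0
    rw [dist_eq_norm, ← inner_sub_left, L2.inner_def]
    have h1 : ∀ᵐ x ∂(length d), ‖inner ℂ ((heatOp t f - f : Lp ℂ 2 (length d)) x) (f x)‖ ≤
        ε / (M + 1) * ‖g x‖ := by
      filter_upwards [Lp.coeFn_sub (heatOp t f) f, heatOp_ae_eq ht0 f, hfg] with x h1 h2 h3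
      refine (norm_inner_le_norm _ _).trans ?_
      rw [h1, Pi.sub_apply, h2, h3, heatFlow_congr hfg]
      refine mul_le_mul_of_nonneg_right ?_ (norm_nonneg _)
      have := ht x
      rw [dist_comm, dist_eq_norm] at this
      exact this.le
    refine (norm_integral_le_of_norm_le (hgi.norm.const_mul _) h1).trans_lt ?_
    rw [integral_const_mul, ← hM, div_mul_eq_mul_div, div_lt_iff₀ (by positivity)]
    exact mul_lt_mul_of_pos_left (lt_add_one M) hε
  rw [tendsto_iff_norm_sub_tendsto_zero]
  have hre : Tendsto (fun t => 2 * RCLike.re (inner ℂ f f) - 2 * RCLike.re (inner ℂ (heatOp t f) f))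
      (𝓝[>] 0) (𝓝 0) := by
    have := ((RCLike.continuous_re.tendsto _).comp hinner).const_mul 2
    have := this.const_sub (2 * RCLike.re (inner ℂ f f))
    rwa [sub_self] at this
  have hsq : Tendsto (fun t => ‖heatOp t f - f‖ ^ 2) (𝓝[>] 0) (𝓝 0) := by
    refine squeeze_zero (fun t => sq_nonneg _) (fun t => ?_) hre
    rw [@norm_sub_sq ℂ, inner_self_eq_norm_sq]
    have := pow_le_pow_left₀ (norm_nonneg _) (norm_heatOp_le t f) 2
    linarith
  have := hsq.sqrt
  simpa [Real.sqrt_sq (norm_nonneg _)] using this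

/-- Strong continuity of the heat semigroup on `L²`. -/
theorem tendsto_heatOp [NeZero d] (f : Lp ℂ 2 (length d)) :
    Tendsto (fun t => heatOp t f) (𝓝[>] 0) (𝓝 f) := by
  rw [Metric.tendsto_nhds]
  intro ε hε
  obtain ⟨g, hgs, hfg, hgc, hg⟩ := (Lp.memLp f).exists_hasCompactSupport_eLpNorm_sub_le
    ENNReal.ofNat_ne_top (ε := ENNReal.ofReal (ε / 4)) (by simpa using hε)
  set g' : Lp ℂ 2 (length d) := hg.toLp g
  have h1 : ‖f - g'‖ ≤ ε / 4 := by
    rw [Lp.norm_def]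
    refine ENNReal.toReal_le_of_le_ofReal (by positivity) (le_of_eq_of_le ?_ hfg)
    refine eLpNorm_congr_ae ?_
    filter_upwards [Lp.coeFn_sub f g', hg.coeFn_toLp] with x h2 h3
    rw [h2, Pi.sub_apply, Pi.sub_apply, h3]
  filter_upwards [Metric.tendsto_nhds.1 (tendsto_heatOp_of_hasCompactSupport hgc hgs hg.coeFn_toLp)
    (ε / 4) (by positivity)] with t ht
  rw [dist_eq_norm] at ht ⊢
  have h2 : heatOp t f - f = heatOp t (f - g') + (heatOp t g' - g') - (f - g') := by
    rw [map_sub]; abel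
  rw [h2]
  have h3 := norm_heatOp_le t (f - g')
  have h4 := norm_sub_le (heatOp t (f - g') + (heatOp t g' - g')) (f - g')
  have h5 := norm_add_le (heatOp t (f - g')) (heatOp t g' - g')
  change ‖heatOp t g' - g'‖ < ε / 4 at ht
  linarith

/-! ### The heat kernel as a family of elements of `L²` -/

/-- The heat kernel with one argument fixed, as an element of `L²`. -/
def kernelLp [NeZero d] {t : ℝ} (ht : 0 < t) (x : LatticeGraph d) : Lp ℂ 2 (length d) :=
  (memLp_heatKernel ht x).ofReal.toLp _

/-- The time derivative of the heat kernel with one argument fixed, as an element of `L²`. -/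
def kernelDerivLp [NeZero d] {t : ℝ} (ht : 0 < t) (x : LatticeGraph d) : Lp ℂ 2 (length d) :=
  (memLp_heatKernelDeriv ht x).ofReal.toLp _

theorem kernelLp_ae_eq [NeZero d] {t : ℝ} (ht : 0 < t) (x : LatticeGraph d) :
    kernelLp ht x =ᵐ[length d] fun y => (heatKernel t x y : ℂ) :=
  MemLp.coeFn_toLp _

theorem kernelDerivLp_ae_eq [NeZero d] {t : ℝ} (ht : 0 < t) (x : LatticeGraph d) :
    kernelDerivLp ht x =ᵐ[length d] fun y => (heatKernelDeriv t x y : ℂ) :=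
  MemLp.coeFn_toLp _

theorem inner_kernelLp [NeZero d] {t : ℝ} (ht : 0 < t) (x : LatticeGraph d)
    (f : Lp ℂ 2 (length d)) : inner ℂ (kernelLp ht x) f = heatFlow t f x := by
  rw [L2.inner_def, heatFlow]
  refine integral_congr_ae ?_
  filter_upwards [kernelLp_ae_eq ht x] with y hy
  rw [hy]
  simp [mul_comm]

theorem inner_kernelDerivLp [NeZero d] {t : ℝ} (ht : 0 < t) (x : LatticeGraph d)
    (f : Lp ℂ 2 (length d)) : inner ℂ (kernelDerivLp ht x) f = heatFlowDeriv t f x := by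
  have hf := isModerate_coe f
  obtain ⟨e, r, hr, rfl⟩ := exists_eq_point x
  have h1 : inner ℂ (kernelDerivLp ht (point e r)) f =
      ∫ y, heatKernelDeriv t (point e r) y • f y ∂(length d) := by
    rw [L2.inner_def]
    refine integral_congr_ae ?_
    filter_upwards [kernelDerivLp_ae_eq ht (point e r)] with y hy
    rw [hy]
    simp [mul_comm]
  have hm : AEStronglyMeasurable (fun y => heatKernelDeriv t (point e r) y • f y) (length d) :=
    (continuous_heatKernelDeriv ht _).aestronglyMeasurable.smul (Lp.memLp f).1
  have h2 : ∀ (c : ℝ) k, Integrable (fun w => c • sourceSum k t e r (forward w.1) w.2 •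
    f (edgeMap d w)) (edgeMeasure d) := fun c k => (hf.integrable_smul k ht e r).smul c
  rw [heatFlowDeriv, (hf.hasDerivAt_heatFlow_point ht e hr).deriv, h1, integral_eq_edge hm,
    edgeFlow, edgeFlow, ← integral_smul, ← integral_smul, ← integral_sub (h2 _ _) (h2 _ _),
    ← integral_smul]
  refine integral_congr_ae ?_
  filter_upwards [ae_edgeMeasure_mem] with w hw
  have h3 := heatKernelDeriv_point ht e (forward w.1) hr hw
  rw [point_forward] at h3
  rw [edgeMap, h3]
  simp only [mul_smul, sub_smul]

/-- The heat flow is injective, by strong continuity. -/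
theorem eq_zero_of_heatFlow_eq_zero [NeZero d] {f : Lp ℂ 2 (length d)}
    (h : ∀ t, 0 < t → ∀ x, heatFlow t f x = 0) : f = 0 := by
  refine tendsto_nhds_unique (tendsto_heatOp f) (tendsto_const_nhds.congr' ?_)
  filter_upwards [self_mem_nhdsWithin] with t ht
  refine (Lp.ext ?_).symm
  filter_upwards [heatOp_ae_eq ht f, Lp.coeFn_zero ℂ 2 (length d)] with x h1 h2
  rw [h1, h t ht, h2]
  rfl

theorem kernelLp_mem_smoothGraph [NeZero d] {t : ℝ} (ht : 0 < t) (x : LatticeGraph d) :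
    (kernelLp ht x, -kernelDerivLp ht x) ∈ smoothGraph d := by
  obtain ⟨h1, h2⟩ := heatKernel_isKirchhoffSmooth ht x
  refine ⟨_, h1, kernelLp_ae_eq ht x, fun z i => ?_⟩
  filter_upwards [ae_edge ((Lp.coeFn_neg (kernelDerivLp ht x)).and (kernelDerivLp_ae_eq ht x)) z i,
    ae_restrict_mem measurableSet_Icc] with s hs hs'
  rw [h2 z i s hs', hs.1, Pi.neg_apply, hs.2]

/-! ### Green's formula -/

/-- A function on the unit interval together with its first two derivatives. -/
structure HasTwoDerivs (a a' a'' : ℝ → ℂ) : Prop where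
  hasDeriv : ∀ s ∈ Icc (0 : ℝ) 1, HasDerivWithinAt a (a' s) (Icc 0 1) s
  hasDeriv_deriv : ∀ s ∈ Icc (0 : ℝ) 1, HasDerivWithinAt a' (a'' s) (Icc 0 1) s
  continuousOn : ContinuousOn a'' (Icc 0 1)

namespace HasTwoDerivs

variable {a a' a'' b b' b'' : ℝ → ℂ}

theorem continuousOn_fun (ha : HasTwoDerivs a a' a'') : ContinuousOn a (Icc 0 1) :=
  fun s hs => (ha.hasDeriv s hs).continuousWithinAt

theorem continuousOn_deriv (ha : HasTwoDerivs a a' a'') : ContinuousOn a' (Icc 0 1) :=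
  fun s hs => (ha.hasDeriv_deriv s hs).continuousWithinAt

theorem conj (ha : HasTwoDerivs a a' a'') : HasTwoDerivs (fun s => star (a s)) (fun s => star (a' s))
    (fun s => star (a'' s)) where
  hasDeriv s hs := (ha.hasDeriv s hs).star
  hasDeriv_deriv s hs := (ha.hasDeriv_deriv s hs).star
  continuousOn := continuous_star.comp_continuousOn ha.continuousOn

theorem reflect (ha : HasTwoDerivs a a' a'') :
    HasTwoDerivs (fun s => a (1 - s)) (fun s => -a' (1 - s)) (fun s => a'' (1 - s)) := by
  have hmap : MapsTo (fun s : ℝ => 1 - s) (Icc 0 1) (Icc 0 1) := fun s hs =>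
    ⟨by linarith [hs.2], by linarith [hs.1]⟩
  have hd : ∀ s, HasDerivWithinAt (fun s : ℝ => 1 - s) (-1) (Icc 0 1) s := fun s =>
    ((hasDerivAt_id s).const_sub 1).hasDerivWithinAt
  refine ⟨fun s hs => ?_, fun s hs => ?_, ha.continuousOn.comp (by fun_prop) hmap⟩
  · have := (ha.hasDeriv (1 - s) (hmap hs)).scomp s (hd s) hmap
    rw [neg_one_smul] at this
    exact this
  · have := ((ha.hasDeriv_deriv (1 - s) (hmap hs)).scomp s (hd s) hmap).neg
    rw [neg_one_smul, neg_neg] at this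
    exact this

theorem green (ha : HasTwoDerivs a a' a'') (hb : HasTwoDerivs b b' b'') :
    ∫ s in Icc (0 : ℝ) 1, (a s * b'' s - a'' s * b s) =
      (a 1 * b' 1 - a' 1 * b 1) - (a 0 * b' 0 - a' 0 * b 0) := by
  have hc : ContinuousOn (fun s => a s * b'' s - a'' s * b s) (Icc 0 1) :=
    (ha.continuousOn_fun.mul hb.continuousOn).sub (ha.continuousOn.mul hb.continuousOn_fun)
  rw [integral_Icc_eq_integral_Ioc, ← intervalIntegral.integral_of_le zero_le_one]
  refine intervalIntegral.integral_eq_sub_of_hasDerivAt_of_le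
    (f := fun s => a s * b' s - a' s * b s) zero_le_one
    ((ha.continuousOn_fun.mul hb.continuousOn_deriv).sub
      (ha.continuousOn_deriv.mul hb.continuousOn_fun)) (fun s hs => ?_)
    (hc.intervalIntegrable_of_Icc zero_le_one)
  have hs' := Ioo_subset_Icc_self hs
  have hn := Icc_mem_nhds hs.1 hs.2
  have h1 := (ha.hasDeriv s hs').hasDerivAt hn
  have h2 := (ha.hasDeriv_deriv s hs').hasDerivAt hn
  have h3 := (hb.hasDeriv s hs').hasDerivAt hn
  have h4 := (hb.hasDeriv_deriv s hs').hasDerivAt hn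
  convert! (h1.mul h4).sub (h2.mul h3) using 1
  ring

/-- Cubic polynomials, against which Green's formula gives the boundary values of a function and of
its derivative. -/
theorem cubic (p q r : ℝ) : HasTwoDerivs (fun s : ℝ => ((p * s + q * s ^ 2 + r * s ^ 3 : ℝ) : ℂ))
    (fun s : ℝ => ((p + 2 * q * s + 3 * r * s ^ 2 : ℝ) : ℂ))
    (fun s : ℝ => ((2 * q + 6 * r * s : ℝ) : ℂ)) := by
  refine ⟨fun s _ => ?_, fun s _ => ?_, by fun_prop⟩
  · have h := (((hasDerivAt_id s).const_mul p).add ((hasDerivAt_pow 2 s).const_mul q)).add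
      ((hasDerivAt_pow 3 s).const_mul r)
    have h2 := h.ofReal_comp.hasDerivWithinAt (s := Icc 0 1)
    convert! h2 using 1
    norm_num
    ring
  · have h := ((hasDerivAt_const s p).add ((hasDerivAt_id s).const_mul (2 * q))).add
      ((hasDerivAt_pow 2 s).const_mul (3 * r))
    have h2 := h.ofReal_comp.hasDerivWithinAt (s := Icc 0 1)
    convert! h2 using 1
    norm_num
    ring

theorem norm_integral_cubic_le (ha : HasTwoDerivs a a' a'') {p q r : ℝ} {C : ℝ}
    (hC : ∀ s ∈ Icc (0 : ℝ) 1, |p * s + q * s ^ 2 + r * s ^ 3| ≤ C)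
    (hC' : ∀ s ∈ Icc (0 : ℝ) 1, |2 * q + 6 * r * s| ≤ C) :
    ‖∫ s in Icc (0 : ℝ) 1, (a s * ((2 * q + 6 * r * s : ℝ) : ℂ) -
      a'' s * ((p * s + q * s ^ 2 + r * s ^ 3 : ℝ) : ℂ))‖ ≤
      C * ∫ s in Icc (0 : ℝ) 1, (‖a s‖ + ‖a'' s‖) := by
  rw [← integral_const_mul]
  refine norm_integral_le_of_norm_le ?_ ?_
  · exact ((continuousOn_const.mul (ha.continuousOn_fun.norm.add
      ha.continuousOn.norm))).integrableOn_Icc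
  · filter_upwards [ae_restrict_mem measurableSet_Icc] with s hs
    refine (norm_sub_le _ _).trans ?_
    rw [norm_mul, norm_mul, Complex.norm_real, Complex.norm_real, Real.norm_eq_abs,
      Real.norm_eq_abs]
    have h1 := mul_le_mul_of_nonneg_left (hC' s hs) (norm_nonneg (a s))
    have h2 := mul_le_mul_of_nonneg_left (hC s hs) (norm_nonneg (a'' s))
    linarith

/-- The boundary values are controlled by the integrals of the function and its second
derivative. -/
theorem norm_zero_le (ha : HasTwoDerivs a a' a'') :
    ‖a 0‖ ≤ 24 * ∫ s in Icc (0 : ℝ) 1, (‖a s‖ + ‖a'' s‖) ∧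
    ‖a' 0‖ ≤ 24 * ∫ s in Icc (0 : ℝ) 1, (‖a s‖ + ‖a'' s‖) := by
  have hI : 0 ≤ ∫ s in Icc (0 : ℝ) 1, (‖a s‖ + ‖a'' s‖) := integral_nonneg fun s => by positivity
  -- Green's formula with `s (1 - s)²`, which vanishes to second order at `1`
  have key0 : ‖a 0‖ ≤ 10 * ∫ s in Icc (0 : ℝ) 1, (‖a s‖ + ‖a'' s‖) := by
    have h := ha.green (cubic 1 (-2) 1)
    have h2 := ha.norm_integral_cubic_le (p := 1) (q := -2) (r := 1) (C := 10)
      (fun s hs => by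
        have h1 := hs.1
        have h2 := hs.2
        rw [abs_le]
        constructor <;> nlinarith [pow_nonneg h1 2, pow_nonneg h1 3, pow_le_one₀ (n := 2) h1 h2,
          pow_le_one₀ (n := 3) h1 h2])
      (fun s hs => by rw [abs_le]; constructor <;> linarith [hs.1, hs.2])
    rw [h] at h2
    norm_num at h2
    exact h2
  -- Green's formula with `1 - 3 s² + 2 s³`, which is `1` to first order at `0`
  have hone : HasTwoDerivs (fun _ => (1 : ℂ)) (fun _ => 0) (fun _ => 0) :=
    ⟨fun s _ => hasDerivWithinAt_const _ _ _, fun s _ => hasDerivWithinAt_const _ _ _,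
      continuousOn_const⟩
  have key1 : ‖a' 0‖ ≤ 24 * ∫ s in Icc (0 : ℝ) 1, (‖a s‖ + ‖a'' s‖) := by
    have h := ha.green (cubic 0 (-3) 2)
    have h2 := ha.norm_integral_cubic_le (p := 0) (q := -3) (r := 2) (C := 23)
      (fun s hs => by
        have h1 := hs.1
        have h2 := hs.2
        rw [abs_le]
        constructor <;> nlinarith [pow_nonneg h1 2, pow_nonneg h1 3, pow_le_one₀ (n := 2) h1 h2,
          pow_le_one₀ (n := 3) h1 h2])
      (fun s hs => by rw [abs_le]; constructor <;> linarith [hs.1, hs.2])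
    have h3 := ha.green hone
    have h4 : ‖∫ s in Icc (0 : ℝ) 1, (a s * 0 - a'' s * 1)‖ ≤
        ∫ s in Icc (0 : ℝ) 1, (‖a s‖ + ‖a'' s‖) := by
      refine norm_integral_le_of_norm_le (ha.continuousOn_fun.norm.add
        ha.continuousOn.norm).integrableOn_Icc (ae_of_all _ fun s => ?_)
      simp
    rw [h] at h2
    rw [h3] at h4
    norm_num at h2 h4
    have h5 : a' 0 = (a' 1) + (-a' 1 + a' 0) := by ring
    calc ‖a' 0‖ = ‖a' 1 + (-a' 1 + a' 0)‖ := by rw [← h5]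
      _ ≤ ‖a' 1‖ + ‖-a' 1 + a' 0‖ := norm_add_le _ _
      _ ≤ _ := by linarith
  exact ⟨key0.trans (by gcongr; norm_num), key1⟩

theorem sq_integral_le {g : ℝ → ℝ} (hg : ContinuousOn g (Icc 0 1)) :
    (∫ s in Icc (0 : ℝ) 1, g s) ^ 2 ≤ ∫ s in Icc (0 : ℝ) 1, g s ^ 2 := by
  set m := ∫ s in Icc (0 : ℝ) 1, g s
  have h3 : 0 ≤ ∫ s in Icc (0 : ℝ) 1, (g s - m) ^ 2 := integral_nonneg fun y => sq_nonneg _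
  have h4 : ∀ s, (g s - m) ^ 2 = g s ^ 2 - 2 * m * g s + m ^ 2 := fun y => by ring
  have h1 : IntegrableOn g (Icc 0 1) := hg.integrableOn_Icc
  have h2 : IntegrableOn (fun s => g s ^ 2) (Icc 0 1) := (hg.pow 2).integrableOn_Icc
  have h5 : IntegrableOn (fun s => g s ^ 2 - 2 * m * g s) (Icc 0 1) := h2.sub (h1.const_mul _)
  simp only [h4] at h3
  rw [integral_add h5 (integrableOn_const (by simp)), integral_sub h2 (h1.const_mul _),
    integral_const_mul, setIntegral_const] at h3
  simp only [Measure.real, Real.volume_Icc, sub_zero, ENNReal.toReal_ofReal zero_le_one,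
    one_smul] at h3
  change 0 ≤ _ - 2 * m * m + m ^ 2 at h3
  linarith

/-- All boundary values are square summable over the edges if the function and its second
derivative are square integrable. -/
theorem sq_boundary_le (ha : HasTwoDerivs a a' a'') :
    ‖a 0‖ ^ 2 ≤ 1152 * ∫ s in Icc (0 : ℝ) 1, (‖a s‖ ^ 2 + ‖a'' s‖ ^ 2) ∧
    ‖a' 0‖ ^ 2 ≤ 1152 * ∫ s in Icc (0 : ℝ) 1, (‖a s‖ ^ 2 + ‖a'' s‖ ^ 2) ∧
    ‖a 1‖ ^ 2 ≤ 1152 * ∫ s in Icc (0 : ℝ) 1, (‖a s‖ ^ 2 + ‖a'' s‖ ^ 2) ∧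
    ‖a' 1‖ ^ 2 ≤ 1152 * ∫ s in Icc (0 : ℝ) 1, (‖a s‖ ^ 2 + ‖a'' s‖ ^ 2) := by
  have key : ∀ x, x ≤ 24 * (∫ s in Icc (0 : ℝ) 1, (‖a s‖ + ‖a'' s‖)) → 0 ≤ x →
      x ^ 2 ≤ 1152 * ∫ s in Icc (0 : ℝ) 1, (‖a s‖ ^ 2 + ‖a'' s‖ ^ 2) := by
    intro x hx hx0
    have hc : ContinuousOn (fun s => ‖a s‖ + ‖a'' s‖) (Icc 0 1) :=
      ha.continuousOn_fun.norm.add ha.continuousOn.norm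
    have h1 := pow_le_pow_left₀ hx0 hx 2
    have h2 := sq_integral_le hc
    have h3 : ∫ s in Icc (0 : ℝ) 1, (‖a s‖ + ‖a'' s‖) ^ 2 ≤
        ∫ s in Icc (0 : ℝ) 1, 2 * (‖a s‖ ^ 2 + ‖a'' s‖ ^ 2) := by
      refine setIntegral_mono_on (hc.pow 2).integrableOn_Icc ((((ha.continuousOn_fun.norm.pow 2).add
        (ha.continuousOn.norm.pow 2)).const_smul (2 : ℝ)).integrableOn_Icc) measurableSet_Icc
        fun s _ => ?_
      nlinarith [sq_nonneg (‖a s‖ - ‖a'' s‖)]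
    rw [integral_const_mul] at h3
    rw [mul_pow] at h1
    linarith
  have hr : (∫ s in Icc (0 : ℝ) 1, (‖a (1 - s)‖ + ‖a'' (1 - s)‖)) =
      ∫ s in Icc (0 : ℝ) 1, (‖a s‖ + ‖a'' s‖) :=
    setIntegral_Icc_reflect fun s => ‖a s‖ + ‖a'' s‖
  have h0 := ha.norm_zero_le
  have h1 := ha.reflect.norm_zero_le
  rw [hr, sub_zero, norm_neg] at h1
  exact ⟨key _ h0.1 (norm_nonneg _), key _ h0.2 (norm_nonneg _), key _ h1.1 (norm_nonneg _),
    key _ h1.2 (norm_nonneg _)⟩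

end HasTwoDerivs

theorem IsKirchhoffSmooth.hasTwoDerivs {φ : LatticeGraph d → ℂ} (hφ : IsKirchhoffSmooth φ)
    (z : Fin d → ℤ) (i : Fin d) :
    HasTwoDerivs (fun s => φ (edge z i s)) (derivWithin (fun s => φ (edge z i s)) (Icc 0 1))
      (iteratedDerivWithin 2 (fun s => φ (edge z i s)) (Icc 0 1)) := by
  have hu := uniqueDiffOn_Icc (zero_lt_one (α := ℝ))
  have h1 : iteratedDerivWithin 2 (fun s => φ (edge z i s)) (Icc 0 1) =
      derivWithin (derivWithin (fun s => φ (edge z i s)) (Icc 0 1)) (Icc 0 1) := by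
    funext s
    rw [iteratedDerivWithin_succ, iteratedDerivWithin_one]
  refine ⟨fun s hs => (hφ.differentiableWithinAt z i hs).hasDerivWithinAt, fun s hs => ?_, ?_⟩
  · rw [h1]
    have := (hφ.smooth z i).differentiableOn_iteratedDerivWithin (m := 1)
      (by exact WithTop.coe_lt_coe.2 (ENat.natCast_lt_top 1)) hu
    rw [iteratedDerivWithin_one] at this
    exact (this s hs).hasDerivWithinAt
  · exact (hφ.smooth z i).continuousOn_iteratedDerivWithin two_le_infty hu

theorem summable_integral_sq {φ : LatticeGraph d → ℂ} (hφ : MemLp φ 2 (length d)) :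
    Summable fun ε : (Fin d → ℤ) × Fin d => ∫ s in Icc (0 : ℝ) 1, ‖φ (edge ε.1 ε.2 s)‖ ^ 2 :=
  (integral_eq_sum_edge hφ.norm.integrable_sq).summable

theorem edge_target (z : Fin d → ℤ) (i : Fin d) : edge (z - Pi.single i 1) i 1 = edge z i 0 := by
  ext j
  by_cases h : j = i
  · subst h; simp [edge_apply]
  · simp [edge_apply, h]

theorem edge_zero_eq (z : Fin d → ℤ) (i j : Fin d) : edge z i 0 = edge z j 0 := by
  ext k
  simp [edge_apply]

/-- The boundary terms of Green's formula cancel at every vertex. -/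
theorem hasSum_boundary [NeZero d] {φ ψ : LatticeGraph d → ℂ} (hφ : IsKirchhoffSmooth φ)
    (hψ : IsKirchhoffSmooth ψ) {B : ((Fin d → ℤ) × Fin d) → ℝ → ℂ}
    (hB : B = fun ε s => star (φ (edge ε.1 ε.2 s)) *
        derivWithin (fun s => ψ (edge ε.1 ε.2 s)) (Icc 0 1) s -
      star (derivWithin (fun s => φ (edge ε.1 ε.2 s)) (Icc 0 1) s) * ψ (edge ε.1 ε.2 s))
    (h0 : Summable fun ε => B ε 0) (h1 : Summable fun ε => B ε 1) :
    ∑' ε, (B ε 1 - B ε 0) = 0 := by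
  let σ : ((Fin d → ℤ) × Fin d) ≃ ((Fin d → ℤ) × Fin d) :=
    { toFun := fun ε => (ε.1 - Pi.single ε.2 1, ε.2)
      invFun := fun ε => (ε.1 + Pi.single ε.2 1, ε.2)
      left_inv := fun ε => by simp
      right_inv := fun ε => by simp }
  have h1' : Summable fun ε => B (σ ε) 1 := σ.summable_iff.2 h1
  rw [h1.tsum_sub h0, ← σ.tsum_eq, ← h1'.tsum_sub h0, (h1'.sub h0).tsum_prod]
  refine (tsum_congr fun z => ?_).trans tsum_zero
  rw [tsum_fintype]
  have hkφ := hφ.kirchhoff z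
  have hkψ := hψ.kirchhoff z
  have hterm : ∀ i, B (σ (z, i)) 1 - B (z, i) 0 =
      star (derivWithin (fun s => φ (edge z i s)) (Icc 0 1) 0 -
        derivWithin (fun s => φ (edge (z - Pi.single i 1) i s)) (Icc 0 1) 1) * ψ (edge z 0 0) -
      star (φ (edge z 0 0)) * (derivWithin (fun s => ψ (edge z i s)) (Icc 0 1) 0 -
        derivWithin (fun s => ψ (edge (z - Pi.single i 1) i s)) (Icc 0 1) 1) := by
    intro i
    simp only [hB, σ, Equiv.coe_fn_mk, edge_target, edge_zero_eq z i 0, star_sub]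
    ring
  rw [Finset.sum_congr rfl fun i _ => hterm i, Finset.sum_sub_distrib, ← Finset.sum_mul,
    ← Finset.mul_sum, ← star_sum, hkφ, hkψ]
  simp

/-- Green's formula: the operator on the smooth functions is symmetric. -/
theorem smoothGraph_symm [NeZero d] {q q' : Lp ℂ 2 (length d) × Lp ℂ 2 (length d)}
    (hq : q ∈ smoothGraph d) (hq' : q' ∈ smoothGraph d) :
    inner ℂ q.2 q'.1 = inner ℂ q.1 q'.2 := by
  obtain ⟨φ, hφ, hφ1, hφ2⟩ := hq
  obtain ⟨ψ, hψ, hψ1, hψ2⟩ := hq'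
  let a : ((Fin d → ℤ) × Fin d) → ℝ → ℂ := fun ε s => φ (edge ε.1 ε.2 s)
  let b : ((Fin d → ℤ) × Fin d) → ℝ → ℂ := fun ε s => ψ (edge ε.1 ε.2 s)
  let a' := fun ε => derivWithin (a ε) (Icc 0 1)
  let b' := fun ε => derivWithin (b ε) (Icc 0 1)
  let a'' := fun ε => iteratedDerivWithin 2 (a ε) (Icc 0 1)
  let b'' := fun ε => iteratedDerivWithin 2 (b ε) (Icc 0 1)
  have ha : ∀ ε, HasTwoDerivs (a ε) (a' ε) (a'' ε) := fun ε => hφ.hasTwoDerivs ε.1 ε.2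
  have hb : ∀ ε, HasTwoDerivs (b ε) (b' ε) (b'' ε) := fun ε => hψ.hasTwoDerivs ε.1 ε.2
  have hsum : ∀ (φ : LatticeGraph d → ℂ) (q : Lp ℂ 2 (length d) × Lp ℂ 2 (length d))
      (hφ : IsKirchhoffSmooth φ), q.1 =ᵐ[length d] φ → (∀ z i, ∀ᵐ s ∂(volume.restrict (Icc (0 : ℝ) 1)),
      q.2 (edge z i s) = -iteratedDerivWithin 2 (fun s => φ (edge z i s)) (Icc 0 1) s) →
      Summable fun ε : (Fin d → ℤ) × Fin d => 1152 * ∫ s in Icc (0 : ℝ) 1, (‖φ (edge ε.1 ε.2 s)‖ ^ 2 +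
        ‖iteratedDerivWithin 2 (fun s => φ (edge ε.1 ε.2 s)) (Icc 0 1) s‖ ^ 2) := by
    intro φ q hφ h1 h2
    refine (((summable_integral_sq (Lp.memLp q.1)).add
      (summable_integral_sq (Lp.memLp q.2))).mul_left 1152).congr fun ε => ?_
    have h := hφ.hasTwoDerivs ε.1 ε.2
    have hA : IntegrableOn (fun s => ‖φ (edge ε.1 ε.2 s)‖ ^ 2) (Icc 0 1) :=
      (h.continuousOn_fun.norm.pow 2).integrableOn_Icc
    have hB : IntegrableOn (fun s => ‖iteratedDerivWithin 2 (fun s => φ (edge ε.1 ε.2 s))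
      (Icc 0 1) s‖ ^ 2) (Icc 0 1) := (h.continuousOn.norm.pow 2).integrableOn_Icc
    rw [integral_add hA hB]
    congr 2
    · refine integral_congr_ae ?_
      filter_upwards [ae_edge h1 ε.1 ε.2] with s hs
      rw [hs]
    · refine integral_congr_ae ?_
      filter_upwards [h2 ε.1 ε.2] with s hs
      rw [hs, norm_neg]
  have hsφ := hsum φ q hφ hφ1 hφ2
  have hsψ := hsum ψ q' hψ hψ1 hψ2
  have hmul : ∀ {A B : ((Fin d → ℤ) × Fin d) → ℂ},
      (∀ ε, ‖A ε‖ ^ 2 ≤ 1152 * ∫ s in Icc (0 : ℝ) 1, (‖φ (edge ε.1 ε.2 s)‖ ^ 2 +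
        ‖iteratedDerivWithin 2 (fun s => φ (edge ε.1 ε.2 s)) (Icc 0 1) s‖ ^ 2)) →
      (∀ ε, ‖B ε‖ ^ 2 ≤ 1152 * ∫ s in Icc (0 : ℝ) 1, (‖ψ (edge ε.1 ε.2 s)‖ ^ 2 +
        ‖iteratedDerivWithin 2 (fun s => ψ (edge ε.1 ε.2 s)) (Icc 0 1) s‖ ^ 2)) →
      Summable fun ε => star (A ε) * B ε := by
    intro A B hA hB
    refine Summable.of_norm_bounded (hsφ.add hsψ) fun ε => ?_
    rw [norm_mul, norm_star]
    nlinarith [hA ε, hB ε, sq_nonneg (‖A ε‖ - ‖B ε‖), norm_nonneg (A ε), norm_nonneg (B ε),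
      sq_nonneg (‖A ε‖), sq_nonneg (‖B ε‖)]
  have hbd := hasSum_boundary hφ hψ rfl
    ((hmul (fun ε => (ha ε).sq_boundary_le.1) fun ε => (hb ε).sq_boundary_le.2.1).sub
      (hmul (fun ε => (ha ε).sq_boundary_le.2.1) fun ε => (hb ε).sq_boundary_le.1))
    ((hmul (fun ε => (ha ε).sq_boundary_le.2.2.1) fun ε => (hb ε).sq_boundary_le.2.2.2).sub
      (hmul (fun ε => (ha ε).sq_boundary_le.2.2.2) fun ε => (hb ε).sq_boundary_le.2.2.1))
  rw [← sub_eq_zero, L2.inner_def, L2.inner_def]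
  have hi1 := L2.integrable_inner (𝕜 := ℂ) q.2 q'.1
  have hi2 := L2.integrable_inner (𝕜 := ℂ) q.1 q'.2
  have hi3 : Integrable (fun x => inner ℂ (q.2 x) (q'.1 x) - inner ℂ (q.1 x) (q'.2 x)) (length d) :=
    hi1.sub hi2
  rw [← integral_sub hi1 hi2, ← (integral_eq_sum_edge hi3).tsum_eq, ← hbd]
  refine tsum_congr fun ε => ?_
  rw [← (ha ε).conj.green (hb ε)]
  refine integral_congr_ae ?_
  filter_upwards [ae_edge hφ1 ε.1 ε.2, ae_edge hψ1 ε.1 ε.2, hφ2 ε.1 ε.2, hψ2 ε.1 ε.2] with s h1 h2 h3 h4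
  simp only [RCLike.inner_apply, h1, h2, h3, h4, map_neg, starRingEnd_apply, a, b, a'',
    b'']
  ring

/-! ### The generator of the heat semigroup -/

/-- The weak form of `∂ₜ Pₜ f = -Pₜ g`. It turns out to describe the graph of the closure of the
operator on the smooth functions, the graph of its adjoint, and the generator. -/
def IsWeakGenerator [NeZero d] (f g : Lp ℂ 2 (length d)) : Prop :=
  ∀ t, 0 < t → ∀ x, heatFlowDeriv t f x = -heatFlow t g x

/-- An element of the adjoint is a weak solution: the relation of the adjoint is tested against the
functions `p(t, x, ·)`, which belong to the operator on the smooth functions. -/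
theorem isWeakGenerator_of_adjoint [NeZero d] {f g : Lp ℂ 2 (length d)}
    (h : ∀ q ∈ smoothGraph d, inner ℂ q.2 f = inner ℂ q.1 g) : IsWeakGenerator f g := by
  intro t ht x
  have := h _ (kernelLp_mem_smoothGraph ht x)
  rw [inner_neg_left, inner_kernelDerivLp, inner_kernelLp] at this
  rw [← this, neg_neg]

/-- The heat flow moves weak solutions into the operator on the smooth functions. -/
theorem IsWeakGenerator.heatOp_mem [NeZero d] {f g : Lp ℂ 2 (length d)}
    (h : IsWeakGenerator f g) {t : ℝ} (ht : 0 < t) : (heatOp t f, heatOp t g) ∈ smoothGraph d := by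
  obtain ⟨h1, h2⟩ := (isModerate_coe f).isKirchhoffSmooth_heatFlow ht
  refine ⟨_, h1, heatOp_ae_eq ht f, fun z i => ?_⟩
  filter_upwards [ae_edge (heatOp_ae_eq ht g) z i, ae_restrict_mem measurableSet_Icc] with s hs hs'
  rw [h2 z i s hs', h t ht, neg_neg, hs]

/-- The approximation by the heat flow at small times. -/
theorem IsWeakGenerator.mem_closure [NeZero d] {f g : Lp ℂ 2 (length d)}
    (h : IsWeakGenerator f g) : (f, g) ∈ (smoothGraph d).topologicalClosure := by
  refine mem_closure_of_tendsto ((tendsto_heatOp f).prodMk_nhds (tendsto_heatOp g)) ?_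
  filter_upwards [self_mem_nhdsWithin] with t ht
  exact h.heatOp_mem ht

theorem inner_eq_of_mem_closure [NeZero d] {q q' : Lp ℂ 2 (length d) × Lp ℂ 2 (length d)}
    (hq : q ∈ smoothGraph d) (hq' : q' ∈ (smoothGraph d).topologicalClosure) :
    inner ℂ q.2 q'.1 = inner ℂ q.1 q'.2 := by
  have hclosed : IsClosed {q' : Lp ℂ 2 (length d) × Lp ℂ 2 (length d) |
      inner ℂ q.2 q'.1 = inner ℂ q.1 q'.2} := isClosed_eq (by fun_prop) (by fun_prop)
  exact closure_minimal (fun q' h => smoothGraph_symm hq h) hclosed hq'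

/-- The closure is contained in the adjoint by symmetry, the adjoint in the weak solutions, and these
in the closure. -/
theorem mem_closure_iff_isWeakGenerator [NeZero d] {q : Lp ℂ 2 (length d) × Lp ℂ 2 (length d)} :
    q ∈ (smoothGraph d).topologicalClosure ↔ IsWeakGenerator q.1 q.2 :=
  ⟨fun h => isWeakGenerator_of_adjoint fun _ hq => inner_eq_of_mem_closure hq h,
    fun h => h.mem_closure⟩

/-- The operator on the smooth functions is closable. -/
theorem graph_kirchhoffLaplacian [NeZero d] :
    (kirchhoffLaplacian d).graph = (smoothGraph d).topologicalClosure := by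
  refine Submodule.toLinearPMap_graph_eq _ fun q hq hq0 => ?_
  have h := mem_closure_iff_isWeakGenerator.1 hq
  refine eq_zero_of_heatFlow_eq_zero fun t ht x => ?_
  have h1 := h t ht x
  rw [← inner_kernelDerivLp ht, hq0, inner_zero_right] at h1
  exact neg_eq_zero.1 h1.symm

theorem mem_graph_iff_isWeakGenerator [NeZero d] {f g : Lp ℂ 2 (length d)} :
    (f, g) ∈ (kirchhoffLaplacian d).graph ↔ IsWeakGenerator f g := by
  rw [graph_kirchhoffLaplacian]
  exact mem_closure_iff_isWeakGenerator

theorem kernelLp_mem_graph [NeZero d] {t : ℝ} (ht : 0 < t) (x : LatticeGraph d) :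
    (kernelLp ht x, -kernelDerivLp ht x) ∈ (kirchhoffLaplacian d).graph := by
  rw [graph_kirchhoffLaplacian]
  exact subset_closure (kernelLp_mem_smoothGraph ht x)

/-- The linear combinations of the functions `p(t, x, ·)`. -/
def kernelSpan (d : ℕ) [NeZero d] : Submodule ℂ (Lp ℂ 2 (length d)) :=
  Submodule.span ℂ {u | ∃ t, ∃ ht : 0 < t, ∃ x, u = kernelLp ht x}

/-- A function orthogonal to all `p(t, x, ·)` has the heat flow zero. -/
theorem dense_kernelSpan [NeZero d] : Dense (kernelSpan d : Set (Lp ℂ 2 (length d))) := by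
  rw [Submodule.dense_iff_topologicalClosure_eq_top, Submodule.topologicalClosure_eq_top_iff,
    Submodule.eq_bot_iff]
  intro g hg
  refine eq_zero_of_heatFlow_eq_zero fun t ht x => ?_
  rw [← inner_kernelLp ht]
  exact (Submodule.mem_orthogonal _ _).1 hg _ (Submodule.subset_span ⟨t, ht, x, rfl⟩)

theorem dense_domain [NeZero d] :
    Dense ((kirchhoffLaplacian d).domain : Set (Lp ℂ 2 (length d))) := by
  refine dense_kernelSpan.mono (Submodule.span_le.2 ?_)
  rintro _ ⟨t, ht, x, rfl⟩
  exact LinearPMap.mem_domain_of_mem_graph (kernelLp_mem_graph ht x)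

/-- The closure and the adjoint have the same graph, that of the weak solutions. -/
theorem isSelfAdjoint_kirchhoffLaplacian [NeZero d] : IsSelfAdjoint (kirchhoffLaplacian d) := by
  rw [LinearPMap.isSelfAdjoint_def]
  refine LinearPMap.eq_of_eq_graph ?_
  rw [LinearPMap.adjoint_graph_eq_graph_adjoint dense_domain, graph_kirchhoffLaplacian]
  ext q
  rw [Submodule.mem_adjoint_iff, mem_closure_iff_isWeakGenerator]
  constructor
  · intro h
    exact isWeakGenerator_of_adjoint fun q' hq' =>
      sub_eq_zero.1 (h q'.1 q'.2 (subset_closure hq'))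
  · intro h a b hab
    rw [sub_eq_zero]
    have hclosed : IsClosed {q' : Lp ℂ 2 (length d) × Lp ℂ 2 (length d) |
      inner ℂ q'.2 q.1 = inner ℂ q'.1 q.2} := isClosed_eq (by fun_prop) (by fun_prop)
    exact closure_minimal (fun q' h' => inner_eq_of_mem_closure h' h.mem_closure) hclosed hab

/-- A mean value inequality on a half open interval. -/
theorem norm_sub_le_of_hasDerivAt_Ioc {E : Type*} [NormedAddCommGroup E] [NormedSpace ℝ E]
    {F F' : ℝ → E} {a : E} {M t : ℝ} (ht : 0 < t) (h : ∀ s ∈ Ioc 0 t, HasDerivAt F (F' s) s)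
    (hb : ∀ s ∈ Ioc 0 t, ‖F' s‖ ≤ M) (hlim : Tendsto F (𝓝[>] 0) (𝓝 a)) :
    ‖F t - a‖ ≤ M * t := by
  have h1 : Tendsto (fun s => ‖F t - F s‖) (𝓝[>] 0) (𝓝 ‖F t - a‖) := (hlim.const_sub _).norm
  refine le_of_tendsto h1 ?_
  filter_upwards [Ioc_mem_nhdsGT ht] with s hs
  have h2 := (convex_Ioc 0 t).norm_image_sub_le_of_norm_hasDerivWithin_le
    (fun s hs => (h s hs).hasDerivWithinAt) hb hs (right_mem_Ioc.2 ht)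
  have hM : 0 ≤ M := (norm_nonneg _).trans (hb t (right_mem_Ioc.2 ht))
  refine h2.trans (mul_le_mul_of_nonneg_left ?_ hM)
  rw [Real.norm_of_nonneg (by linarith [hs.2])]
  linarith [hs.1]

theorem heatFlow_coe_heatOp [NeZero d] {s t : ℝ} (hs : 0 < s) (ht : 0 < t)
    (f : Lp ℂ 2 (length d)) (x : LatticeGraph d) :
    heatFlow s (heatOp t f) x = heatFlow (s + t) f x := by
  rw [heatFlow_congr (heatOp_ae_eq ht f), heatFlow_heatFlow_Lp hs ht]

theorem IsWeakGenerator.hasDerivAt_heatFlow [NeZero d] {f g : Lp ℂ 2 (length d)}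
    (h : IsWeakGenerator f g) {t : ℝ} (ht : 0 < t) (x : LatticeGraph d) :
    HasDerivAt (fun τ => heatFlow τ f x) (-heatFlow t g x) t := by
  rw [← h t ht x]
  exact (isModerate_coe f).hasDerivAt_heatFlow ht x

theorem IsWeakGenerator.hasDerivAt_inner [NeZero d] {f g : Lp ℂ 2 (length d)}
    (h : IsWeakGenerator f g) {t : ℝ} (ht : 0 < t) {ψ : Lp ℂ 2 (length d)} (hψ : ψ ∈ kernelSpan d) :
    HasDerivAt (fun τ => inner ℂ ψ (heatOp τ f)) (-inner ℂ ψ (heatOp t g)) t := by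
  induction hψ using Submodule.span_induction with
  | mem u hu =>
    obtain ⟨r, hr, x, rfl⟩ := hu
    rw [inner_kernelLp, heatFlow_coe_heatOp hr ht]
    refine ((h.hasDerivAt_heatFlow (add_pos hr ht) x).comp_const_add r t).congr_of_eventuallyEq ?_
    filter_upwards [lt_mem_nhds ht] with τ hτ
    rw [inner_kernelLp, heatFlow_coe_heatOp hr hτ]
  | zero => simpa using hasDerivAt_const t (0 : ℂ)
  | add u v _ _ hu hv =>
    simp only [inner_add_left, neg_add]
    exact hu.add hv
  | smul c u _ hu =>
    simp only [inner_smul_left, ← mul_neg]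
    exact hu.const_mul _

/-- The difference quotients of the semigroup converge if `∂ₜ Pₜ f = -Pₜ g` holds weakly. The mean
value inequality applies to the inner products with elements of the dense subspace `kernelSpan`, and
its bound does not depend on the element. -/
theorem IsWeakGenerator.tendsto [NeZero d] {f g : Lp ℂ 2 (length d)} (h : IsWeakGenerator f g) :
    Tendsto (fun t : ℝ => ((t⁻¹ : ℝ) : ℂ) • (heatOp t f - f)) (𝓝[>] 0) (𝓝 (-g)) := by
  have hbound : ∀ {t M : ℝ}, 0 < t → (∀ s ∈ Ioc 0 t, ‖heatOp s g - g‖ ≤ M) →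
      ‖heatOp t f - f + (t : ℂ) • g‖ ≤ M * t := by
    intro t M ht hM
    have hM0 : 0 ≤ M := (norm_nonneg _).trans (hM t (right_mem_Ioc.2 ht))
    set v := heatOp t f - f + (t : ℂ) • g
    have hweak : ∀ ψ ∈ kernelSpan d, ‖inner ℂ ψ v‖ ≤ M * t * ‖ψ‖ := by
      intro ψ hψ
      have h1 : ∀ s ∈ Ioc 0 t, HasDerivAt (fun τ : ℝ => inner ℂ ψ (heatOp τ f) + (τ : ℂ) * inner ℂ ψ g)
          (-inner ℂ ψ (heatOp s g - g)) s := by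
        intro s hs
        have h2 := (h.hasDerivAt_inner hs.1 hψ).add
          (((hasDerivAt_id s).ofReal_comp).mul_const (inner ℂ ψ g))
        convert! h2 using 1
        rw [inner_sub_right]
        simp only [Complex.ofReal_one]
        ring
      have h3 := norm_sub_le_of_hasDerivAt_Ioc ht h1 (M := M * ‖ψ‖) (a := inner ℂ ψ f) (fun s hs => by
        rw [norm_neg, mul_comm]
        exact (norm_inner_le_norm _ _).trans
          (mul_le_mul_of_nonneg_left (hM s hs) (norm_nonneg _))) ?_
      · convert! h3 using 1
        · congr 1
          simp only [v]
          rw [inner_add_right, inner_sub_right, inner_smul_right]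
          ring
        · ring
      · have h4 : Tendsto (fun τ : ℝ => inner ℂ ψ (heatOp τ f) + (τ : ℂ) * inner ℂ ψ g) (𝓝[>] 0)
            (𝓝 (inner ℂ ψ f + ((0 : ℝ) : ℂ) * inner ℂ ψ g)) := by
          refine (tendsto_const_nhds.inner (tendsto_heatOp f)).add (Tendsto.mul_const _ ?_)
          exact (Complex.continuous_ofReal.tendsto 0).mono_left nhdsWithin_le_nhds
        simpa using h4
    have hall : ∀ ψ, ‖inner ℂ ψ v‖ ≤ M * t * ‖ψ‖ := by
      have hclosed : IsClosed {ψ : Lp ℂ 2 (length d) | ‖inner ℂ ψ v‖ ≤ M * t * ‖ψ‖} :=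
        isClosed_le (by fun_prop) (by fun_prop)
      exact fun ψ => closure_minimal hweak hclosed (dense_kernelSpan ψ)
    have h5 := hall v
    rw [inner_self_eq_norm_sq_to_K, norm_pow, RCLike.norm_ofReal, abs_norm, sq] at h5
    rcases (norm_nonneg v).eq_or_lt with h0 | h0
    · rw [← h0]; positivity
    · exact le_of_mul_le_mul_right h5 h0
  rw [Metric.tendsto_nhds]
  intro ε hε
  obtain ⟨δ, hδ, hδ'⟩ := mem_nhdsGT_iff_exists_Ioo_subset.1
    (Metric.tendsto_nhds.1 (tendsto_heatOp g) (ε / 2) (by positivity))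
  filter_upwards [Ioo_mem_nhdsGT hδ] with t ht
  have ht0 : (t : ℂ) ≠ 0 := by exact_mod_cast ht.1.ne'
  have h1 := hbound ht.1 (M := ε / 2) fun s hs => by
    have := hδ' ⟨hs.1, hs.2.trans_lt ht.2⟩
    rw [mem_ofPred_eq, dist_eq_norm] at this
    exact this.le
  have h2 : ((t⁻¹ : ℝ) : ℂ) • (heatOp t f - f) - -g =
      ((t⁻¹ : ℝ) : ℂ) • (heatOp t f - f + (t : ℂ) • g) := by
    rw [smul_add, smul_smul, Complex.ofReal_inv, inv_mul_cancel₀ ht0, one_smul, sub_neg_eq_add]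
  rw [dist_eq_norm, h2, norm_smul, Complex.norm_real, Real.norm_of_nonneg (inv_pos.2 ht.1).le,
    inv_mul_eq_div]
  calc _ ≤ ε / 2 * t / t := by have := ht.1; gcongr
    _ = ε / 2 := by rw [mul_div_cancel_right₀ _ ht.1.ne']
    _ < ε := by linarith

/-- Pairing the difference quotients with `p(s, x, ·)` gives those of `τ ↦ P_τ f (x)` at `τ = s`. -/
theorem isWeakGenerator_of_tendsto [NeZero d] {f g : Lp ℂ 2 (length d)}
    (h : Tendsto (fun t : ℝ => ((t⁻¹ : ℝ) : ℂ) • (heatOp t f - f)) (𝓝[>] 0) (𝓝 (-g))) :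
    IsWeakGenerator f g := by
  intro s hs x
  have h1 : Tendsto (fun t : ℝ => inner ℂ (kernelLp hs x) (((t⁻¹ : ℝ) : ℂ) • (heatOp t f - f)))
      (𝓝[>] 0) (𝓝 (inner ℂ (kernelLp hs x) (-g))) := tendsto_const_nhds.inner h
  rw [inner_neg_right, inner_kernelLp] at h1
  have h2 := ((isModerate_coe f).hasDerivAt_heatFlow hs x).tendsto_slope_zero_right
  refine tendsto_nhds_unique h2 (h1.congr' ?_)
  filter_upwards [self_mem_nhdsWithin] with t ht
  rw [inner_smul_right, inner_sub_right, inner_kernelLp, inner_kernelLp, heatFlow_coe_heatOp hs ht,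
    Complex.real_smul]

/-- The generator of the heat semigroup on `L²` is `-H₀`, with the same domain. -/
theorem mem_graph_iff_tendsto [NeZero d] (f g : Lp ℂ 2 (length d)) :
    (f, g) ∈ (kirchhoffLaplacian d).graph ↔
      Tendsto (fun t : ℝ => ((t⁻¹ : ℝ) : ℂ) • (heatOp t f - f)) (𝓝[>] 0) (𝓝 (-g)) :=
  mem_graph_iff_isWeakGenerator.trans ⟨fun h => h.tendsto, isWeakGenerator_of_tendsto⟩

/-- The quadratic form is the limit of `⟨f, f - P_t f⟩ / t`. -/
theorem inner_kirchhoffLaplacian_nonneg [NeZero d] (f : (kirchhoffLaplacian d).domain) :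
    0 ≤ (inner ℂ (f : Lp ℂ 2 (length d)) (kirchhoffLaplacian d f)).re := by
  have h := (mem_graph_iff_tendsto _ _).1 ((kirchhoffLaplacian d).mem_graph f)
  have h1 := (Complex.continuous_re.tendsto _).comp (tendsto_const_nhds (x := (f : Lp ℂ 2 (length d)))
    |>.inner h)
  rw [inner_neg_right, Complex.neg_re] at h1
  rw [← neg_nonpos]
  refine le_of_tendsto h1 ?_
  filter_upwards [self_mem_nhdsWithin] with t ht
  have ht0 : (0 : ℝ) < t := ht
  -- the semigroup is contractive
  have h2 : (inner ℂ (f : Lp ℂ 2 (length d)) (heatOp t f)).re ≤ ‖(f : Lp ℂ 2 (length d))‖ ^ 2 := by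
    refine (Complex.re_le_norm _).trans ((norm_inner_le_norm _ _).trans ?_)
    rw [sq]
    exact mul_le_mul_of_nonneg_left (norm_heatOp_le t _) (norm_nonneg _)
  have h3 : (inner ℂ (f : Lp ℂ 2 (length d)) (f : Lp ℂ 2 (length d))).re =
      ‖(f : Lp ℂ 2 (length d))‖ ^ 2 := inner_self_eq_norm_sq (𝕜 := ℂ) _
  simp only [Function.comp_apply]
  rw [inner_smul_right, inner_sub_right, Complex.re_ofReal_mul, Complex.sub_re, h3]
  exact mul_nonpos_of_nonneg_of_nonpos (inv_pos.2 ht0).le (by linarith)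

/-! ### The heat semigroup on the continuous functions vanishing at infinity -/

theorem exists_bound_C0 (f : C₀(LatticeGraph d, ℂ)) : ∃ C, ∀ x, ‖f x‖ ≤ C :=
  ⟨‖f.toBCF‖, fun x => f.toBCF.norm_coe_le_norm x⟩

theorem exists_C0_eq_heatFlow [NeZero d] {t : ℝ} (ht : 0 < t) (f : C₀(LatticeGraph d, ℂ)) :
    ∃ g : C₀(LatticeGraph d, ℂ), ∀ x, g x = heatFlow t f x := by
  obtain ⟨C, hC⟩ := exists_bound_C0 f
  have hm : IsModerate f := isModerate_of_bounded f.continuous.aestronglyMeasurable hC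
  refine ⟨⟨⟨heatFlow t f, hm.continuous_heatFlow ht⟩, ?_⟩, fun x => rfl⟩
  rw [Metric.tendsto_nhds]
  intro ε hε
  filter_upwards [eventually_norm_heatFlow_lt hC f.zero_at_infty' t hε] with x hx
  rw [dist_zero_right]
  exact hx t ht le_rfl

theorem tendstoUniformly_heatFlow_C0 [NeZero d] (f : C₀(LatticeGraph d, ℂ)) :
    TendstoUniformly (fun t => heatFlow t f) f (𝓝[>] 0) := by
  obtain ⟨C, hC⟩ := exists_bound_C0 f
  exact tendstoUniformly_heatFlow
    (f.continuous.uniformContinuous_of_tendsto_cocompact f.zero_at_infty') hC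

/-- Pointwise `∂ₜ Pₜ f = -Pₜ g`, and `Pₜ g` tends to `g` uniformly. -/
theorem tendstoUniformly_generator_C0 [NeZero d] {f g : C₀(LatticeGraph d, ℂ)}
    {u v : Lp ℂ 2 (length d)} (hu : u =ᵐ[length d] f) (hv : v =ᵐ[length d] g)
    (h : IsWeakGenerator u v) :
    TendstoUniformly (fun (t : ℝ) x => ((t⁻¹ : ℝ) : ℂ) * (heatFlow t f x - f x))
      (fun x => -g x) (𝓝[>] 0) := by
  obtain ⟨C, hC⟩ := exists_bound_C0 f
  rw [Metric.tendstoUniformly_iff]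
  intro ε hε
  obtain ⟨δ, hδ, hδ'⟩ := mem_nhdsGT_iff_exists_Ioo_subset.1
    (Metric.tendstoUniformly_iff.1 (tendstoUniformly_heatFlow_C0 g) (ε / 2) (by positivity))
  filter_upwards [Ioo_mem_nhdsGT hδ] with t ht x
  have ht0 : (t : ℂ) ≠ 0 := by exact_mod_cast ht.1.ne'
  have h1 : ∀ s ∈ Ioc 0 t, HasDerivAt (fun τ : ℝ => heatFlow τ f x + (τ : ℂ) * g x)
      (-(heatFlow s g x - g x)) s := by
    intro s hs
    have h2 := (h.hasDerivAt_heatFlow hs.1 x).add (((hasDerivAt_id s).ofReal_comp).mul_const (g x))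
    simp only [heatFlow_congr hu, heatFlow_congr hv] at h2
    convert! h2 using 1
    simp only [Complex.ofReal_one]
    ring
  have h3 := norm_sub_le_of_hasDerivAt_Ioc ht.1 h1 (M := ε / 2) (a := f x) (fun s hs => by
    have := hδ' ⟨hs.1, hs.2.trans_lt ht.2⟩ x
    rw [dist_comm, dist_eq_norm] at this
    rw [norm_neg]
    exact this.le) (by
      have h4 : Tendsto (fun τ : ℝ => heatFlow τ f x + (τ : ℂ) * g x) (𝓝[>] 0)
          (𝓝 (f x + ((0 : ℝ) : ℂ) * g x)) := by
        refine (tendsto_heatFlow f.continuous hC x).add (Tendsto.mul_const _ ?_)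
        exact (Complex.continuous_ofReal.tendsto 0).mono_left nhdsWithin_le_nhds
      simpa using h4)
  have h5 : -g x - ((t⁻¹ : ℝ) : ℂ) * (heatFlow t f x - f x) =
      -(((t⁻¹ : ℝ) : ℂ) * (heatFlow t f x + (t : ℂ) * g x - f x)) := by
    rw [Complex.ofReal_inv]
    field_simp
    ring
  rw [dist_eq_norm, h5, norm_neg, norm_mul, Complex.norm_real,
    Real.norm_of_nonneg (inv_pos.2 ht.1).le, inv_mul_eq_div]
  calc _ ≤ ε / 2 * t / t := by have := ht.1; gcongr
    _ = ε / 2 := by rw [mul_div_cancel_right₀ _ ht.1.ne']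
    _ < ε := by linarith

theorem exists_heat_equation [NeZero d] (y : LatticeGraph d) {t : ℝ} (ht : 0 < t) :
    ∃ u : (kirchhoffLaplacian d).domain,
      ((u : Lp ℂ 2 (length d)) =ᵐ[length d] fun x => (heatKernel t x y : ℂ)) ∧
      ∀ᵐ x ∂(length d), HasDerivAt (fun τ : ℝ => (heatKernel τ x y : ℂ))
        (-(kirchhoffLaplacian d u x)) t := by
  obtain ⟨u, hu1, hu2⟩ := (LinearPMap.mem_graph_iff _).1 (kernelLp_mem_graph ht y)
  refine ⟨u, ?_, ?_⟩
  · rw [hu1]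
    filter_upwards [kernelLp_ae_eq ht y] with x hx
    rw [hx, heatKernel_symm]
  · rw [hu2]
    filter_upwards [Lp.coeFn_neg (kernelDerivLp ht y), kernelDerivLp_ae_eq ht y] with x h1 h2
    rw [h1, Pi.neg_apply, neg_neg, h2, heatKernelDeriv_symm]
    exact (hasDerivAt_heatKernel ht x y).ofReal_comp

end LatticeGraph

/-! ### The Kolmogorov extension theorem -/

section Extension

open scoped ENNReal

variable {ι : Type*} {α : ι → Type*} [∀ i, MeasurableSpace (α i)] [∀ i, TopologicalSpace (α i)]
  [∀ i, PolishSpace (α i)] [∀ i, BorelSpace (α i)]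
  {P : ∀ J : Finset ι, Measure (∀ j : J, α j)} [∀ J, IsProbabilityMeasure (P J)]

/-- The points of a sequence of nonempty intersections of finitely many compact cylinders have a
coordinatewise limit along an ultrafilter, which belongs to all the cylinders. -/
theorem nonempty_iInter_cylinder_of_isCompact {β : ι → Type*} [∀ i, TopologicalSpace (β i)]
    {s : ℕ → Finset ι} {K : ∀ n, Set (∀ j : s n, β j)}
    (hK : ∀ n, IsCompact (K n)) (hK' : ∀ n, IsClosed (K n))
    (h : ∀ n, ∃ w : ∀ i, β i, ∀ k ≤ n, w ∈ cylinder (s k) (K k)) :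
    ∃ w : ∀ i, β i, ∀ k, w ∈ cylinder (s k) (K k) := by
  choose w hw using h
  have hlim : ∀ i, ∃ a : β i, (∃ k, i ∈ s k) →
      Tendsto (fun n => w n i) (hyperfilter ℕ : Filter ℕ) (𝓝 a) := by
    intro i
    by_cases hi : ∃ k, i ∈ s k
    · obtain ⟨k, hk⟩ := hi
      have hc : IsCompact ((fun v : ∀ j : s k, β j => v ⟨i, hk⟩) '' K k) :=
        (hK k).image (continuous_apply _)
      have hmem : (fun v : ∀ j : s k, β j => v ⟨i, hk⟩) '' K k ∈
          ((hyperfilter ℕ).map (fun n => w n i) : Ultrafilter (β i)) := by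
        rw [Ultrafilter.mem_map]
        refine Nat.hyperfilter_le_atTop ?_
        filter_upwards [eventually_ge_atTop k] with n hn
        exact ⟨_, hw n k hn, rfl⟩
      obtain ⟨a, -, ha⟩ := hc.ultrafilter_le_nhds' _ hmem
      exact ⟨a, fun _ => ha⟩
    · exact ⟨w 0 i, fun h => absurd h hi⟩
  choose a ha using hlim
  refine ⟨a, fun k => ?_⟩
  rw [mem_cylinder]
  refine (hK' k).mem_of_tendsto (b := (hyperfilter ℕ : Filter ℕ))
    (f := fun n => (s k).restrict (w n)) (tendsto_pi_nhds.2 fun j => ha j ⟨k, j.2⟩) ?_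
  refine Nat.hyperfilter_le_atTop ?_
  filter_upwards [eventually_ge_atTop k] with n hn
  exact hw n k hn

/-- The continuity at the empty set: cylinders are approximated from inside by compact ones. -/
theorem tendsto_projectiveFamilyContent_zero (hP : IsProjectiveMeasureFamily P)
    {A : ℕ → Set (∀ i, α i)} (hA : ∀ n, A n ∈ measurableCylinders α) (hanti : Antitone A)
    (hinter : ⋂ n, A n = ∅) :
    Tendsto (fun n => projectiveFamilyContent hP (A n)) atTop (𝓝 0) := by
  rw [ENNReal.tendsto_atTop_zero]
  by_contra! hcon
  obtain ⟨ε, hε, hcon⟩ := hcon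
  have hlt : ∀ n, ε < projectiveFamilyContent hP (A n) := fun n => by
    obtain ⟨m, hm, h⟩ := hcon n
    exact h.trans_le (projectiveFamilyContent_mono hP (hA m) (hA n) (hanti hm))
  choose s S hS hAS using fun n => (mem_measurableCylinders (A n)).1 (hA n)
  obtain ⟨δ, hδ, hsum⟩ := ENNReal.exists_pos_sum_of_countable' hε.ne' ℕ
  choose K hKS hK hK' hKδ using fun n =>
    (hS n).exists_isCompact_isClosed_sdiff_lt (measure_ne_top (P (s n)) _) (hδ n).ne'
  have hKm : ∀ n, MeasurableSet (S n \ K n) := fun n => (hS n).diff (hK' n).measurableSet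
  obtain ⟨w, hw⟩ := nonempty_iInter_cylinder_of_isCompact hK hK' fun n => by
    by_contra! hempty
    -- the part of `A n` that is lost in the compact cylinders has content less than `ε`
    have hsub : A n ⊆ ⋃ k ≤ n, cylinder (s k) (S k \ K k) := fun w hw => by
      obtain ⟨k, hk, hk'⟩ := hempty w
      have h1 : w ∈ cylinder (s k) (S k) := hAS k ▸ hanti hk hw
      exact mem_iUnion₂.2 ⟨k, hk, h1, hk'⟩
    have hcyl : ∀ k, cylinder (s k) (S k \ K k) ∈ measurableCylinders α := fun k =>
      cylinder_mem_measurableCylinders _ _ (hKm k)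
    have h1 : projectiveFamilyContent hP (A n) ≤
        projectiveFamilyContent hP (⋃ k ≤ n, cylinder (s k) (S k \ K k)) := by
      refine projectiveFamilyContent_mono hP (hA n) ?_ hsub
      have h2 := isSetRing_measurableCylinders.biUnion_mem (Finset.range (n + 1))
        (s := fun k => cylinder (s k) (S k \ K k)) fun k _ => hcyl k
      simpa only [Finset.mem_range_succ_iff] using h2
    have h2 : ∑ k ∈ Finset.range (n + 1), projectiveFamilyContent hP
        (cylinder (s k) (S k \ K k)) ≤ ∑ k ∈ Finset.range (n + 1), δ k :=
      Finset.sum_le_sum fun k _ => by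
        rw [projectiveFamilyContent_cylinder hP (hKm k)]
        exact (hKδ k).le
    exact ((hlt n).trans_le ((h1.trans (projectiveFamilyContent_iUnion_le hP hcyl n)).trans
      (h2.trans (ENNReal.sum_le_tsum _)))).not_gt hsum
  have hmem : w ∈ ⋂ n, A n := mem_iInter.2 fun n => by
    rw [hAS n]
    exact hKS n (hw n)
  rw [hinter] at hmem
  exact hmem

/-- **Kolmogorov's extension theorem**: a projective family of probability measures on the finite
products of Polish spaces has a projective limit. -/
theorem exists_isProjectiveLimit (hP : IsProjectiveMeasureFamily P) :
    ∃ μ : Measure (∀ i, α i), IsProjectiveLimit μ P := by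
  have hsub : (projectiveFamilyContent hP).IsSigmaSubadditive :=
    isSigmaSubadditive_of_addContent_iUnion_eq_tsum isSetRing_measurableCylinders
      fun f hf hUf hdisj => addContent_iUnion_eq_sum_of_tendsto_zero isSetRing_measurableCylinders
        (projectiveFamilyContent hP) (fun s hs => projectiveFamilyContent_ne_top hP)
        (fun A hA => tendsto_projectiveFamilyContent_zero hP hA) hf hUf hdisj
  refine ⟨(projectiveFamilyContent hP).measure isSetSemiring_measurableCylinders
    generateFrom_measurableCylinders.ge hsub, fun I => ?_⟩
  ext S hS
  rw [Measure.map_apply (Finset.measurable_restrict I) hS, AddContent.measure_eq,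
    ← cylinder, projectiveFamilyContent_cylinder hP hS]
  · exact generateFrom_measurableCylinders.symm
  · exact cylinder_mem_measurableCylinders _ _ hS

end Extension

/-! ### Markov processes with a given transition semigroup -/

section MarkovProcess

open ProbabilityTheory
open scoped ENNReal

variable {X : Type*} [MeasurableSpace X] {K : ℝ≥0 → Kernel X X}

theorem measurable_update_uncurry {ι : Type*} [DecidableEq ι] {X : Type*} [MeasurableSpace X]
    (i : ι) :
    Measurable fun q : X × (ι → X) => Function.update q.2 i q.1 := by
  refine measurable_pi_iff.2 fun j => ?_
  by_cases h : j = i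
  · subst h
    simpa using measurable_fst
  · simp only [Function.update_of_ne h]
    exact (measurable_pi_apply j).comp measurable_snd

/-- The law of a path which starts at time `s` and moves, from each of the times in the list to
the next one, according to the transition kernels `K`. Only its values at the times in the list
matter. -/
def pathLaw (K : ℝ≥0 → Kernel X X) : List ℝ≥0 → ℝ≥0 → Kernel X (ℝ≥0 → X)
  | [], _ => Kernel.deterministic (fun x _ => x) (by fun_prop)
  | t :: l, s => ((K (t - s)) ⊗ₖ Kernel.prodMkLeft X (pathLaw K l t)).map
      fun q : X × (ℝ≥0 → X) => Function.update q.2 t q.1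

/-- The integral of a product of functions of the values at the times in the list, with respect to
the law `pathLaw`. -/
def pathIntegral (K : ℝ≥0 → Kernel X X) (f : ℝ≥0 → X → ℝ≥0∞) :
    List ℝ≥0 → ℝ≥0 → X → ℝ≥0∞
  | [], _, _ => 1
  | t :: l, s, x => ∫⁻ y, f t y * pathIntegral K f l t y ∂(K (t - s) x)

instance isMarkovKernel_pathLaw [∀ t, IsMarkovKernel (K t)] (l : List ℝ≥0) (s : ℝ≥0) :
    IsMarkovKernel (pathLaw K l s) := by
  induction l generalizing s with
  | nil => rw [pathLaw]; infer_instance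
  | cons t l ih =>
    rw [pathLaw]
    have := ih t
    exact Kernel.IsMarkovKernel.map _ (measurable_update_uncurry t)

theorem measurable_pathIntegral [∀ t, IsMarkovKernel (K t)] {f : ℝ≥0 → X → ℝ≥0∞}
    (hf : ∀ t, Measurable (f t)) (l : List ℝ≥0) (s : ℝ≥0) :
    Measurable (pathIntegral K f l s) := by
  induction l generalizing s with
  | nil => exact measurable_const
  | cons t l ih => exact ((hf t).mul (ih t)).lintegral_kernel

/-- The times in the list are distinct, so a later step does not overwrite the value of an earlier one. -/
theorem lintegral_pathLaw [∀ t, IsMarkovKernel (K t)] {f : ℝ≥0 → X → ℝ≥0∞}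
    (hf : ∀ t, Measurable (f t)) {l : List ℝ≥0} (hl : l.Nodup) (s : ℝ≥0) (x : X) :
    ∫⁻ w, (l.map fun t => f t (w t)).prod ∂(pathLaw K l s x) = pathIntegral K f l s x := by
  have hmeas : ∀ l : List ℝ≥0, Measurable fun w : ℝ≥0 → X => (l.map fun t => f t (w t)).prod := by
    intro l
    induction l with
    | nil => simp
    | cons t l ih =>
      simp only [List.map_cons, List.prod_cons]
      exact ((hf t).comp (measurable_pi_apply t)).mul ih
  induction l generalizing s x with
  | nil => simp [pathIntegral]
  | cons t l ih =>
    have h1 := Kernel.lintegral_compProd (K (t - s)) (Kernel.prodMkLeft X (pathLaw K l t)) x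
      ((hmeas (t :: l)).comp (measurable_update_uncurry t))
    simp only [Function.comp_apply] at h1
    rw [pathLaw, Kernel.lintegral_map _ (measurable_update_uncurry t) _ (hmeas _), h1,
      pathIntegral]
    refine lintegral_congr fun y => ?_
    rw [List.nodup_cons] at hl
    rw [← ih hl.2, ← lintegral_const_mul _ (hmeas l), Kernel.prodMkLeft_apply]
    refine lintegral_congr fun w => ?_
    rw [List.map_cons, List.prod_cons, Function.update_self]
    congr 2
    refine List.map_congr_left fun r hr => ?_
    rw [Function.update_of_ne]
    rintro rfl
    exact hl.1 hr

/-- Integrating out the last time. -/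
theorem pathIntegral_append {f g : ℝ≥0 → X → ℝ≥0∞} {s t : ℝ≥0} (l : List ℝ≥0)
    (hl : ∀ r ∈ l, g r = f r) (hg : ∀ y, g s y = f s y * ∫⁻ z, f t z ∂(K (t - s) y))
    (r : ℝ≥0) (x : X) :
    pathIntegral K f (l ++ [s, t]) r x = pathIntegral K g (l ++ [s]) r x := by
  induction l generalizing r x with
  | nil => simp [pathIntegral, hg]
  | cons u l ih =>
    simp only [List.cons_append, pathIntegral]
    refine lintegral_congr fun y => ?_
    rw [ih fun v hv => hl v (by simp [hv]), hl u (by simp)]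

theorem filter_sort_mem {I J : Finset ℝ≥0} (h : J ⊆ I) :
    I.sort.filter (· ∈ J) = J.sort := by
  refine List.Perm.eq_of_pairwise' ((Finset.pairwise_sort I (· ≤ ·)).filter _)
    (Finset.pairwise_sort J (· ≤ ·)) ?_
  refine (List.perm_ext_iff_of_nodup ((I.sort_nodup _).filter _) (J.sort_nodup _)).2 fun a => ?_
  simp only [List.mem_filter, Finset.mem_sort, decide_eq_true_eq]
  exact ⟨fun h => h.2, fun ha => ⟨h ha, ha⟩⟩

theorem sort_insert_of_forall_lt {I : Finset ℝ≥0} {a : ℝ≥0} (h : ∀ b ∈ I, b < a) :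
    (insert a I).sort = I.sort ++ [a] := by
  refine List.Perm.eq_of_pairwise' (Finset.pairwise_sort _ (· ≤ ·)) ?_ ?_
  · refine List.pairwise_append.2 ⟨Finset.pairwise_sort _ (· ≤ ·), by simp, fun b hb c hc => ?_⟩
    rw [List.mem_singleton.1 hc]
    exact (h b ((Finset.mem_sort _).1 hb)).le
  · refine (List.perm_ext_iff_of_nodup (Finset.sort_nodup _ _) ?_).2 fun b => ?_
    · refine List.nodup_append'.2 ⟨Finset.sort_nodup _ _, by simp, ?_⟩
      simpa using fun ha => (h a ha).false
    · simp [or_comm]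

theorem prod_sort_eq {M : Type*} [CommMonoid M] (I : Finset ℝ≥0) (f : ℝ≥0 → M) :
    (I.sort.map f).prod = ∏ t ∈ I, f t := by
  rw [← List.prod_toFinset _ (I.sort_nodup _), Finset.sort_toFinset]

variable [∀ t, IsMarkovKernel (K t)]

theorem pathIntegral_cons_one (hK : ∀ s t, K t ∘ₖ K s = K (s + t)) {f : ℝ≥0 → X → ℝ≥0∞}
    (hf : ∀ t, Measurable (f t)) {t : ℝ≥0} (ht : f t = 1) {l : List ℝ≥0}
    (hl : ∀ r ∈ l, t ≤ r) {s : ℝ≥0} (hs : s ≤ t) (x : X) :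
    pathIntegral K f (t :: l) s x = pathIntegral K f l s x := by
  cases l with
  | nil => simp [pathIntegral, ht]
  | cons r l =>
    have hr : t ≤ r := hl r (by simp)
    simp only [pathIntegral, ht, Pi.one_apply, one_mul]
    have h1 := Kernel.lintegral_comp (K (r - t)) (K (t - s)) x
      ((hf r).mul (measurable_pathIntegral (K := K) hf l r))
    simp only [Pi.mul_apply] at h1
    rw [← h1, hK, add_comm, tsub_add_tsub_cancel hr hs]

/-- A time at which the function is constantly one can be left out. This is the consistency of the
finite dimensional laws. -/
theorem pathIntegral_filter (hK : ∀ s t, K t ∘ₖ K s = K (s + t)) {f : ℝ≥0 → X → ℝ≥0∞}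
    (hf : ∀ t, Measurable (f t)) (p : ℝ≥0 → Prop) [DecidablePred p] (hp : ∀ t, ¬ p t → f t = 1)
    {l : List ℝ≥0} (hl : l.SortedLT) {s : ℝ≥0} (hs : ∀ t ∈ l, s ≤ t) (x : X) :
    pathIntegral K f (l.filter p) s x = pathIntegral K f l s x := by
  rw [List.sortedLT_iff_pairwise] at hl
  induction l generalizing s x with
  | nil => rfl
  | cons t l ih =>
    rw [List.pairwise_cons] at hl
    by_cases ht : p t
    · rw [List.filter_cons_of_pos (by simpa using ht), pathIntegral, pathIntegral]
      refine lintegral_congr fun y => ?_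
      rw [ih hl.2 fun r hr => (hl.1 r hr).le]
    · rw [List.filter_cons_of_neg (by simpa using ht),
        pathIntegral_cons_one hK hf (hp t ht) (fun r hr => (hl.1 r hr).le) (hs t (by simp)),
        ih hl.2 fun r hr => hs r (by simp [hr])]

/-- The joint law of the values at the times in `I` of the process started at `x`. -/
def finiteLaw (K : ℝ≥0 → Kernel X X) (x : X) (I : Finset ℝ≥0) : Measure (I → X) :=
  (pathLaw K I.sort 0 x).map I.restrict

instance isProbabilityMeasure_finiteLaw (x : X) (I : Finset ℝ≥0) :
    IsProbabilityMeasure (finiteLaw K x I) :=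
  Measure.isProbabilityMeasure_map (Finset.measurable_restrict I).aemeasurable

theorem lintegral_finiteLaw {f : ℝ≥0 → X → ℝ≥0∞} (hf : ∀ t, Measurable (f t)) (x : X)
    (I : Finset ℝ≥0) :
    ∫⁻ w, ∏ t : I, f t (w t) ∂(finiteLaw K x I) = pathIntegral K f I.sort 0 x := by
  rw [finiteLaw, lintegral_map (by fun_prop) (Finset.measurable_restrict I),
    ← lintegral_pathLaw hf (I.sort_nodup _)]
  refine lintegral_congr fun w => ?_
  rw [prod_sort_eq]
  exact Finset.prod_coe_sort I fun t => f t (w t)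

theorem measure_pi_eq_lintegral {ι : Type*} [Fintype ι] (μ : Measure (ι → X)) {A : ι → Set X}
    (hA : ∀ i, MeasurableSet (A i)) :
    μ (univ.pi A) = ∫⁻ w, ∏ i, (A i).indicator 1 (w i) ∂μ := by
  rw [← lintegral_indicator_one (MeasurableSet.univ_pi hA)]
  refine lintegral_congr fun w => ?_
  by_cases h : w ∈ univ.pi A
  · rw [indicator_of_mem h]
    exact (Finset.prod_eq_one fun i _ => indicator_of_mem (h i (mem_univ i)) _).symm
  · rw [indicator_of_notMem h]
    simp only [mem_univ_pi, not_forall] at h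
    obtain ⟨i, hi⟩ := h
    exact (Finset.prod_eq_zero (Finset.mem_univ i) (indicator_of_notMem hi _)).symm

/-- It suffices to compare the laws on rectangles, where both are path integrals. -/
theorem isProjectiveMeasureFamily_finiteLaw (hK : ∀ s t, K t ∘ₖ K s = K (s + t)) (x : X) :
    IsProjectiveMeasureFamily (α := fun _ : ℝ≥0 => X) (finiteLaw K x) := by
  classical
  intro I J hJI
  have hr : Measurable (Finset.restrict₂ (π := fun _ : ℝ≥0 => X) hJI) :=
    Finset.measurable_restrict₂ hJI
  have := Measure.isProbabilityMeasure_map (μ := finiteLaw K x I) hr.aemeasurable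
  refine ext_of_generate_finite _ generateFrom_pi.symm isPiSystem_pi ?_ (by simp)
  rintro _ ⟨A, hA, rfl⟩
  have hA' : ∀ i, MeasurableSet (A i) := fun i => hA i (mem_univ i)
  let f : ℝ≥0 → X → ℝ≥0∞ := fun t => if h : t ∈ J then (A ⟨t, h⟩).indicator 1 else 1
  have hf : ∀ t, Measurable (f t) := fun t => by
    by_cases h : t ∈ J
    · simp only [f, h, dif_pos]
      exact measurable_one.indicator (hA' _)
    · simp only [f, h, dif_neg, not_false_eq_true]
      exact measurable_one
  have hfJ : ∀ t : J, f t = (A t).indicator 1 := fun t => by simp [f]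
  rw [measure_pi_eq_lintegral _ hA', measure_pi_eq_lintegral _ hA', lintegral_map _ hr]
  · simp only [← hfJ]
    rw [lintegral_finiteLaw hf, ← filter_sort_mem hJI,
      pathIntegral_filter hK hf (· ∈ J) (fun t ht => by simp [f, ht]) I.sortedLT_sort
        (fun t _ => zero_le), ← lintegral_finiteLaw hf]
    refine lintegral_congr fun w => ?_
    let w' : ℝ≥0 → X := fun t => if h : t ∈ I then w ⟨t, h⟩ else x
    have h1 := Finset.prod_coe_sort J fun t => f t (w' t)
    have h2 := Finset.prod_coe_sort I fun t => f t (w' t)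
    rw [Finset.prod_subset hJI fun t _ ht => by simp [f, ht], ← h2] at h1
    simpa [w', hJI _] using h1.symm
  · exact Finset.measurable_prod _ fun i _ =>
      (measurable_one.indicator (hA' i)).comp (measurable_pi_apply i)

theorem lintegral_of_isProjectiveLimit {x : X} {P : Measure (ℝ≥0 → X)}
    (hP : IsProjectiveLimit P (finiteLaw K x)) {f : ℝ≥0 → X → ℝ≥0∞} (hf : ∀ t, Measurable (f t))
    (I : Finset ℝ≥0) :
    ∫⁻ w, ∏ t ∈ I, f t (w t) ∂P = pathIntegral K f I.sort 0 x := by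
  rw [← lintegral_finiteLaw hf, ← hP I,
    lintegral_map (by fun_prop) (Finset.measurable_restrict I)]
  exact lintegral_congr fun w => (Finset.prod_coe_sort I fun t => f t (w t)).symm

/-- The Markov property of a process with the finite dimensional laws `finiteLaw`, in integrated
form. -/
theorem setLIntegral_kernel_of_isProjectiveLimit {x : X} {P : Measure (ℝ≥0 → X)}
    (hP : IsProjectiveLimit P (finiteLaw K x)) (s : ℝ≥0) {t : ℝ≥0} (ht : 0 < t) {A : Set X}
    (hA : MeasurableSet A) {B : Set (Iic s → X)} (hB : MeasurableSet B) :
    ∫⁻ w in (fun (w : ℝ≥0 → X) (r : Iic s) => w r) ⁻¹' B, K t (w s) A ∂P =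
      ∫⁻ w in (fun (w : ℝ≥0 → X) (r : Iic s) => w r) ⁻¹' B, A.indicator 1 (w (s + t)) ∂P := by
  classical
  have hPp : IsProbabilityMeasure P := hP.isProbabilityMeasure
  set R : (ℝ≥0 → X) → Iic s → X := fun w r => w r with hR
  have hRm : Measurable R := measurable_pi_iff.2 fun r => measurable_pi_apply _
  have hst : s < s + t := lt_add_of_pos_right s ht
  have h1m : Measurable fun w : ℝ≥0 → X => K t (w s) A :=
    ((K t).measurable_coe hA).comp (measurable_pi_apply s)
  have h2m : Measurable fun w : ℝ≥0 → X => A.indicator (1 : X → ℝ≥0∞) (w (s + t)) :=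
    (measurable_one.indicator hA).comp (measurable_pi_apply (s + t))
  -- it suffices to compare two finite measures on the rectangles
  suffices h : (P.withDensity fun w => K t (w s) A).map R =
      (P.withDensity fun w => A.indicator 1 (w (s + t))).map R by
    have h' := congrArg (fun ν => ν B) h
    simp only [Measure.map_apply hRm hB] at h'
    rwa [withDensity_apply _ (hRm hB), withDensity_apply _ (hRm hB)] at h'
  have hrect : ∀ (J : Finset (Iic s)) (C : Iic s → Set X), (∀ i, MeasurableSet (C i)) →
      (P.withDensity fun w => K t (w s) A).map R ((J : Set (Iic s)).pi C) =
        (P.withDensity fun w => A.indicator 1 (w (s + t))).map R ((J : Set (Iic s)).pi C) := by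
    intro J C hC
    have hpi : MeasurableSet ((J : Set (Iic s)).pi C) :=
      MeasurableSet.pi J.countable_toSet fun i _ => hC i
    -- as path integrals at the times of the rectangle, `s` and `s + t`; in `g` the last time has been
    -- integrated out
    let f : ℝ≥0 → X → ℝ≥0∞ := fun r =>
      if h : r ≤ s then (if ⟨r, h⟩ ∈ J then (C ⟨r, h⟩).indicator 1 else 1) else A.indicator 1
    let g : ℝ≥0 → X → ℝ≥0∞ := fun r y => if r = s then f s y * K t y A else f r y
    have hf : ∀ r, Measurable (f r) := fun r => by
      simp only [f]
      split_ifs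
      exacts [measurable_one.indicator (hC _), measurable_one, measurable_one.indicator hA]
    have hg : ∀ r, Measurable (g r) := fun r => by
      by_cases h : r = s
      · simp only [g, h, if_true]
        exact (hf s).mul ((K t).measurable_coe hA)
      · simpa only [g, h, if_false] using hf r
    let I : Finset ℝ≥0 := (J.map (Function.Embedding.subtype _)).erase s
    have hI : ∀ r ∈ I, r < s := fun r hr => by
      simp only [I, Finset.mem_erase, Finset.mem_map, Function.Embedding.subtype_apply] at hr
      obtain ⟨hne, j, -, rfl⟩ := hr
      exact lt_of_le_of_ne j.2 hne
    have hsI : s ∉ I := fun h => (hI s h).false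
    have hbox : ∀ w : ℝ≥0 → X, ∏ r ∈ insert s I, f r (w r) =
        (R ⁻¹' (J : Set (Iic s)).pi C).indicator 1 w := by
      intro w
      by_cases hw : w ∈ R ⁻¹' (J : Set (Iic s)).pi C
      · rw [indicator_of_mem hw]
        refine Finset.prod_eq_one fun r hr => ?_
        have hrs : r ≤ s := by
          rcases Finset.mem_insert.1 hr with rfl | h
          exacts [le_rfl, (hI r h).le]
        simp only [f, hrs, dif_pos]
        split_ifs with h
        · exact indicator_of_mem (hw ⟨r, hrs⟩ h) _
        · rfl
      · rw [indicator_of_notMem hw]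
        simp only [mem_preimage, Set.mem_pi, not_forall] at hw
        obtain ⟨j, hj, hw⟩ := hw
        have hj' : j ∈ J := hj
        refine Finset.prod_eq_zero (i := (j : ℝ≥0)) ?_ ?_
        · by_cases h : (j : ℝ≥0) = s
          · simp [h]
          · refine Finset.mem_insert_of_mem (Finset.mem_erase.2 ⟨h, ?_⟩)
            exact Finset.mem_map.2 ⟨j, hj', rfl⟩
        · have : (j : ℝ≥0) ≤ s := j.2
          simp only [f, this, dif_pos, hj', if_true]
          exact indicator_of_notMem hw _
    have hsort : (insert (s + t) (insert s I)).sort = I.sort ++ [s, s + t] := by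
      rw [sort_insert_of_forall_lt, sort_insert_of_forall_lt hI, List.append_assoc]
      · rfl
      · intro b hb
        rcases Finset.mem_insert.1 hb with rfl | h
        exacts [hst, (hI b h).trans hst]
    have hfst : f (s + t) = A.indicator 1 := by simp [f, ht.ne']
    have hmain := pathIntegral_append (K := K) (f := f) (g := g) (s := s) (t := s + t) I.sort
      (fun r hr => by
        have : r ≠ s := (hI r ((Finset.mem_sort _).1 hr)).ne
        funext y
        simp [g, this])
      (fun y => by simp [g, hfst, lintegral_indicator_one hA]) 0 x
    rw [← hsort, ← sort_insert_of_forall_lt hI, ← lintegral_of_isProjectiveLimit hP hf,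
      ← lintegral_of_isProjectiveLimit hP hg] at hmain
    rw [Measure.map_apply hRm hpi, Measure.map_apply hRm hpi, withDensity_apply _ (hRm hpi),
      withDensity_apply _ (hRm hpi), ← lintegral_indicator (hRm hpi),
      ← lintegral_indicator (hRm hpi)]
    have hind : ∀ (F : (ℝ≥0 → X) → ℝ≥0∞) w, (R ⁻¹' (J : Set (Iic s)).pi C).indicator F w =
        (∏ r ∈ insert s I, f r (w r)) * F w := fun F w => by
      rw [hbox]
      by_cases hw : w ∈ R ⁻¹' (J : Set (Iic s)).pi C <;> simp [hw]
    simp only [hind]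
    have hnotin : s + t ∉ insert s I := fun h => by
      rcases Finset.mem_insert.1 h with h | h
      exacts [hst.ne' h, (hst.trans (hI _ h)).false]
    simp only [Finset.prod_insert hnotin, hfst] at hmain
    simp only [mul_comm _ (A.indicator _ _)]
    rw [hmain]
    refine lintegral_congr fun w => ?_
    rw [Finset.prod_insert hsI, Finset.prod_insert hsI,
      Finset.prod_congr rfl fun r hr => show g r (w r) = f r (w r) by simp [g, (hI r hr).ne]]
    simp only [g, if_true]
    ring
  have hfin : IsFiniteMeasure ((P.withDensity fun w => K t (w s) A).map R) := by
    refine ⟨?_⟩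
    rw [Measure.map_apply hRm .univ, preimage_univ, withDensity_apply _ .univ,
      Measure.restrict_univ]
    refine (lintegral_mono fun w => prob_le_one).trans_lt ?_
    simp
  refine ext_of_generate_finite _ generateFrom_squareCylinders.symm
    (isPiSystem_squareCylinders (fun _ => MeasurableSpace.isPiSystem_measurableSet) (by simp)) ?_ ?_
  · rintro _ ⟨J, C, hC, rfl⟩
    exact hrect J C fun i => hC i (mem_univ i)
  · simpa using hrect ∅ (fun _ => univ) fun _ => .univ

/-- A Markov semigroup on a Polish space is the transition semigroup of a Markov process started
from any given point. -/
theorem exists_markovProcess [TopologicalSpace X] [PolishSpace X] [BorelSpace X]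
    (hK0 : K 0 = Kernel.id) (hK : ∀ s t, K t ∘ₖ K s = K (s + t)) (x : X) :
    ∃ P : Measure (ℝ≥0 → X), IsProbabilityMeasure P ∧ (∀ᵐ w ∂P, w 0 = x) ∧
      ∀ s t : ℝ≥0, 0 < t → ∀ A : Set X, MeasurableSet A →
        P[{w : ℝ≥0 → X | w (s + t) ∈ A}.indicator (fun _ => (1 : ℝ)) |
            MeasurableSpace.comap (fun (w : ℝ≥0 → X) (r : Iic s) => w r) inferInstance]
          =ᵐ[P] fun w => (K t (w s)).real A := by
  obtain ⟨P, hP⟩ := exists_isProjectiveLimit (isProjectiveMeasureFamily_finiteLaw hK x)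
  have hPp : IsProbabilityMeasure P := hP.isProbabilityMeasure
  refine ⟨P, hPp, ?_, fun s t ht A hA => ?_⟩
  · have h1 := lintegral_of_isProjectiveLimit hP (f := fun _ => ({x}ᶜ : Set X).indicator 1)
      (fun _ => measurable_one.indicator (measurableSet_singleton x).compl) {0}
    simp only [Finset.prod_singleton, Finset.sort_singleton, pathIntegral, mul_one, tsub_self, hK0,
      Kernel.lintegral_id] at h1
    have h2 : Measurable fun w : ℝ≥0 → X => ({x}ᶜ : Set X).indicator (1 : X → ℝ≥0∞) (w 0) :=
      (measurable_one.indicator (measurableSet_singleton x).compl).comp (measurable_pi_apply 0)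
    rw [indicator_of_notMem (by simp), lintegral_eq_zero_iff h2] at h1
    filter_upwards [h1] with w hw
    by_contra hne
    simp [hne] at hw
  · have hRm : Measurable fun (w : ℝ≥0 → X) (r : Iic s) => w r :=
      measurable_pi_iff.2 fun r => measurable_pi_apply _
    have hm := hRm.comap_le
    have hset : MeasurableSet {w : ℝ≥0 → X | w (s + t) ∈ A} := measurable_pi_apply (s + t) hA
    have h1m : Measurable fun w : ℝ≥0 → X => K t (w s) A :=
      ((K t).measurable_coe hA).comp (measurable_pi_apply s)
    have h2m : Measurable fun w : ℝ≥0 → X => A.indicator (1 : X → ℝ≥0∞) (w (s + t)) :=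
      (measurable_one.indicator hA).comp (measurable_pi_apply (s + t))
    have hgm : Measurable[MeasurableSpace.comap (fun (w : ℝ≥0 → X) (r : Iic s) => w r)
        inferInstance] fun w : ℝ≥0 → X => (K t (w s)).real A := by
      have h3 : Measurable fun v : Iic s → X => (K t (v ⟨s, self_mem_Iic⟩)).real A :=
        (((K t).measurable_coe hA).comp
          (measurable_pi_apply (⟨s, self_mem_Iic⟩ : Iic s))).ennreal_toReal
      exact h3.comp (comap_measurable _)
    symm
    refine ae_eq_condExp_of_forall_setIntegral_eq hm ((integrable_const 1).indicator hset)
      (fun B _ _ => ?_) ?_ hgm.stronglyMeasurable.aestronglyMeasurable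
    · refine (Integrable.of_bound (hgm.mono hm le_rfl).aestronglyMeasurable 1
        (ae_of_all _ fun w => ?_)).integrableOn
      rw [Real.norm_of_nonneg measureReal_nonneg]
      exact measureReal_le_one
    · rintro _ ⟨B, hB, rfl⟩ -
      have h3 := setLIntegral_kernel_of_isProjectiveLimit hP s ht hA hB
      have h4 : ∀ w : ℝ≥0 → X, {w : ℝ≥0 → X | w (s + t) ∈ A}.indicator (fun _ => (1 : ℝ)) w =
          (A.indicator (1 : X → ℝ≥0∞) (w (s + t))).toReal := fun w => by
        by_cases h : w (s + t) ∈ A <;> simp [h]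
      simp only [h4, measureReal_def]
      rw [integral_toReal h1m.aemeasurable (ae_of_all _ fun w => measure_lt_top _ _),
        integral_toReal h2m.aemeasurable (ae_of_all _ fun w => ?_), h3]
      by_cases h : w (s + t) ∈ A <;> simp [h]

end MarkovProcess

namespace LatticeGraph

variable {d : ℕ}

/-! ### Brownian motion on the graph -/

open ProbabilityTheory
open scoped ENNReal

theorem measurable_ofReal_heatKernel [NeZero d] {t : ℝ} (ht : 0 < t) :
    Measurable (Function.uncurry fun x y : LatticeGraph d => ENNReal.ofReal (heatKernel t x y)) :=
  (continuous_heatKernel ht).measurable.ennreal_ofReal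

/-- The transition probabilities `p(t,x,y) μ(dy)`, and the identity for `t = 0`. -/
def heatTransition (d : ℕ) (t : ℝ≥0) : Kernel (LatticeGraph d) (LatticeGraph d) :=
  if t = 0 then Kernel.id else
    (Kernel.const _ (length d)).withDensity fun x y => ENNReal.ofReal (heatKernel t x y)

theorem heatTransition_apply [NeZero d] {t : ℝ≥0} (ht : 0 < t) (x : LatticeGraph d) :
    heatTransition d t x =
      (length d).withDensity fun y => ENNReal.ofReal (heatKernel t x y) := by
  rw [heatTransition, if_neg ht.ne', Kernel.withDensity_apply _ (measurable_ofReal_heatKernel (NNReal.coe_pos.2 ht)),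
    Kernel.const_apply]

instance isMarkovKernel_heatTransition [NeZero d] (t : ℝ≥0) :
    IsMarkovKernel (heatTransition d t) := by
  rcases eq_zero_or_pos t with rfl | ht
  · rw [heatTransition, if_pos rfl]
    infer_instance
  · refine ⟨fun x => ⟨?_⟩⟩
    rw [heatTransition_apply ht, withDensity_apply _ .univ, Measure.restrict_univ,
      lintegral_heatKernel (NNReal.coe_pos.2 ht)]

/-- The Chapman–Kolmogorov equation in terms of transition probabilities. -/
theorem heatTransition_comp [NeZero d] (s t : ℝ≥0) :
    heatTransition d t ∘ₖ heatTransition d s = heatTransition d (s + t) := by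
  rcases eq_zero_or_pos s with rfl | hs
  · rw [zero_add]
    conv_lhs => rw [heatTransition.eq_1 d 0, if_pos rfl]
    exact Kernel.comp_id _
  rcases eq_zero_or_pos t with rfl | ht
  · rw [add_zero]
    conv_lhs => rw [heatTransition.eq_1 d 0, if_pos rfl]
    exact Kernel.id_comp _
  have hs' : (0 : ℝ) < s := NNReal.coe_pos.2 hs
  have ht' : (0 : ℝ) < t := NNReal.coe_pos.2 ht
  ext x A hA
  rw [Kernel.comp_apply' _ _ _ hA, heatTransition_apply hs, heatTransition_apply (add_pos hs ht),
    withDensity_apply _ hA]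
  have hm1 := (measurable_ofReal_heatKernel (d := d) hs').of_uncurry_left (x := x)
  have hm2 := measurable_ofReal_heatKernel (d := d) ht'
  rw [lintegral_withDensity_eq_lintegral_mul _ hm1 (Kernel.measurable_coe _ hA)]
  simp only [Pi.mul_apply, heatTransition_apply ht, withDensity_apply _ hA]
  calc ∫⁻ y, ENNReal.ofReal (heatKernel s x y) *
        ∫⁻ z in A, ENNReal.ofReal (heatKernel t y z) ∂length d ∂length d
      = ∫⁻ y, ∫⁻ z in A, ENNReal.ofReal (heatKernel s x y) *
          ENNReal.ofReal (heatKernel t y z) ∂length d ∂length d := by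
        refine lintegral_congr fun y => (lintegral_const_mul _ hm2.of_uncurry_left).symm
    _ = ∫⁻ z in A, ∫⁻ y, ENNReal.ofReal (heatKernel s x y) *
          ENNReal.ofReal (heatKernel t y z) ∂length d ∂length d := by
        refine lintegral_lintegral_swap (Measurable.aemeasurable ?_)
        exact (hm1.comp measurable_fst).mul hm2
    _ = _ := by
        refine lintegral_congr fun z => ?_
        obtain ⟨hint, heq⟩ := chapmanKolmogorov hs' ht' x z
        rw [NNReal.coe_add, heq, ofReal_integral_eq_lintegral_ofReal hint
          (ae_of_all _ fun y => mul_nonneg (heatKernel_nonneg hs' _ _) (heatKernel_nonneg ht' _ _))]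
        exact lintegral_congr fun y => (ENNReal.ofReal_mul (heatKernel_nonneg hs' _ _)).symm

theorem definesMarkovProcess_heatKernel [NeZero d] :
    DefinesMarkovProcess (length d) (heatKernel (d := d)) := by
  have h := fun x => exists_markovProcess (K := heatTransition d)
    (by rw [heatTransition, if_pos rfl]) heatTransition_comp x
  choose P hP using h
  refine ⟨P, fun x => ⟨(hP x).1, (hP x).2.1, fun s t ht A hA => ?_⟩⟩
  refine ((hP x).2.2 s t ht A hA).trans (ae_of_all _ fun w => ?_)
  have ht' : (0 : ℝ) < t := NNReal.coe_pos.2 ht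
  simp only
  rw [heatTransition_apply ht, measureReal_def, withDensity_apply _ hA,
    integral_eq_lintegral_of_nonneg_ae (ae_of_all _ fun y => heatKernel_nonneg ht' _ _)
      (continuous_heatKernel_right ht' _).aestronglyMeasurable]

theorem conditionA_heatKernel [NeZero d] :
    ConditionA (length d) (kirchhoffLaplacian d) heatKernel where
  continuousOn := continuousOn_heatKernel
  symm t _ x y := heatKernel_symm t x y
  nonneg t ht := heatKernel_nonneg ht
  integrable t ht := integrable_heatKernel ht
  integral_eq_one t ht := integral_heatKernel ht
  heat_equation y t ht := exists_heat_equation y ht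
  initial_condition f x := by
    simp only [kernelOp_heatKernel]
    exact tendsto_heatFlow f.continuous (C := ‖f‖) (fun x => f.norm_coe_le_norm x) x
  chapman_kolmogorov s t hs ht := chapmanKolmogorov hs ht
  l2_semigroup := by
    refine ⟨heatOp, fun t ht f => ?_, fun s t hs ht => ?_, tendsto_heatOp, mem_graph_iff_tendsto⟩
    · rw [kernelOp_heatKernel]
      exact heatOp_ae_eq ht f
    · exact heatOp_add hs ht
  acts_bounded t ht f := by
    rw [kernelOp_heatKernel]
    exact (isModerate_of_bounded f.continuous.aestronglyMeasurable
      (C := ‖f‖) fun x => f.norm_coe_le_norm x).continuous_heatFlow ht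
  acts_C0 t ht f := by
    rw [kernelOp_heatKernel]
    exact exists_C0_eq_heatFlow ht f
  strongly_continuous_C0 f := by
    simp only [kernelOp_heatKernel]
    exact tendstoUniformly_heatFlow_C0 f
  generator_C0 f g u v hu hv h := by
    simp only [kernelOp_heatKernel]
    exact tendstoUniformly_generator_C0 hu hv (mem_graph_iff_isWeakGenerator.1 h)
  markov := definesMarkovProcess_heatKernel

end LatticeGraph

namespace LatticeGraph

variable {d : ℕ}

open DirEdge

/-! ### The heat kernel at the vertices as a Fourier integral -/

/-- The coefficient of `gaussProfile 0 t n` in the heat kernel between the vertex `e.1` and the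
vertex `f.1`. -/
def vertexAmp (f : DirEdge d) (n : ℤ) (e : DirEdge d) : ℝ :=
  amp n e f + amp (n - 1) e (reverse f)

/-- The average of `vertexAmp`, up to a factor two, over the edges at a vertex. -/
def meanAmp (f : DirEdge d) (n : ℤ) (v : Fin d → ℤ) : ℝ :=
  (d : ℝ)⁻¹ * ∑ b, vertexAmp f n (v, b)

theorem vertexAmp_reverse (f : DirEdge d) (n : ℤ) (e : DirEdge d) :
    vertexAmp f n (reverse e) = vertexAmp f (1 - n) e := by
  have h1 := amp_neg n e (reverse f)
  have h2 := amp_neg (n - 1) e f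
  rw [reverse_reverse] at h1
  rw [vertexAmp, vertexAmp, ← h1, ← h2, neg_sub, show (1 - n - 1 : ℤ) = -n by ring, add_comm]

theorem vertexAmp_add_one [NeZero d] (f : DirEdge d) (n : ℤ) (e : DirEdge d) :
    vertexAmp f (n + 1) e + vertexAmp f (1 - n) e = meanAmp f n (target e) := by
  rw [← vertexAmp_reverse, vertexAmp, amp_add_one, show n + 1 - 1 = n - 1 + 1 by ring,
    amp_add_one, meanAmp]
  simp only [scatter, vertexAmp, Finset.sum_add_distrib]
  ring

theorem vertexAmp_neg [NeZero d] (f : DirEdge d) (n : ℤ) (e : DirEdge d) :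
    vertexAmp f (-n) e + vertexAmp f n e = meanAmp f n e.1 := by
  have h := vertexAmp_add_one f n (reverse e)
  rw [vertexAmp_reverse, vertexAmp_reverse, target_reverse] at h
  rw [← h]
  ring_nf

theorem inv_mul_sum_const_dir [NeZero d] (x : ℝ) :
    (d : ℝ)⁻¹ * ∑ _b : Fin d × Bool, x = 2 * x := by
  have hd : (d : ℝ) ≠ 0 := NeZero.ne _
  rw [sum_const_dir]
  field_simp

theorem meanAmp_neg [NeZero d] (f : DirEdge d) (n : ℤ) (v : Fin d → ℤ) :
    meanAmp f (-n) v = meanAmp f n v := by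
  have h : meanAmp f (-n) v + meanAmp f n v = 2 * meanAmp f n v := by
    rw [← inv_mul_sum_const_dir (d := d),
      Finset.sum_congr rfl fun b _ => (vertexAmp_neg f n (v, b)).symm, Finset.sum_add_distrib, mul_add]
    rfl
  linarith

/-- The averages satisfy the discrete wave equation. -/
theorem meanAmp_add_one [NeZero d] (f : DirEdge d) (n : ℤ) (v : Fin d → ℤ) :
    meanAmp f (n + 1) v + meanAmp f (n - 1) v =
      (d : ℝ)⁻¹ * ∑ b, meanAmp f n (v + step b) := by
  rw [← meanAmp_neg f (n - 1), neg_sub]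
  have h : ∀ b, meanAmp f n (v + step b) = vertexAmp f (n + 1) (v, b) + vertexAmp f (1 - n) (v, b) :=
    fun b => (vertexAmp_add_one f n (v, b)).symm
  simp only [h, Finset.sum_add_distrib, mul_add]
  rfl

theorem meanAmp_zero [NeZero d] (f : DirEdge d) (v : Fin d → ℤ) :
    meanAmp f 0 v = 2 / d * if v = f.1 then 1 else 0 := by
  have h : ∀ e : DirEdge d, vertexAmp f 0 e = (d : ℝ)⁻¹ * if e.1 = f.1 then 1 else 0 := by
    intro e
    have h1 := amp_neg 1 e (reverse f)
    have h2 := amp_add_one 0 (reverse e) f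
    rw [reverse_reverse] at h1
    rw [zero_add] at h2
    rw [vertexAmp, zero_sub, h1, h2, scatter, reverse_reverse, target_reverse]
    simp only [amp_zero]
    have h3 : ∀ b, ((e.1, b) = f) ↔ (b = f.2 ∧ e.1 = f.1) := fun b => by
      rw [Prod.ext_iff, and_comm]
    simp only [h3, ite_and, Finset.sum_ite_eq', Finset.mem_univ, if_true]
    ring
  rw [meanAmp, Finset.sum_congr rfl fun b _ => h (v, b)]
  refine (inv_mul_sum_const_dir (d := d) ((d : ℝ)⁻¹ * if v = f.1 then 1 else 0)).trans ?_
  ring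

/-- An even solution of the wave equation on `ℤ × ℤ^d` is determined by its initial values. -/
theorem eq_of_wave_recursion [NeZero d] {F G : ℤ → (Fin d → ℤ) → ℝ}
    (hF : ∀ n v, F (n + 1) v + F (n - 1) v = (d : ℝ)⁻¹ * ∑ b, F n (v + step b))
    (hG : ∀ n v, G (n + 1) v + G (n - 1) v = (d : ℝ)⁻¹ * ∑ b, G n (v + step b))
    (hF' : ∀ n v, F (-n) v = F n v) (hG' : ∀ n v, G (-n) v = G n v)
    (h0 : ∀ v, F 0 v = G 0 v) (n : ℤ) (v : Fin d → ℤ) : F n v = G n v := by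
  have key : ∀ m : ℕ, (∀ v, F m v = G m v) ∧ ∀ v, F (m + 1 : ℕ) v = G (m + 1 : ℕ) v := by
    intro m
    induction m with
    | zero =>
      refine ⟨by simpa using h0, fun v => ?_⟩
      have h1 := hF 0 v
      have h2 := hG 0 v
      simp only [zero_add, zero_sub, hF', hG', h0] at h1 h2
      simp only [zero_add, Nat.cast_one]
      linarith
    | succ m ih =>
      refine ⟨ih.2, fun v => ?_⟩
      have h1 := hF ((m + 1 : ℕ) : ℤ) v
      have h2 := hG ((m + 1 : ℕ) : ℤ) v
      rw [show ((m + 1 : ℕ) : ℤ) - 1 = m by push_cast; ring] at h1 h2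
      simp only [ih.2] at h1
      rw [show ((m + 1 + 1 : ℕ) : ℤ) = ((m + 1 : ℕ) : ℤ) + 1 by push_cast; ring]
      linarith [ih.1 v]
  obtain ⟨m, rfl | rfl⟩ := n.eq_nat_or_neg
  · exact (key m).1 v
  · rw [hF', hG', (key m).1 v]

/-- The symbol of the graph Laplacian: `cos (frequency θ)` is the average of the `cos θ_j`. -/
def frequency (θ : Fin d → ℝ) : ℝ := Real.arccos ((d : ℝ)⁻¹ * ∑ j, Real.cos (θ j))

theorem continuous_frequency : Continuous (frequency (d := d)) := by
  unfold frequency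
  fun_prop

theorem frequency_mem (θ : Fin d → ℝ) : frequency θ ∈ Icc 0 Real.pi :=
  ⟨Real.arccos_nonneg _, Real.arccos_le_pi _⟩

theorem cos_frequency [NeZero d] (θ : Fin d → ℝ) :
    Real.cos (frequency θ) = (d : ℝ)⁻¹ * ∑ j, Real.cos (θ j) := by
  have hd : (0 : ℝ) < d := Nat.cast_pos.2 (NeZero.pos d)
  have h1 : |∑ j, Real.cos (θ j)| ≤ d := by
    refine (Finset.abs_sum_le_sum_abs _ _).trans ?_
    refine (Finset.sum_le_sum fun j _ => Real.abs_cos_le_one (θ j)).trans ?_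
    simp
  have h2 : |(d : ℝ)⁻¹ * ∑ j, Real.cos (θ j)| ≤ 1 := by
    rw [abs_mul, abs_of_pos (inv_pos.2 hd), inv_mul_le_iff₀ hd, mul_one]
    exact h1
  rw [frequency, Real.cos_arccos (abs_le.1 h2).1 (abs_le.1 h2).2]

/-- The pairing of a momentum with a lattice point. -/
def phase (u : Fin d → ℤ) (θ : Fin d → ℝ) : ℝ := ∑ j, u j * θ j

theorem continuous_phase (u : Fin d → ℤ) : Continuous (phase u) := by
  unfold phase
  fun_prop

theorem sum_cos_phase_add_step [NeZero d] (u : Fin d → ℤ) (θ : Fin d → ℝ) :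
    (d : ℝ)⁻¹ * ∑ b, Real.cos (phase (u + step b) θ) =
      2 * Real.cos (frequency θ) * Real.cos (phase u θ) := by
  have h : ∀ b : Fin d × Bool, phase (u + step b) θ =
      phase u θ + (if b.2 then 1 else -1) * θ b.1 := by
    intro b
    simp only [phase, step, Pi.add_apply, Int.cast_add, add_mul, Finset.sum_add_distrib,
      Pi.single_apply]
    congr 1
    rw [Finset.sum_eq_single b.1 (fun j _ hj => by simp [hj]) (by simp)]
    cases b.2 <;> simp
  simp only [h, Fintype.sum_prod_type, Fintype.sum_bool, if_true, Bool.false_eq_true, if_false,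
    one_mul, neg_one_mul, ← sub_eq_add_neg]
  rw [cos_frequency]
  simp only [Real.cos_add, Real.cos_sub, Finset.mul_sum, Finset.sum_mul]
  refine Finset.sum_congr rfl fun j _ => ?_
  ring

/-- Lebesgue measure on the cube `(-π, π]^d` of momenta. -/
def momentumMeasure (d : ℕ) : Measure (Fin d → ℝ) :=
  Measure.pi fun _ => volume.restrict (Ioc (-Real.pi) Real.pi)

instance isFiniteMeasure_momentumMeasure : IsFiniteMeasure (momentumMeasure d) := by
  unfold momentumMeasure
  infer_instance

theorem integral_exp_int_mul (n : ℤ) :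
    ∫ x in Ioc (-Real.pi) Real.pi, Complex.exp (Complex.I * (n * x)) =
      if n = 0 then ((2 * Real.pi : ℝ) : ℂ) else 0 := by
  rw [← intervalIntegral.integral_of_le (by linarith [Real.pi_pos])]
  split_ifs with h
  · subst h
    simp
    ring
  · have hc : Complex.I * n ≠ 0 := by simp [h]
    simp only [← mul_assoc]
    rw [integral_exp_mul_complex hc]
    have h1 : Complex.exp (Complex.I * n * (Real.pi : ℝ)) =
        Complex.exp (Complex.I * n * ((-Real.pi : ℝ) : ℂ)) := by
      rw [Complex.exp_eq_exp_iff_exists_int]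
      exact ⟨n, by push_cast; ring⟩
    rw [h1, sub_self, zero_div]

theorem integral_cos_phase (u : Fin d → ℤ) :
    ∫ θ, Real.cos (phase u θ) ∂(momentumMeasure d) =
      if u = 0 then (2 * Real.pi) ^ d else 0 := by
  have h1 : ∫ θ, Complex.exp (Complex.I * phase u θ) ∂(momentumMeasure d) =
      if u = 0 then (((2 * Real.pi) ^ d : ℝ) : ℂ) else 0 := by
    have h2 : ∀ θ : Fin d → ℝ, Complex.exp (Complex.I * phase u θ) =
        ∏ j, Complex.exp (Complex.I * (u j * θ j)) := fun θ => by
      rw [← Complex.exp_sum, phase, Complex.ofReal_sum, Finset.mul_sum]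
      simp
    simp only [h2]
    rw [momentumMeasure, integral_fintype_prod_eq_prod
      (f := fun j (x : ℝ) => Complex.exp (Complex.I * (u j * x)))]
    simp only [integral_exp_int_mul]
    split_ifs with h
    · subst h
      simp
    · obtain ⟨j, hj⟩ := Function.ne_iff.1 h
      exact Finset.prod_eq_zero (Finset.mem_univ j) (if_neg hj)
  have h3 : ∀ θ, Real.cos (phase u θ) = (Complex.exp (Complex.I * phase u θ)).re := fun θ => by
    rw [mul_comm, Complex.exp_ofReal_mul_I_re]
  have hint : Integrable (fun θ => Complex.exp (Complex.I * phase u θ)) (momentumMeasure d) := by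
    refine Integrable.of_bound (C := 1) (Continuous.aestronglyMeasurable ?_) (ae_of_all _ fun θ => ?_)
    · have := continuous_phase u
      fun_prop
    · rw [mul_comm, Complex.norm_exp_ofReal_mul_I]
  simp only [h3]
  have h4 := integral_re hint
  simp only [RCLike.re_to_complex] at h4
  rw [h4, h1]
  split_ifs
  exacts [Complex.ofReal_re _, Complex.zero_re]

theorem integrable_momentum {F : (Fin d → ℝ) → ℝ} (hF : Continuous F) {C : ℝ}
    (hC : ∀ θ, |F θ| ≤ C) : Integrable F (momentumMeasure d) :=
  Integrable.of_bound hF.aestronglyMeasurable C (ae_of_all _ hC)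

theorem abs_cos_mul_cos_le (x y : ℝ) : |Real.cos x * Real.cos y| ≤ 1 := by
  rw [abs_mul]
  exact mul_le_one₀ (Real.abs_cos_le_one _) (abs_nonneg _) (Real.abs_cos_le_one _)

theorem integrable_cos_mul_cos_phase (n : ℤ) (u : Fin d → ℤ) :
    Integrable (fun θ => Real.cos (n * frequency θ) * Real.cos (phase u θ)) (momentumMeasure d) := by
  have h1 := continuous_phase u
  have h2 := continuous_frequency (d := d)
  exact integrable_momentum (by fun_prop) fun θ => abs_cos_mul_cos_le _ _

/-- Both sides are even solutions of the discrete wave equation with the same initial values. -/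
theorem meanAmp_eq_integral [NeZero d] (f : DirEdge d) (n : ℤ) (v : Fin d → ℤ) :
    meanAmp f n v = 2 / d * ((2 * Real.pi) ^ d)⁻¹ *
      ∫ θ, Real.cos (n * frequency θ) * Real.cos (phase (v - f.1) θ) ∂(momentumMeasure d) := by
  refine eq_of_wave_recursion (G := fun n v => 2 / d * ((2 * Real.pi) ^ d)⁻¹ *
      ∫ θ, Real.cos (n * frequency θ) * Real.cos (phase (v - f.1) θ) ∂(momentumMeasure d))
    (meanAmp_add_one f) ?_ (meanAmp_neg f) ?_ ?_ n v
  · intro n v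
    have h1 : ∫ θ, ∑ b, Real.cos (n * frequency θ) *
        Real.cos (phase (v - f.1 + step b) θ) ∂(momentumMeasure d) =
        ∑ b, ∫ θ, Real.cos (n * frequency θ) *
        Real.cos (phase (v - f.1 + step b) θ) ∂(momentumMeasure d) :=
      integral_finsetSum _ fun b _ => integrable_cos_mul_cos_phase _ _
    simp only [add_sub_right_comm]
    rw [← mul_add, ← integral_add (integrable_cos_mul_cos_phase _ _)
      (integrable_cos_mul_cos_phase _ _), ← Finset.mul_sum, mul_left_comm, ← h1,
      ← integral_const_mul (d : ℝ)⁻¹]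
    congr 1
    refine integral_congr_ae (ae_of_all _ fun θ => ?_)
    simp only
    rw [← Finset.mul_sum, mul_left_comm, sum_cos_phase_add_step]
    push_cast
    rw [add_mul, sub_mul, one_mul, Real.cos_add, Real.cos_sub]
    ring
  · intro n v
    simp
  · intro v
    rw [meanAmp_zero]
    simp only [Int.cast_zero, zero_mul, Real.cos_zero, one_mul, integral_cos_phase, sub_eq_zero]
    have : (2 * Real.pi) ^ d ≠ 0 := by positivity
    split_ifs
    · rw [mul_one, mul_assoc, inv_mul_cancel₀ this, mul_one]
    · simp

/-- The periodic heat kernel `∑ₖ exp (-t (a + 2πk)²)`. -/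
def periodicGauss (t a : ℝ) : ℝ := ∑' k : ℤ, Real.exp (-t * (a + 2 * Real.pi * k) ^ 2)

theorem summable_gaussProfile_int {t : ℝ} (ht : 0 < t) :
    Summable fun n : ℤ => gaussProfile 0 t n := by
  obtain ⟨C, hC, h⟩ := exists_abs_gaussProfile_sub_le 0 (b := t) 0
  refine Summable.of_norm_bounded (summable_half_natAbs.mul_left C) fun n => ?_
  have h1 := h t ht le_rfl 0 (by simp) n
  rw [zero_sub, gaussProfile_zero_neg] at h1
  refine h1.trans ?_
  gcongr
  norm_num

theorem gaussProfile_zero_nonneg (t x : ℝ) : 0 ≤ gaussProfile 0 t x := by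
  rw [gaussProfile_zero]
  positivity

/-- Poisson's summation formula for the Gaussian function. -/
theorem heatNorm_mul_tsum_cos {t : ℝ} (ht : 0 < t) (a : ℝ) :
    heatNorm t * ∑' n : ℤ, Real.cos (n * a) * gaussProfile 0 t n = periodicGauss t a := by
  have hpi := Real.pi_pos
  have hpi' : (Real.pi : ℂ) ≠ 0 := by exact_mod_cast hpi.ne'
  have htC : (t : ℂ) ≠ 0 := by exact_mod_cast ht.ne'
  have hpos : 0 < ((4 * Real.pi * t)⁻¹ : ℝ) := by positivity
  have h := Complex.tsum_exp_neg_quadratic (a := (((4 * Real.pi * t)⁻¹ : ℝ) : ℂ))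
    (by rwa [Complex.ofReal_re]) (Complex.I * a / (2 * Real.pi))
  have h1 : ∀ n : ℤ, Complex.exp (-Real.pi * (((4 * Real.pi * t)⁻¹ : ℝ) : ℂ) * (n : ℂ) ^ 2 +
      2 * Real.pi * (Complex.I * a / (2 * Real.pi)) * n) =
      (gaussProfile 0 t n : ℂ) * Complex.exp (((n * a : ℝ) : ℂ) * Complex.I) := by
    intro n
    rw [gaussProfile_zero, Complex.ofReal_exp, ← Complex.exp_add]
    congr 1
    push_cast
    field_simp
  have h2 : ∀ n : ℤ, Complex.exp (-Real.pi / (((4 * Real.pi * t)⁻¹ : ℝ) : ℂ) *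
      (n + Complex.I * (Complex.I * a / (2 * Real.pi))) ^ 2) =
      ((Real.exp (-t * (a + 2 * Real.pi * (-n : ℤ)) ^ 2) : ℝ) : ℂ) := by
    intro n
    rw [Complex.ofReal_exp]
    congr 1
    push_cast
    rw [← mul_div_assoc, ← mul_assoc, Complex.I_mul_I]
    field_simp
    ring
  have h3 : (1 : ℂ) / (((4 * Real.pi * t)⁻¹ : ℝ) : ℂ) ^ (1 / 2 : ℂ) =
      ((√(4 * Real.pi * t) : ℝ) : ℂ) := by
    rw [show (1 / 2 : ℂ) = (((1 / 2 : ℝ)) : ℂ) by push_cast; rfl, ← Complex.ofReal_cpow hpos.le,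
      ← Real.sqrt_eq_rpow, Real.sqrt_inv]
    push_cast
    rw [one_div, inv_inv]
  simp only [h1, h2, h3] at h
  rw [← Complex.ofReal_tsum, ← Complex.ofReal_mul] at h
  have hs : Summable fun n : ℤ =>
      (gaussProfile 0 t n : ℂ) * Complex.exp (((n * a : ℝ) : ℂ) * Complex.I) := by
    refine Summable.of_norm_bounded (summable_gaussProfile_int ht) fun n => ?_
    rw [norm_mul, Complex.norm_exp_ofReal_mul_I, mul_one, Complex.norm_real,
      Real.norm_of_nonneg (gaussProfile_zero_nonneg _ _)]
  have h4 := congrArg Complex.re h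
  rw [Complex.re_tsum hs, Complex.ofReal_re] at h4
  simp only [Complex.re_ofReal_mul, Complex.exp_ofReal_mul_I_re] at h4
  simp only [mul_comm (Real.cos _)]
  have h5 : √(4 * Real.pi * t) ≠ 0 := by positivity
  rw [h4, heatNorm, inv_mul_cancel_left₀ h5, periodicGauss]
  exact (Equiv.neg ℤ).tsum_eq fun k : ℤ => Real.exp (-t * (a + 2 * Real.pi * k) ^ 2)

/-- The heat kernel between two vertices, as a function of the difference of the vertices. -/
def vertexKernel (t : ℝ) (u : Fin d → ℤ) : ℝ :=
  (d : ℝ)⁻¹ * ((2 * Real.pi) ^ d)⁻¹ *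
    ∫ θ, periodicGauss t (frequency θ) * Real.cos (phase u θ) ∂(momentumMeasure d)

theorem heatKernel_vertex_eq_tsum [NeZero d] {t : ℝ} (ht : 0 < t) (e f : DirEdge d) :
    heatKernel t (point e 0) (point f 0) =
      heatNorm t * ∑' n : ℤ, vertexAmp f n e * gaussProfile 0 t n := by
  rw [heatKernel_point ht e f (by simp) (by simp), sourceSum, transport, transport]
  congr 1
  have h1 := summable_transport 0 ht e f (0 - 0)
  have h2 := summable_transport 0 ht e (reverse f) (0 + 0 - 1)
  rw [← (Equiv.subRight (1 : ℤ)).tsum_eq fun n : ℤ => amp n e (reverse f) *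
    gaussProfile 0 t (0 + 0 - 1 - n)]
  rw [← (Equiv.subRight (1 : ℤ)).summable_iff] at h2
  have h3 := h1.tsum_add h2
  simp only [Function.comp_apply] at h3
  rw [← h3]
  refine tsum_congr fun n => ?_
  simp only [Equiv.subRight_apply]
  rw [show (0 - 0 - (n : ℝ)) = -n by ring,
    show (0 + 0 - 1 - ((n - 1 : ℤ) : ℝ)) = -n by push_cast; ring, gaussProfile_zero_neg, ← add_mul]
  rfl

theorem summable_vertexAmp_mul [NeZero d] {t : ℝ} (ht : 0 < t) (e f : DirEdge d) :
    Summable fun n : ℤ => vertexAmp f n e * gaussProfile 0 t n := by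
  have h1 := summable_transport 0 ht e f 0
  have h2 := summable_transport 0 ht e (reverse f) (-1)
  rw [← (Equiv.subRight (1 : ℤ)).summable_iff] at h2
  refine (h1.add h2).congr fun n => ?_
  simp only [Function.comp_apply, Equiv.subRight_apply]
  rw [zero_sub, show (-1 - ((n - 1 : ℤ) : ℝ)) = -n by push_cast; ring, gaussProfile_zero_neg,
    ← add_mul]
  rfl

/-- The Fourier integral for the averaged amplitudes, summed by Poisson's formula. -/
theorem heatKernel_vertex [NeZero d] {t : ℝ} (ht : 0 < t) (e f : DirEdge d) :
    heatKernel t (point e 0) (point f 0) = vertexKernel t (e.1 - f.1) := by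
  have hd : (d : ℝ) ≠ 0 := NeZero.ne _
  -- the kernel is the same for all the edges at the vertex, so one may take the average
  have h1 : heatKernel t (point e 0) (point f 0) =
      heatNorm t * ∑' n : ℤ, 2⁻¹ * meanAmp f n e.1 * gaussProfile 0 t n := by
    have h2 : ∀ b, heatKernel t (point e 0) (point f 0) =
        heatNorm t * ∑' n : ℤ, vertexAmp f n (e.1, b) * gaussProfile 0 t n := fun b => by
      rw [← heatKernel_vertex_eq_tsum ht]
      obtain ⟨v, a⟩ := e
      rw [point_zero_eq v a b]
    have h3 := inv_mul_sum_const_dir (d := d) (heatKernel t (point e 0) (point f 0))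
    rw [Finset.sum_congr rfl fun b _ => h2 b, ← Finset.mul_sum,
      ← Summable.tsum_finsetSum fun b _ => summable_vertexAmp_mul ht (e.1, b) f] at h3
    simp only [← Finset.sum_mul] at h3
    have h4 : ∀ n : ℤ, 2⁻¹ * meanAmp f n e.1 * gaussProfile 0 t n =
        (2⁻¹ * (d : ℝ)⁻¹) * ((∑ b, vertexAmp f n (e.1, b)) * gaussProfile 0 t n) := fun n => by
      rw [meanAmp]
      ring
    simp only [h4]
    rw [tsum_mul_left]
    linarith
  let F : ℤ → (Fin d → ℝ) → ℝ := fun n θ =>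
    Real.cos (n * frequency θ) * Real.cos (phase (e.1 - f.1) θ) * gaussProfile 0 t n
  have hF : ∀ n, Integrable (F n) (momentumMeasure d) := fun n =>
    (integrable_cos_mul_cos_phase n _).mul_const _
  have hFs : Summable fun n => ∫ θ, ‖F n θ‖ ∂(momentumMeasure d) := by
    refine Summable.of_nonneg_of_le (fun n => integral_nonneg fun θ => norm_nonneg _) (fun n => ?_)
      ((summable_gaussProfile_int ht).mul_right ((momentumMeasure d).real univ))
    have h5 : ∫ _θ, gaussProfile 0 t n ∂(momentumMeasure d) =
        gaussProfile 0 t n * (momentumMeasure d).real univ := by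
      rw [integral_const, smul_eq_mul, mul_comm]
    rw [← h5]
    refine integral_mono (hF n).norm (integrable_const _) fun θ => ?_
    simp only [F]
    rw [norm_mul, Real.norm_of_nonneg (gaussProfile_zero_nonneg t n)]
    exact mul_le_of_le_one_left (gaussProfile_zero_nonneg t n) (abs_cos_mul_cos_le _ _)
  have h6 := integral_tsum_of_summable_integral_norm hF hFs
  have h7 : ∀ θ, ∑' n, F n θ =
      (∑' n : ℤ, Real.cos (n * frequency θ) * gaussProfile 0 t n) *
        Real.cos (phase (e.1 - f.1) θ) := fun θ => by
    rw [← tsum_mul_right]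
    refine tsum_congr fun n => ?_
    simp only [F]
    ring
  simp only [h7, F, integral_mul_const] at h6
  have h8 : ∀ n : ℤ, 2⁻¹ * meanAmp f n e.1 * gaussProfile 0 t n =
      (d : ℝ)⁻¹ * ((2 * Real.pi) ^ d)⁻¹ * ((∫ θ, Real.cos (n * frequency θ) *
        Real.cos (phase (e.1 - f.1) θ) ∂(momentumMeasure d)) * gaussProfile 0 t n) := fun n => by
    rw [meanAmp_eq_integral]
    ring
  simp only [h1, h8]
  rw [tsum_mul_left, h6, mul_left_comm, ← integral_const_mul, vertexKernel]
  congr 2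
  funext θ
  rw [← mul_assoc, heatNorm_mul_tsum_cos ht]

/-! ### Large times: the vertices -/

theorem one_sub_cos_eq_sinc (a : ℝ) : 1 - Real.cos a = a ^ 2 / 2 * Real.sinc (a / 2) ^ 2 := by
  have h1 : Real.sin (a / 2) = a / 2 * Real.sinc (a / 2) := by
    by_cases h : a / 2 = 0
    · simp [h]
    · rw [Real.sinc_of_ne_zero h, mul_div_cancel₀ _ h]
  have h2 : Real.cos a = 1 - 2 * Real.sin (a / 2) ^ 2 := by
    rw [show a = 2 * (a / 2) by ring, Real.cos_two_mul, Real.cos_sq']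
    ring_nf
  rw [h2, h1]
  ring

theorem one_sub_cos_frequency [NeZero d] (θ : Fin d → ℝ) :
    1 - Real.cos (frequency θ) = (d : ℝ)⁻¹ * ∑ j, (1 - Real.cos (θ j)) := by
  have hd : (d : ℝ) ≠ 0 := NeZero.ne _
  rw [cos_frequency, Finset.sum_sub_distrib, mul_sub]
  simp [hd]

theorem frequency_zero [NeZero d] : frequency (0 : Fin d → ℝ) = 0 := by
  have hd : (d : ℝ) ≠ 0 := NeZero.ne _
  simp [frequency, hd]

/-- On the momentum cube, the frequency is comparable to the modulus of the momentum. -/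
theorem frequency_sq_ge [NeZero d] {θ : Fin d → ℝ} (hθ : ∀ j, |θ j| ≤ Real.pi) :
    4 / (d * Real.pi ^ 2) * ∑ j, θ j ^ 2 ≤ frequency θ ^ 2 := by
  have hpi := Real.pi_pos
  have hd : (0 : ℝ) < d := Nat.cast_pos.2 (NeZero.pos d)
  have h1 := Real.one_sub_sq_div_two_le_cos (x := frequency θ)
  have h2 : ∑ j, 2 / Real.pi ^ 2 * θ j ^ 2 ≤ ∑ j, (1 - Real.cos (θ j)) :=
    Finset.sum_le_sum fun j _ => by linarith [Real.cos_le_one_sub_mul_cos_sq (hθ j)]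
  have h3 : (d : ℝ)⁻¹ * ∑ j, 2 / Real.pi ^ 2 * θ j ^ 2 ≤ 1 - Real.cos (frequency θ) := by
    rw [one_sub_cos_frequency]
    gcongr
  rw [← Finset.mul_sum] at h3
  calc _ = 2 * ((d : ℝ)⁻¹ * (2 / Real.pi ^ 2 * ∑ j, θ j ^ 2)) := by
        field_simp
        ring
    _ ≤ _ := by linarith

/-- At small momenta, the square of the frequency is `|θ|² / d`. -/
theorem tendsto_mul_frequency_sq [NeZero d] (x : Fin d → ℝ) :
    Tendsto (fun t : ℝ => t * frequency ((√t)⁻¹ • x) ^ 2) atTop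
      (𝓝 ((d : ℝ)⁻¹ * ∑ j, x j ^ 2)) := by
  have hs : Tendsto (fun t : ℝ => (√t)⁻¹) atTop (𝓝 0) :=
    tendsto_inv_atTop_zero.comp Real.tendsto_sqrt_atTop
  have hx : Tendsto (fun t : ℝ => (√t)⁻¹ • x) atTop (𝓝 0) := by
    simpa using hs.smul_const x
  have hsinc : ∀ {g : ℝ → ℝ}, Tendsto g atTop (𝓝 0) →
      Tendsto (fun t => Real.sinc (g t / 2) ^ 2) atTop (𝓝 1) := fun {g} hg => by
    have h1 : Continuous fun a : ℝ => Real.sinc (a / 2) ^ 2 := by fun_prop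
    have h2 := (h1.tendsto 0).comp hg
    simpa [Function.comp_def] using h2
  have hfreq : Tendsto (fun t : ℝ => frequency ((√t)⁻¹ • x)) atTop (𝓝 0) := by
    have := (continuous_frequency.tendsto (0 : Fin d → ℝ)).comp hx
    rwa [frequency_zero] at this
  have h1 := hsinc hfreq
  have h2 : Tendsto (fun t : ℝ => (d : ℝ)⁻¹ * ∑ j, x j ^ 2 * Real.sinc ((√t)⁻¹ * x j / 2) ^ 2)
      atTop (𝓝 ((d : ℝ)⁻¹ * ∑ j, x j ^ 2 * 1)) := by
    refine (tendsto_finsetSum _ fun j _ => (hsinc ?_).const_mul _).const_mul _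
    simpa using hs.mul_const (x j)
  have h3 := h2.div h1 one_ne_zero
  simp only [mul_one, div_one] at h3
  refine h3.congr' ?_
  filter_upwards [eventually_gt_atTop 0, h1.eventually_ne one_ne_zero] with t ht hne
  rw [Pi.div_apply, div_eq_iff hne]
  have h4 := one_sub_cos_frequency ((√t)⁻¹ • x)
  simp only [one_sub_cos_eq_sinc, Pi.smul_apply, smul_eq_mul, mul_pow, inv_pow,
    Real.sq_sqrt ht.le] at h4
  have h5 : ∑ j, t⁻¹ * x j ^ 2 / 2 * Real.sinc ((√t)⁻¹ * x j / 2) ^ 2 =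
      t⁻¹ / 2 * ∑ j, x j ^ 2 * Real.sinc ((√t)⁻¹ * x j / 2) ^ 2 := by
    rw [Finset.mul_sum]
    exact Finset.sum_congr rfl fun j _ => by ring
  rw [h5] at h4
  have h6 : t * frequency ((√t)⁻¹ • x) ^ 2 * Real.sinc (frequency ((√t)⁻¹ • x) / 2) ^ 2 =
      2 * t * (frequency ((√t)⁻¹ • x) ^ 2 / 2 * Real.sinc (frequency ((√t)⁻¹ • x) / 2) ^ 2) := by
    ring
  rw [h6, h4]
  field_simp

/-- The integral of the limiting Gaussian function of the rescaled momenta. -/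
def gaussIntegral (d : ℕ) : ℝ := ∫ x : Fin d → ℝ, Real.exp (-((d : ℝ)⁻¹ * ∑ j, x j ^ 2))

theorem integrable_exp_neg_mul_sum_sq {c : ℝ} (hc : 0 < c) :
    Integrable fun x : Fin d → ℝ => Real.exp (-(c * ∑ j, x j ^ 2)) := by
  have h := Integrable.fintype_prod (ι := Fin d) (f := fun _ (y : ℝ) => Real.exp (-c * y ^ 2))
    (μ := fun _ => volume) fun _ => integrable_exp_neg_mul_sq hc
  refine h.congr (ae_of_all _ fun x => ?_)
  simp only
  rw [← Real.exp_sum, ← Finset.mul_sum, neg_mul]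

theorem gaussIntegral_pos [NeZero d] : 0 < gaussIntegral d :=
  integral_exp_pos (integrable_exp_neg_mul_sum_sq
    (inv_pos.2 (Nat.cast_pos.2 (NeZero.pos d))))

theorem momentumMeasure_eq : momentumMeasure d =
    volume.restrict (univ.pi fun _ => Ioc (-Real.pi) Real.pi) := by
  rw [momentumMeasure, volume_pi, Measure.restrict_pi_pi]

theorem rpow_half_eq {t : ℝ} (ht : 0 ≤ t) : t ^ ((d : ℝ) / 2) = √t ^ d := by
  rw [Real.sqrt_eq_rpow, ← Real.rpow_natCast, ← Real.rpow_mul ht]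
  ring_nf

theorem rpow_half_mul_integral {t : ℝ} (ht : 0 ≤ t) (F : (Fin d → ℝ) → ℝ) :
    t ^ ((d : ℝ) / 2) * ∫ θ, F θ ∂(momentumMeasure d) =
      ∫ x, (univ.pi fun _ : Fin d => Ioc (-Real.pi) Real.pi).indicator F ((√t)⁻¹ • x) := by
  rw [Measure.integral_comp_inv_smul_of_nonneg _ _ (Real.sqrt_nonneg t), rpow_half_eq ht,
    momentumMeasure_eq, integral_indicator (MeasurableSet.univ_pi fun _ => measurableSet_Ioc),
    smul_eq_mul, Module.finrank_fin_fun]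

/-- Laplace's method: rescaled momenta and dominated convergence. -/
theorem tendsto_rpow_mul_integral_gauss [NeZero d] (u : Fin d → ℤ) :
    Tendsto (fun t : ℝ => t ^ ((d : ℝ) / 2) * ∫ θ, Real.exp (-t * frequency θ ^ 2) *
      Real.cos (phase u θ) ∂(momentumMeasure d)) atTop (𝓝 (gaussIntegral d)) := by
  have hpi := Real.pi_pos
  have hd : (0 : ℝ) < d := Nat.cast_pos.2 (NeZero.pos d)
  set Q : Set (Fin d → ℝ) := univ.pi fun _ => Ioc (-Real.pi) Real.pi with hQ
  have hQm : MeasurableSet Q := MeasurableSet.univ_pi fun _ => measurableSet_Ioc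
  have hpc := continuous_phase u
  have hfc := continuous_frequency (d := d)
  have hmain : Tendsto (fun t : ℝ => ∫ x, Q.indicator (fun θ => Real.exp (-t * frequency θ ^ 2) *
      Real.cos (phase u θ)) ((√t)⁻¹ • x)) atTop (𝓝 (gaussIntegral d)) := by
    refine tendsto_integral_filter_of_dominated_convergence
      (fun x => Real.exp (-(4 / (d * Real.pi ^ 2) * ∑ j, x j ^ 2)))
      (Eventually.of_forall fun t => ?_) ?_ (integrable_exp_neg_mul_sum_sq (by positivity))
      (ae_of_all _ fun x => ?_)
    · refine Measurable.aestronglyMeasurable ?_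
      exact (Measurable.indicator (by fun_prop) hQm).comp (measurable_const_smul _)
    · filter_upwards [eventually_gt_atTop 0] with t ht
      refine ae_of_all _ fun x => ?_
      by_cases hx : (√t)⁻¹ • x ∈ Q
      · rw [indicator_of_mem hx, norm_mul, Real.norm_eq_abs, Real.norm_eq_abs, Real.abs_exp]
        refine (mul_le_of_le_one_right (Real.exp_pos _).le (Real.abs_cos_le_one _)).trans ?_
        refine Real.exp_le_exp.2 ?_
        have h1 := frequency_sq_ge (θ := (√t)⁻¹ • x) fun j => by
          have := hx j (mem_univ j)
          exact abs_le.2 ⟨this.1.le, this.2⟩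
        simp only [Pi.smul_apply, smul_eq_mul, mul_pow, inv_pow, Real.sq_sqrt ht.le,
          ← Finset.mul_sum] at h1
        have h2 := mul_le_mul_of_nonneg_left h1 ht.le
        have h3 : t * (4 / (d * Real.pi ^ 2) * (t⁻¹ * ∑ j, x j ^ 2)) =
            4 / (d * Real.pi ^ 2) * ∑ j, x j ^ 2 := by
          field_simp
        rw [h3] at h2
        linarith
      · rw [indicator_of_notMem hx, norm_zero]
        positivity
    · have hs : Tendsto (fun t : ℝ => (√t)⁻¹) atTop (𝓝 0) :=
        tendsto_inv_atTop_zero.comp Real.tendsto_sqrt_atTop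
      have hx : Tendsto (fun t : ℝ => (√t)⁻¹ • x) atTop (𝓝 0) := by
        simpa using hs.smul_const x
      have hnhds : Q ∈ 𝓝 (0 : Fin d → ℝ) :=
        set_pi_mem_nhds Set.finite_univ fun j _ => Ioc_mem_nhds (by simpa) (by simpa)
      have h1 : Tendsto (fun t : ℝ => Real.exp (-(t * frequency ((√t)⁻¹ • x) ^ 2)) *
          Real.cos (phase u ((√t)⁻¹ • x))) atTop
          (𝓝 (Real.exp (-((d : ℝ)⁻¹ * ∑ j, x j ^ 2)) * 1)) := by
        refine ((Real.continuous_exp.tendsto _).comp (tendsto_mul_frequency_sq x).neg).mul ?_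
        have h2 : Continuous fun θ => Real.cos (phase u θ) := by fun_prop
        have h3 := (h2.tendsto 0).comp hx
        simpa [phase, Function.comp_def] using h3
      rw [mul_one] at h1
      refine h1.congr' ?_
      filter_upwards [hx hnhds] with t ht
      have ht' : (√t)⁻¹ • x ∈ Q := ht
      rw [indicator_of_mem ht', neg_mul]
  refine hmain.congr' ?_
  filter_upwards [eventually_ge_atTop 0] with t ht
  rw [rpow_half_mul_integral ht]

theorem periodicGauss_nonneg (t a : ℝ) : 0 ≤ periodicGauss t a :=
  tsum_nonneg fun _ => (Real.exp_pos _).le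

/-- For large times, only the term with `k = 0` contributes to `periodicGauss`. -/
theorem periodicGauss_sub_mem {t : ℝ} (ht : 1 ≤ t) {a : ℝ} (ha : a ∈ Icc 0 Real.pi) :
    periodicGauss t a - Real.exp (-t * a ^ 2) ∈
      Icc 0 (Real.exp (-(t - 1)) * ∑' k : ℤ, (1 / 2 : ℝ) ^ k.natAbs) := by
  have hpi := Real.pi_gt_three
  have hterm : ∀ k : ℤ, k ≠ 0 → Real.exp (-t * (a + 2 * Real.pi * k) ^ 2) ≤
      Real.exp (-(t - 1)) * (1 / 2) ^ k.natAbs := by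
    intro k hk
    have h1 : (1 : ℝ) ≤ k.natAbs := by exact_mod_cast Int.natAbs_pos.2 hk
    have h2 : ((k.natAbs : ℕ) : ℝ) = |(k : ℝ)| := by
      rw [← Int.cast_abs, Int.abs_eq_natAbs]
      simp
    have h3 : (k.natAbs : ℝ) ≤ |a + 2 * Real.pi * k| := by
      have h4 := abs_sub_abs_le_abs_sub (2 * Real.pi * k) (-a)
      rw [sub_neg_eq_add, abs_neg, abs_of_nonneg ha.1, abs_mul, abs_of_pos (by positivity),
        ← h2, add_comm] at h4
      nlinarith [ha.2]
    have h5 : (k.natAbs : ℝ) ≤ (a + 2 * Real.pi * k) ^ 2 := by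
      rw [← sq_abs]
      nlinarith
    have h6 : Real.exp (-1) ≤ 1 / 2 := by
      have := Real.add_one_le_exp 1
      rw [Real.exp_neg, one_div]
      exact inv_anti₀ (by norm_num) (by linarith)
    calc _ ≤ Real.exp (-(t - 1) + k.natAbs * (-1)) := by
          refine Real.exp_le_exp.2 ?_
          nlinarith
      _ = Real.exp (-(t - 1)) * Real.exp (-1) ^ k.natAbs := by
          rw [Real.exp_add, Real.exp_nat_mul]
      _ ≤ _ := by gcongr
  have hsum := summable_half_natAbs.mul_left (Real.exp (-(t - 1)))
  have hs : Summable fun k : ℤ => Real.exp (-t * (a + 2 * Real.pi * k) ^ 2) := by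
    refine Summable.of_norm_bounded_eventually hsum ?_
    rw [Filter.eventually_cofinite]
    refine (Set.finite_singleton (0 : ℤ)).subset fun k hk => ?_
    by_contra h0
    refine hk ?_
    rw [Real.norm_eq_abs, Real.abs_exp]
    exact hterm k h0
  have h1 : periodicGauss t a - Real.exp (-t * a ^ 2) =
      ∑' k : ℤ, if k = 0 then 0 else Real.exp (-t * (a + 2 * Real.pi * k) ^ 2) := by
    rw [periodicGauss, hs.tsum_eq_add_tsum_ite 0]
    simp
  rw [h1]
  have hle : ∀ k : ℤ, (if k = 0 then 0 else Real.exp (-t * (a + 2 * Real.pi * k) ^ 2)) ≤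
      Real.exp (-(t - 1)) * (1 / 2) ^ k.natAbs := fun k => by
    split_ifs with h
    · positivity
    · exact hterm k h
  have hge : ∀ k : ℤ, 0 ≤ if k = 0 then 0 else Real.exp (-t * (a + 2 * Real.pi * k) ^ 2) :=
    fun k => by split_ifs <;> positivity
  refine ⟨tsum_nonneg hge, ?_⟩
  rw [← tsum_mul_left]
  exact Summable.tsum_le_tsum hle (Summable.of_nonneg_of_le hge hle hsum) hsum

theorem continuous_periodicGauss {t : ℝ} (ht : 0 < t) : Continuous (periodicGauss t) := by
  have h : periodicGauss t = fun a =>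
      heatNorm t * ∑' n : ℤ, Real.cos (n * a) * gaussProfile 0 t n :=
    funext fun a => (heatNorm_mul_tsum_cos ht a).symm
  rw [h]
  refine (continuous_tsum (fun n => by fun_prop) (summable_gaussProfile_int ht)
    fun n a => ?_).const_mul _
  rw [norm_mul, Real.norm_of_nonneg (gaussProfile_zero_nonneg t n)]
  exact mul_le_of_le_one_left (gaussProfile_zero_nonneg t n) (Real.abs_cos_le_one _)

theorem integrable_periodicGauss_frequency {t : ℝ} (ht : 0 < t) :
    Integrable (fun θ => periodicGauss t (frequency θ)) (momentumMeasure d) := by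
  obtain ⟨C, hC⟩ := (isCompact_Icc (a := (0 : ℝ)) (b := Real.pi)).exists_bound_of_continuousOn
    (continuous_periodicGauss ht).continuousOn
  exact integrable_momentum ((continuous_periodicGauss ht).comp continuous_frequency)
    fun θ => hC _ (frequency_mem θ)

theorem integrable_mul_cos_phase {F : (Fin d → ℝ) → ℝ} (hF : Integrable F (momentumMeasure d))
    (u : Fin d → ℤ) : Integrable (fun θ => F θ * Real.cos (phase u θ)) (momentumMeasure d) := by
  have := continuous_phase u
  exact hF.mul_bdd (c := 1) (Continuous.aestronglyMeasurable (by fun_prop))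
    (ae_of_all _ fun θ => Real.abs_cos_le_one _)

/-- The Fourier transform of a nonnegative function is largest at zero. -/
theorem vertexKernel_le {t : ℝ} (ht : 0 < t) (u : Fin d → ℤ) :
    vertexKernel t u ≤ vertexKernel t (0 : Fin d → ℤ) := by
  have hint := integrable_periodicGauss_frequency (d := d) ht
  refine mul_le_mul_of_nonneg_left (integral_mono (integrable_mul_cos_phase hint u)
    (integrable_mul_cos_phase hint 0) fun θ => ?_) (by positivity)
  refine mul_le_mul_of_nonneg_left ?_ (periodicGauss_nonneg _ _)
  simpa [phase] using Real.cos_le_one _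

/-- The limit of `t ^ (d/2) * p(t,x,x)`. -/
def diagonalLimit (d : ℕ) : ℝ := (d : ℝ)⁻¹ * ((2 * Real.pi) ^ d)⁻¹ * gaussIntegral d

theorem diagonalLimit_pos [NeZero d] : 0 < diagonalLimit d := by
  have h1 : (0 : ℝ) < d := Nat.cast_pos.2 (NeZero.pos d)
  have h2 := gaussIntegral_pos (d := d)
  have h3 := Real.pi_pos
  unfold diagonalLimit
  positivity

theorem tendsto_rpow_mul_vertexKernel [NeZero d] (u : Fin d → ℤ) :
    Tendsto (fun t : ℝ => t ^ ((d : ℝ) / 2) * vertexKernel t u) atTop (𝓝 (diagonalLimit d)) := by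
  set S := ∑' k : ℤ, (1 / 2 : ℝ) ^ k.natAbs
  set M := (momentumMeasure d).real univ
  have h1 : Tendsto (fun t : ℝ => t ^ ((d : ℝ) / 2) * ∫ θ, (periodicGauss t (frequency θ) -
      Real.exp (-t * frequency θ ^ 2)) * Real.cos (phase u θ) ∂(momentumMeasure d)) atTop
      (𝓝 0) := by
    have h2 : Tendsto (fun t : ℝ => t ^ ((d : ℝ) / 2) * Real.exp (-1 * t) *
        (Real.exp 1 * S * M)) atTop (𝓝 0) := by
      simpa using (tendsto_rpow_mul_exp_neg_mul_atTop_nhds_zero ((d : ℝ) / 2) 1 one_pos).mul_const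
        (Real.exp 1 * S * M)
    refine squeeze_zero_norm' ?_ h2
    filter_upwards [eventually_ge_atTop 1] with t ht
    have h3 : ‖∫ θ, (periodicGauss t (frequency θ) - Real.exp (-t * frequency θ ^ 2)) *
        Real.cos (phase u θ) ∂(momentumMeasure d)‖ ≤ Real.exp (-(t - 1)) * S * M := by
      refine norm_integral_le_of_norm_le_const (ae_of_all _ fun θ => ?_)
      have h4 := periodicGauss_sub_mem ht (frequency_mem θ)
      rw [norm_mul, Real.norm_of_nonneg h4.1]
      exact (mul_le_of_le_one_right h4.1 (Real.abs_cos_le_one _)).trans h4.2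
    rw [norm_mul, Real.norm_of_nonneg (by positivity)]
    refine (mul_le_mul_of_nonneg_left h3 (by positivity)).trans (le_of_eq ?_)
    rw [neg_sub, sub_eq_add_neg, Real.exp_add, neg_one_mul]
    ring
  have h5 := ((tendsto_rpow_mul_integral_gauss u).add h1).const_mul
    ((d : ℝ)⁻¹ * ((2 * Real.pi) ^ d)⁻¹)
  rw [add_zero] at h5
  refine h5.congr' ?_
  filter_upwards [eventually_gt_atTop 0] with t ht
  have hfc := continuous_frequency (d := d)
  have h6 : Integrable (fun θ => Real.exp (-t * frequency θ ^ 2)) (momentumMeasure d) := by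
    refine integrable_momentum (C := 1) (by fun_prop) fun θ => ?_
    rw [Real.abs_exp, Real.exp_le_one_iff]
    nlinarith [sq_nonneg (frequency θ)]
  have h7 := integrable_periodicGauss_frequency (d := d) ht
  have h8 : Integrable (fun θ => (periodicGauss t (frequency θ) -
      Real.exp (-t * frequency θ ^ 2)) * Real.cos (phase u θ)) (momentumMeasure d) :=
    integrable_mul_cos_phase (h7.sub h6) u
  rw [← mul_add, ← integral_add (integrable_mul_cos_phase h6 u) h8, vertexKernel]
  simp only [← add_mul, add_sub_cancel]
  ring

/-! ### The time derivative of the heat kernel -/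

/-- The last step of a convex sequence descends by at most the mean descent. -/
theorem mul_sub_succ_le_of_convex {a : ℕ → ℝ} (h : ∀ k, 2 * a (k + 1) ≤ a k + a (k + 2)) (n : ℕ) :
    n * (a n - a (n + 1)) ≤ a 0 - a n := by
  induction n with
  | zero => simp
  | succ n ih =>
    push_cast
    nlinarith [h n, mul_le_mul_of_nonneg_left (h n) (Nat.cast_nonneg (α := ℝ) n)]

/-- The first step of a convex sequence rises by at most the mean rise. -/
theorem mul_sub_zero_le_of_convex {a : ℕ → ℝ} (h : ∀ k, 2 * a (k + 1) ≤ a k + a (k + 2)) (n : ℕ) :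
    n * (a 1 - a 0) ≤ a n - a 0 := by
  have h1 : ∀ k, a 1 - a 0 ≤ a (k + 1) - a k := by
    intro k
    induction k with
    | zero => simp
    | succ k ih => linarith [h k]
  induction n with
  | zero => simp
  | succ n ih =>
    push_cast
    linarith [h1 n]

/-- A nonnegative midpoint convex function bounded by `M` beyond `s` has at `t` a derivative between
the slopes of secants over intervals of the length `t - s`, one on each side of `t`. -/
theorem abs_deriv_le_of_midpoint_convex {φ : ℝ → ℝ} {φ' s t M : ℝ} (hs : 0 < s) (hst : s < t)
    (hconv : ∀ a b, 0 < a → 0 < b → 2 * φ ((a + b) / 2) ≤ φ a + φ b)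
    (hnonneg : ∀ a, 0 < a → 0 ≤ φ a) (hM : ∀ a, s ≤ a → φ a ≤ M) (h : HasDerivAt φ φ' t) :
    |φ'| ≤ M / (t - s) := by
  have hts : 0 < t - s := sub_pos.2 hst
  have ht : 0 < t := hs.trans hst
  -- the difference quotients with the increments `(t - s) / n`
  have hlim : Tendsto (fun n : ℕ => (n : ℝ) * (φ (t + (t - s) / n) - φ t)) atTop
      (𝓝 ((t - s) * φ')) := by
    have h1 : Tendsto (fun n : ℕ => (t - s) / (n : ℝ)) atTop (𝓝[≠] 0) := by
      refine tendsto_nhdsWithin_iff.2 ⟨tendsto_const_div_atTop_nhds_zero_nat _, ?_⟩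
      filter_upwards [eventually_gt_atTop 0] with n hn
      have : (0 : ℝ) < n := Nat.cast_pos.2 hn
      exact (div_pos hts this).ne'
    have h2 := ((hasDerivAt_iff_tendsto_slope_zero.1 h).comp h1).const_mul (t - s)
    refine h2.congr' ?_
    filter_upwards [eventually_gt_atTop 0] with n hn
    have : (0 : ℝ) < n := Nat.cast_pos.2 hn
    simp only [Function.comp_apply, smul_eq_mul]
    field_simp
  have hseq : ∀ (n : ℕ), 0 < n → ∀ r, 0 < r → ∀ k : ℕ,
      2 * φ (r + (k + 1 : ℕ) * ((t - s) / n)) ≤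
        φ (r + k * ((t - s) / n)) + φ (r + (k + 2 : ℕ) * ((t - s) / n)) := by
    intro n hn r hr k
    have hn' : (0 : ℝ) < n := Nat.cast_pos.2 hn
    have := hconv (r + k * ((t - s) / n)) (r + (k + 2 : ℕ) * ((t - s) / n)) (by positivity)
      (by positivity)
    refine le_of_eq_of_le ?_ this
    congr 2
    push_cast
    ring
  have hmul : ∀ n : ℕ, 0 < n → (n : ℝ) * ((t - s) / n) = t - s := fun n hn => by
    have hn' : (n : ℝ) ≠ 0 := (Nat.cast_pos.2 hn).ne'
    field_simp
  have hup : (t - s) * φ' ≤ M := by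
    refine le_of_tendsto hlim ?_
    filter_upwards [eventually_gt_atTop 0] with n hn
    have h1 := mul_sub_zero_le_of_convex (a := fun k : ℕ => φ (t + k * ((t - s) / n)))
      (hseq n hn t ht) n
    simp only [Nat.cast_one, one_mul, Nat.cast_zero, zero_mul, add_zero, hmul n hn] at h1
    linarith [hnonneg t ht, hM (t + (t - s)) (by linarith)]
  have hlow : -M ≤ (t - s) * φ' := by
    refine ge_of_tendsto hlim ?_
    filter_upwards [eventually_gt_atTop 0] with n hn
    have h1 := mul_sub_succ_le_of_convex (a := fun k : ℕ => φ (s + k * ((t - s) / n)))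
      (hseq n hn s hs) n
    simp only [Nat.cast_zero, zero_mul, add_zero, hmul n hn, Nat.cast_add, Nat.cast_one, add_mul,
      one_mul] at h1
    rw [← add_assoc, add_sub_cancel] at h1
    linarith [hnonneg t ht, hM s le_rfl]
  have habs := abs_le.2 ⟨hlow, hup⟩
  rwa [abs_mul, abs_of_pos hts, mul_comm, ← le_div_iff₀ hts] at habs

/-- The supremum of the kernel decreases in time, because the kernel is an average of itself. -/
theorem heatKernel_le_of_le [NeZero d] {s t M : ℝ} (hs : 0 < s) (hst : s ≤ t)
    (hM : ∀ x y : LatticeGraph d, heatKernel s x y ≤ M) (x y : LatticeGraph d) :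
    heatKernel t x y ≤ M := by
  rcases hst.eq_or_lt with rfl | hst
  · exact hM x y
  have hts : 0 < t - s := sub_pos.2 hst
  obtain ⟨h1, h2⟩ := chapmanKolmogorov hts hs x y
  rw [sub_add_cancel] at h2
  have h3 : ∫ z, heatKernel (t - s) x z * M ∂(length d) = M := by
    rw [integral_mul_const, integral_heatKernel hts, one_mul]
  rw [h2, ← h3]
  exact integral_mono h1 ((integrable_heatKernel hts x).mul_const M) fun z =>
    mul_le_mul_of_nonneg_left (hM z y) (heatKernel_nonneg hts x z)

/-- `‖p(t/2,x,·) + σ p(t/2,y,·)‖²`, for `σ = ±1`. The cases `σ = 1` and `σ = -1`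
differ by `4 p(t,x,y)`. -/
def quadKernel (σ : ℝ) (x y : LatticeGraph d) (t : ℝ) : ℝ :=
  heatKernel t x x + 2 * σ * heatKernel t x y + heatKernel t y y

theorem quadKernel_add [NeZero d] {σ : ℝ} (hσ : σ ^ 2 = 1) (x y : LatticeGraph d) {s t : ℝ}
    (hs : 0 < s) (ht : 0 < t) :
    Integrable (fun z => (heatKernel s x z + σ * heatKernel s y z) *
      (heatKernel t x z + σ * heatKernel t y z)) (length d) ∧
    quadKernel σ x y (s + t) = ∫ z, (heatKernel s x z + σ * heatKernel s y z) *
      (heatKernel t x z + σ * heatKernel t y z) ∂(length d) := by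
  obtain ⟨h1, h1'⟩ := chapmanKolmogorov hs ht x x
  obtain ⟨h2, h2'⟩ := chapmanKolmogorov hs ht x y
  obtain ⟨h3, h3'⟩ := chapmanKolmogorov hs ht y x
  obtain ⟨h4, h4'⟩ := chapmanKolmogorov hs ht y y
  have h5 : ∀ z, (heatKernel s x z + σ * heatKernel s y z) *
      (heatKernel t x z + σ * heatKernel t y z) =
      (heatKernel s x z * heatKernel t z x + σ * (heatKernel s x z * heatKernel t z y)) +
      (σ * (heatKernel s y z * heatKernel t z x) + heatKernel s y z * heatKernel t z y) := by
    intro z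
    rw [heatKernel_symm t z x, heatKernel_symm t z y]
    linear_combination heatKernel s y z * heatKernel t y z * hσ
  have h6 : Integrable (fun z => heatKernel s x z * heatKernel t z x +
      σ * (heatKernel s x z * heatKernel t z y)) (length d) := h1.add (h2.const_mul σ)
  have h7 : Integrable (fun z => σ * (heatKernel s y z * heatKernel t z x) +
      heatKernel s y z * heatKernel t z y) (length d) := (h3.const_mul σ).add h4
  simp only [h5]
  refine ⟨h6.add h7, ?_⟩
  rw [integral_add h6 h7, integral_add h1 (h2.const_mul σ), integral_add (h3.const_mul σ) h4,
    integral_const_mul, integral_const_mul, ← h1', ← h2', ← h3', ← h4', quadKernel,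
    heatKernel_symm (s + t) y x]
  ring

theorem quadKernel_nonneg [NeZero d] {σ : ℝ} (hσ : σ ^ 2 = 1) (x y : LatticeGraph d) {t : ℝ}
    (ht : 0 < t) : 0 ≤ quadKernel σ x y t := by
  have h := (quadKernel_add hσ x y (half_pos ht) (half_pos ht)).2
  rw [add_halves] at h
  rw [h]
  exact integral_nonneg fun z => mul_self_nonneg _

/-- Convexity in time, from `2 ⟨u, v⟩ ≤ ‖u‖² + ‖v‖²` for the functions at the times `s/2` and `t/2`. -/
theorem quadKernel_midpoint [NeZero d] {σ : ℝ} (hσ : σ ^ 2 = 1) (x y : LatticeGraph d) {s t : ℝ}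
    (hs : 0 < s) (ht : 0 < t) :
    2 * quadKernel σ x y ((s + t) / 2) ≤ quadKernel σ x y s + quadKernel σ x y t := by
  obtain ⟨h1, h1'⟩ := quadKernel_add hσ x y (half_pos hs) (half_pos hs)
  obtain ⟨h2, h2'⟩ := quadKernel_add hσ x y (half_pos hs) (half_pos ht)
  obtain ⟨h3, h3'⟩ := quadKernel_add hσ x y (half_pos ht) (half_pos ht)
  rw [add_halves] at h1' h3'
  rw [add_div, h1', h2', h3', ← integral_add h1 h3, ← integral_const_mul]
  exact integral_mono (h2.const_mul 2) (h1.add h3) fun z => by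
    nlinarith [sq_nonneg ((heatKernel (s / 2) x z + σ * heatKernel (s / 2) y z) -
      (heatKernel (t / 2) x z + σ * heatKernel (t / 2) y z))]

/-- The time derivative gains a factor `1/t`, because `p(t,x,y)` is a difference of two convex
functions of time. -/
theorem abs_heatKernelDeriv_le [NeZero d] {t M : ℝ} (ht : 0 < t)
    (hM : ∀ x y : LatticeGraph d, heatKernel (t / 2) x y ≤ M) (x y : LatticeGraph d) :
    |heatKernelDeriv t x y| ≤ 4 * M / t := by
  have ht2 := half_pos ht
  have hle : ∀ {a : ℝ}, t / 2 ≤ a → ∀ x y : LatticeGraph d, heatKernel a x y ∈ Icc 0 M :=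
    fun ha x y => ⟨heatKernel_nonneg (ht2.trans_le ha) x y, heatKernel_le_of_le ht2 ha hM x y⟩
  have key : ∀ σ : ℝ, σ = 1 ∨ σ = -1 →
      |heatKernelDeriv t x x + 2 * σ * heatKernelDeriv t x y + heatKernelDeriv t y y| ≤
        4 * M / (t - t / 2) := by
    intro σ hσ
    have hσ2 : σ ^ 2 = 1 := by rcases hσ with rfl | rfl <;> norm_num
    refine abs_deriv_le_of_midpoint_convex (φ := quadKernel σ x y) ht2 (half_lt_self ht)
      (fun a b ha hb => quadKernel_midpoint hσ2 x y ha hb)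
      (fun a ha => quadKernel_nonneg hσ2 x y ha) (fun a ha => ?_)
      (((hasDerivAt_heatKernel ht x x).add ((hasDerivAt_heatKernel ht x y).const_mul (2 * σ))).add
        (hasDerivAt_heatKernel ht y y))
    have h1 := hle ha x x
    have h2 := hle ha x y
    have h3 := hle ha y y
    rw [quadKernel]
    rcases hσ with rfl | rfl <;> linarith [h1.1, h1.2, h2.1, h2.2, h3.1, h3.2]
  have h1 := abs_le.1 (key 1 (Or.inl rfl))
  have h2 := abs_le.1 (key (-1) (Or.inr rfl))
  have h3 : 4 * M / (t - t / 2) = 2 * (4 * M / t) := by field_simp; ring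
  rw [h3] at h1 h2
  exact abs_le.2 ⟨by linarith [h1.1, h2.2], by linarith [h1.2, h2.1]⟩

/-! ### Interpolation along the edges -/

/-- The function `f r + D r² / 2` is convex. -/
theorem le_interpolation_add {f f' f'' : ℝ → ℝ} {D : ℝ} (h : ∀ r, HasDerivAt f (f' r) r)
    (h' : ∀ r, HasDerivAt f' (f'' r) r) (hD0 : 0 ≤ D)
    (hD : ∀ r ∈ Icc (0 : ℝ) 1, -D ≤ f'' r) {r : ℝ}
    (hr : r ∈ Icc (0 : ℝ) 1) : f r ≤ (1 - r) * f 0 + r * f 1 + D := by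
  have h1 : ∀ r, HasDerivAt (fun r => f r + D / 2 * r ^ 2) (f' r + D * r) r := fun r => by
    refine ((h r).add (((hasDerivAt_pow 2 r).const_mul (D / 2)))).congr_deriv ?_
    simp only [Nat.cast_ofNat, Nat.add_one_sub_one, pow_one]
    ring
  have h2 : ∀ r, HasDerivAt (fun r => f' r + D * r) (f'' r + D) r := fun r => by
    refine ((h' r).add ((hasDerivAt_id r).const_mul D)).congr_deriv ?_
    rw [mul_one]
  have h3 : deriv (fun r => f r + D / 2 * r ^ 2) = fun r => f' r + D * r :=
    funext fun r => (h1 r).deriv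
  have h4 : deriv (fun r => f' r + D * r) = fun r => f'' r + D := funext fun r => (h2 r).deriv
  have hconv : ConvexOn ℝ (Icc (0 : ℝ) 1) fun r => f r + D / 2 * r ^ 2 := by
    refine convexOn_of_deriv2_nonneg' (convex_Icc 0 1)
      (fun r _ => (h1 r).differentiableAt.differentiableWithinAt) ?_ fun r hr => ?_
    · rw [h3]
      exact fun r _ => (h2 r).differentiableAt.differentiableWithinAt
    · rw [Function.iterate_succ, Function.iterate_one, Function.comp_apply, h3, h4]
      linarith [hD r hr]
  have h5 := hconv.2 (left_mem_Icc.2 zero_le_one) (right_mem_Icc.2 zero_le_one)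
    (sub_nonneg.2 hr.2) hr.1 (by ring)
  simp only [smul_eq_mul, mul_zero, mul_one, zero_add, one_pow] at h5
  nlinarith [mul_nonneg hD0 (sub_nonneg.2 hr.2), mul_nonneg hD0 hr.1, mul_nonneg hD0 (sq_nonneg r)]

/-- A function on an edge differs from the linear interpolation of its values at the ends by at
most the bound of its second derivative; here the latter is the time derivative. -/
theorem heatKernel_point_mem_Icc [NeZero d] {t : ℝ} (ht : 0 < t) {a b D : ℝ} {y : LatticeGraph d}
    (hD : ∀ x, |heatKernelDeriv t x y| ≤ D) {e : DirEdge d}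
    (h0 : heatKernel t (point e 0) y ∈ Icc a b)
    (h1 : heatKernel t (point (reverse e) 0) y ∈ Icc a b) {r : ℝ} (hr : r ∈ Icc (0 : ℝ) 1) :
    heatKernel t (point e r) y ∈ Icc (a - D) (b + D) := by
  obtain ⟨f, s, hs, rfl⟩ := exists_eq_point y
  have hsol := isHeatSolution_sourceSum f s
  have hval : ∀ r ∈ Icc (0 : ℝ) 1, heatNorm t * sourceSum 0 t e r f s =
      heatKernel t (point e r) (point f s) := fun r hr => (heatKernel_point ht e f hr hs).symm
  have hder : ∀ r ∈ Icc (0 : ℝ) 1, |heatNorm t *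
      ((4 * t ^ 2)⁻¹ * sourceSum 2 t e r f s - (2 * t)⁻¹ * sourceSum 0 t e r f s)| ≤ D :=
    fun r hr => by
      rw [← heatKernelDeriv_point ht e f hr hs]
      exact hD _
  rw [point_reverse, sub_zero] at h1
  have hup := le_interpolation_add (hsol.hasDerivAt ht e) (hsol.hasDerivAt_deriv ht e)
    ((abs_nonneg _).trans (hD (point f s))) (fun r hr => (abs_le.1 (hder r hr)).1) hr
  have hlow := le_interpolation_add (fun r => (hsol.hasDerivAt ht e r).neg)
    (fun r => (hsol.hasDerivAt_deriv ht e r).neg)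
    ((abs_nonneg _).trans (hD (point f s))) (fun r hr => neg_le_neg (abs_le.1 (hder r hr)).2) hr
  simp only [Pi.neg_apply, hval r hr, hval 0 (by simp), hval 1 (by simp)] at hup hlow
  constructor <;> nlinarith [hr.1, hr.2, h0.1, h0.2, h1.1, h1.2]

/-- Interpolation in both arguments, between the values at the vertices. -/
theorem heatKernel_mem_Icc_of_vertex [NeZero d] {t : ℝ} (ht : 0 < t) {a b D : ℝ}
    (hD : ∀ x y : LatticeGraph d, |heatKernelDeriv t x y| ≤ D) {e f : DirEdge d}
    (h : ∀ v ∈ ({e.1, target e} : Set (Fin d → ℤ)), ∀ w ∈ ({f.1, target f} : Set (Fin d → ℤ)),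
      vertexKernel t (v - w) ∈ Icc a b)
    {r s : ℝ} (hr : r ∈ Icc (0 : ℝ) 1) (hs : s ∈ Icc (0 : ℝ) 1) :
    heatKernel t (point e r) (point f s) ∈ Icc (a - D - D) (b + D + D) := by
  have key : ∀ g : DirEdge d, g.1 ∈ ({e.1, target e} : Set (Fin d → ℤ)) →
      heatKernel t (point g 0) (point f s) ∈ Icc (a - D) (b + D) := by
    intro g hg
    rw [heatKernel_symm]
    refine heatKernel_point_mem_Icc ht (fun x => hD x _) ?_ ?_ hs
    · rw [heatKernel_symm, heatKernel_vertex ht]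
      exact h _ hg _ (by simp)
    · rw [heatKernel_symm, heatKernel_vertex ht]
      exact h _ hg _ (by simp)
  exact heatKernel_point_mem_Icc ht (fun x => hD x _) (key e (by simp)) (key (reverse e) (by simp))
    hr

/-! ### On-diagonal bounds and the limit for large times -/

theorem exists_heatKernel_le_small (d : ℕ) [NeZero d] (h : ℝ) :
    ∃ C, 0 < C ∧ ∀ t, 0 < t → t ≤ h → ∀ x y : LatticeGraph d,
      heatKernel t x y ≤ C * t ^ (-(1 : ℝ) / 2) := by
  obtain ⟨K, hK, hsum⟩ := exists_abs_sourceSum_le d 0 h 1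
  obtain ⟨C, hC, hW⟩ := exists_edgeWeight_le d
  have hpi := Real.pi_pos
  refine ⟨(√(4 * Real.pi))⁻¹ * (K * C), by positivity, fun t ht hth x y => ?_⟩
  obtain ⟨e, r, hr, rfl⟩ := exists_eq_point x
  obtain ⟨f, s, hs, rfl⟩ := exists_eq_point y
  have h1 : heatNorm t = (√(4 * Real.pi))⁻¹ * t ^ (-(1 : ℝ) / 2) := by
    rw [heatNorm, Real.sqrt_mul (by positivity), mul_inv, neg_div, Real.rpow_neg ht.le,
      Real.sqrt_eq_rpow t]
  have h2 : sourceSum 0 t e r f s ≤ K * C :=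
    (le_abs_self _).trans ((hsum t ht hth e f r (by rw [abs_of_nonneg hr.1]; exact hr.2) s hs).trans
      (mul_le_mul_of_nonneg_left (hW e f) hK.le))
  rw [heatKernel_point ht e f hr hs, mul_right_comm, ← h1]
  exact mul_le_mul_of_nonneg_left h2 (heatNorm_pos ht).le

/-- A bound for the heat kernel at time `t / 2` gives an improved bound at time `t`: on the
vertices the kernel is known, and along the edges it is nearly linear. -/
theorem heatKernel_le_of_half [NeZero d] {t V M : ℝ} (ht : 0 < t)
    (hV : vertexKernel t (0 : Fin d → ℤ) ≤ V)
    (hM : ∀ x y : LatticeGraph d, heatKernel (t / 2) x y ≤ M) (x y : LatticeGraph d) :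
    heatKernel t x y ≤ V + 8 * M / t := by
  obtain ⟨e, r, hr, rfl⟩ := exists_eq_point x
  obtain ⟨f, s, hs, rfl⟩ := exists_eq_point y
  have h := heatKernel_mem_Icc_of_vertex ht (a := 0) (b := V) (abs_heatKernelDeriv_le ht hM)
    (e := e) (f := f) (fun v _ w _ => ⟨?_, (vertexKernel_le ht _).trans hV⟩) hr hs
  · refine h.2.trans (le_of_eq ?_)
    ring
  · have := heatKernel_nonneg ht (point (v, e.2) 0) (point (w, f.2) 0)
    rwa [heatKernel_vertex ht] at this

/-- The bound `B` is propagated from `[T, 2T]` over dyadic ranges of times by `heatKernel_le_of_half`. -/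
theorem exists_rpow_mul_heatKernel_le (d : ℕ) [NeZero d] :
    ∃ T B, 0 < T ∧ 0 < B ∧ ∀ t, T ≤ t → ∀ x y : LatticeGraph d,
      t ^ ((d : ℝ) / 2) * heatKernel t x y ≤ B := by
  have hc := diagonalLimit_pos (d := d)
  obtain ⟨T₁, hT₁⟩ := eventually_atTop.1 ((tendsto_rpow_mul_vertexKernel (d := d) 0).eventually
    (eventually_le_nhds (lt_add_one (diagonalLimit d))))
  set V := diagonalLimit d + 1 with hV
  set K : ℝ := 2 ^ ((d : ℝ) / 2) with hK
  have hKpos : 0 < K := by positivity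
  -- beyond `T` the contribution of `t / 2` is reduced by a factor two
  set T := max (max T₁ 1) (16 * K) with hT
  have hTpos : 0 < T := lt_of_lt_of_le (by positivity) (le_max_right _ _)
  obtain ⟨M, hM⟩ := exists_abs_heatKernel_le (d := d) hTpos
  have hM' : ∀ x y : LatticeGraph d, heatKernel T x y ≤ M := fun x y =>
    (le_abs_self _).trans (hM x y)
  set B := max (2 * V) ((2 * T) ^ ((d : ℝ) / 2) * M) with hB
  have hBpos : 0 < B := lt_of_lt_of_le (by positivity) (le_max_left _ _)
  have hdy : ∀ n : ℕ, ∀ t, T ≤ t → t ≤ 2 ^ n * (2 * T) → ∀ x y : LatticeGraph d,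
      t ^ ((d : ℝ) / 2) * heatKernel t x y ≤ B := by
    intro n
    induction n with
    | zero =>
      intro t ht1 ht2 x y
      rw [pow_zero, one_mul] at ht2
      have ht : 0 < t := hTpos.trans_le ht1
      refine le_trans ?_ (le_max_right _ _)
      have h1 := heatKernel_le_of_le hTpos ht1 hM' x y
      have h2 := heatKernel_nonneg ht x y
      gcongr
    | succ n ih =>
      intro t ht1 ht2 x y
      have ht : 0 < t := hTpos.trans_le ht1
      rcases le_or_gt t (2 * T) with h | h
      · refine ih t ht1 (h.trans ?_) x y
        exact le_mul_of_one_le_left (by positivity) (one_le_pow₀ (by norm_num))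
      have hρ2 : 0 < (t / 2) ^ ((d : ℝ) / 2) := by positivity
      have hρ : 0 < t ^ ((d : ℝ) / 2) := by positivity
      have hhalf : ∀ x y : LatticeGraph d,
          heatKernel (t / 2) x y ≤ B / (t / 2) ^ ((d : ℝ) / 2) := fun x y => by
        rw [le_div_iff₀ hρ2, mul_comm]
        refine ih (t / 2) (by linarith) ?_ x y
        rw [pow_succ] at ht2
        linarith
      have hV' : vertexKernel t (0 : Fin d → ℤ) ≤ V / t ^ ((d : ℝ) / 2) := by
        rw [le_div_iff₀ hρ, mul_comm]
        exact hT₁ t (((le_max_left _ _).trans (le_max_left _ _)).trans ht1)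
      have hK' : t ^ ((d : ℝ) / 2) = K * (t / 2) ^ ((d : ℝ) / 2) := by
        rw [hK, ← Real.mul_rpow (by norm_num) (by positivity), mul_div_cancel₀ _ two_ne_zero]
      have h3 := mul_le_mul_of_nonneg_left (heatKernel_le_of_half ht hV' hhalf x y) hρ.le
      refine h3.trans ?_
      have h4 : t ^ ((d : ℝ) / 2) * (V / t ^ ((d : ℝ) / 2) +
          8 * (B / (t / 2) ^ ((d : ℝ) / 2)) / t) = V + 8 * K * B / t := by
        rw [mul_add, mul_div_cancel₀ _ hρ.ne', hK']
        field_simp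
      have h5 : 8 * K * B / t ≤ B / 2 := by
        rw [div_le_iff₀ ht]
        have : 16 * K ≤ t := (le_max_right _ _).trans ht1
        nlinarith
      have h6 : 2 * V ≤ B := le_max_left _ _
      rw [h4]
      linarith
  refine ⟨T, B, hTpos, hBpos, fun t ht x y => ?_⟩
  obtain ⟨n, hn⟩ := pow_unbounded_of_one_lt (t / (2 * T)) (one_lt_two (α := ℝ))
  rw [div_lt_iff₀ (by positivity)] at hn
  exact hdy n t ht hn.le x y

/-- The kernel at the ends of an edge has the limit already, and along the edge it varies by
`O(t^(-d/2-1))` around its interpolation. -/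
theorem tendstoUniformly_rpow_mul_heatKernel [NeZero d] :
    TendstoUniformly (fun (t : ℝ) (x : LatticeGraph d) => t ^ ((d : ℝ) / 2) * heatKernel t x x)
      (fun _ => diagonalLimit d) atTop := by
  obtain ⟨T, B, hT, hB, hle⟩ := exists_rpow_mul_heatKernel_le d
  set K : ℝ := 2 ^ ((d : ℝ) / 2) with hK
  have hKpos : 0 < K := by positivity
  rw [Metric.tendstoUniformly_iff]
  intro ε hε
  have hvert : ∀ u : Fin d → ℤ, ∀ᶠ t : ℝ in atTop, t ^ ((d : ℝ) / 2) * vertexKernel t u ∈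
      Icc (diagonalLimit d - ε / 4) (diagonalLimit d + ε / 4) := fun u =>
    (tendsto_rpow_mul_vertexKernel u).eventually (Icc_mem_nhds (by linarith) (by linarith))
  have herr : ∀ᶠ t : ℝ in atTop, 8 * K * B / t < ε / 4 :=
    (tendsto_id.const_div_atTop (8 * K * B)).eventually (gt_mem_nhds (by positivity))
  have hstep : ∀ᶠ t : ℝ in atTop, ∀ b : Fin d × Bool, t ^ ((d : ℝ) / 2) *
      vertexKernel t (step b) ∈ Icc (diagonalLimit d - ε / 4) (diagonalLimit d + ε / 4) :=
    eventually_all.2 fun b => hvert _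
  have hstep' : ∀ᶠ t : ℝ in atTop, ∀ b : Fin d × Bool, t ^ ((d : ℝ) / 2) *
      vertexKernel t (-step b) ∈ Icc (diagonalLimit d - ε / 4) (diagonalLimit d + ε / 4) :=
    eventually_all.2 fun b => hvert _
  filter_upwards [hvert 0, herr, hstep, hstep', eventually_ge_atTop (2 * T)] with t h0 h1 h2 h3 h4 x
  have ht : 0 < t := by linarith
  have hρ2 : 0 < (t / 2) ^ ((d : ℝ) / 2) := by positivity
  have hρ : 0 < t ^ ((d : ℝ) / 2) := by positivity
  have hhalf : ∀ x y : LatticeGraph d,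
      heatKernel (t / 2) x y ≤ B / (t / 2) ^ ((d : ℝ) / 2) := fun x y => by
    rw [le_div_iff₀ hρ2, mul_comm]
    exact hle (t / 2) (by linarith) x y
  obtain ⟨e, r, hr, rfl⟩ := exists_eq_point x
  have hK' : t ^ ((d : ℝ) / 2) = K * (t / 2) ^ ((d : ℝ) / 2) := by
    rw [hK, ← Real.mul_rpow (by norm_num) (by positivity), mul_div_cancel₀ _ two_ne_zero]
  have hdiv : ∀ {u : Fin d → ℤ}, t ^ ((d : ℝ) / 2) * vertexKernel t u ∈
      Icc (diagonalLimit d - ε / 4) (diagonalLimit d + ε / 4) →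
      vertexKernel t u ∈ Icc ((diagonalLimit d - ε / 4) / t ^ ((d : ℝ) / 2))
        ((diagonalLimit d + ε / 4) / t ^ ((d : ℝ) / 2)) := fun h => by
    rw [mem_Icc, div_le_iff₀ hρ, le_div_iff₀ hρ, mul_comm (vertexKernel _ _)]
    exact h
  -- the differences of the ends of one edge are zero and the two signs of a single unit vector
  have h5 := heatKernel_mem_Icc_of_vertex ht (abs_heatKernelDeriv_le ht hhalf) (e := e) (f := e)
    (a := (diagonalLimit d - ε / 4) / t ^ ((d : ℝ) / 2))
    (b := (diagonalLimit d + ε / 4) / t ^ ((d : ℝ) / 2)) (fun v hv w hw => hdiv ?_) hr hr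
  · have h6 : t ^ ((d : ℝ) / 2) * (4 * (B / (t / 2) ^ ((d : ℝ) / 2)) / t) = 4 * K * B / t := by
      rw [hK']
      field_simp
    have h7 : 8 * K * B / t = 2 * (4 * K * B / t) := by ring
    have h8 := mul_le_mul_of_nonneg_left h5.1 hρ.le
    have h9 := mul_le_mul_of_nonneg_left h5.2 hρ.le
    rw [mul_sub, mul_sub, h6, mul_div_cancel₀ _ hρ.ne'] at h8
    rw [mul_add, mul_add, h6, mul_div_cancel₀ _ hρ.ne'] at h9
    rw [dist_comm, Real.dist_eq, abs_lt]
    constructor <;> linarith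
  · rcases hv with rfl | rfl <;> rcases hw with rfl | rfl
    · simpa using h0
    · simpa [target] using h3 e.2
    · simpa [target] using h2 e.2
    · simpa using h0

/-- The bound for small times is used up to the time from which on the bound for large times holds. It
is integrable at zero, so `m = 1` suffices, and `d ≥ 3` gives the integrability at infinity. -/
theorem exists_conditionB_heatKernel (d : ℕ) (hd : 3 ≤ d) [NeZero d] :
    ∃ π : ℝ → ℝ, ConditionB (heatKernel (d := d)) π ∧
      (∃ c : ℝ, ∀ᶠ t in atTop, π t ≤ c / t ^ ((d : ℝ) / 2)) ∧
      (∃ c : ℝ, ∀ᶠ t in 𝓝[>] 0, π t ≤ c / t ^ ((1 : ℝ) / 2)) := by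
  obtain ⟨T, B, hT, hB, hle⟩ := exists_rpow_mul_heatKernel_le d
  obtain ⟨C, hC, hsmall⟩ := exists_heatKernel_le_small d T
  have hd' : (3 : ℝ) ≤ d := by exact_mod_cast hd
  refine ⟨fun t => if t ≤ T then C * t ^ (-(1 : ℝ) / 2) else B * t ^ (-((d : ℝ) / 2)),
    ⟨fun t ht x => ?_, 1, ?_⟩, ⟨B, ?_⟩, ⟨C, ?_⟩⟩
  · simp only
    split_ifs with h
    · exact hsmall t ht h x x
    · rw [Real.rpow_neg ht.le, ← div_eq_mul_inv, le_div_iff₀ (by positivity), mul_comm]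
      exact hle t (not_le.1 h).le x x
  · have h1 : IntegrableOn (fun t : ℝ => C * t ^ (-(1 : ℝ) / 2)) (Ioc 0 T) :=
      ((intervalIntegrable_iff_integrableOn_Ioc_of_le hT.le).1
        (intervalIntegral.intervalIntegrable_rpow' (by norm_num))).const_mul C
    have h2 : IntegrableOn (fun t : ℝ => B * t ^ (-((d : ℝ) / 2))) (Ioi T) :=
      (integrableOn_Ioi_rpow_of_lt (by linarith) hT).const_mul B
    have h3 : IntegrableOn (fun t : ℝ => if t ≤ T then C * t ^ (-(1 : ℝ) / 2) else
        B * t ^ (-((d : ℝ) / 2))) (Ioi 0) := by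
      rw [← Ioc_union_Ioi_eq_Ioi hT.le]
      refine (h1.congr_fun (fun t ht => ?_) measurableSet_Ioc).union
        (h2.congr_fun (fun t ht => ?_) measurableSet_Ioi)
      · simp only [if_pos ht.2]
      · simp only [if_neg (not_le.2 (mem_Ioi.1 ht))]
    refine h3.bdd_mul (c := 1) (Measurable.aestronglyMeasurable (by fun_prop)) ?_
    filter_upwards [ae_restrict_mem measurableSet_Ioi] with t ht
    have ht' : (0 : ℝ) < t := ht
    rw [pow_one, Real.norm_of_nonneg (by positivity), div_le_one (by positivity)]
    linarith
  · filter_upwards [eventually_gt_atTop T] with t ht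
    rw [if_neg (not_le.2 ht), Real.rpow_neg (hT.trans ht).le, ← div_eq_mul_inv]
  · filter_upwards [Ioc_mem_nhdsGT hT] with t ht
    rw [if_pos ht.2, neg_div, Real.rpow_neg ht.1.le, ← div_eq_mul_inv]

end LatticeGraph

end

theorem theorem8 (d : ℕ) (hd : 3 ≤ d) :
    -- the space
    CompleteSpace (LatticeGraph d) ∧ SigmaCompactSpace (LatticeGraph d) ∧
    BorelSpace (LatticeGraph d) ∧ SigmaFinite (LatticeGraph.length d) ∧
    -- the closure is the graph of an operator, which is self-adjoint and non-negative
    (LatticeGraph.kirchhoffLaplacian d).graph =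
      (LatticeGraph.smoothGraph d).topologicalClosure ∧
    IsSelfAdjoint (LatticeGraph.kirchhoffLaplacian d) ∧
    (∀ f : (LatticeGraph.kirchhoffLaplacian d).domain,
      0 ≤ (inner ℂ (f : Lp ℂ 2 (LatticeGraph.length d))
        (LatticeGraph.kirchhoffLaplacian d f)).re) ∧
    ∃ p₀ : ℝ → LatticeGraph d → LatticeGraph d → ℝ,
      ConditionA (LatticeGraph.length d) (LatticeGraph.kirchhoffLaplacian d) p₀ ∧
      -- condition (b), with a function having the power bounds for `α = 1`, `β = d`
      (∃ π : ℝ → ℝ, ConditionB p₀ π ∧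
        (∃ c : ℝ, ∀ᶠ t in atTop, π t ≤ c / t ^ ((d : ℝ) / 2)) ∧
        (∃ c : ℝ, ∀ᶠ t in 𝓝[>] 0, π t ≤ c / t ^ ((1 : ℝ) / 2))) ∧
      -- the diagonal of the heat kernel for small and for large times, uniformly in `x`
      (∀ h : ℝ, 0 < h → ∃ C : ℝ, ∀ t, 0 < t → t ≤ h → ∀ x, p₀ t x x ≤ C * t ^ (-(1 : ℝ) / 2)) ∧
      ∃ c : ℝ, 0 < c ∧
        TendstoUniformly (fun (t : ℝ) x => t ^ ((d : ℝ) / 2) * p₀ t x x) (fun _ => c) atTop := by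
  have : NeZero d := ⟨by omega⟩
  refine ⟨inferInstance, inferInstance, inferInstance, inferInstance,
    LatticeGraph.graph_kirchhoffLaplacian, LatticeGraph.isSelfAdjoint_kirchhoffLaplacian,
    LatticeGraph.inner_kirchhoffLaplacian_nonneg, LatticeGraph.heatKernel,
    LatticeGraph.conditionA_heatKernel, LatticeGraph.exists_conditionB_heatKernel d hd,
    fun h _ => ?_, LatticeGraph.diagonalLimit d, LatticeGraph.diagonalLimit_pos,
    LatticeGraph.tendstoUniformly_rpow_mul_heatKernel⟩
  obtain ⟨C, -, hC⟩ := LatticeGraph.exists_heatKernel_le_small d h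
  exact ⟨C, fun t ht hth x => hC t ht hth x x⟩
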